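/- Let $X$ be a complex manifold of dimension $n$, let $\widehat{\mathcal O}_n=\mathbb C[[t_1,\dots,t_n]]$, let $W_n$ be the Lie algebra of formal vector fields, and let $\widehat{CDO}_n=\mathbb C[[c^1_0,\dots,c^n_0]]\,[b^i_l,c^i_m]_{l,m<0}$ be the (completed, $\mathbb Z_{\ge 0}$-graded) $\beta\gamma$ vertex algebra of chiral differential operators on the formal $n$-disk. The extension $\widetilde W_n$ of $W_n$ by closed formal two-forms, with cocycle $ch_2^{GF}:(f^i\partial_i,g^j\partial_j)\mapsto -d(\partial_jf^i)\wedge d(\partial_ig^j)$, acts on $\widehat{CDO}_n$ by derivations: $f^j\partial_j$ acts by $(f^j(c)b^j_{-1})_{(0)}$, and closed two-forms $d\theta$ act by (minus) $\theta_{(0)}$. Let $\sigma$ be a Gelfand–Kazhdan structure on $X$ (a smooth $GL_n$-equivariant map from the frame bundle $Fr_X$ to the bundle of formal coordinates) with associated flat $W_n$-valued connection form $\omega_\sigma$ on $Fr_X$. Let $\alpha$ be a trivialization of $ch_2(T_X)\in H^2(X;\Omega^2_{cl})$, i.e. a smooth basic one-form on $Fr_X$ with values in closed formal two-forms whose covariant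 differential is $ch_2^{GF}(\omega_\sigma,\omega_\sigma)$, the image of $ch_2^{GF}$ under the characteristic map of $\sigma$. Let $CDO_{X,\alpha}$ be the sheaf on $X$ whose sections over $U$ are the smooth $GL_n$-equivariant functions on $Fr_X|_U$ with values in $\widehat{CDO}_n$, locally of bounded conformal dimension, that are flat for the $\widetilde W_n$-valued connection $(\omega_\sigma,-\alpha)$, with the pointwise vertex algebra operations. (a) If $c_1(T_X)=0$ in $H^1(X;\Omega^1_X)$, then there is a map $\Phi:\underline{\mathrm{Vir}}_{c=2n}\to CDO_{X,\alpha}$ of sheaves of ($\mathbb Z_{\ge 0}$-graded) vertex algebras on $X$ from the constant sheaf with value the Virasoro vertex algebra of central charge $2n$; in other words, $CDO_{X,\alpha}$ has a global Virasoro vector, the image of $L_{-2}$. (b) On the formal disk the obstruction is the Gelfand–Fuks class $c_1^{GF}(\widehat T_n)$: let $L_{-2}=\sum_i b^i_{-1}c^i_{-1}\in\widehat{CDO}_n$ be the conformal vector. For every $(Y,B)\in\widetilde W_n$ and every $v\in\widehat{CDO}_n$ of conformal dimension one, with image $\bar v\in\widehat T_n$, one has $\big((Y,B)\cdot L_{-2}\big)_{(2)}v=\langle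 c_1^{GF}(Y),\bar v\rangle$, where $c_1^{GF}(f^i\partial_i)=d(\partial_if^i)$ (the representative of the first Chern class, up to the factor $2\pi i$); moreover $(Y,B)\cdot L_{-2}=0$ if and only if $c_1^{GF}(Y)=0$, and $c_1^{GF}$ is a one-cocycle of $W_n$ with values in formal one-forms. -/

import Mathlib

open scoped ContDiff Manifold TensorProduct

namespace ChiralDO

noncomputable section

/-! ### Vertex algebra operations -/

/-- The operations of a vertex algebra: the vacuum vector, the translation operator, and the
Fourier modes `prod m v w = v_(m) w`, where `Y(v; z) = ∑ v_(m) z^(-m-1)`. -/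
class VertexOps (V : Type*) where
  vac : V
  T : V → V
  prod : ℤ → V → V → V

/-- A map that preserves the vacuum, the translation operator and all Fourier modes. -/
structure IsVertexHom {V W : Type*} [VertexOps V] [VertexOps W] (F : V → W) : Prop where
  map_vac : F VertexOps.vac = VertexOps.vac
  map_T : ∀ v, F (VertexOps.T v) = VertexOps.T (F v)
  map_prod : ∀ m v w, F (VertexOps.prod m v w) = VertexOps.prod m (F v) (F w)

/-! ### Tensor calculus on the formal disk -/

/-- Formal power series `ℂ⟦t₁, …, tₙ⟧`, the functions on the formal `n`-disk. -/
abbrev Ohat (n : ℕ) := MvPowerSeries (Fin n) ℂ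

/-- The partial derivative `∂ / ∂ tᵢ`. -/
def pd {n : ℕ} (i : Fin n) : Ohat n →ₗ[ℂ] Ohat n := (MvPowerSeries.pderiv ℂ i).toLinearMap

/-- Formal vector fields; `X` stands for `∑ X i ∂ᵢ`. -/
abbrev FVect (n : ℕ) := Fin n → Ohat n

/-- Formal one-forms; `θ` stands for `∑ θ i dtᵢ`. -/
abbrev FForm1 (n : ℕ) := Fin n → Ohat n

/-- Formal two-forms; an antisymmetric `B` stands for `∑_{i < j} B i j dtᵢ ∧ dtⱼ`. -/
abbrev FForm2 (n : ℕ) := Fin n → Fin n → Ohat n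

/-- `B` is a closed two-form. -/
def IsClosed2 {n : ℕ} (B : FForm2 n) : Prop :=
  (∀ i j, B i j = -B j i) ∧
    ∀ i j k, pd i (B j k) + pd j (B k i) + pd k (B i j) = 0

/-- The Lie bracket of formal vector fields. -/
def bracket {n : ℕ} (X Y : FVect n) : FVect n := fun i =>
  ∑ k, (X k * pd k (Y i) - Y k * pd k (X i))

/-- The de Rham differential of a function. -/
def dFun {n : ℕ} (f : Ohat n) : FForm1 n := fun i => pd i f

/-- The wedge product of two one-forms. -/
def wedge {n : ℕ} (θ η : FForm1 n) : FForm2 n := fun i j => θ i * η j - θ j * η i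

/-- The pairing of a one-form with a vector field. -/
def pair {n : ℕ} (θ : FForm1 n) (Y : FVect n) : Ohat n := ∑ i, θ i * Y i

/-- The Lie derivative of a one-form. -/
def lie1 {n : ℕ} (X : FVect n) (θ : FForm1 n) : FForm1 n := fun i =>
  ∑ k, (X k * pd k (θ i) + pd i (X k) * θ k)

/-- The Lie derivative of a two-form. -/
def lie2 {n : ℕ} (X : FVect n) (B : FForm2 n) : FForm2 n := fun i j =>
  ∑ k, (X k * pd k (B i j) + pd i (X k) * B k j + pd j (X k) * B i k)

/-- The Gelfand-Fuks-Chern one-cocycle of formal vector fields with values in one-forms,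
`f^i ∂_i ↦ d (∂_i f^i)`; it represents the first Chern class of the tangent module. -/
def gfC1 {n : ℕ} (X : FVect n) : FForm1 n := dFun (∑ i, pd i (X i))

/-- The Gelfand-Fuks two-cocycle of formal vector fields with values in closed two-forms,
`(f^i ∂_i, g^j ∂_j) ↦ - d (∂_j f^i) ∧ d (∂_i g^j)`; it represents the second component of the
Chern character of the tangent module. -/
def gfCh2 {n : ℕ} (X Y : FVect n) : FForm2 n := fun a b =>
  -∑ i, ∑ j, wedge (dFun (pd j (X i))) (dFun (pd i (Y j))) a b

/-- The primitive of a closed two-form given by the radial homotopy of the formal Poincaré lemma: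
`d (primitive B) = B` if `B` is closed. -/
def primitive {n : ℕ} (B : FForm2 n) : FForm1 n := fun k =>
  ∑ j, MvPowerSeries.X j *
    (show Ohat n from fun m => MvPowerSeries.coeff m (B j k) / ((m.degree : ℂ) + 2))

lemma hasSubst_linear {n : ℕ} (J : Matrix (Fin n) (Fin n) ℂ) :
    MvPowerSeries.HasSubst (fun i : Fin n =>
      (∑ k, MvPowerSeries.C (J i k) * MvPowerSeries.X k : Ohat n)) :=
  MvPowerSeries.hasSubst_of_constantCoeff_zero fun i => by simp [map_sum]

/-- The linear change of variables `f(t) ↦ f(J t)`. -/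
def linSubst {n : ℕ} (J : Matrix (Fin n) (Fin n) ℂ) : Ohat n →ₐ[ℂ] Ohat n :=
  MvPowerSeries.substAlgHom (hasSubst_linear J)

/-- The pull-back of a two-form along `t ↦ J t`. -/
def linPull2 {n : ℕ} (J : Matrix (Fin n) (Fin n) ℂ) (B : FForm2 n) : FForm2 n := fun a b =>
  ∑ i, ∑ j, MvPowerSeries.C (J i a * J j b) * linSubst J (B i j)

/-! ### Chiral differential operators on the formal disk -/

/-- The variables over the formal functions of the `c^i_0`: `Sum.inl (i, k)` is `b^i_{-1-k}` and
`Sum.inr (i, k)` is `c^i_{-1-k}`. -/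
abbrev Var (n : ℕ) := (Fin n × ℕ) ⊕ (Fin n × ℕ)

/-- The state space of chiral differential operators on the formal disk,
`ℂ⟦c₀⟧ [b^i_l, c^i_m]` with `l, m < 0`. -/
abbrev CDOhat (n : ℕ) := MvPolynomial (Var n) (Ohat n)

/-- The vector `b^i_{-1-k}`. -/
def bVar {n : ℕ} (i : Fin n) (k : ℕ) : CDOhat n := MvPolynomial.X (Sum.inl (i, k))

/-- The vector `c^i_{-1-k}`. -/
def cVar {n : ℕ} (i : Fin n) (k : ℕ) : CDOhat n := MvPolynomial.X (Sum.inr (i, k))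

/-- The conformal dimensions of the variables: `b^i_l` has dimension `-l`, and so has `c^i_l`
(formal functions of `c_0` have dimension zero). -/
def wt {n : ℕ} : Var n → ℕ
  | Sum.inl (_, k) => k + 1
  | Sum.inr (_, k) => k + 1

/-- The vectors of conformal dimension `N`. -/
def HasDim {n : ℕ} (N : ℕ) (v : CDOhat n) : Prop :=
  MvPolynomial.IsWeightedHomogeneous wt v N

/-- The operator `∂ / ∂ b^i_{-1-k}`. -/
def db {n : ℕ} (i : Fin n) (k : ℕ) : CDOhat n →ₗ[ℂ] CDOhat n :=
  (MvPolynomial.pderiv (R := Ohat n) (Sum.inl (i, k))).toLinearMap.restrictScalars ℂ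

/-- The operator `∂ / ∂ c^i_0`, which differentiates the coefficients. -/
def dc0 {n : ℕ} (i : Fin n) : CDOhat n →ₗ[ℂ] CDOhat n where
  toFun v := ∑ d ∈ v.support, MvPolynomial.monomial d (pd i (MvPolynomial.coeff d v))
  map_add' v w := by
    classical
    ext1 d
    simp only [MvPolynomial.coeff_add, MvPolynomial.coeff_sum, MvPolynomial.coeff_monomial,
      Finset.sum_ite_eq', MvPolynomial.mem_support_iff]
    split_ifs <;> simp_all [← map_add]
  map_smul' r v := by
    classical
    ext1 d
    simp only [MvPolynomial.coeff_smul, MvPolynomial.coeff_sum, MvPolynomial.coeff_monomial,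
      Finset.sum_ite_eq', MvPolynomial.mem_support_iff, RingHom.id_apply]
    split_ifs <;> simp_all

/-- The operator `∂ / ∂ c^i_{-m}`. -/
def dc {n : ℕ} (i : Fin n) : ℕ → (CDOhat n →ₗ[ℂ] CDOhat n)
  | 0 => dc0 i
  | m + 1 => (MvPolynomial.pderiv (R := Ohat n) (Sum.inr (i, m))).toLinearMap.restrictScalars ℂ

/-- The translation operator: the derivation with `b_m ↦ -m b_{m-1}`, `c_m ↦ -(m-1) c_{m-1}`. -/
def transl (n : ℕ) : CDOhat n →ₗ[ℂ] CDOhat n :=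
  ∑ i, (LinearMap.mulLeft ℂ (cVar i 0)) ∘ₗ dc0 i +
    (MvPolynomial.mkDerivation (Ohat n) (A := CDOhat n) fun v => match v with
      | Sum.inl (i, k) => ((k : CDOhat n) + 1) * bVar i (k + 1)
      | Sum.inr (i, k) => ((k : CDOhat n) + 2) * cVar i (k + 1)).toLinearMap.restrictScalars ℂ

/-- The coefficient of `z^(-d)` in the contraction operator
`∑ (∂_z^k ∂_w^m (z - w)⁻¹ / (k! m!))_{w = 0} (∂/∂b_{-1-k} ⊗ ∂/∂c_{-m})`
`  - ∑ (∂_z^m ∂_w^k (z - w)⁻¹ / (k! m!))_{w = 0} (∂/∂c_{-m} ⊗ ∂/∂b_{-1-k})`,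
which encodes the operator products of `b(z)` and `c(z)`. -/
def contraction (n : ℕ) : ℕ → Module.End ℂ (CDOhat n ⊗[ℂ] CDOhat n)
  | 0 => 0
  | d + 1 => ∑ i : Fin n, ∑ p ∈ Finset.HasAntidiagonal.antidiagonal d, (d.choose p.1 : ℂ) •
      ((-1 : ℂ) ^ p.1 • TensorProduct.map (db i p.1) (dc i p.2) +
        (-1 : ℂ) ^ (p.2 + 1) • TensorProduct.map (dc i p.2) (db i p.1))

/-- The coefficient of `z^(-d)` in the exponential of the contraction operator. -/
def wick (n d : ℕ) : Module.End ℂ (CDOhat n ⊗[ℂ] CDOhat n) :=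
  ∑ p ∈ Finset.range (d + 1), (p.factorial : ℂ)⁻¹ •
    PowerSeries.coeff d ((PowerSeries.mk (contraction n)) ^ p)

/-- The Fourier modes of `Y(v; z) w = (e^{zT} ⊗ 1) exp(contraction) (v ⊗ w)`, multiplied out
(Wick's theorem for the normally ordered monomials in `b`, `c` and their derivatives). -/
def modes (n : ℕ) (m : ℤ) (v w : CDOhat n) : CDOhat n :=
  ∑ᶠ d : ℕ, if m + 1 ≤ d then
    (((d - 1 - m).toNat.factorial : ℂ)⁻¹) •
      LinearMap.mul' ℂ (CDOhat n)
        (TensorProduct.map (transl n ^ (d - 1 - m).toNat) LinearMap.id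
          (wick n d (v ⊗ₜ[ℂ] w)))
  else 0

instance (n : ℕ) : VertexOps (CDOhat n) where
  vac := 1
  T := transl n
  prod := modes n

/-- The embedding of formal vector fields, `f ∂_j ↦ f(c) b^j_{-1}`. -/
def tauW {n : ℕ} (X : FVect n) : CDOhat n := ∑ i, MvPolynomial.C (X i) * bVar i 0

/-- The embedding of formal one-forms, `f dt_j ↦ f(c) T c^j_0`. -/
def tauForm {n : ℕ} (θ : FForm1 n) : CDOhat n := ∑ i, MvPolynomial.C (θ i) * cVar i 0

/-- The projection from vectors of dimension one to formal vector fields. -/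
def toVect {n : ℕ} (v : CDOhat n) : FVect n := fun i =>
  MvPolynomial.coeff (Finsupp.single (Sum.inl (i, 0)) 1) v

/-- The conformal vector `L_{-2} = ∑ b^i_{-1} c^i_{-1}`. -/
def conformalVector (n : ℕ) : CDOhat n := ∑ i, bVar i 0 * cVar i 0

/-- The action of the pair `(X, B)`, an element of the extension of formal vector fields by closed
two-forms with cocycle `gfCh2`: the field `X` acts by `(tauW X)_(0)`, and `B = dθ` acts by
`-(tauForm θ)_(0)`. The sign is the one for which this is a Lie algebra action of the extension
by `gfCh2` (rather than by `-gfCh2`). -/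
def extAct {n : ℕ} (X : FVect n) (B : FForm2 n) (v : CDOhat n) : CDOhat n :=
  VertexOps.prod 0 (tauW X) v - VertexOps.prod 0 (tauForm (primitive B)) v

/-- The action of a linear coordinate change: `c ↦ J c`, `b ↦ (Jᵀ)⁻¹ b`. -/
def glAct {n : ℕ} (J : Matrix (Fin n) (Fin n) ℂ) : CDOhat n →+* CDOhat n :=
  MvPolynomial.eval₂Hom (MvPolynomial.C.comp (linSubst J : Ohat n →+* Ohat n)) fun v => match v with
    | Sum.inl (i, k) => ∑ j, MvPolynomial.C (MvPowerSeries.C (J⁻¹ j i)) * bVar j k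
    | Sum.inr (i, k) => ∑ j, MvPolynomial.C (MvPowerSeries.C (J i j)) * cVar j k

/-! ### The Virasoro vertex algebra -/

/-- The relations `[L_m, L_k] = (m - k) L_{m+k} + δ_{m+k,0} c (m³ - m) / 12`. -/
inductive VirRel (c : ℂ) : FreeAlgebra ℂ ℤ → FreeAlgebra ℂ ℤ → Prop
  | comm (m k : ℤ) : VirRel c
      (FreeAlgebra.ι ℂ m * FreeAlgebra.ι ℂ k - FreeAlgebra.ι ℂ k * FreeAlgebra.ι ℂ m)
      (((m : ℂ) - k) • FreeAlgebra.ι ℂ (m + k) +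
        algebraMap ℂ _ (if m + k = 0 then c * ((m : ℂ) ^ 3 - m) / 12 else 0))

/-- The enveloping algebra of the Virasoro Lie algebra with central element set equal to `c`. -/
abbrev VirU (c : ℂ) := RingQuot (VirRel c)

/-- The mode `L_m`. -/
def vL (c : ℂ) (m : ℤ) : VirU c := RingQuot.mkAlgHom ℂ (VirRel c) (FreeAlgebra.ι ℂ m)

/-- The left ideal generated by the `L_m` with `m ≥ -1`. -/
def virIdeal (c : ℂ) : Submodule (VirU c) (VirU c) :=
  Submodule.span (VirU c) (vL c '' {m | -1 ≤ m})

/-- The vacuum module of central charge `c`, the state space of the Virasoro vertex algebra. -/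
abbrev Vir (c : ℂ) := VirU c ⧸ virIdeal c

/-- The vacuum vector. -/
def virVac (c : ℂ) : Vir c := Submodule.Quotient.mk 1

/-- The vector `L_{m₁} L_{m₂} ⋯ L_{mᵣ} |0⟩`. -/
def virWord (c : ℂ) (w : List ℤ) : Vir c := (w.map (vL c)).prod • virVac c

/-- The linear combination of words. -/
def virState (c : ℂ) : (List ℤ →₀ ℂ) →ₗ[ℂ] Vir c := Finsupp.linearCombination ℂ (virWord c)

/-- The Fourier modes of the field of the vector `L_{m₁} L_{m₂} ⋯ L_{mᵣ} |0⟩`. The field of the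
vacuum is the identity, and the field of `L_m v = (L_{-2})_(m+1) v` is determined from that of `v`
and from `Y(L_{-2}; z) = ∑ L_m z^(-m-2)` by
`(a_(p) v)_(N) = ∑_j (-1)^j (p choose j) (a_(p-j) v_(N+j) - (-1)^p v_(p+N-j) a_(j))`. -/
def virField (c : ℂ) : List ℤ → ℤ → Vir c → Vir c
  | [], N, x => if N = -1 then x else 0
  | m :: w, N, x => ∑ᶠ j : ℕ, ((-1 : ℂ) ^ j * (Ring.choose (m + 1) j : ℤ)) •
      (vL c (m - j) • virField c w (N + j) x -
        (-1 : ℂ) ^ (m + 1) • virField c w (m + 1 + N - j) (vL c ((j : ℤ) - 1) • x))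

lemma virState_surjective (c : ℂ) : Function.Surjective (virState c) := by
  have key : ∀ x : FreeAlgebra ℂ ℤ,
      ∀ r ∈ Submodule.span ℂ (Set.range fun w : List ℤ => (w.map (vL c)).prod),
        RingQuot.mkAlgHom ℂ (VirRel c) x * r ∈
          Submodule.span ℂ (Set.range fun w : List ℤ => (w.map (vL c)).prod) := by
    intro x
    induction x using FreeAlgebra.induction with
    | grade0 z =>
      intro r hr
      rw [AlgHom.commutes, ← Algebra.smul_def]
      exact Submodule.smul_mem _ _ hr
    | grade1 m =>
      intro r hr
      induction hr using Submodule.span_induction with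
      | mem r hr =>
        obtain ⟨w, rfl⟩ := hr
        exact Submodule.subset_span ⟨m :: w, by simp [vL]⟩
      | zero => simp
      | add a b _ _ ha hb => rw [mul_add]; exact Submodule.add_mem _ ha hb
      | smul z a _ ha => rw [mul_smul_comm]; exact Submodule.smul_mem _ _ ha
    | mul a b ha hb => intro r hr; rw [map_mul, mul_assoc]; exact ha _ (hb _ hr)
    | add a b ha hb =>
      intro r hr
      rw [map_add, add_mul]
      exact Submodule.add_mem _ (ha _ hr) (hb _ hr)
  intro v
  obtain ⟨u, rfl⟩ := Submodule.Quotient.mk_surjective _ v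
  obtain ⟨x, rfl⟩ := RingQuot.mkAlgHom_surjective ℂ (VirRel c) u
  have h := key x 1 (Submodule.subset_span ⟨[], by simp⟩)
  rw [mul_one] at h
  rw [← LinearMap.mem_range]
  generalize RingQuot.mkAlgHom ℂ (VirRel c) x = r at h ⊢
  induction h using Submodule.span_induction with
  | mem r hr =>
    obtain ⟨w, rfl⟩ := hr
    refine ⟨Finsupp.single w 1, ?_⟩
    simp [virState, virWord, virVac, ← Submodule.Quotient.mk_smul]
  | zero => exact Submodule.zero_mem _
  | add a b _ _ ha hb => rw [Submodule.Quotient.mk_add]; exact Submodule.add_mem _ ha hb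
  | smul z a _ ha => rw [Submodule.Quotient.mk_smul]; exact Submodule.smul_mem _ _ ha

/-- Fourier modes on the vacuum module: write a vector as a linear combination of words. (The
result does not depend on the way in which this is done.) -/
def virModes (c : ℂ) (N : ℤ) (v x : Vir c) : Vir c :=
  (Function.surjInv (virState_surjective c) v).sum fun w z => z • virField c w N x

instance (c : ℂ) : VertexOps (Vir c) where
  vac := virVac c
  T v := vL c (-1) • v
  prod := virModes c

/-- The vectors of conformal dimension `N`: `L_m` raises the dimension by `-m`. -/
def virDim (c : ℂ) (N : ℕ) : Submodule ℂ (Vir c) :=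
  Submodule.span ℂ (virWord c '' {w | w.sum = -(N : ℤ)})

/-! ### Pointwise operations -/

instance {ι : Type*} {V : ι → Type*} [∀ i, VertexOps (V i)] : VertexOps (∀ i, V i) where
  vac _ := VertexOps.vac
  T v i := VertexOps.T (v i)
  prod m v w i := VertexOps.prod m (v i) (w i)

instance {Y V : Type*} [TopologicalSpace Y] [VertexOps V] : VertexOps (LocallyConstant Y V) where
  vac := LocallyConstant.const Y VertexOps.vac
  T f := f.map VertexOps.T
  prod m f g := ⟨fun x => VertexOps.prod m (f x) (g x),
    f.isLocallyConstant.comp₂ g.isLocallyConstant (VertexOps.prod m)⟩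

/-! ### Charts, the frame bundle and its Gelfand-Kazhdan structures

The frame bundle of a complex manifold is trivialised over each chart by the coordinate frame.
Equivariant functions and basic forms on the frame bundle are written as families of local
functions and forms, one for each chart, that are related by the Jacobians of the transition maps. -/

section Manifold

variable {n : ℕ} {X : Type*} [TopologicalSpace X] [ChartedSpace (Fin n → ℂ) X]

/-- The coordinate change from the chart `e` to the chart `e'`. -/
def coordChange (e e' : atlas (Fin n → ℂ) X) (y : Fin n → ℂ) : Fin n → ℂ := e'.1 (e.1.symm y)

/-- The open set on which the coordinate change is defined. -/
def overlap (e e' : atlas (Fin n → ℂ) X) : Set (Fin n → ℂ) := (e.1.symm.trans e'.1).source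

/-- The holomorphic partial derivative. -/
def hpd (k : Fin n) (f : (Fin n → ℂ) → ℂ) (y : Fin n → ℂ) : ℂ := fderiv ℂ f y (Pi.single k 1)

/-- The Jacobian matrix of the coordinate change. -/
def jac (e e' : atlas (Fin n → ℂ) X) (y : Fin n → ℂ) : Matrix (Fin n) (Fin n) ℂ :=
  Matrix.of fun i k => hpd k (fun z => coordChange e e' z i) y

/-- The Taylor series of a holomorphic function at the point `y`. -/
def taylor (f : (Fin n → ℂ) → ℂ) (y : Fin n → ℂ) : Ohat n := fun m =>
  (List.finRange n).foldr (fun i g => (hpd i)^[m i] g) f y / ∏ i, ((m i).factorial : ℂ)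

/-- The derivative, coefficient by coefficient, at `y` in the real direction `v`. -/
def serDeriv (g : (Fin n → ℂ) → Ohat n) (y v : Fin n → ℂ) : Ohat n := fun m =>
  fderiv ℝ (fun z => MvPowerSeries.coeff m (g z)) y v

variable (n X) in
/-- A formal exponential: a smooth section of the bundle of formal coordinates modulo linear
coordinate changes, that is, a smooth equivariant map from the frame bundle to the bundle of formal
coordinates. Its value at the coordinate frame of the chart `e` at the point with coordinates `y`
is a formal coordinate, and `coord e y` is the expression of the latter in the chart `e`. -/
structure FormalExponential where
  coord : atlas (Fin n → ℂ) X → (Fin n → ℂ) → Fin n → Ohat n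
  constantCoeff_coord : ∀ e, ∀ y ∈ e.1.target, ∀ i,
    MvPowerSeries.constantCoeff (coord e y i) = y i
  linear_coord : ∀ e, ∀ y ∈ e.1.target, ∀ i j,
    MvPowerSeries.coeff (Finsupp.single j 1) (coord e y i) = if i = j then 1 else 0
  smooth_coord : ∀ e i m,
    ContDiffOn ℝ ∞ (fun y => MvPowerSeries.coeff m (coord e y i)) e.1.target
  equivariant : ∀ e e', ∀ y ∈ overlap e e', ∀ i,
    MvPowerSeries.subst (fun j => coord e y j - MvPowerSeries.C (y j))
        (taylor (fun z => coordChange e e' z i) y) =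
      linSubst (jac e e' y) (coord e' (coordChange e e' y) i)

/-- The connection one-form with values in formal vector fields, the pull-back of the Grothendieck
connection along the formal exponential, evaluated at the point with coordinates `y` on the
real tangent vector `v`. -/
def FormalExponential.conn (σ : FormalExponential n X) (e : atlas (Fin n → ℂ) X)
    (y v : Fin n → ℂ) : FVect n :=
  -((Matrix.of fun i k => pd k (σ.coord e y i) : Matrix (Fin n) (Fin n) (Ohat n))⁻¹.mulVec
    fun i => serDeriv (fun z => σ.coord e z i) y v)

/-- A trivialization of the second component of the Chern character of the tangent bundle: a smooth
basic one-form on the frame bundle with values in formal closed two-forms, whose covariant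
differential is the image of the cocycle `gfCh2` under the characteristic map of the formal
exponential. -/
structure Ch2Trivialization (σ : FormalExponential n X) where
  form : atlas (Fin n → ℂ) X → (Fin n → ℂ) → (Fin n → ℂ) → FForm2 n
  linear : ∀ e y, IsLinearMap ℝ (form e y)
  closed : ∀ e, ∀ y ∈ e.1.target, ∀ v, IsClosed2 (form e y v)
  smooth : ∀ e v i j m,
    ContDiffOn ℝ ∞ (fun y => MvPowerSeries.coeff m (form e y v i j)) e.1.target
  basic : ∀ e e', ∀ y ∈ overlap e e', ∀ v,
    form e y v =
      linPull2 (jac e e' y) (form e' (coordChange e e' y) ((jac e e' y).mulVec v))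
  trivializes : ∀ e, ∀ y ∈ e.1.target, ∀ v w,
    (fun i j => serDeriv (fun z => form e z w i j) y v) -
        (fun i j => serDeriv (fun z => form e z v i j) y w) +
        lie2 (σ.conn e y v) (form e y w) - lie2 (σ.conn e y w) (form e y v) =
      gfCh2 (σ.conn e y v) (σ.conn e y w)

variable (n X) in
/-- The vanishing of the first Chern class of the tangent bundle in `H¹(X, Ω¹)`: the Čech cocycle
`d log det` of the Jacobians is the coboundary of holomorphic one-forms on the charts. -/
def C1Vanishes : Prop :=
  ∃ η : atlas (Fin n → ℂ) X → (Fin n → ℂ) → Fin n → ℂ,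
    (∀ e, DifferentiableOn ℂ (η e) e.1.target) ∧
    ∀ e e', ∀ y ∈ overlap e e', ∀ k,
      hpd k (fun z => (jac e e' z).det) y / (jac e e' y).det =
        η e y k - ∑ i, jac e e' y i k * η e' (coordChange e e' y) i

/-! ### The sheaf of chiral differential operators -/

/-- The coordinates in the chart `e` of the points of `U`. -/
def chartSet (U : TopologicalSpace.Opens X) (e : atlas (Fin n → ℂ) X) : Set (Fin n → ℂ) :=
  e.1.target ∩ e.1.symm ⁻¹' U

variable (n) in
/-- Functions on the coordinate frames over `U` with values in chiral differential operators on the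
formal disk. -/
abbrev Fam (U : TopologicalSpace.Opens X) : Type _ :=
  ∀ e : atlas (Fin n → ℂ) X, chartSet U e → CDOhat n

/-- The restriction to a smaller open set. -/
def Fam.restrict {U U' : TopologicalSpace.Opens X} (h : U' ≤ U) (s : Fam n U) : Fam n U' :=
  fun e y => s e ⟨y.1, y.2.1, h y.2.2⟩

open Classical in
/-- The coefficient of the monomial `d` in the variables and `m` in `c_0`, extended by zero. -/
def Fam.coeff {U : TopologicalSpace.Opens X} (s : Fam n U) (e : atlas (Fin n → ℂ) X)
    (d : Var n →₀ ℕ) (m : Fin n →₀ ℕ) (y : Fin n → ℂ) : ℂ :=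
  if h : y ∈ chartSet U e then MvPowerSeries.coeff m (MvPolynomial.coeff d (s e ⟨y, h⟩)) else 0

/-- The section over `U` of the sheaf of chiral differential operators, obtained by extended
Gelfand-Kazhdan descent: `s` is an equivariant function on the frame bundle over `U` with
values in chiral differential operators on the formal disk, smooth, locally of bounded conformal
dimension, and flat for the connection `(σ.conn, -α)` with values in the extension of formal
vector fields by closed two-forms. -/
structure IsSection {σ : FormalExponential n X} (α : Ch2Trivialization σ)
    (U : TopologicalSpace.Opens X) (s : Fam n U) : Prop where
  equivariant : ∀ e e' (y : chartSet U e) (y' : chartSet U e'), y.1 ∈ overlap e e' →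
    y'.1 = coordChange e e' y.1 → s e y = glAct (jac e e' y.1) (s e' y')
  smooth : ∀ e d m, ContDiffOn ℝ ∞ (s.coeff e d m) (chartSet U e)
  bounded : ∀ e (y : chartSet U e), ∃ N : ℕ, ∀ᶠ y' in nhds y,
    MvPolynomial.weightedTotalDegree wt (s e y') ≤ N
  flat : ∀ e (y : chartSet U e) (v : Fin n → ℂ) d m,
    fderiv ℝ (s.coeff e d m) y.1 v +
      MvPowerSeries.coeff m (MvPolynomial.coeff d
        (extAct (σ.conn e y.1 v) (-α.form e y.1 v) (s e y))) = 0

end Manifold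

end

end ChiralDO

namespace ChiralDO

noncomputable section

set_option linter.unusedSectionVars false

open Finset.HasAntidiagonal

/-! ### Exponentials of operator-valued power series -/

/-! The fields on the formal disk are given by Wick's theorem: $Y(v,z)w$ is obtained from
$(e^{zT}\otimes 1)\exp(R(z))(v\otimes w)$ by multiplication, where the contraction $R(z)$ is a sum
of tensor products of commuting derivations. This alone gives the vertex algebra axioms. For every
contraction of this kind that is translation covariant, symmetric and locally nilpotent, the
Borcherds identity holds (`WickData.IsTranslationCovariant.borcherds`): on three factors the
exponentials of the pairwise contractions commute, all three double products become combinations of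
the same triple contractions, and their coefficients agree by the residue theorem for $x^A(1+x)^D$
(`intChoose_reflect`). Consequently zero modes are derivations of all products, and a vector with
Virasoro operator products defines a homomorphism from the Virasoro vertex algebra
(`WickData.IsVirasoro.hom`).

The local statement is a computation. The vector $L=\sum b^i_{-1}c^i_{-1}$ is Virasoro of central
charge $2n$. A vector field $X$ has weight one, but it is not primary:
$L_{(2)}X=\operatorname{div}X$. By skew-symmetry
$X_{(0)}L=-\tfrac12T^2\operatorname{div}X=-\tfrac12T\,c_1^{GF}(X)$, whereas the zero modes of
one-forms annihilate $L$. The pairing formula and the vanishing criterion follow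
(`extAct_conformalVector`).

For the global statement $L$ is replaced by $L_\xi=L+\tfrac12T\xi$ with a formal one-form $\xi$. It
is still Virasoro of central charge $2n$, because one-forms have no singular operator products with
each other and are primary of weight one for $L$ (`shiftedConformalVector_isVirasoro`). A vector
field $X$ moves $L_\xi$ by $\tfrac12T(\mathcal L_X\xi-c_1^{GF}(X))$, and a linear change of
coordinates pulls $\xi$ back. It thus suffices to find an equivariant $\xi$ on the frame bundle with
$\partial_v\xi+\mathcal L_X\xi=d\operatorname{div}X$ for the connection $X=\omega_\sigma(v)$.

Such a form is $\xi=-(d\log\det D\varphi+\varphi^*\eta)$, where $\varphi$ is the formal exponential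
and $\eta$ is the cochain of holomorphic one-forms supplied by `C1Vanishes`. The connection
annihilates $\varphi$, hence also pull-backs of holomorphic functions, and it multiplies $\det
D\varphi$ by $-\operatorname{div}X$ (`coordForm_flat`). On an overlap $D\varphi$ changes by the jet
of the Jacobian, whose $d\log\det$ is compensated by the coboundary of $\eta$
(`coordForm_linPull1`). Differentiation in the parameters, the infinitesimal action and linear
coordinate changes respect all Fourier modes, so flatness and equivariance spread from $L_\xi$ to
the images of all words in the $L_m$ (`famHasDeriv_virHom`, `glAct_virHom`).

Identities between formal jets are proved without explicit formulas for coefficients: a family of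
series without constant terms whose derivatives lie in the ideal generated by the family is zero
(`eq_zero_of_pd_mem_span`). -/

lemma sum_antidiagonal_eq_box {M : Type*} [AddCommMonoid M] (g : ℕ → ℕ → M) {a N : ℕ}
    (h : a < N) : ∑ x ∈ antidiagonal a, g x.1 x.2 =
      ∑ x ∈ Finset.range N, ∑ y ∈ Finset.range N, if x + y = a then g x y else 0 := by
  rw [← Finset.sum_product', ← Finset.sum_filter]
  refine Finset.sum_congr ?_ fun _ _ => rfl
  ext x
  simp only [mem_antidiagonal, Finset.mem_filter, Finset.mem_product, Finset.mem_range]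
  omega

section ExpSeries

variable {E : Type*} [Ring E] [Algebra ℂ E]

/-- The coefficients of the exponential of a power series without constant term. -/
def expCoeff (A : PowerSeries E) (d : ℕ) : E :=
  ∑ p ∈ Finset.range (d + 1), (p.factorial : ℂ)⁻¹ • PowerSeries.coeff d (A ^ p)

lemma coeff_pow_eq_zero {A : PowerSeries E} (hA : PowerSeries.coeff 0 A = 0) {d p : ℕ}
    (h : d < p) : PowerSeries.coeff d (A ^ p) = 0 := by
  induction p generalizing d with
  | zero => omega
  | succ p ih =>
    rw [pow_succ, PowerSeries.coeff_mul]
    refine Finset.sum_eq_zero fun x hx => ?_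
    rw [mem_antidiagonal] at hx
    by_cases h1 : x.2 = 0
    · rw [h1, hA, mul_zero]
    · rw [ih (by omega), zero_mul]

/-- Since `A ^ p` starts in degree `p`, the cut-off in `expCoeff` loses nothing and may be raised to
any larger bound. Exponentials in different degrees can then be summed over one range. -/
lemma expCoeff_eq_sum {A : PowerSeries E} (hA : PowerSeries.coeff 0 A = 0) {d N : ℕ}
    (h : d < N) :
    expCoeff A d = ∑ p ∈ Finset.range N, (p.factorial : ℂ)⁻¹ • PowerSeries.coeff d (A ^ p) := by
  refine Finset.sum_subset (Finset.range_subset_range.2 (by omega)) fun p _ hp => ?_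
  rw [coeff_pow_eq_zero hA (by simpa using hp), smul_zero]

lemma coeff_complex_smul (s : ℂ) (A : PowerSeries E) (d : ℕ) :
    PowerSeries.coeff d (s • A) = s • PowerSeries.coeff d A := rfl

@[simp] lemma expCoeff_zero (A : PowerSeries E) : expCoeff A 0 = 1 := by
  simp [expCoeff]

/-- The binomial theorem for commuting series, carried out on a square of exponents that contains
every pair with a nonzero contribution. -/
lemma expCoeff_add {A B : PowerSeries E} (hA : PowerSeries.coeff 0 A = 0)
    (hB : PowerSeries.coeff 0 B = 0) (h : Commute A B) (d : ℕ) :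
    expCoeff (A + B) d =
      ∑ x ∈ antidiagonal d, expCoeff A x.1 * expCoeff B x.2 := by
  have h1 : ∀ x ∈ antidiagonal d, expCoeff A x.1 * expCoeff B x.2 =
      ∑ p ∈ Finset.range (2 * d + 2), ∑ q ∈ Finset.range (2 * d + 2),
        ((p.factorial : ℂ)⁻¹ * (q.factorial : ℂ)⁻¹) •
          (PowerSeries.coeff x.1 (A ^ p) * PowerSeries.coeff x.2 (B ^ q)) := by
    intro x hx
    rw [mem_antidiagonal] at hx
    rw [expCoeff_eq_sum hA (show x.1 < 2 * d + 2 by omega),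
      expCoeff_eq_sum hB (show x.2 < 2 * d + 2 by omega), Finset.sum_mul_sum]
    simp only [smul_mul_smul_comm]
  rw [Finset.sum_congr rfl h1, Finset.sum_comm]
  have h2 : ∀ p ∈ Finset.range (2 * d + 2), ∑ x ∈ antidiagonal d,
      ∑ q ∈ Finset.range (2 * d + 2), ((p.factorial : ℂ)⁻¹ * (q.factorial : ℂ)⁻¹) •
          (PowerSeries.coeff x.1 (A ^ p) * PowerSeries.coeff x.2 (B ^ q)) =
      ∑ q ∈ Finset.range (2 * d + 2), ((p.factorial : ℂ)⁻¹ * (q.factorial : ℂ)⁻¹) •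
        PowerSeries.coeff d (A ^ p * B ^ q) := by
    intro p _
    rw [Finset.sum_comm]
    refine Finset.sum_congr rfl fun q _ => ?_
    rw [PowerSeries.coeff_mul, Finset.smul_sum]
  rw [Finset.sum_congr rfl h2, expCoeff_eq_sum (by rw [map_add, hA, hB, add_zero]) (show d < d + 1 by omega)]
  -- The square also contains pairs with `p + q > d`, which do not occur in the exponential of the
  -- sum; they contribute nothing in degree `d`.
  have h3 : ∀ p q : ℕ, d < p + q → PowerSeries.coeff d (A ^ p * B ^ q) = 0 := by
    intro p q hpq
    rw [PowerSeries.coeff_mul]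
    refine Finset.sum_eq_zero fun x hx => ?_
    rw [mem_antidiagonal] at hx
    rcases lt_or_ge x.1 p with hp | hp
    · rw [coeff_pow_eq_zero hA hp, zero_mul]
    · rw [coeff_pow_eq_zero hB (show x.2 < q by omega), mul_zero]
  have h4 : ∀ N ∈ Finset.range (d + 1), (N.factorial : ℂ)⁻¹ • PowerSeries.coeff d ((A + B) ^ N) =
      ∑ x ∈ antidiagonal N, ((x.1.factorial : ℂ)⁻¹ * (x.2.factorial : ℂ)⁻¹) •
        PowerSeries.coeff d (A ^ x.1 * B ^ x.2) := by
    intro N _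
    rw [h.add_pow', map_sum, Finset.smul_sum]
    refine Finset.sum_congr rfl fun x hx => ?_
    rw [mem_antidiagonal] at hx
    rw [map_nsmul, ← Nat.cast_smul_eq_nsmul ℂ, smul_smul]
    congr 1
    have e1 := Nat.add_choose_mul_factorial_mul_factorial x.1 x.2
    have e2 : ((x.1 + x.2).choose x.1 : ℂ) * x.1.factorial * x.2.factorial =
        (x.1 + x.2).factorial := by
      rw [Nat.choose_symm_add]; exact_mod_cast e1
    have e3 : ((x.1 + x.2).factorial : ℂ) ≠ 0 := by exact_mod_cast Nat.factorial_ne_zero _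
    have e4 : (x.1.factorial : ℂ) ≠ 0 := by exact_mod_cast Nat.factorial_ne_zero _
    have e5 : (x.2.factorial : ℂ) ≠ 0 := by exact_mod_cast Nat.factorial_ne_zero _
    rw [← hx, ← e2]
    have e6 : ((x.1 + x.2).choose x.1 : ℂ) ≠ 0 := fun h0 => e3 (by rw [← e2, h0]; simp)
    field_simp
  rw [Finset.sum_congr rfl h4]
  have h5 : ∀ N ∈ Finset.range (d + 1),
      ∑ x ∈ antidiagonal N, ((x.1.factorial : ℂ)⁻¹ * (x.2.factorial : ℂ)⁻¹) •
        PowerSeries.coeff d (A ^ x.1 * B ^ x.2) =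
      ∑ p ∈ Finset.range (2 * d + 2), ∑ q ∈ Finset.range (2 * d + 2), if p + q = N then
        ((p.factorial : ℂ)⁻¹ * (q.factorial : ℂ)⁻¹) • PowerSeries.coeff d (A ^ p * B ^ q)
        else 0 := by
    intro N hN
    rw [Finset.mem_range] at hN
    exact sum_antidiagonal_eq_box (fun p q => ((p.factorial : ℂ)⁻¹ * (q.factorial : ℂ)⁻¹) •
        PowerSeries.coeff d (A ^ p * B ^ q)) (by omega)
  rw [Finset.sum_congr rfl h5, Finset.sum_comm]
  refine Finset.sum_congr rfl fun p _ => ?_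
  rw [Finset.sum_comm]
  refine Finset.sum_congr rfl fun q _ => ?_
  rw [Finset.sum_ite_eq]
  split_ifs with hpq
  · rfl
  · rw [h3 p q (by simpa using hpq), smul_zero]

/-- The derivation `t ^ e ↦ e t ^ (e + 1)` of operator-valued power series. -/
def shiftDeriv (A : PowerSeries E) : PowerSeries E :=
  PowerSeries.mk fun e => Nat.casesOn e 0 fun e => (e : ℂ) • PowerSeries.coeff e A

@[simp] lemma coeff_zero_shiftDeriv (A : PowerSeries E) :
    PowerSeries.coeff 0 (shiftDeriv A) = 0 := by simp [shiftDeriv]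

@[simp] lemma coeff_succ_shiftDeriv (A : PowerSeries E) (e : ℕ) :
    PowerSeries.coeff (e + 1) (shiftDeriv A) = (e : ℂ) • PowerSeries.coeff e A := by
  simp [shiftDeriv]

/-- `shiftDeriv` is $t^2\,d/dt$, which is a derivation even if the coefficients do not commute. In
the coordinate $z=1/t$ it is $-d/dz$. -/
lemma shiftDeriv_mul (A B : PowerSeries E) :
    shiftDeriv (A * B) = shiftDeriv A * B + A * shiftDeriv B := by
  ext e
  cases e with
  | zero => rw [map_add, PowerSeries.coeff_mul, PowerSeries.coeff_mul]; simp [-PowerSeries.coeff_zero_eq_constantCoeff]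
  | succ e =>
    rw [map_add, PowerSeries.coeff_mul, PowerSeries.coeff_mul, coeff_succ_shiftDeriv,
      Finset.Nat.sum_antidiagonal_succ, Finset.Nat.sum_antidiagonal_succ']
    simp only [coeff_zero_shiftDeriv, coeff_succ_shiftDeriv, zero_mul, mul_zero, zero_add]
    rw [← Finset.sum_add_distrib, PowerSeries.coeff_mul, Finset.smul_sum]
    refine Finset.sum_congr rfl fun x hx => ?_
    rw [mem_antidiagonal] at hx
    rw [smul_mul_assoc, mul_smul_comm, ← add_smul, ← hx, Nat.cast_add]

lemma mul_C_eq_of_shiftDeriv {A : PowerSeries E} {τ : E} {s : ℂ}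
    (h : A * PowerSeries.C τ = PowerSeries.C τ * A + s • shiftDeriv A) (p : ℕ) :
    A ^ p * PowerSeries.C τ = PowerSeries.C τ * A ^ p + s • shiftDeriv (A ^ p) := by
  induction p with
  | zero =>
    have : shiftDeriv (1 : PowerSeries E) = 0 := by
      ext e
      rcases e with _ | _ | e <;> simp [PowerSeries.coeff_one]
    simp [this]
  | succ p ih =>
    rw [pow_succ, mul_assoc, h, mul_add, ← mul_assoc, ih, shiftDeriv_mul, smul_add,
      mul_smul_comm, add_mul, smul_mul_assoc, mul_assoc, add_assoc]

/-- The hypothesis reads $[A,\tau]=s\,t^2A'$. As $t^2\,d/dt$ is a derivation, the relation passes to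
the powers of `A` and to the exponential. In this way the translation covariance of a contraction
becomes that of its Wick exponential. -/
lemma expCoeff_mul_of_commutator {A : PowerSeries E} (hA : PowerSeries.coeff 0 A = 0) {τ : E}
    {s : ℂ} (h : ∀ e, PowerSeries.coeff (e + 1) A * τ =
      τ * PowerSeries.coeff (e + 1) A + (s * e) • PowerSeries.coeff e A) (e : ℕ) :
    expCoeff A (e + 1) * τ = τ * expCoeff A (e + 1) + (s * e) • expCoeff A e := by
  have h' : A * PowerSeries.C τ = PowerSeries.C τ * A + s • shiftDeriv A := by
    ext e
    cases e with
    | zero =>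
      rw [PowerSeries.coeff_mul_C, map_add, PowerSeries.coeff_C_mul, coeff_complex_smul,
        coeff_zero_shiftDeriv, hA]
      simp
    | succ e => simp [h, mul_smul]
  have key := fun p => congrArg (PowerSeries.coeff (e + 1)) (mul_C_eq_of_shiftDeriv h' p)
  simp only [PowerSeries.coeff_mul_C, map_add, PowerSeries.coeff_C_mul, coeff_complex_smul,
    coeff_succ_shiftDeriv, smul_smul] at key
  rw [expCoeff_eq_sum hA (show e + 1 < e + 2 by omega),
    expCoeff_eq_sum hA (show e < e + 2 by omega), Finset.sum_mul, Finset.mul_sum,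
    Finset.smul_sum, ← Finset.sum_add_distrib]
  refine Finset.sum_congr rfl fun p _ => ?_
  rw [smul_mul_assoc, key, smul_add, mul_smul_comm, smul_comm]

/-- The substitution $t\mapsto rt$ is multiplicative and therefore commutes with the exponential. It
is needed for $r=-1$, where it accompanies the exchange of two factors. -/
lemma expCoeff_smul_pow (A : PowerSeries E) (r : ℂ) (d : ℕ) :
    expCoeff (PowerSeries.mk fun e => r ^ e • PowerSeries.coeff e A) d = r ^ d • expCoeff A d := by
  have key : ∀ p d, PowerSeries.coeff d
      ((PowerSeries.mk fun e => r ^ e • PowerSeries.coeff e A) ^ p) =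
        r ^ d • PowerSeries.coeff d (A ^ p) := by
    intro p
    induction p with
    | zero => intro d; rcases d with _ | d <;> simp [PowerSeries.coeff_one]
    | succ p ih =>
      intro d
      rw [pow_succ, pow_succ, PowerSeries.coeff_mul, PowerSeries.coeff_mul, Finset.smul_sum]
      refine Finset.sum_congr rfl fun x hx => ?_
      rw [mem_antidiagonal] at hx
      rw [ih, PowerSeries.coeff_mk, smul_mul_smul_comm, ← pow_add, hx]
  simp only [expCoeff, key, Finset.smul_sum]
  exact Finset.sum_congr rfl fun p _ => smul_comm _ _ _

lemma Commute.expCoeff_right {A : PowerSeries E} {x : E}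
    (h : ∀ e, Commute x (PowerSeries.coeff e A)) (d : ℕ) : Commute x (expCoeff A d) := by
  have h' : Commute (PowerSeries.C x) A := by
    ext e
    simpa using (h e).eq
  refine Commute.sum_right _ _ _ fun p _ => Commute.smul_right ?_ _
  have := congrArg (PowerSeries.coeff d) (h'.pow_right p).eq
  rwa [PowerSeries.coeff_C_mul, PowerSeries.coeff_mul_C] at this

lemma expCoeff_commute {A B : PowerSeries E}
    (h : ∀ e f, Commute (PowerSeries.coeff e A) (PowerSeries.coeff f B)) (d d' : ℕ) :
    Commute (expCoeff A d) (expCoeff B d') :=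
  Commute.expCoeff_right (fun e => (Commute.expCoeff_right (fun f => (h f e).symm) d).symm) d'

end ExpSeries

/-- A map that intertwines two contractions coefficient by coefficient intertwines their powers,
hence their exponentials. Multiplication of factors, insertion and permutation of factors, and
linear coordinate changes are all treated by this principle. -/
lemma expCoeff_intertwine {U V : Type*} [AddCommGroup U] [Module ℂ U] [AddCommGroup V]
    [Module ℂ V] {A : PowerSeries (Module.End ℂ U)} {B : PowerSeries (Module.End ℂ V)}
    {φ : U →ₗ[ℂ] V}
    (h : ∀ e x, PowerSeries.coeff e B (φ x) = φ (PowerSeries.coeff e A x)) (d : ℕ) (x : U) :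
    expCoeff B d (φ x) = φ (expCoeff A d x) := by
  have key : ∀ (p d : ℕ) (x : U),
      (PowerSeries.coeff d (B ^ p) : Module.End ℂ V) (φ x) =
        φ ((PowerSeries.coeff d (A ^ p) : Module.End ℂ U) x) := by
    intro p
    induction p with
    | zero => intro d x; rcases d with _ | d <;> simp [PowerSeries.coeff_one]
    | succ p ih =>
      intro d x
      simp only [pow_succ, PowerSeries.coeff_mul, LinearMap.sum_apply, map_sum,
        Module.End.mul_apply, h, ih]
  simp only [expCoeff, LinearMap.sum_apply, map_sum, LinearMap.smul_apply, map_smul, key]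

/-! ### Divided powers of an operator -/

section DivPow

variable {E : Type*} [Ring E] [Algebra ℂ E]

/-- The divided power `τ ^ b / b!`, which vanishes for negative `b`. -/
def divPow (τ : E) (b : ℤ) : E :=
  if 0 ≤ b then (b.toNat.factorial : ℂ)⁻¹ • τ ^ b.toNat else 0

lemma divPow_of_neg (τ : E) {b : ℤ} (h : b < 0) : divPow τ b = 0 := if_neg (by omega)

lemma divPow_natCast (τ : E) (b : ℕ) : divPow τ b = (b.factorial : ℂ)⁻¹ • τ ^ b := by
  simp [divPow]

@[simp] lemma divPow_zero (τ : E) : divPow τ 0 = 1 := by simp [divPow]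

@[simp] lemma divPow_one (τ : E) : divPow τ 1 = τ := by simp [divPow]

lemma mul_divPow (τ : E) (b : ℤ) : τ * divPow τ b = ((b : ℂ) + 1) • divPow τ (b + 1) := by
  rcases lt_or_ge b 0 with h | h
  · rw [divPow_of_neg τ h, mul_zero]
    -- At `b = -1` the divided power on the right is `1`, but its coefficient `b + 1` vanishes.
    rcases eq_or_ne b (-1) with rfl | h'
    · simp
    · rw [divPow_of_neg τ (show b + 1 < 0 by omega), smul_zero]
  · lift b to ℕ using h
    rw [divPow_natCast, show ((b : ℤ) + 1) = ((b + 1 : ℕ) : ℤ) by push_cast; rfl, divPow_natCast,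
      mul_smul_comm, ← pow_succ', smul_smul, Nat.factorial_succ]
    congr 1
    have h1 : ((b : ℂ) + 1) ≠ 0 := by exact_mod_cast Nat.succ_ne_zero b
    have h2 : (b.factorial : ℂ) ≠ 0 := by exact_mod_cast b.factorial_ne_zero
    push_cast
    field_simp

lemma commute_divPow (τ : E) (b : ℤ) : Commute τ (divPow τ b) := by
  unfold divPow
  split_ifs
  · exact ((Commute.refl τ).pow_right _).smul_right _
  · exact Commute.zero_right _

lemma Commute.divPow_right {x τ : E} (h : Commute x τ) (b : ℤ) : Commute x (divPow τ b) := by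
  unfold divPow
  split_ifs
  · exact (h.pow_right _).smul_right _
  · exact Commute.zero_right _

lemma divPow_mul (τ : E) (a b : ℕ) :
    divPow τ a * divPow τ b = ((a + b).choose a : ℂ) • divPow τ ((a : ℤ) + b) := by
  rw [show ((a : ℤ) + b) = ((a + b : ℕ) : ℤ) by push_cast; rfl]
  simp only [divPow_natCast]
  rw [smul_mul_smul_comm, ← pow_add, smul_smul]
  congr 1
  have e2 : ((a + b).choose a : ℂ) * a.factorial * b.factorial = (a + b).factorial := by
    rw [Nat.choose_symm_add]; exact_mod_cast Nat.add_choose_mul_factorial_mul_factorial a b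
  have e3 : ((a + b).factorial : ℂ) ≠ 0 := by exact_mod_cast Nat.factorial_ne_zero _
  have e4 : (a.factorial : ℂ) ≠ 0 := by exact_mod_cast Nat.factorial_ne_zero _
  have e5 : (b.factorial : ℂ) ≠ 0 := by exact_mod_cast Nat.factorial_ne_zero _
  have e6 : ((a + b).choose a : ℂ) ≠ 0 := fun h0 => e3 (by rw [← e2, h0]; simp)
  rw [← e2]
  field_simp

lemma succ_mul_multichoose_succ (d j : ℕ) :
    (j + 1) * Nat.multichoose d (j + 1) = (d + j) * Nat.multichoose d j := by
  cases d with
  | zero => cases j <;> simp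
  | succ d =>
    rw [Nat.multichoose_eq, Nat.multichoose_eq]
    simp only [show d + 1 + (j + 1) - 1 = d + j + 1 by omega,
      show d + 1 + j - 1 = d + j by omega]
    have := Nat.add_one_mul_choose_eq (d + j) j
    rw [mul_comm, ← this]
    ring

/-- The commutation rule integrates to $w(t)e^{x\tau}=e^{x\tau}w\big(t/(1-sxt)\big)$, since
$t^2\,d/dt$ translates the coordinate $-1/t$. The multiset coefficients come from expanding
$\big(t/(1-sxt)\big)^d=t^d\sum_j\binom{d+j-1}{j}(sxt)^j$. In the formal proof this is an induction
on `b`. -/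
lemma mul_divPow_of_commutator {w : ℕ → E} {τ : E} {s : ℂ} (h0 : w 0 = 1)
    (h : ∀ e, w (e + 1) * τ = τ * w (e + 1) + (s * e) • w e) (a : ℕ) (b : ℤ) :
    w a * divPow τ b = ∑ x ∈ antidiagonal a,
      (s ^ x.2 * (Nat.multichoose x.1 x.2 : ℂ)) • (divPow τ (b - x.2) * w x.1) := by
  rcases lt_or_ge b 0 with hb | hb
  · rw [divPow_of_neg _ hb, mul_zero, Finset.sum_eq_zero]
    intro x _
    rw [divPow_of_neg _ (show b - x.2 < 0 by omega), zero_mul, smul_zero]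
  lift b to ℕ using hb
  induction b generalizing a with
  | zero =>
    rw [Finset.sum_eq_single (a, 0)]
    · simp
    · rintro ⟨d, j⟩ hx hne
      rw [mem_antidiagonal] at hx
      rw [divPow_of_neg, zero_mul, smul_zero]
      have : j ≠ 0 := by rintro rfl; exact hne (by simp_all)
      simp only [Nat.cast_zero]
      omega
    · intro hx; exact absurd (by simp [mem_antidiagonal]) hx
  | succ b ih =>
    have hb : ((b : ℂ) + 1) ≠ 0 := by exact_mod_cast Nat.succ_ne_zero b
    have hd : divPow τ ((b + 1 : ℕ) : ℤ) = ((b : ℂ) + 1)⁻¹ • (τ * divPow τ b) := by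
      rw [mul_divPow, smul_smul]
      push_cast
      rw [inv_mul_cancel₀ hb, one_smul]
    rw [hd, mul_smul_comm, inv_smul_eq_iff₀ hb, ← mul_assoc]
    have step : ∀ a, τ * (w a * divPow τ b) = ∑ x ∈ antidiagonal a,
        (((b : ℂ) - x.2 + 1) * (s ^ x.2 * (Nat.multichoose x.1 x.2 : ℂ))) •
          (divPow τ (((b + 1 : ℕ) : ℤ) - x.2) * w x.1) := by
      intro a
      rw [ih, Finset.mul_sum]
      refine Finset.sum_congr rfl fun x _ => ?_
      rw [mul_smul_comm, ← mul_assoc, mul_divPow, smul_mul_assoc, smul_smul, mul_comm]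
      congr 2
      · push_cast; ring
      · congr 1; push_cast; ring
    cases a with
    | zero =>
      have := step 0
      simp only [h0, one_mul] at this ⊢
      rw [this]
      simp [h0]
    | succ a =>
      rw [h, add_mul, smul_mul_assoc, mul_assoc, step, ih a, Finset.Nat.sum_antidiagonal_succ',
        Finset.Nat.sum_antidiagonal_succ', smul_add, add_assoc, Finset.smul_sum, Finset.smul_sum,
        ← Finset.sum_add_distrib]
      congr 1
      · simp
      · refine Finset.sum_congr rfl fun x hx => ?_
        rw [mem_antidiagonal] at hx
        have e1 : ((b + 1 : ℕ) : ℤ) - ((x.2 + 1 : ℕ) : ℤ) = (b : ℤ) - x.2 := by push_cast; ring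
        simp only [e1, smul_smul, ← add_smul]
        congr 1
        have e2 : ((x.2 : ℂ) + 1) * (Nat.multichoose x.1 (x.2 + 1) : ℂ) =
            ((x.1 : ℂ) + x.2) * Nat.multichoose x.1 x.2 := by
          exact_mod_cast succ_mul_multichoose_succ x.1 x.2
        rw [← hx]
        push_cast
        linear_combination (-s ^ (x.2 + 1)) * e2

end DivPow

/-! ### Vertex operators from a commuting contraction -/

/-- A commutative algebra with a translation derivation and a contraction operator that is, degree
by degree, a finite combination of tensor products of commuting derivations. -/
structure WickData (V : Type*) [CommRing V] [Algebra ℂ V] where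
  T : V →ₗ[ℂ] V
  J : Type
  S : ℕ → Finset J
  cf : ℕ → J → ℂ
  D : J → V →ₗ[ℂ] V
  D' : J → V →ₗ[ℂ] V
  T_mul : ∀ a b, T (a * b) = T a * b + a * T b
  D_mul : ∀ j a b, D j (a * b) = D j a * b + a * D j b
  D'_mul : ∀ j a b, D' j (a * b) = D' j a * b + a * D' j b
  D_D : ∀ i j, Commute (D i) (D j)
  D_D' : ∀ i j, Commute (D i) (D' j)
  D'_D' : ∀ i j, Commute (D' i) (D' j)

namespace WickData

variable {V : Type*} [CommRing V] [Algebra ℂ V] (𝒲 : WickData V)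

/-- The coefficients of the contraction operator. -/
def R (d : ℕ) : Module.End ℂ (V ⊗[ℂ] V) :=
  ∑ j ∈ 𝒲.S d, 𝒲.cf d j • TensorProduct.map (𝒲.D j) (𝒲.D' j)

/-- The coefficients of the exponential of the contraction operator. -/
def W (d : ℕ) : Module.End ℂ (V ⊗[ℂ] V) := expCoeff (PowerSeries.mk 𝒲.R) d

/-- The contraction of the first and the second of three factors. -/
def R12 (d : ℕ) : Module.End ℂ (V ⊗[ℂ] (V ⊗[ℂ] V)) :=
  ∑ j ∈ 𝒲.S d, 𝒲.cf d j •
    TensorProduct.map (𝒲.D j) (TensorProduct.map (𝒲.D' j) LinearMap.id)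

/-- The contraction of the first and the third of three factors. -/
def R13 (d : ℕ) : Module.End ℂ (V ⊗[ℂ] (V ⊗[ℂ] V)) :=
  ∑ j ∈ 𝒲.S d, 𝒲.cf d j •
    TensorProduct.map (𝒲.D j) (TensorProduct.map LinearMap.id (𝒲.D' j))

/-- The contraction of the second and the third of three factors. -/
def R23 (d : ℕ) : Module.End ℂ (V ⊗[ℂ] (V ⊗[ℂ] V)) :=
  ∑ j ∈ 𝒲.S d, 𝒲.cf d j •
    TensorProduct.map LinearMap.id (TensorProduct.map (𝒲.D j) (𝒲.D' j))

/-- The exponential of `R12`. -/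
def W12 (d : ℕ) : Module.End ℂ (V ⊗[ℂ] (V ⊗[ℂ] V)) := expCoeff (PowerSeries.mk 𝒲.R12) d

/-- The exponential of `R13`. -/
def W13 (d : ℕ) : Module.End ℂ (V ⊗[ℂ] (V ⊗[ℂ] V)) := expCoeff (PowerSeries.mk 𝒲.R13) d

/-- The exponential of `R23`. -/
def W23 (d : ℕ) : Module.End ℂ (V ⊗[ℂ] (V ⊗[ℂ] V)) := expCoeff (PowerSeries.mk 𝒲.R23) d

lemma commute_sum_map {U : Type*} [AddCommGroup U] [Module ℂ U] {ι κ : Type*} {s : Finset ι}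
    {t : Finset κ} {a : ι → ℂ} {b : κ → ℂ} {f : ι → Module.End ℂ U} {g : κ → Module.End ℂ U}
    (h : ∀ i j, Commute (f i) (g j)) : Commute (∑ i ∈ s, a i • f i) (∑ j ∈ t, b j • g j) :=
  Commute.sum_left _ _ _ fun i _ => Commute.sum_right _ _ _ fun j _ =>
    ((h i j).smul_left _).smul_right _

lemma commute_map {U U' : Type*} [AddCommGroup U] [Module ℂ U] [AddCommGroup U'] [Module ℂ U']
    {f f' : Module.End ℂ U} {g g' : Module.End ℂ U'} (h : Commute f f') (h' : Commute g g') :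
    Commute (TensorProduct.map f g : Module.End ℂ (U ⊗[ℂ] U')) (TensorProduct.map f' g') := by
  change _ * _ = _ * _
  rw [← TensorProduct.map_mul, ← TensorProduct.map_mul, h.eq, h'.eq]

lemma commute_id_left {U : Type*} [AddCommGroup U] [Module ℂ U] (f : Module.End ℂ U) :
    Commute (LinearMap.id : Module.End ℂ U) f := Commute.one_left f

lemma commute_id_right {U : Type*} [AddCommGroup U] [Module ℂ U] (f : Module.End ℂ U) :
    Commute f (LinearMap.id : Module.End ℂ U) := Commute.one_right f

/-- In each tensor slot the two operators are commuting derivations or one of them is the identity.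
This and the next two lemmas allow the contractions of three factors to be exponentiated and
reordered independently. -/
lemma commute_R12_R13 (d e : ℕ) : Commute (𝒲.R12 d) (𝒲.R13 e) :=
  commute_sum_map fun i j => commute_map (𝒲.D_D i j)
    (commute_map (commute_id_right _) (commute_id_left _))

lemma commute_R12_R23 (d e : ℕ) : Commute (𝒲.R12 d) (𝒲.R23 e) :=
  commute_sum_map fun i j => commute_map (commute_id_right _)
    (commute_map (𝒲.D_D' j i).symm (commute_id_left _))

lemma commute_R13_R23 (d e : ℕ) : Commute (𝒲.R13 d) (𝒲.R23 e) :=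
  commute_sum_map fun i j => commute_map (commute_id_right _)
    (commute_map (commute_id_left _) (𝒲.D'_D' i j))

lemma commute_W12_W13 (d e : ℕ) : Commute (𝒲.W12 d) (𝒲.W13 e) :=
  expCoeff_commute (fun a b => by simpa using 𝒲.commute_R12_R13 a b) d e

lemma commute_W12_W23 (d e : ℕ) : Commute (𝒲.W12 d) (𝒲.W23 e) :=
  expCoeff_commute (fun a b => by simpa using 𝒲.commute_R12_R23 a b) d e

lemma commute_W13_W23 (d e : ℕ) : Commute (𝒲.W13 d) (𝒲.W23 e) :=
  expCoeff_commute (fun a b => by simpa using 𝒲.commute_R13_R23 a b) d e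

variable (V) in
/-- The multiplication of the last two factors. -/
def mulR : V ⊗[ℂ] (V ⊗[ℂ] V) →ₗ[ℂ] V ⊗[ℂ] V :=
  TensorProduct.map LinearMap.id (LinearMap.mul' ℂ V)

variable (V) in
/-- The multiplication of the first two factors. -/
def mulL : V ⊗[ℂ] (V ⊗[ℂ] V) →ₗ[ℂ] V ⊗[ℂ] V :=
  TensorProduct.map (LinearMap.mul' ℂ V) LinearMap.id ∘ₗ
    (TensorProduct.assoc ℂ V V V).symm.toLinearMap

@[simp] lemma mulR_tmul (u v x : V) : mulR V (u ⊗ₜ (v ⊗ₜ x)) = u ⊗ₜ (v * x) := rfl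

@[simp] lemma mulL_tmul (u v x : V) : mulL V (u ⊗ₜ (v ⊗ₜ x)) = (u * v) ⊗ₜ x := rfl

lemma linearMap_ext3 {U : Type*} [AddCommGroup U] [Module ℂ U]
    {f g : V ⊗[ℂ] (V ⊗[ℂ] V) →ₗ[ℂ] U} (h : ∀ u v x, f (u ⊗ₜ (v ⊗ₜ x)) = g (u ⊗ₜ (v ⊗ₜ x))) :
    f = g := by
  ext u v x
  exact h u v x

/-- The operators `D' j` obey the Leibniz rule, so contracting with a product means contracting with
one of its two factors. -/
lemma R_mulR (d : ℕ) (t : V ⊗[ℂ] (V ⊗[ℂ] V)) :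
    𝒲.R d (mulR V t) = mulR V ((𝒲.R12 d + 𝒲.R13 d) t) := by
  suffices 𝒲.R d ∘ₗ mulR V = mulR V ∘ₗ (𝒲.R12 d + 𝒲.R13 d) from LinearMap.congr_fun this t
  refine linearMap_ext3 fun u v x => ?_
  simp [R, R12, R13, LinearMap.sum_apply, 𝒲.D'_mul, TensorProduct.tmul_add,
    Finset.sum_add_distrib]

lemma R_mulL (d : ℕ) (t : V ⊗[ℂ] (V ⊗[ℂ] V)) :
    𝒲.R d (mulL V t) = mulL V ((𝒲.R13 d + 𝒲.R23 d) t) := by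
  suffices 𝒲.R d ∘ₗ mulL V = mulL V ∘ₗ (𝒲.R13 d + 𝒲.R23 d) from LinearMap.congr_fun this t
  refine linearMap_ext3 fun u v x => ?_
  simp [R, R23, R13, LinearMap.sum_apply, 𝒲.D_mul, TensorProduct.add_tmul,
    Finset.sum_add_distrib]

variable (hS : 𝒲.S 0 = ∅)
include hS

/-- Wick's theorem for a product in the second slot: the two partial contractions commute, so the
exponential of their sum factors. -/
lemma W_mulR (d : ℕ) (t : V ⊗[ℂ] (V ⊗[ℂ] V)) :
    𝒲.W d (mulR V t) = mulR V (∑ x ∈ antidiagonal d, 𝒲.W12 x.1 (𝒲.W13 x.2 t)) := by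
  have h1 : PowerSeries.mk (fun e => 𝒲.R12 e + 𝒲.R13 e) =
      PowerSeries.mk 𝒲.R12 + PowerSeries.mk 𝒲.R13 := by ext1 e; simp
  have h2 := expCoeff_intertwine (A := PowerSeries.mk fun e => 𝒲.R12 e + 𝒲.R13 e)
    (B := PowerSeries.mk 𝒲.R) (φ := mulR V) (fun e x => by
      rw [PowerSeries.coeff_mk, PowerSeries.coeff_mk, 𝒲.R_mulR]) d t
  rw [W, h2, h1, expCoeff_add (by rw [PowerSeries.coeff_mk, R12, hS, Finset.sum_empty])
    (by rw [PowerSeries.coeff_mk, R13, hS, Finset.sum_empty]), LinearMap.sum_apply]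
  · rfl
  · ext1 e
    rw [PowerSeries.coeff_mul, PowerSeries.coeff_mul, ← Finset.Nat.sum_antidiagonal_swap]
    refine Finset.sum_congr rfl fun x _ => ?_
    simpa using (𝒲.commute_R12_R13 x.2 x.1).eq

lemma W_mulL (d : ℕ) (t : V ⊗[ℂ] (V ⊗[ℂ] V)) :
    𝒲.W d (mulL V t) = mulL V (∑ x ∈ antidiagonal d, 𝒲.W13 x.1 (𝒲.W23 x.2 t)) := by
  have h1 : PowerSeries.mk (fun e => 𝒲.R13 e + 𝒲.R23 e) =
      PowerSeries.mk 𝒲.R13 + PowerSeries.mk 𝒲.R23 := by ext1 e; simp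
  have h2 := expCoeff_intertwine (A := PowerSeries.mk fun e => 𝒲.R13 e + 𝒲.R23 e)
    (B := PowerSeries.mk 𝒲.R) (φ := mulL V) (fun e x => by
      rw [PowerSeries.coeff_mk, PowerSeries.coeff_mk, 𝒲.R_mulL]) d t
  rw [W, h2, h1, expCoeff_add (by rw [PowerSeries.coeff_mk, R13, hS, Finset.sum_empty])
    (by rw [PowerSeries.coeff_mk, R23, hS, Finset.sum_empty]), LinearMap.sum_apply]
  · rfl
  · ext1 e
    rw [PowerSeries.coeff_mul, PowerSeries.coeff_mul, ← Finset.Nat.sum_antidiagonal_swap]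
    refine Finset.sum_congr rfl fun x _ => ?_
    simpa using (𝒲.commute_R13_R23 x.2 x.1).eq

end WickData

/-! ### Translation covariance, symmetry and local finiteness of the Wick exponential -/

namespace WickData

variable {V : Type*} [CommRing V] [Algebra ℂ V]

variable (V) in
/-- The exchange of the first two of three factors. -/
def swap12 : V ⊗[ℂ] (V ⊗[ℂ] V) →ₗ[ℂ] V ⊗[ℂ] (V ⊗[ℂ] V) :=
  (TensorProduct.leftComm ℂ V V V).toLinearMap

@[simp] lemma swap12_tmul (u v x : V) : swap12 V (u ⊗ₜ (v ⊗ₜ x)) = v ⊗ₜ (u ⊗ₜ x) := rfl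

/-- The compatibility of the contraction with the translation operator and with the exchange of the
factors, and its local nilpotency. -/
structure IsTranslationCovariant (𝒲 : WickData V) : Prop where
  S_zero : 𝒲.S 0 = ∅
  R_map_T_left : ∀ e v w, 𝒲.R (e + 1) (𝒲.T v ⊗ₜ w) =
    TensorProduct.map 𝒲.T LinearMap.id (𝒲.R (e + 1) (v ⊗ₜ w)) + (-(e : ℂ)) • 𝒲.R e (v ⊗ₜ w)
  R_comm : ∀ e v w, 𝒲.R e (w ⊗ₜ v) =
    (-1 : ℂ) ^ e • TensorProduct.comm ℂ V V (𝒲.R e (v ⊗ₜ w))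
  nilpotent : ∀ v w, ∃ K, ∀ d, K ≤ d → 𝒲.W d (v ⊗ₜ w) = 0

variable {𝒲 : WickData V} (h𝒲 : 𝒲.IsTranslationCovariant)

@[simp] lemma W_zero : 𝒲.W 0 = 1 := expCoeff_zero _
@[simp] lemma W12_zero : 𝒲.W12 0 = 1 := expCoeff_zero _
@[simp] lemma W13_zero : 𝒲.W13 0 = 1 := expCoeff_zero _

variable (V) in
/-- The insertion of a third factor. -/
def insert3 (x : V) : V ⊗[ℂ] V →ₗ[ℂ] V ⊗[ℂ] (V ⊗[ℂ] V) :=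
  (TensorProduct.assoc ℂ V V V).toLinearMap ∘ₗ (TensorProduct.mk ℂ (V ⊗[ℂ] V) V).flip x

@[simp] lemma insert3_tmul (x u v : V) : insert3 V x (u ⊗ₜ v) = u ⊗ₜ (v ⊗ₜ x) := rfl

variable (V) in
/-- The insertion of a second factor. -/
def insert2 (x : V) : V ⊗[ℂ] V →ₗ[ℂ] V ⊗[ℂ] (V ⊗[ℂ] V) :=
  TensorProduct.map LinearMap.id (TensorProduct.mk ℂ V V x)

@[simp] lemma insert2_tmul (x u v : V) : insert2 V x (u ⊗ₜ v) = u ⊗ₜ (x ⊗ₜ v) := rfl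

lemma W12_insert3 (s : V ⊗[ℂ] V) (x : V) (d : ℕ) :
    𝒲.W12 d (insert3 V x s) = insert3 V x (𝒲.W d s) := by
  refine (expCoeff_intertwine (φ := insert3 V x) (fun e s => ?_) d s)
  rw [PowerSeries.coeff_mk, PowerSeries.coeff_mk]
  induction s with
  | zero => simp
  | add a b ha hb => simp only [map_add, ha, hb]
  | tmul u v => simp [R12, R, LinearMap.sum_apply]

lemma W23_tmul (u : V) (s : V ⊗[ℂ] V) (d : ℕ) : 𝒲.W23 d (u ⊗ₜ s) = u ⊗ₜ 𝒲.W d s := by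
  refine (expCoeff_intertwine (φ := TensorProduct.mk ℂ V (V ⊗[ℂ] V) u) (fun e s => ?_) d s)
  rw [PowerSeries.coeff_mk, PowerSeries.coeff_mk]
  induction s with
  | zero => simp
  | add a b ha hb => simp only [map_add, ha, hb]
  | tmul v x => simp [R23, R, LinearMap.sum_apply]

section
include h𝒲

lemma IsTranslationCovariant.coeff_zero_mk_R : PowerSeries.coeff 0 (PowerSeries.mk 𝒲.R) = 0 := by
  rw [PowerSeries.coeff_mk, R, h𝒲.S_zero, Finset.sum_empty]

lemma IsTranslationCovariant.coeff_zero_mk_R12 : PowerSeries.coeff 0 (PowerSeries.mk 𝒲.R12) = 0 := by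
  rw [PowerSeries.coeff_mk, R12, h𝒲.S_zero, Finset.sum_empty]

lemma IsTranslationCovariant.coeff_zero_mk_R13 : PowerSeries.coeff 0 (PowerSeries.mk 𝒲.R13) = 0 := by
  rw [PowerSeries.coeff_mk, R13, h𝒲.S_zero, Finset.sum_empty]

lemma IsTranslationCovariant.R_T_left (e : ℕ) : 𝒲.R (e + 1) * TensorProduct.map 𝒲.T LinearMap.id =
    TensorProduct.map 𝒲.T LinearMap.id * 𝒲.R (e + 1) + (-1 * (e : ℂ)) • 𝒲.R e := by
  refine TensorProduct.ext' fun v w => ?_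
  simpa using h𝒲.R_map_T_left e v w

lemma IsTranslationCovariant.R_comm' (e : ℕ) (s : V ⊗[ℂ] V) : 𝒲.R e (TensorProduct.comm ℂ V V s) =
    (-1 : ℂ) ^ e • TensorProduct.comm ℂ V V (𝒲.R e s) := by
  induction s with
  | zero => simp
  | add a b ha hb => simp only [map_add, ha, hb, smul_add]
  | tmul v w => exact h𝒲.R_comm e v w

/-- The left-hand relation conjugated by the exchange of the factors. The signs in `R_comm` for the
degrees `e + 1` and `e` are opposite, which turns `-e` into `e`. -/
lemma IsTranslationCovariant.R_T_right (e : ℕ) : 𝒲.R (e + 1) * TensorProduct.map LinearMap.id 𝒲.T =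
    TensorProduct.map LinearMap.id 𝒲.T * 𝒲.R (e + 1) + (1 * (e : ℂ)) • 𝒲.R e := by
  refine TensorProduct.ext' fun v w => ?_
  have h1 : ∀ s, TensorProduct.comm ℂ V V (TensorProduct.map 𝒲.T LinearMap.id s) =
      TensorProduct.map LinearMap.id 𝒲.T (TensorProduct.comm ℂ V V s) := by
    intro s
    induction s with
    | zero => simp
    | add a b ha hb => simp only [map_add, ha, hb]
    | tmul v w => rfl
  have h2 := h𝒲.R_map_T_left e w v
  have h3 := h𝒲.R_comm (e + 1) (𝒲.T w) v
  rw [h2, map_add, h1, map_smul, h𝒲.R_comm (e + 1) v w, h𝒲.R_comm e v w, map_smul, map_smul,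
    map_smul] at h3
  simp only [TensorProduct.comm_comm] at h3
  simp only [Module.End.mul_apply, LinearMap.add_apply, LinearMap.smul_apply,
    TensorProduct.map_tmul, LinearMap.id_apply, h3, smul_add, smul_smul]
  congr 1
  · rw [← mul_pow]; simp
  · congr 1
    rw [pow_succ, one_mul, show (-1 : ℂ) ^ e * -1 * (-(e : ℂ) * (-1) ^ e) =
      ((-1) ^ e * (-1) ^ e) * e by ring, ← mul_pow]
    simp

lemma IsTranslationCovariant.R12_T2 (e : ℕ) : 𝒲.R12 (e + 1) *
      TensorProduct.map LinearMap.id (TensorProduct.map 𝒲.T LinearMap.id) =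
    TensorProduct.map LinearMap.id (TensorProduct.map 𝒲.T LinearMap.id) * 𝒲.R12 (e + 1) +
      (1 * (e : ℂ)) • 𝒲.R12 e := by
  refine linearMap_ext3 fun u v x => ?_
  have := congrArg (insert3 V x)
    (LinearMap.congr_fun (h𝒲.R_T_right e) (u ⊗ₜ v))
  simpa [R12, R, LinearMap.sum_apply] using this

lemma IsTranslationCovariant.R13_T1 (e : ℕ) : 𝒲.R13 (e + 1) * TensorProduct.map 𝒲.T LinearMap.id =
    TensorProduct.map 𝒲.T LinearMap.id * 𝒲.R13 (e + 1) + (-1 * (e : ℂ)) • 𝒲.R13 e := by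
  refine linearMap_ext3 fun u v x => ?_
  have := congrArg (insert2 V v) (h𝒲.R_map_T_left e u x)
  simpa [R13, R, LinearMap.sum_apply] using this

lemma IsTranslationCovariant.W_T_left (e : ℕ) : 𝒲.W (e + 1) * TensorProduct.map 𝒲.T LinearMap.id =
    TensorProduct.map 𝒲.T LinearMap.id * 𝒲.W (e + 1) + (-1 * (e : ℂ)) • 𝒲.W e :=
  expCoeff_mul_of_commutator h𝒲.coeff_zero_mk_R (fun e => by simpa only [PowerSeries.coeff_mk] using h𝒲.R_T_left e) e

lemma IsTranslationCovariant.W_T_right (e : ℕ) : 𝒲.W (e + 1) * TensorProduct.map LinearMap.id 𝒲.T =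
    TensorProduct.map LinearMap.id 𝒲.T * 𝒲.W (e + 1) + (1 * (e : ℂ)) • 𝒲.W e :=
  expCoeff_mul_of_commutator h𝒲.coeff_zero_mk_R (fun e => by simpa using h𝒲.R_T_right e) e

lemma IsTranslationCovariant.W12_T2 (e : ℕ) : 𝒲.W12 (e + 1) *
      TensorProduct.map LinearMap.id (TensorProduct.map 𝒲.T LinearMap.id) =
    TensorProduct.map LinearMap.id (TensorProduct.map 𝒲.T LinearMap.id) * 𝒲.W12 (e + 1) +
      (1 * (e : ℂ)) • 𝒲.W12 e :=
  expCoeff_mul_of_commutator h𝒲.coeff_zero_mk_R12 (fun e => by simpa using h𝒲.R12_T2 e) e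

lemma IsTranslationCovariant.W13_T1 (e : ℕ) : 𝒲.W13 (e + 1) * TensorProduct.map 𝒲.T LinearMap.id =
    TensorProduct.map 𝒲.T LinearMap.id * 𝒲.W13 (e + 1) + (-1 * (e : ℂ)) • 𝒲.W13 e :=
  expCoeff_mul_of_commutator h𝒲.coeff_zero_mk_R13 (fun e => by simpa using h𝒲.R13_T1 e) e

/-- Exchanging the factors turns the contraction $R(t)$ into $R(-t)$, and the exponential inherits
this. -/
lemma IsTranslationCovariant.W_comm (d : ℕ) (s : V ⊗[ℂ] V) : 𝒲.W d (TensorProduct.comm ℂ V V s) =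
    (-1 : ℂ) ^ d • TensorProduct.comm ℂ V V (𝒲.W d s) := by
  have h1 := expCoeff_intertwine (A := PowerSeries.mk fun e => (-1 : ℂ) ^ e • PowerSeries.coeff e
      (PowerSeries.mk 𝒲.R)) (B := PowerSeries.mk 𝒲.R)
    (φ := (TensorProduct.comm ℂ V V).toLinearMap) (fun e x => by simp [h𝒲.R_comm']) d s
  rw [expCoeff_smul_pow] at h1
  simpa [W] using h1

lemma IsTranslationCovariant.W12_swap12 (d : ℕ) (t : V ⊗[ℂ] (V ⊗[ℂ] V)) :
    𝒲.W12 d (swap12 V t) = (-1 : ℂ) ^ d • swap12 V (𝒲.W12 d t) := by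
  suffices 𝒲.W12 d ∘ₗ swap12 V = (-1 : ℂ) ^ d • (swap12 V ∘ₗ 𝒲.W12 d) from
    LinearMap.congr_fun this t
  refine linearMap_ext3 fun u v x => ?_
  have h1 : ∀ s, swap12 V (insert3 V x s) = insert3 V x (TensorProduct.comm ℂ V V s) := by
    intro s
    induction s with
    | zero => simp
    | add a b ha hb => simp only [map_add, ha, hb]
    | tmul v w => rfl
  have h2 := W12_insert3 (𝒲 := 𝒲) (v ⊗ₜ u) x d
  have h3 := h𝒲.W_comm d (u ⊗ₜ v)
  rw [TensorProduct.comm_tmul] at h3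
  rw [h3, map_smul, ← h1, ← W12_insert3] at h2
  simpa using h2

end

lemma W13_swap12 (d : ℕ) (t : V ⊗[ℂ] (V ⊗[ℂ] V)) :
    𝒲.W13 d (swap12 V t) = swap12 V (𝒲.W23 d t) := by
  refine expCoeff_intertwine (φ := swap12 V) (fun e t => ?_) d t
  rw [PowerSeries.coeff_mk, PowerSeries.coeff_mk]
  suffices 𝒲.R13 e ∘ₗ swap12 V = swap12 V ∘ₗ 𝒲.R23 e from LinearMap.congr_fun this t
  refine linearMap_ext3 fun u v x => ?_
  simp [R13, R23]

lemma W23_swap12 (d : ℕ) (t : V ⊗[ℂ] (V ⊗[ℂ] V)) :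
    𝒲.W23 d (swap12 V t) = swap12 V (𝒲.W13 d t) := by
  refine expCoeff_intertwine (φ := swap12 V) (fun e t => ?_) d t
  rw [PowerSeries.coeff_mk, PowerSeries.coeff_mk]
  suffices 𝒲.R23 e ∘ₗ swap12 V = swap12 V ∘ₗ 𝒲.R13 e from LinearMap.congr_fun this t
  refine linearMap_ext3 fun u v x => ?_
  simp [R13, R23]

section
include h𝒲

lemma IsTranslationCovariant.exists_W_eq_zero (s : V ⊗[ℂ] V) : ∃ K, ∀ d, K ≤ d → 𝒲.W d s = 0 := by
  induction s with
  | zero => exact ⟨0, by simp⟩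
  | tmul v w => exact h𝒲.nilpotent v w
  | add a b ha hb =>
    obtain ⟨K, hK⟩ := ha
    obtain ⟨L, hL⟩ := hb
    exact ⟨max K L, fun d hd => by
      rw [map_add, hK d (le_trans (le_max_left _ _) hd), hL d (le_trans (le_max_right _ _) hd),
        add_zero]⟩

lemma IsTranslationCovariant.exists_W12_eq_zero (t : V ⊗[ℂ] (V ⊗[ℂ] V)) : ∃ K, ∀ d, K ≤ d → 𝒲.W12 d t = 0 := by
  obtain ⟨t, rfl⟩ := (TensorProduct.assoc ℂ V V V).surjective t
  induction t with
  | zero => exact ⟨0, by simp⟩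
  | tmul s x =>
    obtain ⟨K, hK⟩ := h𝒲.exists_W_eq_zero s
    exact ⟨K, fun d hd => by
      change 𝒲.W12 d (insert3 V x s) = 0
      rw [W12_insert3, hK d hd, map_zero]⟩
  | add a b ha hb =>
    obtain ⟨K, hK⟩ := ha
    obtain ⟨L, hL⟩ := hb
    exact ⟨max K L, fun d hd => by
      rw [map_add, map_add, hK d (le_trans (le_max_left _ _) hd),
        hL d (le_trans (le_max_right _ _) hd), add_zero]⟩

lemma IsTranslationCovariant.exists_W23_eq_zero (t : V ⊗[ℂ] (V ⊗[ℂ] V)) : ∃ K, ∀ d, K ≤ d → 𝒲.W23 d t = 0 := by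
  induction t with
  | zero => exact ⟨0, by simp⟩
  | tmul u s =>
    obtain ⟨K, hK⟩ := h𝒲.exists_W_eq_zero s
    exact ⟨K, fun d hd => by rw [W23_tmul, hK d hd, TensorProduct.tmul_zero]⟩
  | add a b ha hb =>
    obtain ⟨K, hK⟩ := ha
    obtain ⟨L, hL⟩ := hb
    exact ⟨max K L, fun d hd => by
      rw [map_add, hK d (le_trans (le_max_left _ _) hd), hL d (le_trans (le_max_right _ _) hd),
        add_zero]⟩

/-- The first and third factors are not adjacent; after the exchange of the first two, the
contraction concerns the last two. -/
lemma IsTranslationCovariant.exists_W13_eq_zero (t : V ⊗[ℂ] (V ⊗[ℂ] V)) : ∃ K, ∀ d, K ≤ d → 𝒲.W13 d t = 0 := by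
  obtain ⟨K, hK⟩ := h𝒲.exists_W23_eq_zero (swap12 V t)
  refine ⟨K, fun d hd => (TensorProduct.leftComm ℂ V V V).injective ?_⟩
  rw [map_zero, ← hK d hd, W23_swap12]
  rfl

/-- All but finitely many of the contractions of a triple tensor vanish. -/
lemma IsTranslationCovariant.exists_bound (t : V ⊗[ℂ] (V ⊗[ℂ] V)) : ∃ K, ∀ d e f, K ≤ d ∨ K ≤ e ∨ K ≤ f →
    𝒲.W12 d (𝒲.W13 e (𝒲.W23 f t)) = 0 := by
  obtain ⟨F, hF⟩ := h𝒲.exists_W23_eq_zero t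
  obtain ⟨G, hG⟩ := h𝒲.exists_W13_eq_zero t
  obtain ⟨H, hH⟩ := h𝒲.exists_W12_eq_zero t
  refine ⟨max F (max G H), fun d e f h => ?_⟩
  have c1 : ∀ s, 𝒲.W13 e (𝒲.W23 f s) = 𝒲.W23 f (𝒲.W13 e s) :=
    LinearMap.congr_fun (𝒲.commute_W13_W23 e f).eq
  have c2 : ∀ s, 𝒲.W12 d (𝒲.W23 f s) = 𝒲.W23 f (𝒲.W12 d s) :=
    LinearMap.congr_fun (𝒲.commute_W12_W23 d f).eq
  have c3 : ∀ s, 𝒲.W12 d (𝒲.W13 e s) = 𝒲.W13 e (𝒲.W12 d s) :=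
    LinearMap.congr_fun (𝒲.commute_W12_W13 d e).eq
  simp only [max_le_iff] at h
  rcases h with h | h | h
  · rw [c3, c2, hH d h.2.2, map_zero, map_zero]
  · rw [c1, hG e h.2.1, map_zero, map_zero]
  · rw [hF f h.1, map_zero, map_zero]

end

end WickData

/-! ### Binomial identities -/

/-- The binomial coefficient with an integral lower index, zero if the latter is negative. -/
def intChoose (x y : ℤ) : ℤ := if 0 ≤ y then Ring.choose x y.toNat else 0

lemma intChoose_of_neg (x : ℤ) {y : ℤ} (h : y < 0) : intChoose x y = 0 := if_neg (by omega)

lemma intChoose_natCast (x : ℤ) (y : ℕ) : intChoose x y = Ring.choose x y := by simp [intChoose]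

lemma intChoose_natCast_natCast (x y : ℕ) : intChoose x y = x.choose y := by
  rw [intChoose_natCast, Ring.choose_natCast]

/-- Vandermonde's convolution. With the convention for negative lower indices the terms with `i > r`
vanish, so the range may be any `I > r`. -/
lemma intChoose_add (x y r : ℤ) {I : ℕ} (h : r < I) :
    intChoose (x + y) r = ∑ i ∈ Finset.range I, Ring.choose x i * intChoose y (r - i) := by
  rcases lt_or_ge r 0 with hr | hr
  · rw [intChoose_of_neg _ hr, Finset.sum_eq_zero]
    intro i _
    rw [intChoose_of_neg _ (by omega), mul_zero]
  lift r to ℕ using hr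
  rw [intChoose_natCast, Ring.add_choose_eq r (Commute.all x y),
    Finset.Nat.sum_antidiagonal_eq_sum_range_succ (fun i j => Ring.choose x i * Ring.choose y j)]
  refine Finset.sum_subset_zero_on_sdiff (Finset.range_subset_range.2 (by omega)) ?_ ?_
  · intro i hi
    simp only [Finset.mem_sdiff, Finset.mem_range] at hi
    rw [intChoose_of_neg _ (by omega), mul_zero]
  · intro i hi
    rw [Finset.mem_range] at hi
    rw [show (r : ℤ) - i = ((r - i : ℕ) : ℤ) by omega, intChoose_natCast]

lemma choose_neg_natCast (d j : ℕ) :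
    Ring.choose (-(d : ℤ)) j = (-1) ^ j * (Nat.multichoose d j : ℤ) := by
  rw [Ring.choose_neg, Units.smul_def, smul_eq_mul, Nat.multichoose_eq]
  congr 1
  · rcases Nat.eq_zero_or_pos (d + j) with h | h
    · obtain ⟨rfl, rfl⟩ : d = 0 ∧ j = 0 := by omega
      simp
    · rw [show (d : ℤ) + j - 1 = ((d + j - 1 : ℕ) : ℤ) by omega, Ring.choose_natCast]

lemma intChoose_neg_succ (n k : ℕ) :
    intChoose (-(n : ℤ) - 1) k = (-1) ^ k * ((n + k).choose k : ℤ) := by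
  rw [intChoose_natCast, show -(n : ℤ) - 1 = -((n + 1 : ℕ) : ℤ) by push_cast; ring,
    choose_neg_natCast, Nat.multichoose_eq, show n + 1 + k - 1 = n + k by omega]

/-- The residue theorem for $x^A(1+x)^D\,dx$ on the sphere. The two coefficients on the left are
those of $x^{-1-A}$ in the expansions of $(1+x)^D$ at infinity and at $0$; their difference is the
residue at $x=-1$, which in the coordinate $1+x$ is the right-hand side up to sign. Formally the
identity is checked according to the signs of `A` and `D`. It is the combinatorial content of the
Borcherds identity. -/
lemma intChoose_reflect (A D : ℤ) :
    (-1 : ℂ) ^ (D + A + 1) * ((intChoose D (D + A + 1) - intChoose D (-1 - A) : ℤ) : ℂ) =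
      (intChoose A (-1 - D) : ℤ) := by
  obtain ⟨a, rfl | rfl⟩ : ∃ a : ℕ, A = a ∨ A = -(a : ℤ) - 1 := by
    rcases lt_or_ge A 0 with h | h
    · exact ⟨(-A - 1).toNat, Or.inr (by omega)⟩
    · exact ⟨A.toNat, Or.inl (by omega)⟩
  all_goals
    obtain ⟨n, rfl | rfl⟩ : ∃ n : ℕ, D = n ∨ D = -(n : ℤ) - 1 := by
      rcases lt_or_ge D 0 with h | h
      · exact ⟨(-D - 1).toNat, Or.inr (by omega)⟩
      · exact ⟨D.toNat, Or.inl (by omega)⟩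
  · rw [intChoose_of_neg _ (show (-1 - (a : ℤ)) < 0 by omega),
      intChoose_of_neg _ (show (-1 - (n : ℤ)) < 0 by omega),
      show (n : ℤ) + a + 1 = ((n + a + 1 : ℕ) : ℤ) by push_cast; ring, intChoose_natCast_natCast,
      Nat.choose_eq_zero_of_lt (by omega)]
    simp
  · rw [intChoose_of_neg _ (show (-1 - (a : ℤ)) < 0 by omega),
      show -1 - (-(n : ℤ) - 1) = (n : ℤ) by ring, intChoose_natCast_natCast]
    rcases lt_or_ge a n with h | h
    · rw [intChoose_of_neg _ (by omega), Nat.choose_eq_zero_of_lt h]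
      simp
    · rw [show -(n : ℤ) - 1 + a + 1 = ((a - n : ℕ) : ℤ) by omega, intChoose_neg_succ,
        show n + (a - n) = a by omega, Nat.choose_symm h, zpow_natCast]
      push_cast
      rw [sub_zero, ← mul_assoc, ← mul_pow]
      simp
  · rw [show -1 - (-(a : ℤ) - 1) = (a : ℤ) by ring, intChoose_natCast_natCast,
      intChoose_of_neg _ (show (-1 - (n : ℤ)) < 0 by omega)]
    rcases lt_or_ge n a with h | h
    · rw [intChoose_of_neg _ (by omega), Nat.choose_eq_zero_of_lt h]
      simp
    · rw [show (n : ℤ) + (-a - 1) + 1 = ((n - a : ℕ) : ℤ) by omega, intChoose_natCast_natCast,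
        Nat.choose_symm h]
      simp
  · rw [intChoose_of_neg _ (by omega), show -1 - (-(a : ℤ) - 1) = (a : ℤ) by ring,
      show -1 - (-(n : ℤ) - 1) = (n : ℤ) by ring, intChoose_neg_succ, intChoose_neg_succ,
      show -(n : ℤ) - 1 + (-a - 1) + 1 = -((n + a + 1 : ℕ) : ℤ) by push_cast; ring, zpow_neg,
      zpow_natCast, show (n + a).choose a = (a + n).choose n by
        rw [Nat.add_comm n a, Nat.choose_symm_add]]
    rw [← inv_pow, pow_succ, pow_add]
    have h1 : ((-1 : ℂ) ^ a) * (-1) ^ a = 1 := by rw [← mul_pow]; simp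
    norm_num
    linear_combination ((-1 : ℂ) ^ n * ((a + n).choose n : ℂ)) * h1

/-! ### Rearrangement of finite sums -/

section Reindex

variable {U : Type*} [AddCommGroup U] [Module ℂ U]

lemma sum_range_eq_of_vanish {f : ℕ → U} {K N : ℕ} (hKN : K ≤ N)
    (h : ∀ i, K ≤ i → f i = 0) :
    ∑ i ∈ Finset.range N, f i = ∑ i ∈ Finset.range K, f i :=
  (Finset.sum_subset (Finset.range_subset_range.2 hKN) fun i _ hi =>
    h i (by simpa using hi)).symm

/-- The total degree `g` enters the right-hand side only through a condition. A subsequent sum over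
`g` then removes the condition and leaves free sums over a box. -/
lemma sum_antidiagonal_antidiagonal_eq_box (H : ℕ → ℕ → ℕ → U) {K J : ℕ}
    (h : ∀ d e j, K ≤ d ∨ K ≤ e ∨ J ≤ j → H d e j = 0) (g : ℕ) :
    ∑ x ∈ antidiagonal g, ∑ y ∈ antidiagonal x.1, H y.1 x.2 y.2 =
      ∑ d ∈ Finset.range K, ∑ e ∈ Finset.range K, ∑ j ∈ Finset.range J,
        if d + e + j = g then H d e j else 0 := by
  set N := max (g + 1) (max K J) with hN
  have hg : g < N := lt_of_lt_of_le (Nat.lt_succ_self g) (le_max_left _ _)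
  have hK : K ≤ N := le_trans (le_max_left _ _) (le_max_right _ _)
  have hJ : J ≤ N := le_trans (le_max_right _ _) (le_max_right _ _)
  have e1 : ∀ x ∈ antidiagonal g, ∑ y ∈ antidiagonal x.1, H y.1 x.2 y.2 =
      ∑ d ∈ Finset.range N, ∑ j ∈ Finset.range N, if d + j = x.1 then H d x.2 j else 0 := by
    intro x hx
    rw [mem_antidiagonal] at hx
    exact sum_antidiagonal_eq_box (fun d j => H d x.2 j) (by omega)
  rw [Finset.sum_congr rfl e1, sum_antidiagonal_eq_box (fun a e => ∑ d ∈ Finset.range N,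
    ∑ j ∈ Finset.range N, if d + j = a then H d e j else 0) hg]
  have e2 : ∑ d ∈ Finset.range K, ∑ e ∈ Finset.range K, ∑ j ∈ Finset.range J,
        (if d + e + j = g then H d e j else 0) =
      ∑ d ∈ Finset.range N, ∑ e ∈ Finset.range N, ∑ j ∈ Finset.range N,
        if d + e + j = g then H d e j else 0 := by
    rw [sum_range_eq_of_vanish hK]
    · refine Finset.sum_congr rfl fun d _ => ?_
      rw [sum_range_eq_of_vanish hK]
      · refine Finset.sum_congr rfl fun e _ => ?_
        rw [sum_range_eq_of_vanish hJ]
        intro j hj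
        rw [h d e j (by tauto), ite_self]
      · intro e he
        exact Finset.sum_eq_zero fun j _ => by rw [h d e j (by tauto), ite_self]
    · intro d hd
      exact Finset.sum_eq_zero fun e _ => Finset.sum_eq_zero fun j _ => by
        rw [h d e j (by tauto), ite_self]
  rw [e2, Finset.sum_comm]
  have e3 : ∀ e ∈ Finset.range N, (∑ a ∈ Finset.range N, if a + e = g then
      ∑ d ∈ Finset.range N, ∑ j ∈ Finset.range N, (if d + j = a then H d e j else 0) else 0) =
      ∑ d ∈ Finset.range N, ∑ j ∈ Finset.range N, if d + e + j = g then H d e j else 0 := by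
    intro e _
    have : ∀ a d j, (if a + e = g then if d + j = a then H d e j else 0 else 0) =
        if d + j = a then (if d + e + j = g then H d e j else 0) else 0 := by
      intro a d j
      split_ifs <;> first | rfl | omega
    have e4 : ∀ a ∈ Finset.range N, (if a + e = g then
      ∑ d ∈ Finset.range N, ∑ j ∈ Finset.range N, (if d + j = a then H d e j else 0) else 0) =
      ∑ d ∈ Finset.range N, ∑ j ∈ Finset.range N,
        if d + j = a then (if d + e + j = g then H d e j else 0) else 0 := by
      intro a _
      split_ifs with ha
      · refine Finset.sum_congr rfl fun d _ => Finset.sum_congr rfl fun j _ => ?_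
        rw [← this, if_pos ha]
      · symm
        refine Finset.sum_eq_zero fun d _ => Finset.sum_eq_zero fun j _ => ?_
        rw [← this, if_neg ha]
    rw [Finset.sum_congr rfl e4, Finset.sum_comm]
    refine Finset.sum_congr rfl fun d _ => ?_
    rw [Finset.sum_comm]
    refine Finset.sum_congr rfl fun j _ => ?_
    rw [Finset.sum_ite_eq]
    split_ifs with h1 h2 h2
    · rfl
    · rfl
    · simp only [Finset.mem_range] at h1; omega
    · rfl
  rw [Finset.sum_congr rfl e3, Finset.sum_comm]

/-- A Vandermonde summation for a family indexed by the integers. -/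
lemma sum_multichoose_intChoose {g : ℤ → U} {A J L : ℕ} (e : ℕ) (r : ℤ) (hJ : r < J)
    (hL : A ≤ L) (hA : ∀ a, (A : ℤ) ≤ a → g a = 0) :
    ∑ j ∈ Finset.range J, ∑ l ∈ Finset.range L,
      ((-1 : ℂ) ^ j * (Nat.multichoose e j : ℂ)) •
        ((intChoose (l + (r - j)) (r - j) : ℤ) : ℂ) • g (l + (r - j)) =
      ∑ a ∈ Finset.range A, ((intChoose ((a : ℤ) - e) r : ℤ) : ℂ) • g a := by
  have h1 : ∀ j ∈ Finset.range J, ∑ l ∈ Finset.range L,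
      ((-1 : ℂ) ^ j * (Nat.multichoose e j : ℂ)) •
        ((intChoose (l + (r - j)) (r - j) : ℤ) : ℂ) • g (l + (r - j)) =
      ∑ a ∈ Finset.range A, ((Ring.choose (-(e : ℤ)) j * intChoose a (r - j) : ℤ) : ℂ) •
        g a := by
    intro j _
    rw [← Finset.smul_sum]
    have h2 : ∑ l ∈ Finset.range L, ((intChoose (l + (r - j)) (r - j) : ℤ) : ℂ) •
        g (l + (r - j)) = ∑ a ∈ Finset.range A, ((intChoose a (r - j) : ℤ) : ℂ) • g a := by
      rcases lt_or_ge (r - j) 0 with hr | hr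
      · rw [Finset.sum_eq_zero, Finset.sum_eq_zero]
        · intro i _; rw [intChoose_of_neg _ hr]; simp
        · intro i _; rw [intChoose_of_neg _ hr]; simp
      · obtain ⟨q, hq⟩ : ∃ q : ℕ, r - j = q := ⟨(r - j).toNat, by omega⟩
        rw [hq]
        have h3 : ∀ l : ℕ, ((intChoose (l + (q : ℤ)) q : ℤ) : ℂ) • g (l + (q : ℤ)) =
            ((intChoose ((l + q : ℕ) : ℤ) q : ℤ) : ℂ) • g ((l + q : ℕ) : ℤ) := by
          intro l; push_cast; rfl
        simp only [h3]
        have h4 : ∑ l ∈ Finset.range L, ((intChoose ((l + q : ℕ) : ℤ) q : ℤ) : ℂ) •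
            g ((l + q : ℕ) : ℤ) = ∑ a ∈ Finset.range (q + L),
              ((intChoose (a : ℤ) q : ℤ) : ℂ) • g (a : ℤ) := by
          rw [Finset.sum_range_add]
          rw [Finset.sum_eq_zero (s := Finset.range q), zero_add]
          · simp only [Nat.add_comm]
          · intro a ha
            rw [intChoose_natCast_natCast, Nat.choose_eq_zero_of_lt (by simpa using ha)]
            simp
        rw [h4, sum_range_eq_of_vanish (show A ≤ q + L by omega)]
        intro a ha
        rw [hA a (by exact_mod_cast ha), smul_zero]
    rw [h2, Finset.smul_sum]
    refine Finset.sum_congr rfl fun a _ => ?_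
    rw [choose_neg_natCast, smul_smul]
    push_cast
    rfl
  rw [Finset.sum_congr rfl h1, Finset.sum_comm]
  refine Finset.sum_congr rfl fun a _ => ?_
  rw [← Finset.sum_smul, ← Int.cast_sum, ← intChoose_add _ _ _ hJ,
    neg_add_eq_sub]

end Reindex

section Reindex

variable {U : Type*} [AddCommGroup U] [Module ℂ U]

/-- Regarded as sums over all integers, the sums can be shifted and reflected by bijections of `ℤ`
without bookkeeping of the limits. -/
lemma sum_range_eq_finsum {F : ℤ → U} {N : ℕ} (h0 : ∀ z < 0, F z = 0)
    (hN : ∀ z, (N : ℤ) ≤ z → F z = 0) : ∑ i ∈ Finset.range N, F i = ∑ᶠ z, F z := by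
  rw [finsum_eq_sum_of_support_subset (s := (Finset.range N).map Nat.castEmbedding) _ ?_,
    Finset.sum_map]
  · rfl
  · intro z hz
    simp only [Finset.coe_map, Set.mem_image, Finset.mem_coe, Finset.mem_range]
    have h1 : 0 ≤ z := not_lt.1 fun h => hz (h0 z h)
    have h2 : z < N := not_le.1 fun h => hz (hN z h)
    exact ⟨z.toNat, by omega, by simp; omega⟩

lemma sum_range_shift {φ : ℤ → ℂ} {g : ℤ → U} {A I : ℕ} (c : ℤ) (hφ : ∀ z < 0, φ z = 0)
    (h0 : ∀ a < 0, g a = 0) (hA : ∀ a, (A : ℤ) ≤ a → g a = 0) (hI : (A : ℤ) - c ≤ I) :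
    ∑ l ∈ Finset.range I, φ l • g (c + l) = ∑ a ∈ Finset.range A, φ (a - c) • g a := by
  rw [sum_range_eq_finsum (F := fun z => φ z • g (c + z)),
    sum_range_eq_finsum (F := fun z => φ (z - c) • g z), ← finsum_comp_equiv (Equiv.addLeft c)
      (f := fun z => φ (z - c) • g z)]
  · refine finsum_congr fun z => ?_
    simp
  · intro z hz; rw [h0 z hz, smul_zero]
  · intro z hz; rw [hA z hz, smul_zero]
  · intro z hz; simp only [hφ z hz, zero_smul]
  · intro z hz; simp only [hA (c + z) (by omega), smul_zero]

lemma sum_range_reflect {φ : ℤ → ℂ} {g : ℤ → U} {A I : ℕ} (c : ℤ) (hφ : ∀ z < 0, φ z = 0)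
    (h0 : ∀ a < 0, g a = 0) (hA : ∀ a, (A : ℤ) ≤ a → g a = 0) (hI : c < I) :
    ∑ l ∈ Finset.range I, φ l • g (c - l) = ∑ a ∈ Finset.range A, φ (c - a) • g a := by
  rw [sum_range_eq_finsum (F := fun z => φ z • g (c - z)),
    sum_range_eq_finsum (F := fun z => φ (c - z) • g z), ← finsum_comp_equiv (Equiv.subLeft c)]
  · refine finsum_congr fun z => ?_
    simp
  · intro z hz; rw [h0 z hz, smul_zero]
  · intro z hz; rw [hA z hz, smul_zero]
  · intro z hz; simp only [hφ z hz, zero_smul]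
  · intro z hz; simp only [h0 (c - z) (by omega), smul_zero]

/-- The coefficient identity behind $(1-x)^p(1-x)^{-d}=(1-x)^{p-d}$; the vanishing of `h` beyond `I`
permits the passage from the triangle to the square. -/
lemma sum_choose_multichoose (p : ℤ) (d : ℕ) {h : ℕ → U} {I : ℕ} (hI : ∀ l, I ≤ l → h l = 0) :
    ∑ i ∈ Finset.range I, ((-1 : ℂ) ^ i * (Ring.choose p i : ℤ)) •
      ∑ j ∈ Finset.range I, (Nat.multichoose d j : ℂ) • h (i + j) =
    ∑ l ∈ Finset.range I, ((-1 : ℂ) ^ (l : ℤ) * (intChoose (p - d) l : ℤ)) • h l := by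
  have h1 : ∀ l ∈ Finset.range I, ((-1 : ℂ) ^ (l : ℤ) * (intChoose (p - d) l : ℤ)) • h l =
      ∑ i ∈ Finset.range I, ∑ j ∈ Finset.range I, if i + j = l then
        (((-1 : ℂ) ^ i * (Ring.choose p i : ℤ)) * (Nat.multichoose d j : ℂ)) • h l else 0 := by
    intro l hl
    rw [Finset.mem_range] at hl
    rw [← sum_antidiagonal_eq_box (fun i j => (((-1 : ℂ) ^ i * (Ring.choose p i : ℤ)) *
      (Nat.multichoose d j : ℂ)) • h l) hl, ← Finset.sum_smul, intChoose_natCast,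
      sub_eq_add_neg, Ring.add_choose_eq l (Commute.all _ _)]
    congr 1
    push_cast
    rw [Finset.mul_sum]
    refine Finset.sum_congr rfl fun x hx => ?_
    rw [mem_antidiagonal] at hx
    rw [choose_neg_natCast, ← hx, zpow_natCast, pow_add]
    push_cast
    have : (-1 : ℂ) ^ x.2 * (-1) ^ x.2 = 1 := by rw [← mul_pow]; simp
    linear_combination ((-1 : ℂ) ^ x.1 * (Ring.choose p x.1 : ℤ) * (Nat.multichoose d x.2)) * this
  rw [Finset.sum_congr rfl h1, Finset.sum_comm]
  refine Finset.sum_congr rfl fun i _ => ?_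
  rw [Finset.sum_comm, Finset.smul_sum]
  refine Finset.sum_congr rfl fun j _ => ?_
  rw [Finset.sum_ite_eq, smul_smul]
  split_ifs with hij
  · rfl
  · rw [hI _ (by simpa using hij), smul_zero]

end Reindex

/-! ### Fourier modes, their compositions and the Borcherds identity -/

namespace WickData

variable {V : Type*} [CommRing V] [Algebra ℂ V] {𝒲 : WickData V}

variable (𝒲) in
/-- The Fourier modes of the vertex operator, on the tensor product. -/
def Y (m : ℤ) (s : V ⊗[ℂ] V) : V :=
  ∑ᶠ d : ℕ, LinearMap.mul' ℂ V
    (TensorProduct.map (divPow 𝒲.T (d - 1 - m)) LinearMap.id (𝒲.W d s))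

variable (𝒲) in
/-- The Fourier modes of the vertex operator. -/
def mode (m : ℤ) (v w : V) : V := 𝒲.Y m (v ⊗ₜ w)

lemma Y_eq_sum {s : V ⊗[ℂ] V} {K : ℕ} (hK : ∀ d, K ≤ d → 𝒲.W d s = 0) (m : ℤ) :
    𝒲.Y m s = ∑ d ∈ Finset.range K, LinearMap.mul' ℂ V
      (TensorProduct.map (divPow 𝒲.T (d - 1 - m)) LinearMap.id (𝒲.W d s)) := by
  refine finsum_eq_sum_of_support_subset _ fun d hd => ?_
  rw [Finset.mem_coe, Finset.mem_range]
  by_contra h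
  exact hd (by simp only [hK d (not_lt.1 h), map_zero])

variable (𝒲) in
/-- The product of three vectors after application of divided powers of the translation operator to
the first two. -/
def M (p q : ℤ) : V ⊗[ℂ] (V ⊗[ℂ] V) →ₗ[ℂ] V :=
  LinearMap.mul' ℂ V ∘ₗ mulR V ∘ₗ
    TensorProduct.map (divPow 𝒲.T p) (TensorProduct.map (divPow 𝒲.T q) LinearMap.id)

lemma M_tmul (p q : ℤ) (u v x : V) :
    𝒲.M p q (u ⊗ₜ (v ⊗ₜ x)) = divPow 𝒲.T p u * (divPow 𝒲.T q v * x) := rfl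

lemma M_of_neg_left {p : ℤ} (q : ℤ) (h : p < 0) (t) : 𝒲.M p q t = 0 := by
  suffices 𝒲.M p q = 0 by rw [this]; rfl
  refine linearMap_ext3 fun u v x => ?_
  rw [M_tmul, divPow_of_neg _ h]
  simp

lemma M_of_neg_right (p : ℤ) {q : ℤ} (h : q < 0) (t) : 𝒲.M p q t = 0 := by
  suffices 𝒲.M p q = 0 by rw [this]; rfl
  refine linearMap_ext3 fun u v x => ?_
  rw [M_tmul, divPow_of_neg _ h]
  simp

lemma M_swap12 (p q : ℤ) (t) : 𝒲.M p q (swap12 V t) = 𝒲.M q p t := by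
  suffices 𝒲.M p q ∘ₗ swap12 V = 𝒲.M q p from LinearMap.congr_fun this t
  refine linearMap_ext3 fun u v x => ?_
  rw [LinearMap.comp_apply, swap12_tmul, M_tmul, M_tmul]
  ring

lemma divPow_map_left {U : Type*} [AddCommGroup U] [Module ℂ U] (b : ℤ) :
    TensorProduct.map (divPow 𝒲.T b) (LinearMap.id : Module.End ℂ U) =
      divPow (TensorProduct.map 𝒲.T LinearMap.id : Module.End ℂ (V ⊗[ℂ] U)) b := by
  unfold divPow
  split_ifs
  · rw [TensorProduct.map_smul_left, TensorProduct.map_pow, ← Module.End.one_eq_id, one_pow]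
  · exact TensorProduct.map_zero_left _

lemma divPow_map_right {U : Type*} [AddCommGroup U] [Module ℂ U] (τ : Module.End ℂ U) (b : ℤ) :
    TensorProduct.map (LinearMap.id : Module.End ℂ V) (divPow τ b) =
      divPow (TensorProduct.map LinearMap.id τ : Module.End ℂ (V ⊗[ℂ] U)) b := by
  unfold divPow
  split_ifs
  · rw [TensorProduct.map_smul_right, TensorProduct.map_pow, ← Module.End.one_eq_id, one_pow]
  · exact TensorProduct.map_zero_right _

lemma T_pow_mul (c : ℕ) (a b : V) : divPow 𝒲.T c (a * b) =
    ∑ x ∈ antidiagonal c, divPow 𝒲.T x.1 a * divPow 𝒲.T x.2 b := by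
  induction c with
  | zero => simp
  | succ c ih =>
    have hc : ((c : ℂ) + 1) ≠ 0 := by exact_mod_cast Nat.succ_ne_zero c
    have key : ∀ (b : ℤ) (y : V), 𝒲.T (divPow 𝒲.T b y) =
        ((b : ℂ) + 1) • divPow 𝒲.T (b + 1) y := fun b y =>
      LinearMap.congr_fun (mul_divPow 𝒲.T b) y
    have h1 := key c (a * b)
    rw [ih, map_sum] at h1
    simp only [𝒲.T_mul, key] at h1
    rw [Finset.sum_add_distrib] at h1
    refine smul_right_injective V hc ?_
    simp only
    push_cast at h1 ⊢
    rw [← h1]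
    have e1 : ∀ f : ℕ × ℕ → V, ((c : ℂ) + 1) • ∑ x ∈ antidiagonal (c + 1), f x =
        ∑ x ∈ antidiagonal (c + 1), (x.1 : ℂ) • f x +
          ∑ x ∈ antidiagonal (c + 1), (x.2 : ℂ) • f x := by
      intro f
      rw [Finset.smul_sum, ← Finset.sum_add_distrib]
      refine Finset.sum_congr rfl fun x hx => ?_
      rw [mem_antidiagonal] at hx
      rw [← add_smul]
      congr 1
      exact_mod_cast hx.symm
    rw [e1, Finset.Nat.sum_antidiagonal_succ, Finset.Nat.sum_antidiagonal_succ']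
    simp [Algebra.smul_mul_assoc]

/-- The Leibniz rule for divided powers, with an arbitrarily large range of summation. -/
lemma divPow_T_mul (c : ℤ) {L : ℕ} (hL : c < L) (a b : V) : divPow 𝒲.T c (a * b) =
    ∑ l ∈ Finset.range L, divPow 𝒲.T l a * divPow 𝒲.T (c - l) b := by
  rcases lt_or_ge c 0 with hc | hc
  · rw [divPow_of_neg _ hc, Finset.sum_eq_zero]
    · simp
    · intro l _
      rw [divPow_of_neg _ (show c - l < 0 by omega)]
      simp
  lift c to ℕ using hc
  rw [T_pow_mul, Finset.Nat.sum_antidiagonal_eq_sum_range_succ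
    (fun i j => divPow 𝒲.T (i : ℤ) a * divPow 𝒲.T (j : ℤ) b)]
  refine Finset.sum_subset_zero_on_sdiff (Finset.range_subset_range.2 (by omega)) ?_ ?_
  · intro i hi
    simp only [Finset.mem_sdiff, Finset.mem_range] at hi
    rw [divPow_of_neg _ (show (c : ℤ) - i < 0 by omega)]
    simp
  · intro i hi
    rw [Finset.mem_range] at hi
    rw [show (c : ℤ) - i = ((c - i : ℕ) : ℤ) by omega]

lemma mul_divPow_mulL (c : ℤ) {L : ℕ} (hL : c < L) (t : V ⊗[ℂ] (V ⊗[ℂ] V)) :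
    LinearMap.mul' ℂ V (TensorProduct.map (divPow 𝒲.T c) LinearMap.id (mulL V t)) =
      ∑ l ∈ Finset.range L, 𝒲.M l (c - l) t := by
  suffices LinearMap.mul' ℂ V ∘ₗ TensorProduct.map (divPow 𝒲.T c) LinearMap.id ∘ₗ mulL V =
      ∑ l ∈ Finset.range L, 𝒲.M l (c - l) by
    have := LinearMap.congr_fun this t
    rwa [LinearMap.sum_apply] at this
  refine linearMap_ext3 fun u v x => ?_
  simp only [LinearMap.comp_apply, mulL_tmul, TensorProduct.map_tmul, LinearMap.id_apply,
    LinearMap.mul'_apply, LinearMap.sum_apply, M_tmul]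
  rw [divPow_T_mul c hL, Finset.sum_mul]
  exact Finset.sum_congr rfl fun l _ => mul_assoc _ _ _

lemma M_divPow_left (l : ℕ) (q b : ℤ) (t : V ⊗[ℂ] (V ⊗[ℂ] V)) :
    𝒲.M l q (TensorProduct.map (divPow 𝒲.T b) LinearMap.id t) =
      ((intChoose (l + b) b : ℤ) : ℂ) • 𝒲.M (l + b) q t := by
  suffices 𝒲.M l q ∘ₗ TensorProduct.map (divPow 𝒲.T b) LinearMap.id =
      ((intChoose (l + b) b : ℤ) : ℂ) • 𝒲.M (l + b) q from LinearMap.congr_fun this t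
  refine linearMap_ext3 fun u v x => ?_
  simp only [LinearMap.comp_apply, TensorProduct.map_tmul, LinearMap.id_apply, M_tmul,
    LinearMap.smul_apply]
  rcases lt_or_ge b 0 with hb | hb
  · rw [divPow_of_neg _ hb, intChoose_of_neg _ hb]
    simp
  lift b to ℕ using hb
  rw [← Module.End.mul_apply, divPow_mul, LinearMap.smul_apply, Algebra.smul_mul_assoc,
    show (l : ℤ) + b = ((l + b : ℕ) : ℤ) by push_cast; rfl, intChoose_natCast_natCast,
    Nat.choose_symm_add]
  simp

section
variable (h𝒲 : 𝒲.IsTranslationCovariant)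
include h𝒲

/-- Translating the second factor is invisible to the contraction of the first and third factors and
shifts the argument of the contraction of the first two. The multiset coefficients expand that
shift. -/
lemma IsTranslationCovariant.W_mulR_divPow (t : V ⊗[ℂ] (V ⊗[ℂ] V)) (b : ℤ) (g : ℕ) :
    𝒲.W g (mulR V (TensorProduct.map LinearMap.id
      (TensorProduct.map (divPow 𝒲.T b) LinearMap.id) t)) =
    ∑ x ∈ antidiagonal g, ∑ y ∈ antidiagonal x.1, (Nat.multichoose y.1 y.2 : ℂ) •
      mulR V (TensorProduct.map LinearMap.id
        (TensorProduct.map (divPow 𝒲.T (b - y.2)) LinearMap.id)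
          (𝒲.W12 y.1 (𝒲.W13 x.2 t))) := by
  rw [𝒲.W_mulR h𝒲.S_zero, map_sum]
  refine Finset.sum_congr rfl fun x _ => ?_
  have c1 : ∀ s, 𝒲.W13 x.2 (TensorProduct.map LinearMap.id
      (TensorProduct.map (divPow 𝒲.T b) LinearMap.id) s) =
      TensorProduct.map LinearMap.id (TensorProduct.map (divPow 𝒲.T b) LinearMap.id)
        (𝒲.W13 x.2 s) := by
    have : Commute (TensorProduct.map LinearMap.id
      (TensorProduct.map (divPow 𝒲.T b) LinearMap.id)) (𝒲.W13 x.2) := by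
      refine Commute.expCoeff_right (fun e => ?_) _
      rw [PowerSeries.coeff_mk]
      exact Commute.sum_right _ _ _ fun j _ => (commute_map (commute_id_left _)
        (commute_map (commute_id_right _) (commute_id_left _))).smul_right _
    exact fun s => (LinearMap.congr_fun this.eq s).symm
  have c2 := LinearMap.congr_fun (mul_divPow_of_commutator (w := 𝒲.W12) W12_zero
    h𝒲.W12_T2 x.1 b) (𝒲.W13 x.2 t)
  rw [← divPow_map_right, ← divPow_map_left, Module.End.mul_apply] at c2
  rw [c1, c2, LinearMap.sum_apply, map_sum]
  refine Finset.sum_congr rfl fun y _ => ?_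
  rw [LinearMap.smul_apply, map_smul, one_pow, one_mul, Module.End.mul_apply,
    ← divPow_map_right, ← divPow_map_left]

/-- Here the first factor is translated: the contraction of the last two factors does not see this,
and the contraction of the first and third is shifted in the opposite direction, whence the sign
`(-1) ^ y.2`. -/
lemma IsTranslationCovariant.W_mulL_divPow (t : V ⊗[ℂ] (V ⊗[ℂ] V)) (b : ℤ) (g : ℕ) :
    𝒲.W g (mulL V (TensorProduct.map (divPow 𝒲.T b) LinearMap.id t)) =
    ∑ x ∈ antidiagonal g, ∑ y ∈ antidiagonal x.1,
      ((-1 : ℂ) ^ y.2 * (Nat.multichoose y.1 y.2 : ℂ)) •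
      mulL V (TensorProduct.map (divPow 𝒲.T (b - y.2)) LinearMap.id
          (𝒲.W13 y.1 (𝒲.W23 x.2 t))) := by
  rw [𝒲.W_mulL h𝒲.S_zero, map_sum]
  refine Finset.sum_congr rfl fun x _ => ?_
  have c1 : ∀ s, 𝒲.W23 x.2 (TensorProduct.map (divPow 𝒲.T b) LinearMap.id s) =
      TensorProduct.map (divPow 𝒲.T b) LinearMap.id (𝒲.W23 x.2 s) := by
    have : Commute (TensorProduct.map (divPow 𝒲.T b) LinearMap.id) (𝒲.W23 x.2) := by
      refine Commute.expCoeff_right (fun e => ?_) _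
      rw [PowerSeries.coeff_mk]
      exact Commute.sum_right _ _ _ fun j _ => (commute_map (commute_id_right _)
        (commute_id_left _)).smul_right _
    exact fun s => (LinearMap.congr_fun this.eq s).symm
  have c2 := LinearMap.congr_fun (mul_divPow_of_commutator (w := 𝒲.W13) W13_zero
    h𝒲.W13_T1 x.1 b) (𝒲.W23 x.2 t)
  rw [← divPow_map_left, Module.End.mul_apply] at c2
  rw [c1, c2, LinearMap.sum_apply, map_sum]
  refine Finset.sum_congr rfl fun y _ => ?_
  rw [LinearMap.smul_apply, map_smul, Module.End.mul_apply, ← divPow_map_left]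

end

lemma Y_eq_box_sum {s : V ⊗[ℂ] V} {K J : ℕ} {H : ℕ → ℕ → ℕ → V ⊗[ℂ] V}
    (hs : ∀ g, 𝒲.W g s = ∑ d ∈ Finset.range K, ∑ e ∈ Finset.range K, ∑ j ∈ Finset.range J,
      if d + e + j = g then H d e j else 0) (m : ℤ) :
    𝒲.Y m s = ∑ d ∈ Finset.range K, ∑ e ∈ Finset.range K, ∑ j ∈ Finset.range J,
      LinearMap.mul' ℂ V (TensorProduct.map (divPow 𝒲.T (d + e + j - 1 - m)) LinearMap.id
        (H d e j)) := by
  rw [Y_eq_sum (K := K + K + J)]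
  · simp only [hs, map_sum]
    rw [Finset.sum_comm]
    refine Finset.sum_congr rfl fun d hd => ?_
    rw [Finset.sum_comm]
    refine Finset.sum_congr rfl fun e he => ?_
    rw [Finset.sum_comm]
    refine Finset.sum_congr rfl fun j hj => ?_
    rw [Finset.mem_range] at hd he hj
    rw [Finset.sum_eq_single (d + e + j)]
    · rw [if_pos rfl]; push_cast; rfl
    · intro g _ hg
      rw [if_neg (Ne.symm hg), map_zero, map_zero]
    · intro h
      exact absurd (Finset.mem_range.2 (by omega)) h
  · intro g hg
    rw [hs]
    refine Finset.sum_eq_zero fun d hd => Finset.sum_eq_zero fun e he =>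
      Finset.sum_eq_zero fun j hj => ?_
    rw [Finset.mem_range] at hd he hj
    rw [if_neg (by omega)]

end WickData

namespace WickData

variable {V : Type*} [CommRing V] [Algebra ℂ V] {𝒲 : WickData V}

lemma Y_add (h𝒲 : 𝒲.IsTranslationCovariant) (m : ℤ) (s t : V ⊗[ℂ] V) :
    𝒲.Y m (s + t) = 𝒲.Y m s + 𝒲.Y m t := by
  obtain ⟨K, hK⟩ := h𝒲.exists_W_eq_zero s
  obtain ⟨L, hL⟩ := h𝒲.exists_W_eq_zero t
  have hs : ∀ d, max K L ≤ d → 𝒲.W d s = 0 := fun d hd => hK d (le_trans (le_max_left _ _) hd)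
  have ht : ∀ d, max K L ≤ d → 𝒲.W d t = 0 := fun d hd => hL d (le_trans (le_max_right _ _) hd)
  rw [Y_eq_sum hs, Y_eq_sum ht, Y_eq_sum (K := max K L)
    (fun d hd => by rw [map_add, hs d hd, ht d hd, add_zero])]
  simp only [map_add, Finset.sum_add_distrib]

variable (𝒲) in
lemma Y_smul (m : ℤ) (r : ℂ) (s : V ⊗[ℂ] V) : 𝒲.Y m (r • s) = r • 𝒲.Y m s := by
  unfold Y
  rw [smul_finsum]
  simp only [map_smul]

/-- The Fourier modes as a bilinear map. -/
def IsTranslationCovariant.modeLin (h𝒲 : 𝒲.IsTranslationCovariant) (m : ℤ) :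
    V →ₗ[ℂ] V →ₗ[ℂ] V :=
  TensorProduct.curry
    { toFun := 𝒲.Y m
      map_add' := Y_add h𝒲 m
      map_smul' := 𝒲.Y_smul m }

lemma IsTranslationCovariant.modeLin_apply (h𝒲 : 𝒲.IsTranslationCovariant) (m : ℤ) (v w : V) :
    h𝒲.modeLin m v w = 𝒲.mode m v w := rfl

section
variable (h𝒲 : 𝒲.IsTranslationCovariant)
include h𝒲

lemma IsTranslationCovariant.Y_mulR_sum (t : V ⊗[ℂ] (V ⊗[ℂ] V)) {K J : ℕ}
    (hK : ∀ d e f, K ≤ d ∨ K ≤ e ∨ K ≤ f → 𝒲.W12 d (𝒲.W13 e (𝒲.W23 f t)) = 0) (m k : ℤ)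
    (hJ : (K : ℤ) - k ≤ J) :
    𝒲.Y m (∑ f ∈ Finset.range K, mulR V (TensorProduct.map LinearMap.id
      (TensorProduct.map (divPow 𝒲.T (f - 1 - k)) LinearMap.id) (𝒲.W23 f t))) =
    ∑ d ∈ Finset.range K, ∑ e ∈ Finset.range K, ∑ f ∈ Finset.range K, ∑ j ∈ Finset.range J,
      (Nat.multichoose d j : ℂ) •
        𝒲.M (d + e + j - 1 - m) (f - 1 - k - j) (𝒲.W12 d (𝒲.W13 e (𝒲.W23 f t))) := by
  have key : ∀ f ∈ Finset.range K, ∀ g, 𝒲.W g (mulR V (TensorProduct.map LinearMap.id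
      (TensorProduct.map (divPow 𝒲.T (f - 1 - k)) LinearMap.id) (𝒲.W23 f t))) =
      ∑ d ∈ Finset.range K, ∑ e ∈ Finset.range K, ∑ j ∈ Finset.range J, if d + e + j = g then
        (Nat.multichoose d j : ℂ) • mulR V (TensorProduct.map LinearMap.id
          (TensorProduct.map (divPow 𝒲.T (f - 1 - k - j)) LinearMap.id)
            (𝒲.W12 d (𝒲.W13 e (𝒲.W23 f t)))) else 0 := by
    intro f hf g
    rw [Finset.mem_range] at hf
    rw [h𝒲.W_mulR_divPow]
    refine sum_antidiagonal_antidiagonal_eq_box (fun d e j => (Nat.multichoose d j : ℂ) •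
      mulR V (TensorProduct.map LinearMap.id
        (TensorProduct.map (divPow 𝒲.T (f - 1 - k - j)) LinearMap.id)
          (𝒲.W12 d (𝒲.W13 e (𝒲.W23 f t))))) ?_ g
    rintro d e j (h | h | h)
    · simp [hK d e f (Or.inl h)]
    · simp [hK d e f (Or.inr (Or.inl h))]
    · simp [divPow_of_neg _ (show (f : ℤ) - 1 - k - j < 0 by omega)]
  rw [Y_eq_box_sum (K := K) (J := J) (H := fun d e j => ∑ f ∈ Finset.range K,
      (Nat.multichoose d j : ℂ) • mulR V (TensorProduct.map LinearMap.id
          (TensorProduct.map (divPow 𝒲.T (f - 1 - k - j)) LinearMap.id)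
            (𝒲.W12 d (𝒲.W13 e (𝒲.W23 f t)))))]
  · refine Finset.sum_congr rfl fun d _ => Finset.sum_congr rfl fun e _ => ?_
    rw [Finset.sum_comm]
    refine Finset.sum_congr rfl fun j _ => ?_
    simp only [map_sum, map_smul]
    refine Finset.sum_congr rfl fun f _ => ?_
    congr 1
    generalize 𝒲.W12 d (𝒲.W13 e (𝒲.W23 f t)) = s
    suffices LinearMap.mul' ℂ V ∘ₗ TensorProduct.map (divPow 𝒲.T (d + e + j - 1 - m))
        LinearMap.id ∘ₗ mulR V ∘ₗ TensorProduct.map LinearMap.id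
          (TensorProduct.map (divPow 𝒲.T (f - 1 - k - j)) LinearMap.id) =
        𝒲.M (d + e + j - 1 - m) (f - 1 - k - j) from LinearMap.congr_fun this s
    exact linearMap_ext3 fun u v x => rfl
  · intro g
    rw [map_sum, Finset.sum_congr rfl fun f hf => key f hf g, Finset.sum_comm]
    refine Finset.sum_congr rfl fun d _ => ?_
    rw [Finset.sum_comm]
    refine Finset.sum_congr rfl fun e _ => ?_
    rw [Finset.sum_comm]
    refine Finset.sum_congr rfl fun j _ => ?_
    split_ifs
    · rfl
    · exact Finset.sum_const_zero

/-- Both compositions $u_{(m)}(v_{(k)}x)$ and $(u_{(p)}v)_{(N)}x$ are written in the same terms: a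
triple contraction of $u\otimes v\otimes x$, followed by divided powers of $T$ on $u$ and on $v$.
The first expansion is given here, the second in `mode_mode_left`. -/
lemma IsTranslationCovariant.mode_mode {u v x : V} {K J : ℕ}
    (hvx : ∀ f, K ≤ f → 𝒲.W f (v ⊗ₜ x) = 0)
    (hK : ∀ d e f, K ≤ d ∨ K ≤ e ∨ K ≤ f →
      𝒲.W12 d (𝒲.W13 e (𝒲.W23 f (u ⊗ₜ (v ⊗ₜ x)))) = 0) (m k : ℤ)
    (hJ : (K : ℤ) - k ≤ J) :
    𝒲.mode m u (𝒲.mode k v x) =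
    ∑ d ∈ Finset.range K, ∑ e ∈ Finset.range K, ∑ f ∈ Finset.range K, ∑ j ∈ Finset.range J,
      (Nat.multichoose d j : ℂ) • 𝒲.M (d + e + j - 1 - m) (f - 1 - k - j)
        (𝒲.W12 d (𝒲.W13 e (𝒲.W23 f (u ⊗ₜ (v ⊗ₜ x))))) := by
  rw [← h𝒲.Y_mulR_sum _ hK m k hJ, mode, mode, Y_eq_sum hvx, TensorProduct.tmul_sum]
  congr 1
  refine Finset.sum_congr rfl fun f _ => ?_
  rw [W23_tmul]
  rfl

lemma IsTranslationCovariant.Y_mulL_sum (t : V ⊗[ℂ] (V ⊗[ℂ] V)) {K A : ℕ}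
    (hK : ∀ d e f, K ≤ d ∨ K ≤ e ∨ K ≤ f → 𝒲.W12 d (𝒲.W13 e (𝒲.W23 f t)) = 0) (p N : ℤ)
    (hA : 3 * (K : ℤ) - p - N ≤ A) :
    𝒲.Y N (∑ d ∈ Finset.range K, mulL V (TensorProduct.map (divPow 𝒲.T (d - 1 - p))
      LinearMap.id (𝒲.W12 d t))) =
    ∑ d ∈ Finset.range K, ∑ e ∈ Finset.range K, ∑ f ∈ Finset.range K, ∑ a ∈ Finset.range A,
      ((intChoose ((a : ℤ) - e) (d - 1 - p) : ℤ) : ℂ) •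
        𝒲.M a (d + e + f - p - N - 2 - a) (𝒲.W12 d (𝒲.W13 e (𝒲.W23 f t))) := by
  have c1 : ∀ d e f s, 𝒲.W13 e (𝒲.W23 f (𝒲.W12 d s)) = 𝒲.W12 d (𝒲.W13 e (𝒲.W23 f s)) := by
    intro d e f s
    have h1 := LinearMap.congr_fun (𝒲.commute_W12_W23 d f).eq s
    have h2 := LinearMap.congr_fun (𝒲.commute_W12_W13 d e).eq (𝒲.W23 f s)
    simp only [Module.End.mul_apply] at h1 h2
    rw [← h1, h2]
  set J : ℕ := (K - p).toNat with hJdef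
  have hJ : (K : ℤ) - p ≤ J := by omega
  -- This exceeds every divided power $e+f+j-1-N$ in the box, so the Leibniz rule may be used with
  -- one range, and it is at least `A`, as the Vandermonde summation requires.
  set L : ℕ := A + 2 * K + J + (-N).toNat with hL
  have key : ∀ d ∈ Finset.range K, ∀ g, 𝒲.W g (mulL V (TensorProduct.map
      (divPow 𝒲.T (d - 1 - p)) LinearMap.id (𝒲.W12 d t))) =
      ∑ e ∈ Finset.range K, ∑ f ∈ Finset.range K, ∑ j ∈ Finset.range J, if e + f + j = g then
        ((-1 : ℂ) ^ j * (Nat.multichoose e j : ℂ)) •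
          mulL V (TensorProduct.map (divPow 𝒲.T (d - 1 - p - j)) LinearMap.id
            (𝒲.W12 d (𝒲.W13 e (𝒲.W23 f t)))) else 0 := by
    intro d hd g
    rw [Finset.mem_range] at hd
    rw [h𝒲.W_mulL_divPow]
    simp only [c1]
    refine sum_antidiagonal_antidiagonal_eq_box (fun e f j =>
      ((-1 : ℂ) ^ j * (Nat.multichoose e j : ℂ)) •
          mulL V (TensorProduct.map (divPow 𝒲.T (d - 1 - p - j)) LinearMap.id
            (𝒲.W12 d (𝒲.W13 e (𝒲.W23 f t))))) ?_ g
    rintro e f j (h | h | h)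
    · simp [hK d e f (Or.inr (Or.inl h))]
    · simp [hK d e f (Or.inr (Or.inr h))]
    · simp [divPow_of_neg _ (show (d : ℤ) - 1 - p - j < 0 by omega)]
  rw [Y_eq_box_sum (K := K) (J := J) (H := fun e f j => ∑ d ∈ Finset.range K,
        ((-1 : ℂ) ^ j * (Nat.multichoose e j : ℂ)) •
          mulL V (TensorProduct.map (divPow 𝒲.T (d - 1 - p - j)) LinearMap.id
            (𝒲.W12 d (𝒲.W13 e (𝒲.W23 f t)))))]
  · have e1 : ∀ e ∈ Finset.range K, ∀ f ∈ Finset.range K, ∀ j ∈ Finset.range J, ∀ d ∈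
        Finset.range K, LinearMap.mul' ℂ V (TensorProduct.map (divPow 𝒲.T (e + f + j - 1 - N))
          LinearMap.id (((-1 : ℂ) ^ j * (Nat.multichoose e j : ℂ)) •
          mulL V (TensorProduct.map (divPow 𝒲.T (d - 1 - p - j)) LinearMap.id
            (𝒲.W12 d (𝒲.W13 e (𝒲.W23 f t)))))) =
        ∑ l ∈ Finset.range L, ((-1 : ℂ) ^ j * (Nat.multichoose e j : ℂ)) •
          ((intChoose (l + ((d : ℤ) - 1 - p - j)) (d - 1 - p - j) : ℤ) : ℂ) •
            (fun z : ℤ => 𝒲.M z (d + e + f - p - N - 2 - z)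
              (𝒲.W12 d (𝒲.W13 e (𝒲.W23 f t)))) (l + ((d : ℤ) - 1 - p - j)) := by
      intro e he f hf j hj d hd
      rw [Finset.mem_range] at he hf hj hd
      rw [map_smul, map_smul, mul_divPow_mulL _ (L := L) (by omega), Finset.smul_sum]
      refine Finset.sum_congr rfl fun l _ => ?_
      rw [M_divPow_left]
      congr 3
      ring_nf
    have e3 : ∀ e ∈ Finset.range K, ∀ f ∈ Finset.range K, ∀ d ∈ Finset.range K,
        ∑ j ∈ Finset.range J, ∑ l ∈ Finset.range L,
          ((-1 : ℂ) ^ j * (Nat.multichoose e j : ℂ)) •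
          ((intChoose (l + ((d : ℤ) - 1 - p - j)) (d - 1 - p - j) : ℤ) : ℂ) •
            (fun z : ℤ => 𝒲.M z (d + e + f - p - N - 2 - z)
              (𝒲.W12 d (𝒲.W13 e (𝒲.W23 f t)))) (l + ((d : ℤ) - 1 - p - j)) =
        ∑ a ∈ Finset.range A, ((intChoose ((a : ℤ) - e) (d - 1 - p) : ℤ) : ℂ) •
          𝒲.M a (d + e + f - p - N - 2 - a) (𝒲.W12 d (𝒲.W13 e (𝒲.W23 f t))) := by
      intro e he f hf d hd
      rw [Finset.mem_range] at he hf hd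
      generalize 𝒲.W12 d (𝒲.W13 e (𝒲.W23 f t)) = s
      have h1 : (d : ℤ) - 1 - p < J := by omega
      have h2 : A ≤ L := by omega
      exact sum_multichoose_intChoose (g := fun z : ℤ => 𝒲.M z (d + e + f - p - N - 2 - z) s)
        (A := A) (J := J) (L := L) e (d - 1 - p) h1 h2
        fun a ha => M_of_neg_right _ (by omega) _
    symm
    rw [Finset.sum_comm]
    refine Finset.sum_congr rfl fun e he => ?_
    rw [Finset.sum_comm]
    refine Finset.sum_congr rfl fun f hf => ?_
    simp only [map_sum]
    rw [Finset.sum_comm (s := Finset.range J) (t := Finset.range K)]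
    refine Finset.sum_congr rfl fun d hd => ?_
    rw [← e3 e he f hf d hd]
    exact Finset.sum_congr rfl fun j hj => (e1 e he f hf j hj d hd).symm
  · intro g
    rw [map_sum, Finset.sum_congr rfl fun d hd => key d hd g, Finset.sum_comm]
    refine Finset.sum_congr rfl fun e _ => ?_
    rw [Finset.sum_comm]
    refine Finset.sum_congr rfl fun f _ => ?_
    rw [Finset.sum_comm]
    refine Finset.sum_congr rfl fun j _ => ?_
    split_ifs
    · rfl
    · exact Finset.sum_const_zero

lemma IsTranslationCovariant.mode_mode_left {u v x : V} {K A : ℕ}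
    (huv : ∀ d, K ≤ d → 𝒲.W d (u ⊗ₜ v) = 0)
    (hK : ∀ d e f, K ≤ d ∨ K ≤ e ∨ K ≤ f →
      𝒲.W12 d (𝒲.W13 e (𝒲.W23 f (u ⊗ₜ (v ⊗ₜ x)))) = 0) (p N : ℤ)
    (hA : 3 * (K : ℤ) - p - N ≤ A) :
    𝒲.mode N (𝒲.mode p u v) x =
    ∑ d ∈ Finset.range K, ∑ e ∈ Finset.range K, ∑ f ∈ Finset.range K, ∑ a ∈ Finset.range A,
      ((intChoose ((a : ℤ) - e) (d - 1 - p) : ℤ) : ℂ) •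
        𝒲.M a (d + e + f - p - N - 2 - a)
          (𝒲.W12 d (𝒲.W13 e (𝒲.W23 f (u ⊗ₜ (v ⊗ₜ x))))) := by
  rw [← h𝒲.Y_mulL_sum _ hK p N hA, mode, mode, Y_eq_sum huv, TensorProduct.sum_tmul]
  congr 1
  refine Finset.sum_congr rfl fun d _ => ?_
  rw [← insert3_tmul, W12_insert3]
  generalize 𝒲.W d (u ⊗ₜ v) = s
  induction s with
  | zero => simp
  | add a b ha hb => simp only [map_add, TensorProduct.add_tmul, ha, hb]
  | tmul a b => rfl

/-- The Borcherds identity. -/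
theorem IsTranslationCovariant.borcherds (u v x : V) (m k p : ℤ) : ∃ I₀ : ℕ, ∀ I, I₀ ≤ I →
    ∑ i ∈ Finset.range I, ((Ring.choose m i : ℤ) : ℂ) •
      𝒲.mode (m + k - i) (𝒲.mode (p + i) u v) x =
    ∑ i ∈ Finset.range I, ((-1 : ℂ) ^ i * (Ring.choose p i : ℤ)) •
      (𝒲.mode (m + p - i) u (𝒲.mode (k + i) v x) -
        (-1 : ℂ) ^ p • 𝒲.mode (k + p - i) v (𝒲.mode (m + i) u x)) := by
  obtain ⟨K₁, h₁⟩ := h𝒲.exists_W_eq_zero (u ⊗ₜ v)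
  obtain ⟨K₂, h₂⟩ := h𝒲.exists_W_eq_zero (v ⊗ₜ x)
  obtain ⟨K₃, h₃⟩ := h𝒲.exists_W_eq_zero (u ⊗ₜ x)
  obtain ⟨K₄, h₄⟩ := h𝒲.exists_bound (u ⊗ₜ (v ⊗ₜ x))
  obtain ⟨K, k₁, k₂, k₃, k₄⟩ : ∃ K, K₁ ≤ K ∧ K₂ ≤ K ∧ K₃ ≤ K ∧ K₄ ≤ K :=
    ⟨K₁ + K₂ + K₃ + K₄, by omega, by omega, by omega, by omega⟩
  have huv : ∀ d, K ≤ d → 𝒲.W d (u ⊗ₜ v) = 0 := fun d hd => h₁ d (k₁.trans hd)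
  have hvx : ∀ d, K ≤ d → 𝒲.W d (v ⊗ₜ x) = 0 := fun d hd => h₂ d (k₂.trans hd)
  have hux : ∀ d, K ≤ d → 𝒲.W d (u ⊗ₜ x) = 0 := fun d hd => h₃ d (k₃.trans hd)
  set E : ℕ → ℕ → ℕ → V ⊗[ℂ] (V ⊗[ℂ] V) := fun d e f =>
    𝒲.W12 d (𝒲.W13 e (𝒲.W23 f (u ⊗ₜ (v ⊗ₜ x)))) with hE
  have hK : ∀ d e f, K ≤ d ∨ K ≤ e ∨ K ≤ f → E d e f = 0 := fun d e f h =>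
    h₄ d e f (h.imp k₄.trans (Or.imp k₄.trans k₄.trans))
  -- Exchanging $u$ and $v$ interchanges the contractions with $x$ and gives the contraction between
  -- $u$ and $v$ its sign. The second product on the right is thereby expressed in the same triple
  -- contractions.
  have hE' : ∀ d e f, 𝒲.W12 d (𝒲.W13 f (𝒲.W23 e (v ⊗ₜ (u ⊗ₜ x)))) =
      (-1 : ℂ) ^ d • swap12 V (E d e f) := by
    intro d e f
    rw [← swap12_tmul u v x, W23_swap12, W13_swap12, h𝒲.W12_swap12]
    have := LinearMap.congr_fun (𝒲.commute_W13_W23 e f).eq (u ⊗ₜ (v ⊗ₜ x))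
    simp only [Module.End.mul_apply] at this
    rw [← this]
  have hK' : ∀ d f e, K ≤ d ∨ K ≤ f ∨ K ≤ e →
      𝒲.W12 d (𝒲.W13 f (𝒲.W23 e (v ⊗ₜ (u ⊗ₜ x)))) = 0 := by
    intro d f e h
    rw [hE', hK d e f (by tauto), map_zero, smul_zero]
  -- Larger than every total power $d+e+f-p-m-k-2$ of $T$ with $d,e,f<K$; for $a\ge A$ the power
  -- left for $v$ is negative and the term vanishes.
  set A : ℕ := 3 * K + p.natAbs + m.natAbs + k.natAbs with hA
  set I₀ : ℕ := A + 3 * K + p.natAbs + m.natAbs + k.natAbs with hI₀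
  refine ⟨I₀, fun I hI => ?_⟩
  have hAI : A ≤ I := by omega
  -- Here `a` is the divided power of $T$ on $u$; the power on $v$ is the rest of a total that is
  -- the same in all three products. The identity now has to be checked coefficient by coefficient
  -- for each `d`, `e`, `f`, `a`.
  set g : ℕ → ℕ → ℕ → ℤ → V := fun d e f a =>
    𝒲.M a (d + e + f - p - m - k - 2 - a) (E d e f) with hg
  have g0 : ∀ d e f, ∀ a < 0, g d e f a = 0 := fun d e f a ha => M_of_neg_left _ ha _
  have gA : ∀ d e f, d < K → e < K → f < K → ∀ a : ℤ, (A : ℤ) ≤ a → g d e f a = 0 :=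
    fun d e f hd he hf a ha => M_of_neg_right _ (by omega) _
  have L1 : ∀ i ∈ Finset.range I, ((Ring.choose m i : ℤ) : ℂ) •
      𝒲.mode (m + k - i) (𝒲.mode (p + i) u v) x =
      ∑ d ∈ Finset.range K, ∑ e ∈ Finset.range K, ∑ f ∈ Finset.range K, ∑ a ∈ Finset.range A,
        ((Ring.choose m i * intChoose ((a : ℤ) - e) (d - 1 - p - i) : ℤ) : ℂ) • g d e f a := by
    intro i _
    rw [h𝒲.mode_mode_left huv hK (A := A) (p + i) (m + k - i) (by omega), Finset.smul_sum]
    refine Finset.sum_congr rfl fun d _ => ?_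
    rw [Finset.smul_sum]
    refine Finset.sum_congr rfl fun e _ => ?_
    rw [Finset.smul_sum]
    refine Finset.sum_congr rfl fun f _ => ?_
    rw [Finset.smul_sum]
    refine Finset.sum_congr rfl fun a _ => ?_
    rw [smul_smul, show (d : ℤ) - 1 - (p + i) = d - 1 - p - i by ring,
      show (d : ℤ) + e + f - (p + i) - (m + k - i) - 2 - a = d + e + f - p - m - k - 2 - a by ring]
    push_cast
    rfl
  have R1 : ∀ i ∈ Finset.range I, ((-1 : ℂ) ^ i * (Ring.choose p i : ℤ)) •
      𝒲.mode (m + p - i) u (𝒲.mode (k + i) v x) =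
      ∑ d ∈ Finset.range K, ∑ e ∈ Finset.range K, ∑ f ∈ Finset.range K,
        ((-1 : ℂ) ^ i * (Ring.choose p i : ℤ)) • ∑ j ∈ Finset.range I,
          (Nat.multichoose d j : ℂ) •
            (fun l : ℕ => g d e f (d + e - 1 - m - p + l)) (i + j) := by
    intro i _
    rw [h𝒲.mode_mode hvx hK (J := I) (m + p - i) (k + i) (by omega), Finset.smul_sum]
    refine Finset.sum_congr rfl fun d _ => ?_
    rw [Finset.smul_sum]
    refine Finset.sum_congr rfl fun e _ => ?_
    rw [Finset.smul_sum]
    refine Finset.sum_congr rfl fun f _ => ?_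
    congr 1
    refine Finset.sum_congr rfl fun j _ => ?_
    simp only [hg]
    congr 3 <;> push_cast <;> ring
  have R2 : ∀ i ∈ Finset.range I, ((-1 : ℂ) ^ i * (Ring.choose p i : ℤ)) •
      (-1 : ℂ) ^ p • 𝒲.mode (k + p - i) v (𝒲.mode (m + i) u x) =
      ∑ d ∈ Finset.range K, ∑ e ∈ Finset.range K, ∑ f ∈ Finset.range K,
        ((-1 : ℂ) ^ p * (-1 : ℂ) ^ d) • ((-1 : ℂ) ^ i * (Ring.choose p i : ℤ)) •
          ∑ j ∈ Finset.range I, (Nat.multichoose d j : ℂ) •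
            (fun l : ℕ => g d e f (e - 1 - m - l)) (i + j) := by
    intro i _
    rw [h𝒲.mode_mode hux hK' (J := I) (k + p - i) (m + i) (by omega), Finset.smul_sum,
      Finset.smul_sum]
    refine Finset.sum_congr rfl fun d _ => ?_
    rw [Finset.sum_comm, Finset.smul_sum, Finset.smul_sum]
    refine Finset.sum_congr rfl fun e _ => ?_
    rw [Finset.smul_sum, Finset.smul_sum]
    refine Finset.sum_congr rfl fun f _ => ?_
    rw [smul_smul, smul_smul, Finset.smul_sum, Finset.smul_sum]
    refine Finset.sum_congr rfl fun j _ => ?_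
    rw [hE', map_smul, M_swap12, smul_smul, smul_smul, smul_smul]
    simp only [hg]
    congr 1
    · ring
    · congr 2 <;> push_cast <;> ring
  rw [Finset.sum_congr rfl L1]
  simp only [smul_sub]
  rw [Finset.sum_sub_distrib, Finset.sum_congr rfl R1, Finset.sum_congr rfl R2]
  have swap : ∀ F : ℕ → ℕ → ℕ → ℕ → V, ∑ i ∈ Finset.range I, ∑ d ∈ Finset.range K,
      ∑ e ∈ Finset.range K, ∑ f ∈ Finset.range K, F i d e f =
      ∑ d ∈ Finset.range K, ∑ e ∈ Finset.range K, ∑ f ∈ Finset.range K,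
        ∑ i ∈ Finset.range I, F i d e f := by
    intro F
    rw [Finset.sum_comm]
    refine Finset.sum_congr rfl fun d _ => ?_
    rw [Finset.sum_comm]
    refine Finset.sum_congr rfl fun e _ => ?_
    rw [Finset.sum_comm]
  rw [swap, swap, swap]
  rw [← Finset.sum_sub_distrib]
  refine Finset.sum_congr rfl fun d hd => ?_
  rw [← Finset.sum_sub_distrib]
  refine Finset.sum_congr rfl fun e he => ?_
  rw [← Finset.sum_sub_distrib]
  refine Finset.sum_congr rfl fun f hf => ?_
  rw [Finset.mem_range] at hd he hf
  have ch0 : ∀ z < 0, (-1 : ℂ) ^ z * ((intChoose (p - d) z : ℤ) : ℂ) = 0 := by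
    intro z hz
    simp [intChoose_of_neg _ hz]
  -- The sum over `i` and the expansion of the shift collapse to $\binom{p-d}{l}$. The power of $T$
  -- on $u$ increases with `l` in the first product and decreases in the second, hence a shift here
  -- and a reflection in `s2`.
  have s1 := (sum_choose_multichoose p d (I := I) (h := fun l : ℕ =>
      g d e f (d + e - 1 - m - p + l)) (fun l hl => gA d e f hd he hf _ (by omega))).trans
    (sum_range_shift (φ := fun z : ℤ => (-1 : ℂ) ^ z * ((intChoose (p - d) z : ℤ) : ℂ))
      (g := g d e f) (A := A) ((d : ℤ) + e - 1 - m - p) ch0 (g0 d e f) (gA d e f hd he hf)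
      (by omega))
  have s2 := (sum_choose_multichoose p d (I := I) (h := fun l : ℕ =>
      g d e f (e - 1 - m - l)) (fun l hl => g0 d e f _ (by omega))).trans
    (sum_range_reflect (φ := fun z : ℤ => (-1 : ℂ) ^ z * ((intChoose (p - d) z : ℤ) : ℂ))
      (g := g d e f) (A := A) ((e : ℤ) - 1 - m) ch0 (g0 d e f) (gA d e f hd he hf)
      (by omega))
  beta_reduce at s1 s2 ⊢
  rw [s1, ← Finset.smul_sum, s2, Finset.sum_comm, Finset.smul_sum, ← Finset.sum_sub_distrib]
  refine Finset.sum_congr rfl fun a _ => ?_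
  rw [← Finset.sum_smul, ← Int.cast_sum, ← intChoose_add m (a - e) (d - 1 - p) (by omega),
    smul_smul, ← sub_smul]
  congr 1
  -- With $A=m+a-e$ and $D=p-d$, the expansion at infinity comes from $u(vx)$, the one at zero from
  -- $v(ux)$, and the residue at $-1$ from $(uv)x$.
  have key := intChoose_reflect (m + (a - e)) (p - d)
  rw [show -1 - (p - (d : ℤ)) = d - 1 - p by ring,
    show p - (d : ℤ) + (m + (a - e)) + 1 = a - (d + e - 1 - m - p) by ring,
    show -1 - (m + ((a : ℤ) - e)) = e - 1 - m - a by ring] at key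
  rw [← key]
  have sgn : (-1 : ℂ) ^ p * (-1 : ℂ) ^ d * (-1 : ℂ) ^ ((e : ℤ) - 1 - m - a) =
      (-1 : ℂ) ^ ((a : ℤ) - (d + e - 1 - m - p)) := by
    have h1 : (-1 : ℂ) ≠ 0 := by norm_num
    rw [← zpow_natCast, ← zpow_add₀ h1, ← zpow_add₀ h1,
      show (a : ℤ) - (d + e - 1 - m - p) = (p + d + (e - 1 - m - a)) +
        2 * (a - d - e + 1 + m) by ring, zpow_add₀ h1 _ (2 * _), zpow_mul]
    norm_num
  push_cast
  linear_combination ((intChoose (p - d) (e - 1 - m - a) : ℤ) : ℂ) * sgn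

end

end WickData

/-! ### Vacuum, translation, skew-symmetry and the commutator formula -/

namespace WickData

variable {V : Type*} [CommRing V] [Algebra ℂ V] {𝒲 : WickData V}

lemma T_one : 𝒲.T 1 = 0 := by
  have := 𝒲.T_mul 1 1
  simpa using this

lemma D_one (j) : 𝒲.D j 1 = 0 := by
  have := 𝒲.D_mul j 1 1
  simpa using this

lemma divPow_T_one (b : ℤ) (h : b ≠ 0) : divPow 𝒲.T b 1 = 0 := by
  rcases lt_or_ge b 0 with hb | hb
  · rw [divPow_of_neg _ hb]; rfl
  · lift b to ℕ using hb
    obtain ⟨c, rfl⟩ : ∃ c, b = c + 1 := ⟨b - 1, by omega⟩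
    rw [divPow_natCast, LinearMap.smul_apply, pow_succ, Module.End.mul_apply, T_one, map_zero,
      smul_zero]

lemma T_divPow_T (b : ℤ) (y : V) :
    𝒲.T (divPow 𝒲.T b y) = ((b : ℂ) + 1) • divPow 𝒲.T (b + 1) y :=
  LinearMap.congr_fun (mul_divPow 𝒲.T b) y

lemma divPow_T_T (b : ℤ) (y : V) :
    divPow 𝒲.T b (𝒲.T y) = ((b : ℂ) + 1) • divPow 𝒲.T (b + 1) y := by
  rw [← T_divPow_T]
  exact (LinearMap.congr_fun (commute_divPow 𝒲.T b).eq y).symm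

/-- The coefficients of $e^{zT}\big((e^{-zT}x)\,y\big)=x\,e^{zT}y$. This moves the translation from
one factor to the other in the proof of skew-symmetry. -/
lemma sum_divPow_T_mul (b : ℕ) (x y : V) : ∑ q ∈ antidiagonal b,
    (-1 : ℂ) ^ q.2 • divPow 𝒲.T q.1 (divPow 𝒲.T q.2 x * y) = x * divPow 𝒲.T b y := by
  induction b generalizing x with
  | zero => simp
  | succ b ih =>
    have hb : ((b : ℂ) + 1) ≠ 0 := by exact_mod_cast Nat.succ_ne_zero b
    refine smul_right_injective V hb ?_
    have e1 : ∀ f : ℕ × ℕ → V, ((b : ℂ) + 1) • ∑ x ∈ antidiagonal (b + 1), f x =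
        ∑ x ∈ antidiagonal (b + 1), (x.1 : ℂ) • f x +
          ∑ x ∈ antidiagonal (b + 1), (x.2 : ℂ) • f x := by
      intro f
      rw [Finset.smul_sum, ← Finset.sum_add_distrib]
      refine Finset.sum_congr rfl fun x hx => ?_
      rw [mem_antidiagonal] at hx
      rw [← add_smul]
      congr 1
      exact_mod_cast hx.symm
    have h1 := congrArg 𝒲.T (ih x)
    have h2 := ih (𝒲.T x)
    rw [𝒲.T_mul, T_divPow_T, map_sum] at h1
    simp only [map_smul, T_divPow_T] at h1
    simp only [divPow_T_T, smul_mul_assoc, map_smul] at h2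
    simp only
    rw [e1, Finset.Nat.sum_antidiagonal_succ, Finset.Nat.sum_antidiagonal_succ']
    simp only [Nat.cast_zero, zero_smul, zero_add]
    push_cast
    rw [mul_smul_comm] at h1
    have h3 := sub_eq_of_eq_add' h1
    rw [← h2, Int.cast_natCast] at h3
    rw [← h3, sub_eq_add_neg, ← Finset.sum_neg_distrib]
    congr 1
    · refine Finset.sum_congr rfl fun q _ => ?_
      rw [smul_comm]
      push_cast
      rfl
    · refine Finset.sum_congr rfl fun q _ => ?_
      rw [pow_succ]
      push_cast
      module

section
variable (h𝒲 : 𝒲.IsTranslationCovariant)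
include h𝒲

lemma IsTranslationCovariant.mode_add_left (m : ℤ) (u v w : V) :
    𝒲.mode m (u + v) w = 𝒲.mode m u w + 𝒲.mode m v w := by
  simp only [← h𝒲.modeLin_apply, map_add, LinearMap.add_apply]

lemma IsTranslationCovariant.mode_add_right (m : ℤ) (u v w : V) :
    𝒲.mode m u (v + w) = 𝒲.mode m u v + 𝒲.mode m u w := by
  simp only [← h𝒲.modeLin_apply, map_add]

lemma IsTranslationCovariant.mode_smul_left (m : ℤ) (r : ℂ) (v w : V) :
    𝒲.mode m (r • v) w = r • 𝒲.mode m v w := by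
  simp only [← h𝒲.modeLin_apply, map_smul, LinearMap.smul_apply]

lemma IsTranslationCovariant.mode_smul_right (m : ℤ) (r : ℂ) (v w : V) :
    𝒲.mode m v (r • w) = r • 𝒲.mode m v w := by
  simp only [← h𝒲.modeLin_apply, map_smul]

@[simp] lemma IsTranslationCovariant.mode_zero_left (m : ℤ) (w : V) : 𝒲.mode m 0 w = 0 := by
  simp only [← h𝒲.modeLin_apply, map_zero, LinearMap.zero_apply]

@[simp] lemma IsTranslationCovariant.mode_zero_right (m : ℤ) (w : V) : 𝒲.mode m w 0 = 0 := by
  simp only [← h𝒲.modeLin_apply, map_zero]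

lemma IsTranslationCovariant.W_one_left (x : V) (d : ℕ) :
    𝒲.W d (1 ⊗ₜ x) = if d = 0 then 1 ⊗ₜ x else 0 := by
  have h : ∀ p, 0 < p → ∀ d : ℕ, (PowerSeries.coeff d ((PowerSeries.mk 𝒲.R) ^ p) :
      Module.End ℂ (V ⊗[ℂ] V)) (1 ⊗ₜ[ℂ] x) = 0 := by
    intro p hp d
    obtain ⟨q, rfl⟩ : ∃ q, p = q + 1 := ⟨p - 1, by omega⟩
    rw [pow_succ, PowerSeries.coeff_mul, LinearMap.sum_apply]
    refine Finset.sum_eq_zero fun y _ => ?_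
    rw [Module.End.mul_apply, PowerSeries.coeff_mk, R, LinearMap.sum_apply, Finset.sum_eq_zero,
      map_zero]
    intro j _
    simp [D_one]
  rw [W, expCoeff, LinearMap.sum_apply, Finset.sum_eq_single 0]
  · split_ifs with hd
    · simp [hd]
    · simp [PowerSeries.coeff_one, hd]
  · intro p _ hp
    rw [LinearMap.smul_apply, h p (Nat.pos_of_ne_zero hp), smul_zero]
  · simp

lemma IsTranslationCovariant.mode_one_left (m : ℤ) (x : V) :
    𝒲.mode m 1 x = if m = -1 then x else 0 := by
  rw [mode, Y_eq_sum (K := 1) (fun d hd => by rw [h𝒲.W_one_left, if_neg (by omega)]),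
    Finset.sum_range_one, h𝒲.W_one_left, if_pos rfl, TensorProduct.map_tmul,
    LinearMap.mul'_apply]
  split_ifs with h
  · simp [h]
  · rw [divPow_T_one _ (by push_cast; omega), zero_mul]

lemma IsTranslationCovariant.exists_bound_T_left (u v : V) : ∃ K, ∀ d, K ≤ d →
    𝒲.W d (u ⊗ₜ v) = 0 ∧ 𝒲.W d (𝒲.T u ⊗ₜ v) = 0 ∧ 𝒲.W d (u ⊗ₜ 𝒲.T v) = 0 := by
  obtain ⟨K₁, h₁⟩ := h𝒲.exists_W_eq_zero (u ⊗ₜ v)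
  obtain ⟨K₂, h₂⟩ := h𝒲.exists_W_eq_zero (𝒲.T u ⊗ₜ v)
  obtain ⟨K₃, h₃⟩ := h𝒲.exists_W_eq_zero (u ⊗ₜ 𝒲.T v)
  exact ⟨K₁ + K₂ + K₃, fun d hd => ⟨h₁ d (by omega), h₂ d (by omega), h₃ d (by omega)⟩⟩

/-- Absorbing $T$ into the divided power contributes the factor $d-m$ in contraction degree $d$;
commuting $T$ through the Wick exponential contributes $-d$ to the same term after a shift of the
index. The sum is $-m$ in every degree. -/
lemma IsTranslationCovariant.mode_T_left (m : ℤ) (u v : V) :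
    𝒲.mode m (𝒲.T u) v = (-m : ℂ) • 𝒲.mode (m - 1) u v := by
  obtain ⟨K, hK⟩ := h𝒲.exists_bound_T_left u v
  set B : ℤ → V ⊗[ℂ] V → V := fun b s =>
    LinearMap.mul' ℂ V (TensorProduct.map (divPow 𝒲.T b) LinearMap.id s) with hB
  have hBT : ∀ b s, B b (TensorProduct.map 𝒲.T LinearMap.id s) = ((b : ℂ) + 1) • B (b + 1) s := by
    intro b s
    simp only [hB]
    induction s with
    | zero => simp
    | add s t hs ht => simp only [map_add, smul_add, hs, ht]
    | tmul x y =>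
      simp only [TensorProduct.map_tmul, LinearMap.id_apply, LinearMap.mul'_apply]
      rw [← Module.End.mul_apply, ← (commute_divPow 𝒲.T b).eq, mul_divPow, LinearMap.smul_apply,
        Algebra.smul_mul_assoc]
  have hB1 : ∀ b s t, B b (s + t) = B b s + B b t := fun b s t => by simp only [hB, map_add]
  have hB2 : ∀ b (r : ℂ) s, B b (r • s) = r • B b s := fun b r s => by simp only [hB, map_smul]
  have hB0 : ∀ b, B b 0 = 0 := fun b => by simp only [hB, map_zero]
  rw [mode, mode, Y_eq_sum (K := K + 1) (fun d hd => (hK d (by omega)).2.1),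
    Y_eq_sum (K := K) (fun d hd => (hK d hd).1)]
  change ∑ d ∈ Finset.range (K + 1), B (d - 1 - m) (𝒲.W d (𝒲.T u ⊗ₜ v)) =
    (-m : ℂ) • ∑ d ∈ Finset.range K, B (d - 1 - (m - 1)) (𝒲.W d (u ⊗ₜ v))
  have e0 : B (((0 : ℕ) : ℤ) - 1 - m) (𝒲.W 0 (𝒲.T u ⊗ₜ v)) =
      (-m : ℂ) • B (((0 : ℕ) : ℤ) - 1 - (m - 1)) (𝒲.W 0 (u ⊗ₜ v)) := by
    have := hBT (((0 : ℕ) : ℤ) - 1 - m) (u ⊗ₜ v)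
    rw [TensorProduct.map_tmul, LinearMap.id_apply] at this
    rw [W_zero, Module.End.one_apply, Module.End.one_apply, this]
    congr 2
    · push_cast; ring
    · ring
  have e1 : ∀ d : ℕ, B (((d + 1 : ℕ) : ℤ) - 1 - m) (𝒲.W (d + 1) (𝒲.T u ⊗ₜ v)) =
      ((d : ℂ) + 1 - m) • B (((d + 1 : ℕ) : ℤ) - 1 - (m - 1)) (𝒲.W (d + 1) (u ⊗ₜ v)) -
        (d : ℂ) • B ((d : ℤ) - 1 - (m - 1)) (𝒲.W d (u ⊗ₜ v)) := by
    intro d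
    have h1 := LinearMap.congr_fun (h𝒲.W_T_left d) (u ⊗ₜ v)
    simp only [Module.End.mul_apply, LinearMap.add_apply, LinearMap.smul_apply,
      TensorProduct.map_tmul, LinearMap.id_apply] at h1
    rw [h1, hB1, hB2, hBT, neg_one_mul, neg_smul, ← sub_eq_add_neg]
    congr 2
    · push_cast; ring
    · congr 1; ring
    · congr 1; push_cast; ring
  rw [Finset.sum_range_succ', e0, Finset.sum_congr rfl fun d _ => e1 d, Finset.sum_sub_distrib]
  -- The shift of the index that aligns the two contributions; the boundary term at `K` vanishes by
  -- the choice of `K`.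
  have e2 := Finset.sum_range_succ' (fun d : ℕ => ((d : ℂ) - m) •
    B ((d : ℤ) - 1 - (m - 1)) (𝒲.W d (u ⊗ₜ v))) K
  rw [Finset.sum_range_succ, (hK K le_rfl).1, hB0, smul_zero, add_zero] at e2
  simp only [Nat.cast_zero, zero_sub] at e2
  push_cast at e2 ⊢
  have e3 : ∑ d ∈ Finset.range K, ((d : ℂ) + 1 - m) •
      B ((d : ℤ) + 1 - 1 - (m - 1)) (𝒲.W (d + 1) (u ⊗ₜ v)) =
      ∑ d ∈ Finset.range K, ((d : ℂ) - m) • B ((d : ℤ) - 1 - (m - 1)) (𝒲.W d (u ⊗ₜ v)) -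
        (-m : ℂ) • B (-1 - (m - 1)) (𝒲.W 0 (u ⊗ₜ v)) := by
    rw [e2, add_sub_cancel_right]
  rw [e3, sub_right_comm, sub_add_cancel, ← Finset.sum_sub_distrib, Finset.smul_sum]
  refine Finset.sum_congr rfl fun d _ => ?_
  rw [← sub_smul]
  congr 1
  ring

/-- The Leibniz rule gives a factor $d-m$ from the divided power in degree $d$, and the commutator
of the Wick exponential with $T$ on the second factor accounts for $d$ of it. -/
lemma IsTranslationCovariant.T_mode (m : ℤ) (u v : V) :
    𝒲.T (𝒲.mode m u v) = (-m : ℂ) • 𝒲.mode (m - 1) u v + 𝒲.mode m u (𝒲.T v) := by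
  obtain ⟨K, hK⟩ := h𝒲.exists_bound_T_left u v
  set B : ℤ → V ⊗[ℂ] V → V := fun b s =>
    LinearMap.mul' ℂ V (TensorProduct.map (divPow 𝒲.T b) LinearMap.id s) with hB
  have hBT : ∀ b s, 𝒲.T (B b s) = ((b : ℂ) + 1) • B (b + 1) s +
      B b (TensorProduct.map LinearMap.id 𝒲.T s) := by
    intro b s
    simp only [hB]
    induction s with
    | zero => simp
    | add s t hs ht => simp only [map_add, smul_add, hs, ht]; abel
    | tmul x y =>
      simp only [TensorProduct.map_tmul, LinearMap.id_apply, LinearMap.mul'_apply, 𝒲.T_mul]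
      rw [← Module.End.mul_apply, mul_divPow, LinearMap.smul_apply, Algebra.smul_mul_assoc]
  have hB1 : ∀ b s t, B b (s + t) = B b s + B b t := fun b s t => by simp only [hB, map_add]
  have hB2 : ∀ b (r : ℂ) s, B b (r • s) = r • B b s := fun b r s => by simp only [hB, map_smul]
  have hB0 : ∀ b, B b 0 = 0 := fun b => by simp only [hB, map_zero]
  rw [mode, mode, mode, Y_eq_sum (K := K + 1) (fun d hd => (hK d (by omega)).2.2),
    Y_eq_sum (K := K) (fun d hd => (hK d hd).1) (m - 1), Y_eq_sum (K := K + 1)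
    (fun d hd => (hK d (by omega)).1) m]
  change 𝒲.T (∑ d ∈ Finset.range (K + 1), B (d - 1 - m) (𝒲.W d (u ⊗ₜ v))) =
    (-m : ℂ) • ∑ d ∈ Finset.range K, B (d - 1 - (m - 1)) (𝒲.W d (u ⊗ₜ v)) +
      ∑ d ∈ Finset.range (K + 1), B (d - 1 - m) (𝒲.W d (u ⊗ₜ 𝒲.T v))
  have e1 : ∀ d : ℕ, B (((d + 1 : ℕ) : ℤ) - 1 - m) (𝒲.W (d + 1) (u ⊗ₜ 𝒲.T v)) =
      B (((d + 1 : ℕ) : ℤ) - 1 - m)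
        (TensorProduct.map LinearMap.id 𝒲.T (𝒲.W (d + 1) (u ⊗ₜ v))) +
        (d : ℂ) • B ((d : ℤ) - 1 - (m - 1)) (𝒲.W d (u ⊗ₜ v)) := by
    intro d
    have h1 := LinearMap.congr_fun (h𝒲.W_T_right d) (u ⊗ₜ v)
    simp only [Module.End.mul_apply, LinearMap.add_apply, LinearMap.smul_apply,
      TensorProduct.map_tmul, LinearMap.id_apply] at h1
    rw [h1, hB1, hB2, one_mul]
    congr 3
    push_cast; ring
  have e0 : B (((0 : ℕ) : ℤ) - 1 - m) (𝒲.W 0 (u ⊗ₜ 𝒲.T v)) = B (((0 : ℕ) : ℤ) - 1 - m)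
      (TensorProduct.map LinearMap.id 𝒲.T (𝒲.W 0 (u ⊗ₜ v))) := by
    simp
  rw [Finset.sum_range_succ' (fun d : ℕ => B (d - 1 - m) (𝒲.W d (u ⊗ₜ 𝒲.T v))), e0,
    Finset.sum_congr rfl fun d _ => e1 d, map_sum, Finset.sum_congr rfl fun d _ => hBT _ _,
    Finset.sum_add_distrib, Finset.sum_add_distrib,
    Finset.sum_range_succ' (fun d : ℕ => B (d - 1 - m)
      (TensorProduct.map LinearMap.id 𝒲.T (𝒲.W d (u ⊗ₜ v)))), Finset.sum_range_succ,
    (hK K le_rfl).1, hB0, smul_zero, add_zero]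
  have e3 : ∑ d ∈ Finset.range K, ((((d : ℤ) - 1 - m : ℤ) : ℂ) + 1) •
        B ((d : ℤ) - 1 - m + 1) (𝒲.W d (u ⊗ₜ v)) =
      (-m : ℂ) • ∑ d ∈ Finset.range K, B (d - 1 - (m - 1)) (𝒲.W d (u ⊗ₜ v)) +
      ∑ d ∈ Finset.range K, (d : ℂ) • B ((d : ℤ) - 1 - (m - 1)) (𝒲.W d (u ⊗ₜ v)) := by
    rw [Finset.smul_sum, ← Finset.sum_add_distrib]
    refine Finset.sum_congr rfl fun d _ => ?_
    rw [← add_smul, show (d : ℤ) - 1 - m + 1 = d - 1 - (m - 1) by ring]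
    congr 1
    push_cast; ring
  rw [e3]
  abel

lemma IsTranslationCovariant.mode_T_left_add (m : ℤ) (u v : V) :
    𝒲.T (𝒲.mode m u v) = 𝒲.mode m (𝒲.T u) v + 𝒲.mode m u (𝒲.T v) := by
  rw [h𝒲.T_mode, h𝒲.mode_T_left]

/-- Skew-symmetry of the vertex operators. -/
lemma IsTranslationCovariant.mode_skew (m : ℤ) (u v : V) : ∃ J₀ : ℕ, ∀ J, J₀ ≤ J →
    𝒲.mode m u v = ∑ j ∈ Finset.range J,
      (-(-1 : ℂ) ^ (m + j)) • divPow 𝒲.T j (𝒲.mode (m + j) v u) := by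
  obtain ⟨K₁, h₁⟩ := h𝒲.exists_W_eq_zero (u ⊗ₜ v)
  obtain ⟨K₂, h₂⟩ := h𝒲.exists_W_eq_zero (v ⊗ₜ u)
  refine ⟨K₁ + K₂ + (-m).toNat, fun J hJ => ?_⟩
  have hsw : ∀ d, 𝒲.W d (u ⊗ₜ v) = (-1 : ℂ) ^ d • TensorProduct.comm ℂ V V (𝒲.W d (v ⊗ₜ u)) :=
    fun d => by rw [← h𝒲.W_comm, TensorProduct.comm_tmul]
  -- After the exchange of the factors the power of $T$ acts on the wrong one; it is transferred at
  -- the price of an overall $e^{zT}$, whose expansion is the sum over `j`.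
  have key : ∀ (b : ℤ), b < J → ∀ s : V ⊗[ℂ] V, LinearMap.mul' ℂ V
      (TensorProduct.map (divPow 𝒲.T b) LinearMap.id (TensorProduct.comm ℂ V V s)) =
      ∑ j ∈ Finset.range J, (-1 : ℂ) ^ (b - j) • divPow 𝒲.T j (LinearMap.mul' ℂ V
        (TensorProduct.map (divPow 𝒲.T (b - j)) LinearMap.id s)) := by
    intro b hb s
    induction s with
    | zero => simp
    | add s t hs ht =>
      simp only [map_add, smul_add, hs, ht, Finset.sum_add_distrib]
    | tmul x y =>
      simp only [TensorProduct.comm_tmul, TensorProduct.map_tmul, LinearMap.id_apply,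
        LinearMap.mul'_apply]
      rcases lt_or_ge b 0 with hb0 | hb0
      · rw [divPow_of_neg _ hb0, Finset.sum_eq_zero]
        · simp
        · intro j _
          rw [divPow_of_neg _ (show b - j < 0 by omega)]
          simp
      lift b to ℕ using hb0
      rw [mul_comm, ← sum_divPow_T_mul, Finset.Nat.sum_antidiagonal_eq_sum_range_succ
        (fun i j => (-1 : ℂ) ^ j • divPow 𝒲.T (i : ℤ) (divPow 𝒲.T (j : ℤ) x * y))]
      refine Finset.sum_subset_zero_on_sdiff (Finset.range_subset_range.2 (by omega)) ?_ ?_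
      · intro i hi
        simp only [Finset.mem_sdiff, Finset.mem_range] at hi
        rw [divPow_of_neg _ (show (b : ℤ) - i < 0 by omega)]
        simp
      · intro i hi
        rw [Finset.mem_range] at hi
        rw [show (b : ℤ) - i = ((b - i : ℕ) : ℤ) by omega, zpow_natCast]
  rw [mode, Y_eq_sum (K := K₁ + K₂) (fun d hd => h₁ d (by omega))]
  have e1 : ∀ d ∈ Finset.range (K₁ + K₂), LinearMap.mul' ℂ V
      (TensorProduct.map (divPow 𝒲.T (d - 1 - m)) LinearMap.id (𝒲.W d (u ⊗ₜ v))) =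
      ∑ j ∈ Finset.range J, (-(-1 : ℂ) ^ (m + j)) • divPow 𝒲.T j (LinearMap.mul' ℂ V
        (TensorProduct.map (divPow 𝒲.T (d - 1 - (m + j))) LinearMap.id (𝒲.W d (v ⊗ₜ u)))) := by
    intro d hd
    rw [Finset.mem_range] at hd
    rw [hsw, map_smul, map_smul, key _ (by omega), Finset.smul_sum]
    refine Finset.sum_congr rfl fun j _ => ?_
    rw [smul_smul, show (d : ℤ) - 1 - m - j = d - 1 - (m + j) by ring]
    congr 1
    have h1 : (-1 : ℂ) ≠ 0 := by norm_num
    rw [← zpow_natCast, ← zpow_add₀ h1, show (d : ℤ) + (d - 1 - (m + j)) =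
      -(m + j) + 2 * (d - (1 : ℤ)) + 1 by ring, zpow_add₀ h1, zpow_add₀ h1, zpow_mul, zpow_neg,
      ← inv_zpow]
    norm_num
  rw [Finset.sum_congr rfl e1, Finset.sum_comm]
  refine Finset.sum_congr rfl fun j _ => ?_
  rw [mode, Y_eq_sum (K := K₁ + K₂) (fun d hd => h₂ d (by omega)), map_sum, Finset.smul_sum]

/-- The Borcherds identity at `p = 0`, where `Ring.choose 0 i` leaves a single term on the right. -/
lemma IsTranslationCovariant.mode_commutator (m k : ℤ) (u v x : V) : ∃ I₀ : ℕ, ∀ I, I₀ ≤ I →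
    𝒲.mode m u (𝒲.mode k v x) - 𝒲.mode k v (𝒲.mode m u x) =
      ∑ i ∈ Finset.range I, ((Ring.choose m i : ℤ) : ℂ) • 𝒲.mode (m + k - i) (𝒲.mode i u v) x := by
  obtain ⟨I₀, h⟩ := h𝒲.borcherds u v x m k 0
  refine ⟨I₀ + 1, fun I hI => ?_⟩
  have := h I (by omega)
  simp only [zero_add] at this
  rw [this, Finset.sum_eq_single 0]
  · simp
  · intro i _ hi
    obtain ⟨j, rfl⟩ : ∃ j, i = j + 1 := ⟨i - 1, by omega⟩
    simp [Ring.choose_zero_succ]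
  · intro h0
    simp at h0
    omega

/-- The Borcherds identity at `m = 0`, where a single term is left on the left. It has the same form
as the recursion that defines `virField`. -/
lemma IsTranslationCovariant.mode_iterate (p N : ℤ) (u v x : V) : ∃ I₀ : ℕ, ∀ I, I₀ ≤ I →
    𝒲.mode N (𝒲.mode p u v) x =
    ∑ i ∈ Finset.range I, ((-1 : ℂ) ^ i * (Ring.choose p i : ℤ)) •
      (𝒲.mode (p - i) u (𝒲.mode (N + i) v x) -
        (-1 : ℂ) ^ p • 𝒲.mode (p + N - i) v (𝒲.mode i u x)) := by
  obtain ⟨I₀, h⟩ := h𝒲.borcherds u v x 0 N p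
  refine ⟨I₀ + 1, fun I hI => ?_⟩
  have := h I (by omega)
  simp only [zero_add] at this
  rw [add_comm p N, ← this, Finset.sum_eq_single 0]
  · simp
  · intro i _ hi
    obtain ⟨j, rfl⟩ : ∃ j, i = j + 1 := ⟨i - 1, by omega⟩
    simp [Ring.choose_zero_succ]
  · intro h0
    simp at h0
    omega

/-- The zero modes are derivations of all the products. -/
lemma IsTranslationCovariant.mode_zero_mode (k : ℤ) (u v x : V) :
    𝒲.mode 0 u (𝒲.mode k v x) = 𝒲.mode k (𝒲.mode 0 u v) x + 𝒲.mode k v (𝒲.mode 0 u x) := by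
  obtain ⟨I₀, h⟩ := h𝒲.mode_commutator 0 k u v x
  have := h (I₀ + 1) (by omega)
  rw [Finset.sum_eq_single 0] at this
  · rw [sub_eq_iff_eq_add] at this
    rw [this]
    simp
  · intro i _ hi
    obtain ⟨j, rfl⟩ : ∃ j, i = j + 1 := ⟨i - 1, by omega⟩
    simp [Ring.choose_zero_succ]
  · intro h0
    simp at h0

end

end WickData

/-! ### The vacuum module of the Virasoro algebra -/

section Virasoro
variable {c : ℂ}

lemma vL_mul_vL (m k : ℤ) : vL c m * vL c k = vL c k * vL c m +
    (((m : ℂ) - k) • vL c (m + k) +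
      algebraMap ℂ _ (if m + k = 0 then c * ((m : ℂ) ^ 3 - m) / 12 else 0)) := by
  have := RingQuot.mkAlgHom_rel ℂ (VirRel.comm (c := c) m k)
  simp only [map_sub, map_mul, map_add, map_smul, AlgHom.commutes] at this
  rw [← sub_eq_iff_eq_add']
  exact this

lemma virWord_nil : virWord c [] = virVac c := by simp [virWord]

lemma virWord_cons (m : ℤ) (w : List ℤ) : virWord c (m :: w) = vL c m • virWord c w := by
  simp [virWord, mul_smul]

lemma vL_smul_virVac {m : ℤ} (h : -1 ≤ m) : vL c m • virVac c = 0 := by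
  rw [virVac, ← Submodule.Quotient.mk_smul, smul_eq_mul, mul_one, Submodule.Quotient.mk_eq_zero]
  exact Submodule.subset_span ⟨m, h, rfl⟩

/-- To prove a property of all vectors of the vacuum module it suffices to prove it for words. -/
lemma vir_induction {p : Vir c → Prop} (hword : ∀ w, p (virWord c w)) (hzero : p 0)
    (hadd : ∀ x y, p x → p y → p (x + y)) (hsmul : ∀ (z : ℂ) x, p x → p (z • x)) (x : Vir c) :
    p x := by
  obtain ⟨f, rfl⟩ := virState_surjective c x
  induction f using Finsupp.induction_linear with
  | zero => simpa using hzero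
  | add f g hf hg => rw [map_add]; exact hadd _ _ hf hg
  | single w z =>
    rw [virState, Finsupp.linearCombination_single]
    exact hsmul _ _ (hword w)

lemma smul_smul_vir_comm (z : ℂ) (u : VirU c) (x : Vir c) : u • z • x = z • u • x := by
  obtain ⟨y, rfl⟩ := Submodule.Quotient.mk_surjective _ x
  rw [← Submodule.Quotient.mk_smul, ← Submodule.Quotient.mk_smul, ← Submodule.Quotient.mk_smul,
    ← Submodule.Quotient.mk_smul, smul_comm]

lemma smul_assoc_vir (z : ℂ) (u : VirU c) (x : Vir c) : (z • u) • x = z • u • x := by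
  obtain ⟨y, rfl⟩ := Submodule.Quotient.mk_surjective _ x
  rw [← Submodule.Quotient.mk_smul, ← Submodule.Quotient.mk_smul,
    ← Submodule.Quotient.mk_smul, smul_assoc]

@[simp] lemma smul_zero_vir (z : ℂ) : z • (0 : Vir c) = 0 := smul_zero (M := ℂ) (A := Vir c) z

/-- An $L_j$ with large $j$ passes through a letter $L_m$ at the price of $L_{j+m}$ only, since the
central term needs $j+m=0$; both then annihilate the shorter word. -/
lemma exists_vL_smul_eq_zero (x : Vir c) : ∃ K : ℤ, ∀ j, K ≤ j → vL c j • x = 0 := by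
  induction x using vir_induction with
  | hword w =>
    induction w with
    | nil => exact ⟨-1, fun j hj => by rw [virWord_nil, vL_smul_virVac hj]⟩
    | cons m w ih =>
      obtain ⟨K, hK⟩ := ih
      refine ⟨max K (max (K - m) (1 - m)), fun j hj => ?_⟩
      simp only [max_le_iff] at hj
      rw [virWord_cons, ← mul_smul, vL_mul_vL, add_smul, add_smul, mul_smul, hK j hj.1, smul_zero,
        smul_assoc_vir, hK (j + m) (by omega), smul_zero_vir, if_neg (by omega), map_zero, zero_smul,
        add_zero, add_zero]
  | hzero => exact ⟨0, fun j _ => smul_zero _⟩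
  | hadd x y hx hy =>
    obtain ⟨K, hK⟩ := hx
    obtain ⟨L, hL⟩ := hy
    exact ⟨max K L, fun j hj => by
      rw [smul_add, hK j (by omega), hL j (by omega), add_zero]⟩
  | hsmul z x hx =>
    obtain ⟨K, hK⟩ := hx
    exact ⟨K, fun j hj => by rw [smul_smul_vir_comm, hK j hj, smul_zero_vir]⟩

lemma virField_zero_right (w : List ℤ) : ∀ N, virField c w N 0 = 0 := by
  induction w with
  | nil => intro N; simp [virField]
  | cons m w ih => intro N; simp [virField, ih]

lemma exists_virField_eq_zero (w : List ℤ) : ∀ x : Vir c,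
    ∃ K : ℤ, ∀ N, K ≤ N → virField c w N x = 0 := by
  induction w with
  | nil => exact fun x => ⟨0, fun N hN => by rw [virField, if_neg (by omega)]⟩
  | cons m w ih =>
    intro x
    obtain ⟨K₁, h₁⟩ := exists_vL_smul_eq_zero x
    choose K hK using ih
    -- Only finitely many of the vectors $L_{j-1}x$ are nonzero, so the bounds that the induction
    -- gives for them have a common bound.
    obtain ⟨L, hL⟩ : ∃ L : ℤ, ∀ j ∈ Finset.range (K₁ + 1).toNat,
        K (vL c ((j : ℤ) - 1) • x) + j - m - 1 ≤ L := by
      obtain ⟨L, hL⟩ := (Finset.image (fun j : ℕ => K (vL c ((j : ℤ) - 1) • x) + j - m - 1)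
        (Finset.range (K₁ + 1).toNat)).bddAbove
      exact ⟨L, fun j hj => hL (Finset.mem_coe.2 (Finset.mem_image_of_mem _ hj))⟩
    refine ⟨max (K x) L, fun N hN => ?_⟩
    rw [virField]
    convert finsum_zero with j
    rw [hK x _ (by omega), smul_zero, zero_sub]
    by_cases hj : j < (K₁ + 1).toNat
    · have := hL j (Finset.mem_range.2 hj)
      rw [hK (vL c ((j : ℤ) - 1) • x) _ (by omega)]
      simp
    · rw [h₁ _ (by omega), virField_zero_right]
      simp

/-- The sum in the recursion is finite and may be cut off at any large `J`. The freedom in `J` is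
needed to match it with the equally truncated `mode_iterate`. -/
lemma exists_virField_cons (m : ℤ) (w : List ℤ) (N : ℤ) (x : Vir c) : ∃ J₀ : ℕ, ∀ J, J₀ ≤ J →
    virField c (m :: w) N x = ∑ j ∈ Finset.range J,
      ((-1 : ℂ) ^ j * (Ring.choose (m + 1) j : ℤ)) •
      (vL c (m - j) • virField c w (N + j) x -
        (-1 : ℂ) ^ (m + 1) • virField c w (m + 1 + N - j) (vL c ((j : ℤ) - 1) • x)) := by
  obtain ⟨K₁, h₁⟩ := exists_vL_smul_eq_zero x
  obtain ⟨K, hK⟩ := exists_virField_eq_zero w x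
  refine ⟨(K₁ + 1).toNat + (K - N).toNat, fun J hJ => ?_⟩
  rw [virField]
  refine finsum_eq_sum_of_support_subset _ fun j hj => ?_
  by_contra hj'
  rw [Finset.coe_range, Set.mem_Iio, not_lt] at hj'
  refine hj ?_
  simp only
  rw [h₁ _ (by omega), hK _ (by omega), virField_zero_right]
  simp

end Virasoro

lemma ringChoose_three (z : ℤ) :
    ((Ring.choose z 3 : ℤ) : ℂ) = (z : ℂ) * (z - 1) * (z - 2) / 6 := by
  have h := Ring.descPochhammer_eq_factorial_smul_choose z 3
  simp only [descPochhammer_succ_right, descPochhammer_zero, Polynomial.smeval_mul,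
    Polynomial.smeval_sub, Polynomial.smeval_X, Polynomial.smeval_one, Polynomial.smeval_natCast]
    at h
  simp at h
  have h2 : ((z : ℂ) * (z - 1) * (z - 2)) = (Nat.factorial 3 : ℂ) * ((Ring.choose z 3 : ℤ) : ℂ) := by
    exact_mod_cast h
  rw [h2]
  norm_num [Nat.factorial]

/-! ### Conformal vectors and homomorphisms from the Virasoro vertex algebra -/

namespace WickData

variable {V : Type*} [CommRing V] [Algebra ℂ V] {𝒲 : WickData V}

/-- The operator products of `ν` with itself are those of a conformal vector of central
charge `c`. -/
structure IsVirasoro (𝒲 : WickData V) (c : ℂ) (ν : V) : Prop where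
  mode_zero : 𝒲.mode 0 ν ν = 𝒲.T ν
  mode_one : 𝒲.mode 1 ν ν = (2 : ℂ) • ν
  mode_two : 𝒲.mode 2 ν ν = 0
  mode_three : 𝒲.mode 3 ν ν = (c / 2) • 1
  mode_of_ge : ∀ i : ℕ, 4 ≤ i → 𝒲.mode i ν ν = 0

lemma IsTranslationCovariant.mode_one_right (h𝒲 : 𝒲.IsTranslationCovariant) {m : ℤ} (hm : 0 ≤ m)
    (u : V) : 𝒲.mode m u 1 = 0 := by
  obtain ⟨J₀, h⟩ := h𝒲.mode_skew m u 1
  rw [h J₀ le_rfl]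
  refine Finset.sum_eq_zero fun j _ => ?_
  rw [h𝒲.mode_one_left, if_neg (by omega), map_zero, smul_zero]

variable (h𝒲 : 𝒲.IsTranslationCovariant) {c : ℂ} {ν : V} (hν : 𝒲.IsVirasoro c ν)
include h𝒲 hν

/-- Only four terms of the commutator formula survive. The terms $i=0,1$ contribute
$-(m+k+2)+2(m+1)=m-k$, the term $i=2$ is zero, and $i=3$ is the central term $\binom{m+1}{3}\frac
c2=\frac{c(m^3-m)}{12}$, present only where the vacuum has its mode $-1$. -/
lemma IsVirasoro.commutator (m k : ℤ) (x : V) :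
    𝒲.mode (m + 1) ν (𝒲.mode (k + 1) ν x) - 𝒲.mode (k + 1) ν (𝒲.mode (m + 1) ν x) =
      ((m : ℂ) - k) • 𝒲.mode (m + k + 1) ν x +
        (if m + k = 0 then c * ((m : ℂ) ^ 3 - m) / 12 else 0) • x := by
  obtain ⟨I₀, h⟩ := h𝒲.mode_commutator (m + 1) (k + 1) ν ν x
  rw [h (I₀ + 4) (by omega), add_comm I₀, Finset.sum_range_add, Finset.sum_eq_zero (s := Finset.range I₀),
    add_zero]
  swap
  · intro i _
    rw [hν.mode_of_ge (4 + i) (by omega), h𝒲.mode_zero_left, smul_zero]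
  simp only [Finset.sum_range_succ, Finset.sum_range_zero, zero_add, Nat.cast_zero, Nat.cast_one,
    Nat.cast_ofNat, hν.mode_zero, hν.mode_one, hν.mode_two, hν.mode_three, h𝒲.mode_zero_left,
    h𝒲.mode_T_left, h𝒲.mode_smul_left, h𝒲.mode_one_left, ringChoose_three, Ring.choose_zero_right,
    Ring.choose_one_right, smul_zero, add_zero, smul_smul]
  rw [show m + 1 + (k + 1) - 0 - 1 = m + k + 1 by ring, show m + 1 + (k + 1) - 1 = m + k + 1 by ring,
    ← add_smul]
  congr 1
  · congr 1; push_cast; ring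
  · by_cases hmk : m + k = 0
    · rw [if_pos hmk, if_pos (by omega)]
      congr 1; push_cast; ring
    · rw [if_neg hmk, if_neg (by omega)]
      simp

/-- The representation of the Virasoro algebra defined by a conformal vector. -/
def IsVirasoro.rep : VirU c →ₐ[ℂ] Module.End ℂ V :=
  RingQuot.liftAlgHom ℂ ⟨FreeAlgebra.lift ℂ fun m => h𝒲.modeLin (m + 1) ν, fun x y hxy => by
    obtain ⟨m, k⟩ := hxy
    ext v
    have := hν.commutator h𝒲 m k v
    simp only [map_sub, map_mul, map_add, map_smul, AlgHom.commutes, FreeAlgebra.lift_ι_apply,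
      LinearMap.sub_apply, LinearMap.add_apply, LinearMap.smul_apply, Module.End.mul_apply,
      h𝒲.modeLin_apply, Module.algebraMap_end_apply, this]⟩

lemma IsVirasoro.rep_vL (m : ℤ) (v : V) : hν.rep h𝒲 (vL c m) v = 𝒲.mode (m + 1) ν v := by
  simp [rep, vL, h𝒲.modeLin_apply]

/-- The homomorphism from the Virasoro vertex algebra defined by a conformal vector. -/
def IsVirasoro.hom : Vir c →ₗ[ℂ] V :=
  Submodule.liftQ ((virIdeal c).restrictScalars ℂ)
    ((LinearMap.applyₗ (1 : V)) ∘ₗ (hν.rep h𝒲).toLinearMap) (by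
      intro u hu
      rw [Submodule.restrictScalars_mem, virIdeal] at hu
      simp only [LinearMap.mem_ker, LinearMap.comp_apply, AlgHom.toLinearMap_apply,
        LinearMap.applyₗ_apply_apply]
      induction hu using Submodule.span_induction with
      | mem x hx =>
        obtain ⟨m, hm, rfl⟩ := hx
        -- For $m\ge-1$ the operator $L_m$ is the mode $\nu_{(m+1)}$ with a non-negative index, and
        -- such modes annihilate the vacuum.
        rw [hν.rep_vL, h𝒲.mode_one_right (by simp at hm; omega)]
      | zero => simp
      | add x y _ _ hx hy => rw [map_add, LinearMap.add_apply, hx, hy, add_zero]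
      | smul a x _ hx =>
        rw [smul_eq_mul, map_mul (hν.rep h𝒲), Module.End.mul_apply, hx, map_zero]) ∘ₗ
  (Submodule.Quotient.restrictScalarsEquiv ℂ (virIdeal c)).symm.toLinearMap

lemma IsVirasoro.hom_mk (u : VirU c) :
    hν.hom h𝒲 (Submodule.Quotient.mk u) = hν.rep h𝒲 u 1 := rfl

lemma IsVirasoro.hom_smul (u : VirU c) (x : Vir c) :
    hν.hom h𝒲 (u • x) = hν.rep h𝒲 u (hν.hom h𝒲 x) := by
  obtain ⟨y, rfl⟩ := Submodule.Quotient.mk_surjective _ x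
  rw [← Submodule.Quotient.mk_smul, hν.hom_mk, hν.hom_mk, smul_eq_mul, map_mul,
    Module.End.mul_apply]

lemma IsVirasoro.hom_vL_smul (m : ℤ) (x : Vir c) :
    hν.hom h𝒲 (vL c m • x) = 𝒲.mode (m + 1) ν (hν.hom h𝒲 x) := by
  rw [hν.hom_smul, hν.rep_vL]

lemma IsVirasoro.hom_virVac : hν.hom h𝒲 (virVac c) = 1 := by
  rw [virVac, hν.hom_mk, map_one (hν.rep h𝒲), Module.End.one_apply]

lemma IsVirasoro.hom_virWord_cons (m : ℤ) (w : List ℤ) : hν.hom h𝒲 (virWord c (m :: w)) =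
    𝒲.mode (m + 1) ν (hν.hom h𝒲 (virWord c w)) := by
  rw [virWord_cons, hν.hom_vL_smul]

/-- Both $\nu_{(0)}$ and $T$ are derivations of all products, and they agree on the vacuum and on
$\nu$. They therefore agree on everything that the modes of $\nu$ generate from the vacuum. -/
lemma IsVirasoro.hom_T (x : Vir c) : hν.hom h𝒲 (vL c (-1) • x) = 𝒲.T (hν.hom h𝒲 x) := by
  rw [hν.hom_vL_smul]
  induction x using vir_induction with
  | hword w =>
    induction w with
    | nil => rw [virWord_nil, hν.hom_virVac, h𝒲.mode_one_right (by norm_num), T_one]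
    | cons m w ih =>
      rw [hν.hom_virWord_cons, show (-1 + 1 : ℤ) = 0 by norm_num] at *
      rw [h𝒲.mode_zero_mode, ih, hν.mode_zero, h𝒲.mode_T_left_add]
  | hzero => simp [h𝒲.mode_zero_right]
  | hadd x y hx hy => rw [map_add, h𝒲.mode_add_right, hx, hy, map_add]
  | hsmul z x hx => rw [map_smul, h𝒲.mode_smul_right, hx, map_smul]

/-- The recursion for `virField` and the iterate formula for $(\nu_{(m+1)}v)_{(N)}$ are the same
expression, so induction on the word suffices. -/
lemma IsVirasoro.hom_virField (w : List ℤ) : ∀ N x, hν.hom h𝒲 (virField c w N x) =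
    𝒲.mode N (hν.hom h𝒲 (virWord c w)) (hν.hom h𝒲 x) := by
  induction w with
  | nil =>
    intro N x
    rw [virWord_nil, hν.hom_virVac, h𝒲.mode_one_left, virField]
    split_ifs <;> simp
  | cons m w ih =>
    intro N x
    obtain ⟨J₀, hJ⟩ := exists_virField_cons m w N x
    obtain ⟨I₀, hI⟩ := h𝒲.mode_iterate (m + 1) N ν (hν.hom h𝒲 (virWord c w)) (hν.hom h𝒲 x)
    rw [hν.hom_virWord_cons, hI (I₀ + J₀) (by omega), hJ (I₀ + J₀) (by omega), map_sum]
    refine Finset.sum_congr rfl fun j _ => ?_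
    rw [LinearMap.map_smul_of_tower, map_sub,
      LinearMap.map_smul_of_tower _ ((-1 : ℂ) ^ (m + 1)), hν.hom_vL_smul, ih, ih, hν.hom_vL_smul, sub_add_cancel,
      show m - (j : ℤ) + 1 = m + 1 - j by ring]

/-- The formula for words extends linearly to every presentation of `v` by words. The arbitrary
presentation chosen in `virModes` is therefore harmless after application of the homomorphism. -/
lemma IsVirasoro.hom_virModes (N : ℤ) (v x : Vir c) : hν.hom h𝒲 (virModes c N v x) =
    𝒲.mode N (hν.hom h𝒲 v) (hν.hom h𝒲 x) := by
  have key : ∀ f : List ℤ →₀ ℂ, hν.hom h𝒲 (f.sum fun w z => z • virField c w N x) =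
      𝒲.mode N (hν.hom h𝒲 (virState c f)) (hν.hom h𝒲 x) := by
    intro f
    rw [virState, Finsupp.linearCombination_apply, Finsupp.sum, Finsupp.sum, map_sum, map_sum,
      ← h𝒲.modeLin_apply, map_sum, LinearMap.sum_apply]
    refine Finset.sum_congr rfl fun w _ => ?_
    rw [map_smul, hν.hom_virField, map_smul, map_smul, LinearMap.smul_apply, h𝒲.modeLin_apply]
  rw [virModes, key, Function.surjInv_eq (virState_surjective c)]

lemma IsVirasoro.hom_mem_of_mem_virDim (G : ℤ → Submodule ℂ V) (h1 : 1 ∈ G 0)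
    (hG : ∀ m k v, v ∈ G k → 𝒲.mode m ν v ∈ G (k + 1 - m)) {N : ℕ} {x : Vir c}
    (hx : x ∈ virDim c N) : hν.hom h𝒲 x ∈ G N := by
  have key : ∀ w : List ℤ, hν.hom h𝒲 (virWord c w) ∈ G (-w.sum) := by
    intro w
    induction w with
    | nil => simpa [virWord_nil, hν.hom_virVac] using h1
    | cons m w ih =>
      rw [hν.hom_virWord_cons, List.sum_cons]
      convert hG (m + 1) _ _ ih using 2
      ring
  induction hx using Submodule.span_induction with
  | mem x hx =>
    obtain ⟨w, hw, rfl⟩ := hx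
    have := key w
    rwa [hw, neg_neg] at this
  | zero => simp
  | add x y _ _ hx hy => rw [map_add]; exact Submodule.add_mem _ hx hy
  | smul z x _ hx => rw [map_smul]; exact Submodule.smul_mem _ _ hx

end WickData

/-! ### Derivations of the state space -/

variable {n : ℕ}

lemma pd_mul (i : Fin n) (f g : Ohat n) : pd i (f * g) = pd i f * g + f * pd i g := by
  have := (MvPowerSeries.pderiv ℂ i).leibniz f g
  change MvPowerSeries.pderiv ℂ i (f * g) = _
  rw [this, smul_eq_mul, smul_eq_mul, add_comm, mul_comm g]
  rfl

lemma coeff_pd (i : Fin n) (f : Ohat n) (m : Fin n →₀ ℕ) : MvPowerSeries.coeff m (pd i f) =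
    MvPowerSeries.coeff (m + Finsupp.single i 1) f * (m i + 1) :=
  MvPowerSeries.coeff_pderiv f m

lemma pd_comm (i j : Fin n) (f : Ohat n) : pd i (pd j f) = pd j (pd i f) := by
  ext m
  rw [coeff_pd, coeff_pd, coeff_pd, coeff_pd, add_right_comm]
  rcases eq_or_ne i j with rfl | h
  · rfl
  · simp [h, h.symm]
    ring

@[simp] lemma pd_C (i : Fin n) (z : ℂ) : pd i (MvPowerSeries.C z) = 0 := MvPowerSeries.pderiv_C

lemma pd_X (i j : Fin n) : pd i (MvPowerSeries.X j : Ohat n) = if i = j then 1 else 0 := by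
  classical
  change MvPowerSeries.pderiv ℂ i _ = _
  rw [MvPowerSeries.pderiv_X, Pi.single_apply]
  simp only [eq_comm]

lemma coeff_dc0 (i : Fin n) (v : CDOhat n) (d : Var n →₀ ℕ) :
    MvPolynomial.coeff d (dc0 i v) = pd i (MvPolynomial.coeff d v) := by
  classical
  simp only [dc0, LinearMap.coe_mk, AddHom.coe_mk, MvPolynomial.coeff_sum,
    MvPolynomial.coeff_monomial, Finset.sum_ite_eq', MvPolynomial.mem_support_iff]
  split_ifs with h
  · rfl
  · rw [not_not] at h
    rw [h, map_zero]

lemma dc0_monomial (i : Fin n) (d : Var n →₀ ℕ) (f : Ohat n) :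
    dc0 i (MvPolynomial.monomial d f) = MvPolynomial.monomial d (pd i f) := by
  classical
  ext1 e
  rw [coeff_dc0, MvPolynomial.coeff_monomial, MvPolynomial.coeff_monomial]
  split_ifs <;> simp

lemma dc0_mul (i : Fin n) (v w : CDOhat n) : dc0 i (v * w) = dc0 i v * w + v * dc0 i w := by
  induction v using MvPolynomial.induction_on' with
  | add p q hp hq => rw [add_mul, map_add, map_add, hp, hq]; ring
  | monomial d f =>
    induction w using MvPolynomial.induction_on' with
    | add p q hp hq => rw [mul_add, map_add, map_add, hp, hq]; ring
    | monomial e g =>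
      rw [MvPolynomial.monomial_mul, dc0_monomial, dc0_monomial, dc0_monomial, pd_mul, map_add,
        MvPolynomial.monomial_mul, MvPolynomial.monomial_mul]

lemma db_mul (i : Fin n) (k : ℕ) (v w : CDOhat n) : db i k (v * w) = db i k v * w + v * db i k w := by
  have := (MvPolynomial.pderiv (R := Ohat n) (Sum.inl (i, k))).leibniz v w
  simp only [smul_eq_mul] at this
  change MvPolynomial.pderiv (R := Ohat n) (Sum.inl (i, k)) (v * w) = _
  rw [this, mul_comm w, add_comm]
  rfl

lemma dc_mul (i : Fin n) (m : ℕ) (v w : CDOhat n) : dc i m (v * w) = dc i m v * w + v * dc i m w := by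
  cases m with
  | zero => exact dc0_mul i v w
  | succ m =>
    have := (MvPolynomial.pderiv (R := Ohat n) (Sum.inr (i, m))).leibniz v w
    simp only [smul_eq_mul] at this
    change MvPolynomial.pderiv (R := Ohat n) (Sum.inr (i, m)) (v * w) = _
    rw [this, mul_comm w, add_comm]
    rfl

/-- A linear map on the state space that satisfies the Leibniz rule. -/
def IsDeriv (D : Module.End ℂ (CDOhat n)) : Prop := ∀ v w, D (v * w) = D v * w + v * D w

lemma isDeriv_db (i : Fin n) (k : ℕ) : IsDeriv (db i k) := db_mul i k
lemma isDeriv_dc (i : Fin n) (k : ℕ) : IsDeriv (dc i k) := dc_mul i k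

lemma IsDeriv.add {D E : Module.End ℂ (CDOhat n)} (hD : IsDeriv D) (hE : IsDeriv E) :
    IsDeriv (D + E) := fun v w => by
  simp only [LinearMap.add_apply, hD v w, hE v w]
  ring

lemma IsDeriv.zero : IsDeriv (0 : Module.End ℂ (CDOhat n)) := fun v w => by simp

lemma IsDeriv.smul {D : Module.End ℂ (CDOhat n)} (hD : IsDeriv D) (z : ℂ) : IsDeriv (z • D) :=
  fun v w => by simp [hD v w]

lemma IsDeriv.sum {ι : Type*} (s : Finset ι) {D : ι → Module.End ℂ (CDOhat n)}
    (hD : ∀ i ∈ s, IsDeriv (D i)) : IsDeriv (∑ i ∈ s, D i) := by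
  classical
  induction s using Finset.induction_on with
  | empty => simpa using IsDeriv.zero
  | insert i s hi ih =>
    rw [Finset.sum_insert hi]
    exact (hD i (Finset.mem_insert_self i s)).add
      (ih fun j hj => hD j (Finset.mem_insert_of_mem hj))

lemma IsDeriv.mulLeft {D : Module.End ℂ (CDOhat n)} (hD : IsDeriv D) (a : CDOhat n) :
    IsDeriv (LinearMap.mulLeft ℂ a ∘ₗ D) := fun v w => by
  simp only [LinearMap.comp_apply, LinearMap.mulLeft_apply, hD v w]
  ring

lemma isDeriv_transl : IsDeriv (transl n) := by
  refine IsDeriv.add (IsDeriv.sum _ fun i _ => IsDeriv.mulLeft (fun v w => dc0_mul i v w) _) ?_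
  intro v w
  simp only [LinearMap.coe_restrictScalars]
  refine (Derivation.leibniz _ v w).trans ?_
  rw [smul_eq_mul, smul_eq_mul, add_comm, mul_comm w]
  rfl

lemma IsDeriv.commutator {D E : Module.End ℂ (CDOhat n)} (hD : IsDeriv D) (hE : IsDeriv E) :
    IsDeriv (D * E - E * D) := fun v w => by
  simp only [LinearMap.sub_apply, Module.End.mul_apply, hD _ _, hE _ _, map_add]
  ring

lemma IsDeriv.ext {D E : Module.End ℂ (CDOhat n)} (hD : IsDeriv D) (hE : IsDeriv E)
    (hC : ∀ f, D (MvPolynomial.C f) = E (MvPolynomial.C f))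
    (hX : ∀ x, D (MvPolynomial.X x) = E (MvPolynomial.X x)) : D = E := by
  refine LinearMap.ext fun v => ?_
  induction v using MvPolynomial.induction_on with
  | C f => exact hC f
  | add p q hp hq => rw [map_add, map_add, hp, hq]
  | mul_X p i hp => rw [hD, hE, hp, hX]

section values
open MvPolynomial

@[simp] lemma db_C (i : Fin n) (k : ℕ) (f : Ohat n) : db i k (C f) = 0 :=
  MvPolynomial.pderiv_C

@[simp] lemma dc_zero_C (i : Fin n) (f : Ohat n) : dc i 0 (C f : CDOhat n) = C (pd i f) :=
  dc0_monomial i 0 f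

@[simp] lemma dc_succ_C (i : Fin n) (m : ℕ) (f : Ohat n) : dc i (m + 1) (C f : CDOhat n) = 0 :=
  MvPolynomial.pderiv_C

@[simp] lemma db_bVar (i j : Fin n) (k l : ℕ) :
    db i k (bVar j l) = if i = j ∧ k = l then 1 else 0 := by
  classical
  change MvPolynomial.pderiv (R := Ohat n) (Sum.inl (i, k)) (X (Sum.inl (j, l))) = _
  rw [MvPolynomial.pderiv_X, Pi.single_apply]
  simp [eq_comm]

@[simp] lemma db_cVar (i j : Fin n) (k l : ℕ) : db i k (cVar j l) = 0 := by
  classical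
  change MvPolynomial.pderiv (R := Ohat n) (Sum.inl (i, k)) (X (Sum.inr (j, l))) = _
  rw [MvPolynomial.pderiv_X, Pi.single_apply]
  simp

@[simp] lemma dc_zero_X (i : Fin n) (x : Var n) : dc i 0 (X x : CDOhat n) = 0 := by
  change dc0 i (monomial _ 1) = 0
  rw [dc0_monomial, ← map_one (MvPowerSeries.C (σ := Fin n) (R := ℂ)), pd_C, map_zero]

@[simp] lemma dc_bVar (i j : Fin n) (k l : ℕ) : dc i k (bVar j l) = 0 := by
  classical
  cases k with
  | zero => exact dc_zero_X _ _
  | succ k =>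
    change MvPolynomial.pderiv (R := Ohat n) (Sum.inr (i, k)) (X (Sum.inl (j, l))) = _
    rw [MvPolynomial.pderiv_X, Pi.single_apply]
    simp

@[simp] lemma dc_cVar (i j : Fin n) (k l : ℕ) :
    dc i k (cVar j l) = if i = j ∧ k = l + 1 then 1 else 0 := by
  classical
  cases k with
  | zero => rw [if_neg (by omega)]; exact dc_zero_X _ _
  | succ k =>
    change MvPolynomial.pderiv (R := Ohat n) (Sum.inr (i, k)) (X (Sum.inr (j, l))) = _
    rw [MvPolynomial.pderiv_X, Pi.single_apply]
    simp [eq_comm]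

lemma transl_C (f : Ohat n) : transl n (C f) = ∑ i, C (pd i f) * cVar i 0 := by
  simp only [transl, LinearMap.add_apply, LinearMap.sum_apply, LinearMap.comp_apply,
    LinearMap.mulLeft_apply]
  refine (congrArg₂ _ rfl (MvPolynomial.derivation_C _ f)).trans ?_
  rw [add_zero]
  exact Finset.sum_congr rfl fun i _ => by rw [mul_comm]; congr 1; exact dc_zero_C i f

@[simp] lemma transl_bVar (i : Fin n) (k : ℕ) :
    transl n (bVar i k) = ((k : ℂ) + 1) • bVar i (k + 1) := by
  have h : ∀ j, dc0 j (bVar i k) = 0 := fun j => dc_zero_X _ _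
  simp only [transl, LinearMap.add_apply, LinearMap.sum_apply, LinearMap.comp_apply,
    LinearMap.mulLeft_apply, h, mul_zero, Finset.sum_const_zero, zero_add]
  change MvPolynomial.mkDerivation (Ohat n) _ (X _) = _
  rw [MvPolynomial.mkDerivation_X, add_smul, one_smul, Nat.cast_smul_eq_nsmul, nsmul_eq_mul]
  ring

@[simp] lemma transl_cVar (i : Fin n) (k : ℕ) :
    transl n (cVar i k) = ((k : ℂ) + 2) • cVar i (k + 1) := by
  have h : ∀ j, dc0 j (cVar i k) = 0 := fun j => dc_zero_X _ _
  simp only [transl, LinearMap.add_apply, LinearMap.sum_apply, LinearMap.comp_apply,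
    LinearMap.mulLeft_apply, h, mul_zero, Finset.sum_const_zero, zero_add]
  change MvPolynomial.mkDerivation (Ohat n) _ (X _) = _
  rw [MvPolynomial.mkDerivation_X, add_smul, Nat.cast_smul_eq_nsmul, nsmul_eq_mul, two_smul]
  ring

end values

/-- To compare two derivations of the state space, compare their values on the generators. -/
lemma IsDeriv.ext_gen {D E : Module.End ℂ (CDOhat n)} (hD : IsDeriv D) (hE : IsDeriv E)
    (hC : ∀ f, D (MvPolynomial.C f) = E (MvPolynomial.C f))
    (hb : ∀ i k, D (bVar i k) = E (bVar i k)) (hc : ∀ i k, D (cVar i k) = E (cVar i k)) :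
    D = E := hD.ext hE hC (by rintro (⟨i, k⟩ | ⟨i, k⟩); exacts [hb i k, hc i k])

lemma IsDeriv.commute {D E : Module.End ℂ (CDOhat n)} (hD : IsDeriv D) (hE : IsDeriv E)
    (hC : ∀ f, D (E (MvPolynomial.C f)) = E (D (MvPolynomial.C f)))
    (hb : ∀ i k, D (E (bVar i k)) = E (D (bVar i k)))
    (hc : ∀ i k, D (E (cVar i k)) = E (D (cVar i k))) : Commute D E := by
  have : D * E - E * D = 0 := (hD.commutator hE).ext_gen .zero
    (fun f => by simp [hC]) (fun i k => by simp [hb]) (fun i k => by simp [hc])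
  exact sub_eq_zero.1 this

lemma IsDeriv.map_one {D : Module.End ℂ (CDOhat n)} (hD : IsDeriv D) : D 1 = 0 := by
  simpa using hD 1 1

@[simp] lemma db_one (i : Fin n) (k : ℕ) : db i k (1 : CDOhat n) = 0 := (isDeriv_db i k).map_one
@[simp] lemma dc_one (i : Fin n) (k : ℕ) : dc i k (1 : CDOhat n) = 0 := (isDeriv_dc i k).map_one

lemma commute_db_db (i j : Fin n) (k l : ℕ) : Commute (db i k) (db j l) :=
  (isDeriv_db i k).commute (isDeriv_db j l) (by simp)
    (fun _ _ => by simp only [db_bVar]; split_ifs <;> simp) (by simp)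

lemma commute_db_dc (i j : Fin n) (k l : ℕ) : Commute (db i k) (dc j l) :=
  (isDeriv_db i k).commute (isDeriv_dc j l) (by cases l <;> simp)
    (fun _ _ => by simp only [db_bVar, dc_bVar]; split_ifs <;> simp)
    (fun _ _ => by simp only [db_cVar, dc_cVar]; split_ifs <;> simp)

lemma commute_dc_dc (i j : Fin n) (k l : ℕ) : Commute (dc i k) (dc j l) :=
  (isDeriv_dc i k).commute (isDeriv_dc j l) (by cases l <;> cases k <;> simp [pd_comm i j])
    (by simp) (fun _ _ => by simp only [dc_cVar]; split_ifs <;> simp)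

lemma dc_transl_zero (i : Fin n) : dc i 0 * transl n = transl n * dc i 0 :=
  (isDeriv_dc i 0).commute isDeriv_transl
    (fun f => by simp [transl_C, dc_mul, pd_comm i]) (by simp) (by simp)

/-- $T$ produces $c_{-m-1}$ from $c_{-m}$ with the factor $m+1$. The case $m=0$, where $c_{-1}$
arises from the coefficients in $c_0$, fits the same pattern. -/
lemma dc_transl_succ (i : Fin n) (m : ℕ) : dc i (m + 1) * transl n =
    transl n * dc i (m + 1) + ((m : ℂ) + 1) • dc i m := by
  suffices h : dc i (m + 1) * transl n - transl n * dc i (m + 1) = ((m : ℂ) + 1) • dc i m from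
    LinearMap.ext fun v => sub_eq_iff_eq_add'.1 (LinearMap.congr_fun h v)
  refine ((isDeriv_dc i (m + 1)).commutator isDeriv_transl).ext_gen ((isDeriv_dc i m).smul _)
    (fun f => ?_) (by simp) fun j k => ?_
  · rcases m with _ | m
    · simp [transl_C, dc_mul]
    · simp [transl_C, dc_mul]
  · simp only [LinearMap.sub_apply, Module.End.mul_apply, transl_cVar, map_smul, dc_cVar,
      LinearMap.smul_apply]
    have : transl n (if i = j ∧ m + 1 = k + 1 then (1 : CDOhat n) else 0) = 0 := by
      split_ifs <;> simp [isDeriv_transl.map_one]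
    rw [this, sub_zero]
    by_cases h : i = j ∧ m = k + 1
    · obtain ⟨rfl, rfl⟩ := h
      simp; norm_num [add_assoc]
    · rw [if_neg h, if_neg (by omega)]
      simp

/-- For `k = 0` the index `k - 1` is again `0`, but its coefficient vanishes. -/
lemma db_transl (i : Fin n) (k : ℕ) : db i k * transl n =
    transl n * db i k + (k : ℂ) • db i (k - 1) := by
  suffices h : db i k * transl n - transl n * db i k = (k : ℂ) • db i (k - 1) from
    LinearMap.ext fun v => sub_eq_iff_eq_add'.1 (LinearMap.congr_fun h v)
  refine ((isDeriv_db i k).commutator isDeriv_transl).ext_gen ((isDeriv_db i (k - 1)).smul _)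
    (fun f => ?_) (fun j l => ?_) (by simp)
  · simp [transl_C, db_mul]
  · simp only [LinearMap.sub_apply, Module.End.mul_apply, transl_bVar, map_smul, db_bVar,
      LinearMap.smul_apply]
    have : transl n (if i = j ∧ k = l then (1 : CDOhat n) else 0) = 0 := by
      split_ifs <;> simp [isDeriv_transl.map_one]
    rw [this, sub_zero]
    by_cases h : i = j ∧ k = l + 1
    · obtain ⟨rfl, rfl⟩ := h
      simp
    · rcases k with _ | k
      · simp
      · rw [if_neg h, if_neg (by simpa using h)]
        simp

/-! ### The grading by the conformal dimension -/

variable {n : ℕ}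

variable (n) in
/-- The vectors of conformal dimension `k`, for an arbitrary integer `k`. -/
def dimSub (k : ℤ) : Submodule ℂ (CDOhat n) where
  carrier := {v | ∀ d, MvPolynomial.coeff d v ≠ 0 → (Finsupp.weight wt d : ℤ) = k}
  zero_mem' d h := absurd (MvPolynomial.coeff_zero d) h
  add_mem' {v w} hv hw d h := by
    by_cases h' : MvPolynomial.coeff d v = 0
    · rw [MvPolynomial.coeff_add, h', zero_add] at h
      exact hw d h
    · exact hv d h'
  smul_mem' z v hv d h := hv d fun h' => h (by rw [MvPolynomial.coeff_smul, h', smul_zero])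

lemma mem_dimSub {k : ℤ} {v : CDOhat n} : v ∈ dimSub n k ↔
    ∀ d, MvPolynomial.coeff d v ≠ 0 → (Finsupp.weight wt d : ℤ) = k := Iff.rfl

lemma hasDim_iff {N : ℕ} {v : CDOhat n} : HasDim N v ↔ v ∈ dimSub n N := by
  rw [mem_dimSub]
  exact ⟨fun h d hd => by exact_mod_cast h hd, fun h d hd => by exact_mod_cast h d hd⟩

lemma eq_zero_of_mem_dimSub {k : ℤ} (hk : k < 0) {v : CDOhat n} (hv : v ∈ dimSub n k) : v = 0 := by
  ext1 d
  rw [MvPolynomial.coeff_zero]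
  by_contra h
  have := hv d h
  omega

lemma monomial_mem_dimSub (d : Var n →₀ ℕ) (f : Ohat n) :
    MvPolynomial.monomial d f ∈ dimSub n (Finsupp.weight wt d : ℕ) := by
  classical
  intro e he
  rw [MvPolynomial.coeff_monomial] at he
  split_ifs at he with h
  · rw [h]
  · exact absurd rfl he

lemma one_mem_dimSub : (1 : CDOhat n) ∈ dimSub n 0 := by
  simpa using monomial_mem_dimSub (n := n) 0 1

lemma mul_mem_dimSub {k l : ℤ} {v w : CDOhat n} (hv : v ∈ dimSub n k) (hw : w ∈ dimSub n l) :
    v * w ∈ dimSub n (k + l) := by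
  classical
  intro d hd
  rw [MvPolynomial.coeff_mul] at hd
  obtain ⟨x, hx, hxd⟩ := Finset.exists_ne_zero_of_sum_ne_zero hd
  rw [mem_antidiagonal] at hx
  rw [← hx, map_add, Nat.cast_add, hv _ (left_ne_zero_of_mul hxd), hw _ (right_ne_zero_of_mul hxd)]

lemma bVar_mem_dimSub (i : Fin n) (k : ℕ) : bVar i k ∈ dimSub n (k + 1) := by
  have := monomial_mem_dimSub (n := n) (Finsupp.single (Sum.inl (i, k)) 1) 1
  rw [Finsupp.weight_single, one_smul] at this
  exact_mod_cast this

lemma cVar_mem_dimSub (i : Fin n) (k : ℕ) : cVar i k ∈ dimSub n (k + 1) := by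
  have := monomial_mem_dimSub (n := n) (Finsupp.single (Sum.inr (i, k)) 1) 1
  rw [Finsupp.weight_single, one_smul] at this
  exact_mod_cast this

lemma C_mem_dimSub (f : Ohat n) : (MvPolynomial.C f : CDOhat n) ∈ dimSub n 0 := by
  simpa using monomial_mem_dimSub (n := n) 0 f

lemma pderiv_mem_dimSub (x : Var n) {k : ℤ} {v : CDOhat n} (hv : v ∈ dimSub n k) :
    MvPolynomial.pderiv x v ∈ dimSub n (k - wt x) := by
  intro d hd
  rw [MvPolynomial.coeff_pderiv] at hd
  have := hv _ (left_ne_zero_of_mul hd)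
  rw [map_add, Finsupp.weight_single, one_smul] at this
  push_cast at this
  omega

lemma db_mem_dimSub (i : Fin n) (l : ℕ) {k : ℤ} {v : CDOhat n} (hv : v ∈ dimSub n k) :
    db i l v ∈ dimSub n (k - (l + 1)) := by
  have := pderiv_mem_dimSub (Sum.inl (i, l)) hv
  exact_mod_cast this

lemma dc_mem_dimSub (i : Fin n) (m : ℕ) {k : ℤ} {v : CDOhat n} (hv : v ∈ dimSub n k) :
    dc i m v ∈ dimSub n (k - m) := by
  cases m with
  | zero =>
    intro d hd
    rw [show dc i 0 v = dc0 i v from rfl, coeff_dc0] at hd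
    rw [hv d fun h => hd (by rw [h, map_zero])]
    simp
  | succ m =>
    have := pderiv_mem_dimSub (Sum.inr (i, m)) hv
    exact_mod_cast this

lemma transl_mem_dimSub {k : ℤ} {v : CDOhat n} (hv : v ∈ dimSub n k) :
    transl n v ∈ dimSub n (k + 1) := by
  have hX : ∀ x : Var n, transl n (MvPolynomial.X x) ∈ dimSub n (wt x + 1) := by
    rintro (⟨i, k⟩ | ⟨i, k⟩)
    · refine (congrArg (· ∈ dimSub n _) (transl_bVar i k)).mpr (Submodule.smul_mem _ _ ?_)
      exact_mod_cast bVar_mem_dimSub i (k + 1)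
    · refine (congrArg (· ∈ dimSub n _) (transl_cVar i k)).mpr (Submodule.smul_mem _ _ ?_)
      exact_mod_cast cVar_mem_dimSub i (k + 1)
  have h0 : ∀ f : Ohat n, transl n (MvPolynomial.C f) ∈ dimSub n 1 := fun f => by
    rw [transl_C]
    refine Submodule.sum_mem _ fun i _ => ?_
    simpa using mul_mem_dimSub (C_mem_dimSub (pd i f)) (cVar_mem_dimSub i 0)
  have key : ∀ d f, transl n (MvPolynomial.monomial d f) ∈
      dimSub n ((Finsupp.weight wt d : ℕ) + 1) := by
    intro d f
    induction d using Finsupp.induction_linear generalizing f with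
    | zero =>
      simpa using h0 f
    | add d e hd he =>
      rw [← mul_one f, ← MvPolynomial.monomial_mul, isDeriv_transl, map_add]
      refine Submodule.add_mem _ ?_ ?_
      · convert mul_mem_dimSub (hd f) (monomial_mem_dimSub e 1) using 2
        push_cast; ring
      · convert mul_mem_dimSub (monomial_mem_dimSub d f) (he 1) using 2
        push_cast; ring
    | single x a =>
      induction a with
      | zero => simpa using h0 f
      | succ a ih =>
        rw [Finsupp.single_add, ← mul_one f, ← MvPolynomial.monomial_mul, isDeriv_transl,
          map_add]
        refine Submodule.add_mem _ ?_ ?_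
        · convert mul_mem_dimSub ih (monomial_mem_dimSub (Finsupp.single x 1) 1) using 2
          push_cast; ring
        · convert mul_mem_dimSub (monomial_mem_dimSub (Finsupp.single x a) f) (hX x) using 2
          · simp only [Finsupp.weight_single, one_smul]
            push_cast; ring
          · rfl
  rw [v.as_sum, map_sum]
  refine Submodule.sum_mem _ fun d hd => ?_
  rw [← hv d (MvPolynomial.mem_support_iff.1 hd)]
  exact key _ _

lemma divPow_transl_mem_dimSub {k : ℤ} {v : CDOhat n} (hv : v ∈ dimSub n k) (b : ℤ) :
    divPow (transl n) b v ∈ dimSub n (k + b) := by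
  rw [divPow]
  split_ifs with h
  · rw [LinearMap.smul_apply]
    refine Submodule.smul_mem _ _ ?_
    lift b to ℕ using h
    simp only [Int.toNat_natCast]
    induction b with
    | zero => simpa using hv
    | succ b ih =>
      rw [pow_succ', Module.End.mul_apply]
      convert transl_mem_dimSub ih using 2
      push_cast; ring
  · simp

/-! ### The contraction -/

variable (n) in
/-- The contraction of chiral differential operators. -/
def cdoData : WickData (CDOhat n) where
  T := transl n
  -- The Boolean selects the half of the contraction: with `true` the $b$-derivative acts on the
  -- first factor and the $c$-derivative on the second.
  J := Fin n × (ℕ × ℕ) × Bool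
  S
    | 0 => ∅
    | d + 1 => Finset.univ ×ˢ antidiagonal d ×ˢ Finset.univ
  -- Degree `d + 1` is indexed by the antidiagonal of `d`, hence the subtraction; in degree zero the
  -- index set is empty.
  cf d j := ((d - 1).choose j.2.1.1 : ℂ) *
    if j.2.2 then (-1 : ℂ) ^ j.2.1.1 else (-1 : ℂ) ^ (j.2.1.2 + 1)
  D j := if j.2.2 then db j.1 j.2.1.1 else dc j.1 j.2.1.2
  D' j := if j.2.2 then dc j.1 j.2.1.2 else db j.1 j.2.1.1
  T_mul := isDeriv_transl
  D_mul j := by split_ifs; exacts [isDeriv_db _ _, isDeriv_dc _ _]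
  D'_mul j := by split_ifs; exacts [isDeriv_dc _ _, isDeriv_db _ _]
  D_D i j := by
    split_ifs
    exacts [commute_db_db .., commute_db_dc .., (commute_db_dc ..).symm, commute_dc_dc ..]
  D_D' i j := by
    split_ifs
    exacts [commute_db_dc .., commute_db_db .., commute_dc_dc .., (commute_db_dc ..).symm]
  D'_D' i j := by
    split_ifs
    exacts [commute_dc_dc .., (commute_db_dc ..).symm, commute_db_dc .., commute_db_db ..]

lemma cdoData_R (d : ℕ) : (cdoData n).R d = contraction n d := by
  cases d with
  | zero => rfl
  | succ d =>
    rw [WickData.R, contraction]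
    change ∑ j ∈ (Finset.univ ×ˢ antidiagonal d ×ˢ Finset.univ), _ = _
    rw [Finset.sum_product]
    refine Finset.sum_congr rfl fun i _ => ?_
    rw [Finset.sum_product]
    refine Finset.sum_congr rfl fun p _ => ?_
    simp [cdoData, smul_smul]

lemma cdoData_W (d : ℕ) : (cdoData n).W d = wick n d := by
  rw [WickData.W, wick, expCoeff]
  have : (PowerSeries.mk (cdoData n).R) = PowerSeries.mk (contraction n) := by
    ext1 d; simp [cdoData_R]
  rw [this]

lemma cdoData_mode (m : ℤ) (v w : CDOhat n) : (cdoData n).mode m v w = modes n m v w := by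
  rw [WickData.mode, WickData.Y, modes]
  refine finsum_congr fun d => ?_
  rw [cdoData_W, divPow]
  split_ifs with h1 h2 h2
  · simp only [TensorProduct.map_smul_left, LinearMap.smul_apply, map_smul]
    rfl
  · omega
  · omega
  · simp

lemma contraction_succ_tmul (d : ℕ) (v w : CDOhat n) : contraction n (d + 1) (v ⊗ₜ w) =
    ∑ i : Fin n, ∑ p ∈ antidiagonal d, (d.choose p.1 : ℂ) •
      ((-1 : ℂ) ^ p.1 • (db i p.1 v ⊗ₜ[ℂ] dc i p.2 w) +
        (-1 : ℂ) ^ (p.2 + 1) • (dc i p.2 v ⊗ₜ[ℂ] db i p.1 w)) := by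
  simp [contraction, LinearMap.sum_apply]

/-- The absorption identity $(k+1)\binom{e+1}{k+1}=(e+1)\binom ek$, after the index is shifted. It
collects the terms in which commuting with $T$ has lowered an index of $b$. -/
lemma sum_choose_antidiagonal_fst {M : Type*} [AddCommGroup M] [Module ℂ M] (e : ℕ)
    (F : ℕ → ℕ → M) : ∑ p ∈ antidiagonal (e + 1), ((e + 1).choose p.1 : ℂ) • (-1 : ℂ) ^ p.1 •
      (p.1 : ℂ) • F (p.1 - 1) p.2 = (-((e : ℂ) + 1)) • ∑ p ∈ antidiagonal e, (e.choose p.1 : ℂ) •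
      (-1 : ℂ) ^ p.1 • F p.1 p.2 := by
  rw [Finset.Nat.sum_antidiagonal_succ, Finset.smul_sum]
  simp only [Nat.cast_zero, zero_smul, smul_zero, zero_add, Nat.add_sub_cancel, smul_smul]
  refine Finset.sum_congr rfl fun p _ => ?_
  congr 1
  have h : (((e + 1) * e.choose p.1 : ℕ) : ℂ) = (((e + 1).choose (p.1 + 1) * (p.1 + 1) : ℕ) : ℂ) :=
    congrArg _ (Nat.add_one_mul_choose_eq e p.1)
  push_cast at h ⊢
  linear_combination (-(-1 : ℂ) ^ p.1) * -h

lemma sum_choose_antidiagonal_snd {M : Type*} [AddCommGroup M] [Module ℂ M] (e : ℕ)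
    (F : ℕ → ℕ → M) : ∑ p ∈ antidiagonal (e + 1), ((e + 1).choose p.1 : ℂ) •
      (-1 : ℂ) ^ (p.2 + 1) • (p.2 : ℂ) • F p.1 (p.2 - 1) =
      (-((e : ℂ) + 1)) • ∑ p ∈ antidiagonal e, (e.choose p.1 : ℂ) •
        (-1 : ℂ) ^ (p.2 + 1) • F p.1 p.2 := by
  rw [Finset.Nat.sum_antidiagonal_succ', Finset.smul_sum]
  simp only [Nat.cast_zero, zero_smul, smul_zero, zero_add, Nat.add_sub_cancel, smul_smul]
  refine Finset.sum_congr rfl fun p hp => ?_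
  rw [mem_antidiagonal] at hp
  congr 1
  have h : (((e + 1) * e.choose p.2 : ℕ) : ℂ) = (((e + 1).choose (p.2 + 1) * (p.2 + 1) : ℕ) : ℂ) :=
    congrArg _ (Nat.add_one_mul_choose_eq e p.2)
  rw [← Nat.choose_symm_of_eq_add (show e = p.1 + p.2 from hp.symm),
    ← Nat.choose_symm_of_eq_add (show e + 1 = p.1 + (p.2 + 1) by omega)] at h
  push_cast at h ⊢
  linear_combination (-(-1 : ℂ) ^ p.2) * h

/-- Commuting $T$ with the partial derivatives lowers their indices by one; absorption sums the
lowered terms to $-e$ times the contraction of degree $e$. This is the coefficient form of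
$\partial_z z^{-e}=-e\,z^{-e-1}$. -/
lemma contraction_T_left (e : ℕ) (v w : CDOhat n) : contraction n (e + 1) (transl n v ⊗ₜ w) =
    TensorProduct.map (transl n) LinearMap.id (contraction n (e + 1) (v ⊗ₜ w)) +
      (-(e : ℂ)) • contraction n e (v ⊗ₜ w) := by
  have hdb : ∀ i k, db i k (transl n v) = transl n (db i k v) + (k : ℂ) • db i (k - 1) v :=
    fun i k => LinearMap.congr_fun (db_transl i k) v
  have hdc : ∀ (i : Fin n) k, dc i k (transl n v) = transl n (dc i k v) + (k : ℂ) • dc i (k - 1) v := by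
    intro i k
    cases k with
    | zero => simpa using LinearMap.congr_fun (dc_transl_zero i) v
    | succ k => simpa using LinearMap.congr_fun (dc_transl_succ i k) v
  rw [contraction_succ_tmul, contraction_succ_tmul]
  simp only [map_sum, map_smul, map_add, TensorProduct.map_tmul, LinearMap.id_apply, hdb, hdc]
  rcases e with _ | e
  · simp
  rw [contraction_succ_tmul, Finset.smul_sum, ← Finset.sum_add_distrib]
  refine Finset.sum_congr rfl fun i _ => ?_
  have h1 := sum_choose_antidiagonal_fst e fun k l => db i k v ⊗ₜ[ℂ] dc i l w
  have h2 := sum_choose_antidiagonal_snd e fun k l => dc i l v ⊗ₜ[ℂ] db i k w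
  simp only [TensorProduct.add_tmul, TensorProduct.smul_tmul', smul_add, Finset.sum_add_distrib]
    at h1 h2 ⊢
  push_cast
  rw [h1, h2]
  abel

/-- The exchange of the factors interchanges the two halves of the contraction. Their signs $(-1)^k$
and $(-1)^{l+1}$, with $k+l=e$ in degree $e+1$, differ by exactly $(-1)^{e+1}$. -/
lemma contraction_comm (e : ℕ) (v w : CDOhat n) : contraction n e (w ⊗ₜ v) =
    (-1 : ℂ) ^ e • TensorProduct.comm ℂ _ _ (contraction n e (v ⊗ₜ w)) := by
  rcases e with _ | e
  · simp [contraction]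
  rw [contraction_succ_tmul, contraction_succ_tmul]
  simp only [map_sum, map_smul, map_add, TensorProduct.comm_tmul, Finset.smul_sum]
  refine Finset.sum_congr rfl fun i _ => Finset.sum_congr rfl fun p hp => ?_
  rw [mem_antidiagonal] at hp
  have h1 : ∀ k : ℕ, (-1 : ℂ) ^ k * (-1) ^ k = 1 := fun k => by rw [← mul_pow]; norm_num
  rw [smul_comm _ ((e.choose p.1 : ℂ)), smul_add, smul_add, smul_add, smul_smul ((-1 : ℂ) ^ (e + 1)),
    smul_smul ((-1 : ℂ) ^ (e + 1)), add_comm, ← hp]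
  congr 3
  · linear_combination (-1 : ℂ) ^ p.2 * h1 p.1
  · linear_combination (-(-1 : ℂ) ^ p.1) * h1 p.2

/-! ### The tensor product of two graded spaces -/

variable (n) in
/-- The tensors of conformal dimension `k`. -/
def dimSub₂ (k : ℤ) : Submodule ℂ (CDOhat n ⊗[ℂ] CDOhat n) :=
  Submodule.span ℂ {s | ∃ a b : ℤ, a + b = k ∧ ∃ v ∈ dimSub n a, ∃ w ∈ dimSub n b, s = v ⊗ₜ w}

lemma tmul_mem_dimSub₂ {a b k : ℤ} (h : a + b = k) {v w : CDOhat n} (hv : v ∈ dimSub n a)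
    (hw : w ∈ dimSub n b) : v ⊗ₜ w ∈ dimSub₂ n k :=
  Submodule.subset_span ⟨a, b, h, v, hv, w, hw, rfl⟩

lemma eq_zero_of_mem_dimSub₂ {k : ℤ} (hk : k < 0) {s : CDOhat n ⊗[ℂ] CDOhat n}
    (hs : s ∈ dimSub₂ n k) : s = 0 := by
  induction hs using Submodule.span_induction with
  | mem s hs =>
    obtain ⟨a, b, h, v, hv, w, hw, rfl⟩ := hs
    rcases lt_or_ge a 0 with ha | ha
    · rw [eq_zero_of_mem_dimSub ha hv, TensorProduct.zero_tmul]
    · rw [eq_zero_of_mem_dimSub (by omega) hw, TensorProduct.tmul_zero]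
  | zero => rfl
  | add s t _ _ hs ht => rw [hs, ht, add_zero]
  | smul z s _ hs => rw [hs, smul_zero]

lemma contraction_mem_dimSub₂ (e : ℕ) {k : ℤ} {s : CDOhat n ⊗[ℂ] CDOhat n}
    (hs : s ∈ dimSub₂ n k) : contraction n e s ∈ dimSub₂ n (k - e) := by
  induction hs using Submodule.span_induction with
  | mem s hs =>
    obtain ⟨a, b, h, v, hv, w, hw, rfl⟩ := hs
    rcases e with _ | e
    · simp [contraction]
    rw [contraction_succ_tmul]
    refine Submodule.sum_mem _ fun i _ => Submodule.sum_mem _ fun p hp => ?_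
    rw [mem_antidiagonal] at hp
    refine Submodule.smul_mem _ _ (Submodule.add_mem _ (Submodule.smul_mem _ _ ?_)
      (Submodule.smul_mem _ _ ?_))
    · exact tmul_mem_dimSub₂ (by push_cast; omega) (db_mem_dimSub i p.1 hv) (dc_mem_dimSub i p.2 hw)
    · exact tmul_mem_dimSub₂ (by push_cast; omega) (dc_mem_dimSub i p.2 hv) (db_mem_dimSub i p.1 hw)
  | zero => simp
  | add s t _ _ hs ht => rw [map_add]; exact Submodule.add_mem _ hs ht
  | smul z s _ hs => rw [map_smul]; exact Submodule.smul_mem _ _ hs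

lemma W_mem_dimSub₂ (d : ℕ) {k : ℤ} {s : CDOhat n ⊗[ℂ] CDOhat n}
    (hs : s ∈ dimSub₂ n k) : (cdoData n).W d s ∈ dimSub₂ n (k - d) := by
  have key : ∀ p d : ℕ, ∀ k : ℤ, ∀ s ∈ dimSub₂ n k,
      (PowerSeries.coeff d ((PowerSeries.mk (contraction n)) ^ p) :
        Module.End ℂ (CDOhat n ⊗[ℂ] CDOhat n)) s ∈ dimSub₂ n (k - d) := by
    intro p
    induction p with
    | zero =>
      intro d k s hs
      rw [pow_zero, PowerSeries.coeff_one]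
      split_ifs with h
      · simpa [h] using hs
      · simp
    | succ p ih =>
      intro d k s hs
      rw [pow_succ, PowerSeries.coeff_mul, LinearMap.sum_apply]
      refine Submodule.sum_mem _ fun x hx => ?_
      rw [mem_antidiagonal] at hx
      rw [Module.End.mul_apply, PowerSeries.coeff_mk]
      convert ih x.1 _ _ (contraction_mem_dimSub₂ x.2 hs) using 2
      omega
  rw [cdoData_W, wick, LinearMap.sum_apply]
  exact Submodule.sum_mem _ fun p _ => Submodule.smul_mem _ _ (key p d k s hs)

/-- The degree-`d` part lowers the conformal dimension by `d`, and there are no vectors of negative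
dimension. -/
lemma exists_W_eq_zero (s : CDOhat n ⊗[ℂ] CDOhat n) :
    ∃ K, ∀ d, K ≤ d → (cdoData n).W d s = 0 := by
  induction s with
  | zero => exact ⟨0, fun d _ => map_zero _⟩
  | add s t hs ht =>
    obtain ⟨K, hK⟩ := hs
    obtain ⟨L, hL⟩ := ht
    exact ⟨max K L, fun d hd => by rw [map_add, hK d (by omega), hL d (by omega), add_zero]⟩
  | tmul v w =>
    induction v using MvPolynomial.induction_on' with
    | add p q hp hq =>
      obtain ⟨K, hK⟩ := hp
      obtain ⟨L, hL⟩ := hq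
      exact ⟨max K L, fun d hd => by
        rw [TensorProduct.add_tmul, map_add, hK d (by omega), hL d (by omega), add_zero]⟩
    | monomial a f =>
      induction w using MvPolynomial.induction_on' with
      | add p q hp hq =>
        obtain ⟨K, hK⟩ := hp
        obtain ⟨L, hL⟩ := hq
        exact ⟨max K L, fun d hd => by
          rw [TensorProduct.tmul_add, map_add, hK d (by omega), hL d (by omega), add_zero]⟩
      | monomial b g =>
        refine ⟨Finsupp.weight wt a + Finsupp.weight wt b + 1, fun d hd => ?_⟩
        refine eq_zero_of_mem_dimSub₂ ?_ (W_mem_dimSub₂ d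
          (tmul_mem_dimSub₂ rfl (monomial_mem_dimSub a f) (monomial_mem_dimSub b g)))
        omega

lemma cdo_isTranslationCovariant : (cdoData n).IsTranslationCovariant where
  S_zero := rfl
  R_map_T_left e v w := by
    rw [cdoData_R, cdoData_R]
    exact contraction_T_left e v w
  R_comm e v w := by
    rw [cdoData_R]
    exact contraction_comm e v w
  nilpotent v w := exists_W_eq_zero _

lemma mode_mem_dimSub (m : ℤ) {a b : ℤ} {v w : CDOhat n} (hv : v ∈ dimSub n a)
    (hw : w ∈ dimSub n b) : (cdoData n).mode m v w ∈ dimSub n (a + b - m - 1) := by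
  obtain ⟨K, hK⟩ := exists_W_eq_zero (v ⊗ₜ[ℂ] w)
  rw [WickData.mode, WickData.Y_eq_sum hK]
  refine Submodule.sum_mem _ fun d _ => ?_
  have h := W_mem_dimSub₂ d (tmul_mem_dimSub₂ rfl hv hw)
  generalize (cdoData n).W d (v ⊗ₜ[ℂ] w) = s at h
  induction h using Submodule.span_induction with
  | mem s hs =>
    obtain ⟨a', b', h, v, hv, w, hw, rfl⟩ := hs
    rw [TensorProduct.map_tmul, LinearMap.mul'_apply, LinearMap.id_apply]
    convert mul_mem_dimSub (divPow_transl_mem_dimSub hv (d - 1 - m)) hw using 2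
    · omega
    · rfl
  | zero => simp
  | add s t _ _ hs ht => rw [map_add, map_add]; exact Submodule.add_mem _ hs ht
  | smul z s _ hs => rw [map_smul, map_smul]; exact Submodule.smul_mem _ _ hs

section
variable {E : Type*} [Ring E] [Algebra ℂ E]

/-- If $[A,x]=B$ commutes with $A$, then $[A^{p+1},x]=(p+1)BA^p$, and the factorials turn this into
$[e^A,x]=Be^A$. -/
lemma expCoeff_mul_of_commute_commutator {A B : PowerSeries E} (hA : PowerSeries.coeff 0 A = 0)
    {x : E} (h : ∀ e, PowerSeries.coeff e A * x = x * PowerSeries.coeff e A + PowerSeries.coeff e B)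
    (hc : Commute A B) (d : ℕ) :
    expCoeff A d * x = x * expCoeff A d +
      ∑ p ∈ antidiagonal d, PowerSeries.coeff p.1 B * expCoeff A p.2 := by
  have h1 : A * PowerSeries.C x = PowerSeries.C x * A + B := by
    ext e
    rw [map_add, PowerSeries.coeff_mul_C, PowerSeries.coeff_C_mul, h]
  have h2 : ∀ p : ℕ, A ^ (p + 1) * PowerSeries.C x =
      PowerSeries.C x * A ^ (p + 1) + (p + 1) • (B * A ^ p) := by
    intro p
    induction p with
    | zero => simpa using h1
    | succ p ih =>
      rw [pow_succ A (p + 1), mul_assoc, h1, mul_add, ← mul_assoc, ih, add_mul, mul_assoc,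
        ← pow_succ, (hc.pow_left (p + 1)).eq, succ_nsmul _ (p + 1), smul_mul_assoc, mul_assoc,
        ← pow_succ, add_assoc]
  have h3 : ∀ p ∈ antidiagonal d, expCoeff A p.2 = ∑ q ∈ Finset.range (d + 1),
      (q.factorial : ℂ)⁻¹ • PowerSeries.coeff p.2 (A ^ q) := fun p hp => by
    rw [mem_antidiagonal] at hp
    exact expCoeff_eq_sum hA (by omega)
  rw [Finset.sum_congr rfl fun p hp => by rw [h3 p hp, Finset.mul_sum], Finset.sum_comm,
    expCoeff_eq_sum hA (show d < d + 1 + 1 by omega), Finset.sum_mul, Finset.mul_sum,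
    Finset.sum_range_succ', Finset.sum_range_succ' (fun i => x * _), add_right_comm,
    ← Finset.sum_add_distrib]
  congr 1
  · refine Finset.sum_congr rfl fun p _ => ?_
    have h4 := congrArg (PowerSeries.coeff d) (h2 p)
    rw [map_add, PowerSeries.coeff_mul_C, PowerSeries.coeff_C_mul, map_nsmul,
      PowerSeries.coeff_mul] at h4
    rw [smul_mul_assoc, h4, smul_add, mul_smul_comm]
    congr 1
    rw [← Nat.cast_smul_eq_nsmul ℂ, smul_smul, Finset.smul_sum]
    refine Finset.sum_congr rfl fun q _ => ?_
    rw [mul_smul_comm]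
    congr 1
    rw [Nat.factorial_succ]
    have := Nat.factorial_ne_zero p
    push_cast
    field_simp
  · simp [PowerSeries.coeff_one]

end

/-! ### Operator products -/

local notation "𝓜" => WickData.mode (cdoData n)

lemma W_of_contraction_eq_zero {s : CDOhat n ⊗[ℂ] CDOhat n} (hs : ∀ e, contraction n e s = 0)
    (d : ℕ) : (cdoData n).W d s = if d = 0 then s else 0 := by
  have h : ∀ p, 0 < p → ∀ d : ℕ, (PowerSeries.coeff d ((PowerSeries.mk (contraction n)) ^ p) :
      Module.End ℂ (CDOhat n ⊗[ℂ] CDOhat n)) s = 0 := by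
    intro p hp d
    obtain ⟨q, rfl⟩ : ∃ q, p = q + 1 := ⟨p - 1, by omega⟩
    rw [pow_succ, PowerSeries.coeff_mul, LinearMap.sum_apply]
    refine Finset.sum_eq_zero fun y _ => ?_
    rw [Module.End.mul_apply, PowerSeries.coeff_mk, hs, map_zero]
  rw [cdoData_W, wick, LinearMap.sum_apply, Finset.sum_eq_single 0]
  · split_ifs with hd
    · simp [hd]
    · simp [PowerSeries.coeff_one, hd]
  · intro p _ hp
    rw [LinearMap.smul_apply, h p (Nat.pos_of_ne_zero hp), smul_zero]
  · simp

/-- The contraction of a generator $x$ with the second slot is an operator `A e` on that slot which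
commutes with all further contractions. Each new generator is thus either left uncontracted or
contracted once. -/
lemma W_mul_left {x : CDOhat n} {A : ℕ → Module.End ℂ (CDOhat n)}
    (hA : ∀ e v w, contraction n e ((x * v) ⊗ₜ w) =
      TensorProduct.map (LinearMap.mulLeft ℂ x) LinearMap.id (contraction n e (v ⊗ₜ w)) +
        v ⊗ₜ A e w)
    (hc : ∀ e f, Commute (contraction n e) (TensorProduct.map LinearMap.id (A f)))
    (d : ℕ) (v w : CDOhat n) : (cdoData n).W d ((x * v) ⊗ₜ w) =
      TensorProduct.map (LinearMap.mulLeft ℂ x) LinearMap.id ((cdoData n).W d (v ⊗ₜ w)) +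
        ∑ p ∈ antidiagonal d, TensorProduct.map LinearMap.id (A p.1) ((cdoData n).W p.2 (v ⊗ₜ w)) := by
  have := expCoeff_mul_of_commute_commutator (A := PowerSeries.mk (cdoData n).R)
    (B := PowerSeries.mk fun e => (TensorProduct.map LinearMap.id (A e) :
      Module.End ℂ (CDOhat n ⊗[ℂ] CDOhat n)))
    (x := TensorProduct.map (LinearMap.mulLeft ℂ x) LinearMap.id)
    (by rw [PowerSeries.coeff_mk, cdoData_R]; rfl) (fun e => by
      rw [PowerSeries.coeff_mk, PowerSeries.coeff_mk, cdoData_R]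
      exact TensorProduct.ext' fun v w => by simpa using hA e v w) (by
      ext1 d
      rw [PowerSeries.coeff_mul, PowerSeries.coeff_mul, ← Finset.Nat.sum_antidiagonal_swap]
      refine Finset.sum_congr rfl fun p _ => ?_
      simp only [PowerSeries.coeff_mk, cdoData_R, Prod.fst_swap, Prod.snd_swap]
      exact hc _ _) d
  simpa [WickData.W] using LinearMap.congr_fun this (v ⊗ₜ w)

/-- The contractions of `b^i_{-1}` with the second factor. -/
def bContr (i : Fin n) : ℕ → Module.End ℂ (CDOhat n)
  | 0 => 0
  | e + 1 => dc i e

/-- The contractions of `c^i_{-1}` with the second factor. -/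
def cContr (i : Fin n) : ℕ → Module.End ℂ (CDOhat n)
  | 0 => 0
  | e + 1 => (e : ℂ) • db i (e - 1)

lemma contraction_commute_right (B : Module.End ℂ (CDOhat n)) (hb : ∀ i k, Commute (db i k) B)
    (hc : ∀ i k, Commute (dc i k) B) (e : ℕ) :
    Commute (contraction n e) (TensorProduct.map LinearMap.id B) := by
  have h : ∀ P Q : Module.End ℂ (CDOhat n), Commute Q B →
      Commute (TensorProduct.map P Q) (TensorProduct.map LinearMap.id B) := by
    intro P Q hQ
    refine TensorProduct.ext' fun v w => ?_
    have := LinearMap.congr_fun hQ.eq w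
    simp only [Module.End.mul_apply] at this
    simp [this]
  cases e with
  | zero => exact Commute.zero_left _
  | succ e =>
    refine Commute.sum_left _ _ _ fun i _ => Commute.sum_left _ _ _ fun p _ => ?_
    exact Commute.smul_left (Commute.add_left (Commute.smul_left (h _ _ (hc _ _)) _)
      (Commute.smul_left (h _ _ (hb _ _)) _)) _

lemma contraction_succ_mul_tmul (e : ℕ) (x v w : CDOhat n) : contraction n (e + 1) ((x * v) ⊗ₜ w) =
    TensorProduct.map (LinearMap.mulLeft ℂ x) LinearMap.id (contraction n (e + 1) (v ⊗ₜ w)) +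
      ∑ i : Fin n, ∑ p ∈ antidiagonal e, (e.choose p.1 : ℂ) •
        ((-1 : ℂ) ^ p.1 • ((db i p.1 x * v) ⊗ₜ[ℂ] dc i p.2 w) +
          (-1 : ℂ) ^ (p.2 + 1) • ((dc i p.2 x * v) ⊗ₜ[ℂ] db i p.1 w)) := by
  simp only [contraction_succ_tmul, db_mul, dc_mul, map_sum,
    map_smul, map_add, TensorProduct.map_tmul, LinearMap.mulLeft_apply, LinearMap.id_apply,
    TensorProduct.add_tmul]
  rw [← Finset.sum_add_distrib]
  refine Finset.sum_congr rfl fun i _ => ?_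
  rw [← Finset.sum_add_distrib]
  refine Finset.sum_congr rfl fun p _ => ?_
  module

lemma W_bVar_mul (i : Fin n) (d : ℕ) (v w : CDOhat n) : (cdoData n).W d ((bVar i 0 * v) ⊗ₜ w) =
    TensorProduct.map (LinearMap.mulLeft ℂ (bVar i 0)) LinearMap.id ((cdoData n).W d (v ⊗ₜ w)) +
      ∑ p ∈ antidiagonal d,
        TensorProduct.map LinearMap.id (bContr i p.1) ((cdoData n).W p.2 (v ⊗ₜ w)) := by
  refine W_mul_left (fun e v w => ?_) (fun e f => ?_) d v w
  · rcases e with _ | e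
    · simp [contraction, bContr]
    -- The generator $b_{-1}$ is seen only by the derivative with index $0$, so one term of the
    -- antidiagonal remains, with coefficient $1$.
    rw [contraction_succ_mul_tmul, bContr, Finset.sum_eq_single i, Finset.sum_eq_single (0, e)]
    · simp
    · rintro ⟨k, l⟩ hp hne
      rw [mem_antidiagonal] at hp
      have : k ≠ 0 := by rintro rfl; simp at hp; exact hne (by rw [hp])
      simp [this]
    · simp
    · intro j _ hj
      simp [hj]
    · simp
  · cases f with
    | zero =>
      rw [bContr, TensorProduct.map_zero_right]
      exact Commute.zero_right _
    | succ f =>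
      exact contraction_commute_right (dc i f) (fun j k => commute_db_dc j i k f)
        (fun j k => commute_dc_dc j i k f) e

lemma W_cVar_mul (i : Fin n) (d : ℕ) (v w : CDOhat n) : (cdoData n).W d ((cVar i 0 * v) ⊗ₜ w) =
    TensorProduct.map (LinearMap.mulLeft ℂ (cVar i 0)) LinearMap.id ((cdoData n).W d (v ⊗ₜ w)) +
      ∑ p ∈ antidiagonal d,
        TensorProduct.map LinearMap.id (cContr i p.1) ((cdoData n).W p.2 (v ⊗ₜ w)) := by
  refine W_mul_left (fun e v w => ?_) (fun e f => ?_) d v w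
  · rcases e with _ | e
    · simp [contraction, cContr]
    rw [contraction_succ_mul_tmul, cContr, Finset.sum_eq_single i]
    · rcases e with _ | e
      · simp
      -- The generator $c_{-1}$ is seen only by the $c$-derivative with index $1$. The coefficient
      -- $\binom{e+1}{e}=e+1$ is the scalar in `cContr`, and the sign is $(-1)^{1+1}$.
      rw [Finset.sum_eq_single (e, 1)]
      · simp
      · rintro ⟨k, l⟩ hp hne
        rw [mem_antidiagonal] at hp
        have : l ≠ 1 := by rintro rfl; exact hne (by simpa using hp)
        simp [this]
      · simp
    · intro j _ hj
      simp [hj]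
    · simp
  · cases f with
    | zero =>
      rw [cContr, TensorProduct.map_zero_right]
      exact Commute.zero_right _
    | succ f =>
      rw [cContr, TensorProduct.map_smul_right]
      exact (contraction_commute_right (db i (f - 1)) (fun j k => commute_db_db j i k _)
        (fun j k => (commute_db_dc i j _ k).symm) e).smul_right _

lemma W_one_tmul (d : ℕ) (w : CDOhat n) : (cdoData n).W d (1 ⊗ₜ w) = if d = 0 then 1 ⊗ₜ w else 0 :=
  cdo_isTranslationCovariant.W_one_left w d

lemma sum_antidiagonal_ite {M : Type*} [AddCommMonoid M] (d : ℕ) (F : ℕ → M) :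
    ∑ p ∈ antidiagonal d, (if p.2 = 0 then F p.1 else 0) = F d := by
  rw [Finset.sum_eq_single (d, 0)]
  · simp
  · rintro ⟨k, l⟩ hp hne
    rw [mem_antidiagonal] at hp
    refine if_neg ?_
    rintro rfl
    exact hne (by simpa using hp)
  · simp

lemma W_cVar (i : Fin n) (d : ℕ) (w : CDOhat n) : (cdoData n).W d (cVar i 0 ⊗ₜ w) =
    (if d = 0 then cVar i 0 ⊗ₜ w else 0) + 1 ⊗ₜ cContr i d w := by
  have := W_cVar_mul i d 1 w
  rw [mul_one] at this
  rw [this, Finset.sum_congr rfl fun p _ => by rw [W_one_tmul, apply_ite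
    (TensorProduct.map LinearMap.id (cContr i p.1)), map_zero], W_one_tmul,
    sum_antidiagonal_ite d fun k => TensorProduct.map LinearMap.id (cContr i k) (1 ⊗ₜ w)]
  congr 1
  split_ifs <;> simp

/-- The four terms are the uncontracted product, the contraction of $c$ alone, of $b$ alone, and of
both. The double contraction is the source of the central charge and of the divergence. -/
lemma W_bVar_mul_cVar (i : Fin n) (d : ℕ) (w : CDOhat n) :
    (cdoData n).W d ((bVar i 0 * cVar i 0) ⊗ₜ w) =
      (if d = 0 then (bVar i 0 * cVar i 0) ⊗ₜ w else 0) + bVar i 0 ⊗ₜ cContr i d w +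
        cVar i 0 ⊗ₜ bContr i d w +
        1 ⊗ₜ ∑ p ∈ antidiagonal d, bContr i p.1 (cContr i p.2 w) := by
  rw [W_bVar_mul]
  simp only [W_cVar, map_add, apply_ite (TensorProduct.map _ _), map_zero, TensorProduct.map_tmul,
    Finset.sum_add_distrib, LinearMap.id_apply, LinearMap.mulLeft_apply, mul_one,
    sum_antidiagonal_ite d fun k => cVar i 0 ⊗ₜ[ℂ] bContr i k w, ← TensorProduct.tmul_sum]
  abel

/-- The modes of the conformal vector. -/
lemma mode_conformalVector (m : ℕ) {w : CDOhat n} (hb : ∀ i k, 1 ≤ k → db i k w = 0)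
    (hc : ∀ i k, 2 ≤ k → dc i k w = 0) : 𝓜 m (conformalVector n) w =
      ∑ i, (divPow (transl n) (1 - m) (bVar i 0) * db i 0 w +
        divPow (transl n) (-m) (cVar i 0) * dc i 0 w +
        divPow (transl n) (1 - m) (cVar i 0) * dc i 1 w) +
      if 2 ≤ m then ∑ i, dc i (m - 2) (db i 0 w) else 0 := by
  have hbc : ∀ i k, 2 ≤ k → dc i k (db i 0 w) = 0 := fun i k hk => by
    have := LinearMap.congr_fun (commute_db_dc i i 0 k).eq w
    simp only [Module.End.mul_apply] at this
    rw [← this, hc i k hk, map_zero]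
  have hcc : ∀ i d, cContr i d w = if d = 2 then db i 0 w else 0 := by
    rintro i (_ | _ | _ | d)
    · simp [cContr]
    · simp [cContr]
    · simp [cContr]
    · rw [cContr, LinearMap.smul_apply, hb i _ (by omega), smul_zero, if_neg (by omega)]
  have hbb : ∀ i d, bContr i d w = if d = 1 then dc i 0 w else if d = 2 then dc i 1 w else 0 := by
    rintro i (_ | _ | _ | d)
    · simp [bContr]
    · simp [bContr]
    · simp [bContr]
    · rw [bContr, hc i _ (by omega), if_neg (by omega), if_neg (by omega)]
  have hs : ∀ i d, ∑ p ∈ antidiagonal d, bContr i p.1 (cContr i p.2 w) =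
      if 3 ≤ d then dc i (d - 3) (db i 0 w) else 0 := by
    intro i d
    simp only [hcc]
    by_cases hd : 3 ≤ d
    · rw [Finset.sum_eq_single (d - 2, 2), if_pos hd, if_pos rfl,
        show d - 2 = (d - 3) + 1 by omega, bContr]
      · rintro ⟨k, l⟩ hp hne
        rw [mem_antidiagonal] at hp
        simp only at hp ⊢
        rw [if_neg, map_zero]
        rintro rfl
        exact hne (by rw [← hp]; simp)
      · intro h
        simp at h
        omega
    · rw [if_neg hd]
      refine Finset.sum_eq_zero ?_
      rintro ⟨k, l⟩ hp
      rw [mem_antidiagonal] at hp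
      simp only at hp ⊢
      split_ifs with h
      · obtain rfl : k = 0 := by omega
        simp [bContr]
      · simp
  have hW : ∀ d, (cdoData n).W d (conformalVector n ⊗ₜ w) = ∑ i : Fin n,
      ((if d = 0 then (bVar i 0 * cVar i 0) ⊗ₜ w else 0) +
        (if d = 2 then bVar i 0 ⊗ₜ[ℂ] db i 0 w else 0) +
        (if d = 1 then cVar i 0 ⊗ₜ[ℂ] dc i 0 w else 0) +
        (if d = 2 then cVar i 0 ⊗ₜ[ℂ] dc i 1 w else 0) +
        (if 3 ≤ d then 1 ⊗ₜ[ℂ] dc i (d - 3) (db i 0 w) else 0)) := by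
    intro d
    rw [conformalVector, TensorProduct.sum_tmul, map_sum]
    refine Finset.sum_congr rfl fun i _ => ?_
    rw [W_bVar_mul_cVar, hcc, hbb, hs]
    split_ifs <;> first | omega | simp
  -- A double contraction of degree `d` differentiates by the $c$-variable of index `d - 3`, and by
  -- assumption only indices at most $1$ contribute.
  have hK : ∀ d, 5 ≤ d → (cdoData n).W d (conformalVector n ⊗ₜ w) = 0 := by
    intro d hd
    rw [hW]
    refine Finset.sum_eq_zero fun i _ => ?_
    rw [if_neg (by omega), if_neg (by omega), if_neg (by omega), if_neg (by omega),
      hbc i _ (by omega)]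
    simp
  have hT : (cdoData n).T = transl n := rfl
  rw [WickData.mode, WickData.Y_eq_sum hK]
  simp only [hW, Finset.sum_range_succ, Finset.sum_range_zero, map_sum, map_add]
  simp only [zero_add, ↓reduceIte, OfNat.ofNat_ne_zero, one_ne_zero, OfNat.ofNat_ne_one,
    OfNat.one_ne_ofNat, map_zero, add_zero, TensorProduct.map_tmul, LinearMap.mul'_apply,
    LinearMap.id_apply, hT, Nat.reduceEqDiff, Nat.reduceLeDiff, zero_ne_one]
  have h1 : ∀ (b : ℤ), divPow (transl n) b (1 : CDOhat n) = if b = 0 then 1 else 0 := by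
    intro b
    split_ifs with hb
    · rw [hb, divPow_zero, Module.End.one_apply]
    · exact WickData.divPow_T_one (𝒲 := cdoData n) b hb
  have h0 : divPow (transl n) (((0 : ℕ) : ℤ) - 1 - m) = 0 := divPow_of_neg _ (by omega)
  rw [show ((1 : ℕ) : ℤ) - 1 - m = -m by omega, show ((2 : ℕ) : ℤ) - 1 - m = 1 - m by omega]
  simp only [h0, LinearMap.zero_apply, zero_mul, Finset.sum_const_zero, zero_add, h1]
  rw [add_assoc (Finset.sum _ _ + Finset.sum _ _), ← Finset.sum_add_distrib]
  congr 1
  · exact Finset.sum_congr rfl fun i _ => by abel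
  -- The first factor of a double contraction is the vacuum, whose divided powers survive only for
  -- `m = d - 1`. The degrees `d = 3` and `d = 4` correspond to `m = 2` and `m = 3`.
  · rcases m with _ | _ | _ | _ | m
    · simp
    · simp
    · simp
    · simp
    · rw [if_neg (by omega), if_neg (by omega), if_pos (by omega)]
      simp only [zero_mul, Finset.sum_const_zero, add_zero]
      exact (Finset.sum_eq_zero fun i _ => hbc i _ (by omega)).symm

@[simp] lemma db_tauW (i : Fin n) (k : ℕ) (X : FVect n) :
    db i k (tauW X) = if k = 0 then MvPolynomial.C (X i) else 0 := by
  simp only [tauW, map_sum, db_mul, db_C, zero_mul, zero_add, db_bVar]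
  rw [Finset.sum_eq_single i]
  · simp
  · intro j _ hj
    simp [hj.symm]
  · simp

@[simp] lemma dc_zero_tauW (i : Fin n) (X : FVect n) :
    dc i 0 (tauW X) = tauW fun k => pd i (X k) := by
  simp [tauW, dc_mul]

@[simp] lemma dc_succ_tauW (i : Fin n) (k : ℕ) (X : FVect n) : dc i (k + 1) (tauW X) = 0 := by
  simp [tauW, dc_mul]

@[simp] lemma db_tauForm (i : Fin n) (k : ℕ) (θ : FForm1 n) : db i k (tauForm θ) = 0 := by
  simp [tauForm, db_mul]

@[simp] lemma dc_zero_tauForm (i : Fin n) (θ : FForm1 n) :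
    dc i 0 (tauForm θ) = tauForm fun k => pd i (θ k) := by
  simp [tauForm, dc_mul]

@[simp] lemma dc_succ_tauForm (i : Fin n) (k : ℕ) (θ : FForm1 n) :
    dc i (k + 1) (tauForm θ) = if k = 0 then MvPolynomial.C (θ i) else 0 := by
  simp only [tauForm, map_sum, dc_mul, dc_succ_C, zero_mul, zero_add, dc_cVar]
  rw [Finset.sum_eq_single i]
  · simp
  · intro j _ hj
    simp [hj.symm]
  · simp

@[simp] lemma db_conformalVector (i : Fin n) (k : ℕ) :
    db i k (conformalVector n) = if k = 0 then cVar i 0 else 0 := by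
  simp only [conformalVector, map_sum, db_mul, db_bVar, db_cVar, mul_zero, add_zero]
  rw [Finset.sum_eq_single i]
  · simp
  · intro j _ hj
    simp [hj.symm]
  · simp

@[simp] lemma dc_conformalVector (i : Fin n) (k : ℕ) :
    dc i k (conformalVector n) = if k = 1 then bVar i 0 else 0 := by
  simp only [conformalVector, map_sum, dc_mul, dc_bVar, dc_cVar, zero_mul, zero_add]
  rw [Finset.sum_eq_single i]
  · simp
  · intro j _ hj
    simp [hj.symm]
  · simp

lemma transl_tauW (X : FVect n) : transl n (tauW X) =
    ∑ i, (cVar i 0 * tauW (fun k => pd i (X k)) + MvPolynomial.C (X i) * bVar i 1) := by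
  have h : ∀ i, transl n (MvPolynomial.C (X i) * bVar i 0) =
      ∑ j, cVar j 0 * (MvPolynomial.C (pd j (X i)) * bVar i 0) +
        MvPolynomial.C (X i) * bVar i 1 := fun i => by
    rw [isDeriv_transl, transl_C, transl_bVar, Nat.cast_zero, zero_add, one_smul, Finset.sum_mul]
    exact congrArg₂ _ (Finset.sum_congr rfl fun j _ => by ring) rfl
  simp only [tauW, map_sum, h, Finset.mul_sum]
  rw [Finset.sum_add_distrib, Finset.sum_add_distrib, Finset.sum_comm]

lemma transl_tauForm (θ : FForm1 n) : transl n (tauForm θ) =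
    ∑ i, (cVar i 0 * tauForm (fun k => pd i (θ k)) +
      (2 : ℂ) • (MvPolynomial.C (θ i) * cVar i 1)) := by
  have h : ∀ i, transl n (MvPolynomial.C (θ i) * cVar i 0) =
      ∑ j, cVar j 0 * (MvPolynomial.C (pd j (θ i)) * cVar i 0) +
        (2 : ℂ) • (MvPolynomial.C (θ i) * cVar i 1) := fun i => by
    rw [isDeriv_transl, transl_C, transl_cVar, Nat.cast_zero, zero_add, Finset.sum_mul,
      mul_smul_comm]
    exact congrArg₂ _ (Finset.sum_congr rfl fun j _ => by ring) rfl
  simp only [tauForm, map_sum, h, Finset.mul_sum]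
  rw [Finset.sum_add_distrib, Finset.sum_add_distrib, Finset.sum_comm]

lemma conformalVector_mem_dimSub : conformalVector n ∈ dimSub n 2 :=
  Submodule.sum_mem _ fun i _ => by
    simpa using mul_mem_dimSub (bVar_mem_dimSub i 0) (cVar_mem_dimSub i 0)

lemma tauW_mem_dimSub (X : FVect n) : tauW X ∈ dimSub n 1 :=
  Submodule.sum_mem _ fun i _ => by
    simpa using mul_mem_dimSub (C_mem_dimSub (X i)) (bVar_mem_dimSub i 0)

lemma tauForm_mem_dimSub (θ : FForm1 n) : tauForm θ ∈ dimSub n 1 :=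
  Submodule.sum_mem _ fun i _ => by
    simpa using mul_mem_dimSub (C_mem_dimSub (θ i)) (cVar_mem_dimSub i 0)

lemma mode_eq_zero_of_lt {a b m : ℤ} {v w : CDOhat n} (hv : v ∈ dimSub n a) (hw : w ∈ dimSub n b)
    (h : a + b ≤ m) : 𝓜 m v w = 0 :=
  eq_zero_of_mem_dimSub (by omega) (mode_mem_dimSub m hv hw)

lemma mode_zero_conformalVector {w : CDOhat n} (hb : ∀ i k, 1 ≤ k → db i k w = 0)
    (hc : ∀ i k, 2 ≤ k → dc i k w = 0) : 𝓜 0 (conformalVector n) w =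
      ∑ i, (bVar i 1 * db i 0 w + cVar i 0 * dc i 0 w + (2 : ℂ) • (cVar i 1 * dc i 1 w)) := by
  have := mode_conformalVector 0 hb hc
  simpa [divPow_one, divPow_zero] using this

lemma mode_one_conformalVector {w : CDOhat n} (hb : ∀ i k, 1 ≤ k → db i k w = 0)
    (hc : ∀ i k, 2 ≤ k → dc i k w = 0) : 𝓜 1 (conformalVector n) w =
      ∑ i, (bVar i 0 * db i 0 w + cVar i 0 * dc i 1 w) := by
  have := mode_conformalVector 1 hb hc
  simpa [divPow_of_neg, divPow_zero] using this

lemma mode_add_two_conformalVector (m : ℕ) {w : CDOhat n} (hb : ∀ i k, 1 ≤ k → db i k w = 0)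
    (hc : ∀ i k, 2 ≤ k → dc i k w = 0) : 𝓜 (m + 2) (conformalVector n) w =
      ∑ i, dc i m (db i 0 w) := by
  have := mode_conformalVector (m + 2) hb hc
  rw [divPow_of_neg _ (by omega), divPow_of_neg _ (by omega)] at this
  simpa using this

lemma db_tauW_of_pos {X : FVect n} (i : Fin n) (k : ℕ) (hk : 1 ≤ k) : db i k (tauW X) = 0 := by
  rw [db_tauW, if_neg (by omega)]

lemma dc_tauW_of_lt {X : FVect n} (i : Fin n) (k : ℕ) (hk : 2 ≤ k) : dc i k (tauW X) = 0 := by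
  obtain ⟨k, rfl⟩ : ∃ l, k = l + 1 := ⟨k - 1, by omega⟩
  rw [dc_succ_tauW]

lemma dc_tauForm_of_lt {θ : FForm1 n} (i : Fin n) (k : ℕ) (hk : 2 ≤ k) :
    dc i k (tauForm θ) = 0 := by
  obtain ⟨k, rfl⟩ : ∃ l, k = l + 1 := ⟨k - 1, by omega⟩
  rw [dc_succ_tauForm, if_neg (by omega)]

lemma conformalVector_mode_zero_tauW (X : FVect n) :
    𝓜 0 (conformalVector n) (tauW X) = transl n (tauW X) := by
  rw [mode_zero_conformalVector db_tauW_of_pos dc_tauW_of_lt, transl_tauW]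
  refine Finset.sum_congr rfl fun i _ => ?_
  rw [db_tauW, if_pos rfl, dc_zero_tauW, dc_succ_tauW i 0, mul_zero, smul_zero]
  ring

lemma conformalVector_mode_one_tauW (X : FVect n) :
    𝓜 1 (conformalVector n) (tauW X) = tauW X := by
  rw [mode_one_conformalVector db_tauW_of_pos dc_tauW_of_lt]
  refine Finset.sum_congr rfl fun i _ => ?_
  rw [db_tauW, if_pos rfl, dc_succ_tauW i 0, mul_zero]
  ring

/-- Contracting $b^i$ with the coefficient and $c^i$ with $b^j$ leaves $\partial_iX^i$. This failure
of vector fields to be primary is the origin of the obstruction. -/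
lemma conformalVector_mode_two_tauW (X : FVect n) :
    𝓜 2 (conformalVector n) (tauW X) = MvPolynomial.C (∑ i, pd i (X i)) := by
  have := mode_add_two_conformalVector 0 (db_tauW_of_pos (X := X)) dc_tauW_of_lt
  simpa using this

lemma conformalVector_mode_zero_tauForm (θ : FForm1 n) :
    𝓜 0 (conformalVector n) (tauForm θ) = transl n (tauForm θ) := by
  rw [mode_zero_conformalVector (by simp) dc_tauForm_of_lt, transl_tauForm]
  refine Finset.sum_congr rfl fun i _ => ?_
  rw [db_tauForm, dc_zero_tauForm, dc_succ_tauForm i 0, if_pos rfl, mul_zero, zero_add,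
    mul_comm (cVar i 1)]

lemma conformalVector_mode_one_tauForm (θ : FForm1 n) :
    𝓜 1 (conformalVector n) (tauForm θ) = tauForm θ := by
  rw [mode_one_conformalVector (by simp) dc_tauForm_of_lt]
  refine Finset.sum_congr rfl fun i _ => ?_
  rw [db_tauForm, dc_succ_tauForm i 0, if_pos rfl, mul_zero]
  ring

lemma conformalVector_mode_add_two_tauForm (m : ℕ) (θ : FForm1 n) :
    𝓜 (m + 2) (conformalVector n) (tauForm θ) = 0 := by
  rw [mode_add_two_conformalVector m (by simp) dc_tauForm_of_lt]
  simp

lemma conformalVector_isVirasoro : (cdoData n).IsVirasoro (2 * n) (conformalVector n) := by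
  have hb : ∀ (i : Fin n) k, 1 ≤ k → db i k (conformalVector n) = 0 := fun i k hk => by
    rw [db_conformalVector, if_neg (by omega)]
  have hc : ∀ (i : Fin n) k, 2 ≤ k → dc i k (conformalVector n) = 0 := fun i k hk => by
    rw [dc_conformalVector, if_neg (by omega)]
  refine ⟨?_, ?_, ?_, ?_, fun i hi => ?_⟩
  · rw [mode_zero_conformalVector hb hc]
    have h : ∀ i : Fin n, transl n (bVar i 0 * cVar i 0) =
        bVar i 1 * cVar i 0 + (2 : ℂ) • (cVar i 1 * bVar i 0) := fun i => by
      rw [isDeriv_transl, transl_bVar, transl_cVar, Nat.cast_zero, zero_add, zero_add, zero_add, one_smul,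
        mul_smul_comm, mul_comm (cVar i 1)]
    change _ = transl n (∑ i, bVar i 0 * cVar i 0)
    rw [map_sum]
    refine Finset.sum_congr rfl fun i _ => ?_
    rw [h, db_conformalVector, dc_conformalVector, dc_conformalVector, if_pos rfl, if_pos rfl,
      if_neg zero_ne_one, mul_zero, add_zero]
  · rw [mode_one_conformalVector hb hc]
    conv_rhs => rw [conformalVector, Finset.smul_sum]
    refine Finset.sum_congr rfl fun i _ => ?_
    rw [db_conformalVector, dc_conformalVector, if_pos rfl, if_pos rfl, two_smul,
      mul_comm (cVar i 0)]
  · simpa using mode_add_two_conformalVector 0 hb hc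
  -- The double contraction of $b^ic^i$ with itself is $1$ for each $i$; the sum $n$ is half of the
  -- central charge $2n$.
  · have := mode_add_two_conformalVector 1 hb hc
    rw [show ((1 : ℕ) : ℤ) + 2 = 3 by norm_num] at this
    rw [this]
    simp [Algebra.smul_def]
  · exact mode_eq_zero_of_lt conformalVector_mem_dimSub conformalVector_mem_dimSub (by omega)

/-- Every term of the contraction applies a $b$-derivative to one of the two factors. -/
lemma contraction_eq_zero {v w : CDOhat n} (hv : ∀ i k, db i k v = 0) (hw : ∀ i k, db i k w = 0)
    (e : ℕ) : contraction n e (v ⊗ₜ w) = 0 := by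
  cases e with
  | zero => rfl
  | succ e => simp [contraction_succ_tmul, hv, hw]

/-- Vectors without `b` have no singular operator products. -/
lemma mode_of_db_eq_zero {v w : CDOhat n} (hv : ∀ i k, db i k v = 0) (hw : ∀ i k, db i k w = 0)
    {m : ℤ} (hm : 0 ≤ m) : 𝓜 m v w = 0 := by
  have h := W_of_contraction_eq_zero (contraction_eq_zero hv hw)
  rw [WickData.mode, WickData.Y_eq_sum (K := 1) (fun d hd => by rw [h, if_neg (by omega)]),
    Finset.sum_range_one, divPow_of_neg _ (by push_cast; omega)]
  simp

lemma db_transl_tauForm (i : Fin n) (k : ℕ) (θ : FForm1 n) :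
    db i k (transl n (tauForm θ)) = 0 := by
  have := LinearMap.congr_fun (db_transl i k) (tauForm θ)
  simpa using this

lemma transl_C_eq_tauForm (f : Ohat n) : transl n (MvPolynomial.C f) = tauForm (dFun f) :=
  transl_C f

/-- The zero modes of vector fields act on one-forms by the Lie derivative. -/
lemma tauW_mode_zero_tauForm (X : FVect n) (θ : FForm1 n) :
    𝓜 0 (tauW X) (tauForm θ) = tauForm (lie1 X θ) := by
  have hW : ∀ d, (cdoData n).W d (tauW X ⊗ₜ tauForm θ) = (if d = 0 then tauW X ⊗ₜ tauForm θ else 0) +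
      ∑ i, MvPolynomial.C (X i) ⊗ₜ[ℂ] bContr i d (tauForm θ) := by
    intro d
    have h1 : ∀ i d, (cdoData n).W d (MvPolynomial.C (X i) ⊗ₜ tauForm θ) = _ := fun i d =>
      W_of_contraction_eq_zero (contraction_eq_zero (by simp) (by simp)) d
    have h2 : ∀ i, (cdoData n).W d ((MvPolynomial.C (X i) * bVar i 0) ⊗ₜ tauForm θ) =
        (if d = 0 then (MvPolynomial.C (X i) * bVar i 0) ⊗ₜ tauForm θ else 0) +
          MvPolynomial.C (X i) ⊗ₜ[ℂ] bContr i d (tauForm θ) := by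
      intro i
      rw [mul_comm, W_bVar_mul, h1]
      simp only [h1, apply_ite (TensorProduct.map _ _), map_zero, TensorProduct.map_tmul,
        LinearMap.id_apply, LinearMap.mulLeft_apply,
        sum_antidiagonal_ite d fun k => MvPolynomial.C (X i) ⊗ₜ[ℂ] bContr i k (tauForm θ)]
    rw [tauW, TensorProduct.sum_tmul, map_sum, Finset.sum_congr rfl fun i _ => h2 i,
      Finset.sum_add_distrib]
    split_ifs <;> simp
  have hb : ∀ i d, 3 ≤ d → bContr i d (tauForm θ) = 0 := by
    intro i d hd
    obtain ⟨e, rfl⟩ : ∃ e, d = e + 1 := ⟨d - 1, by omega⟩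
    exact dc_tauForm_of_lt i e (by omega)
  rw [WickData.mode, WickData.Y_eq_sum (K := 3) fun d hd => by
    rw [hW, if_neg (by omega)]; simp [hb _ _ hd]]
  have h1 := fun i => dc_zero_tauForm i θ
  have h2 := fun i => dc_succ_tauForm i 0 θ
  simp only [hW, Finset.sum_range_succ, Finset.sum_range_zero, map_add, map_sum]
  simp only [zero_add, ↓reduceIte, OfNat.ofNat_ne_zero, one_ne_zero, map_zero,
    TensorProduct.map_tmul, LinearMap.mul'_apply, LinearMap.id_apply, bContr, h1, h2,
    LinearMap.zero_apply, TensorProduct.tmul_zero, Finset.sum_const_zero, add_zero]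
  -- Degree $1$ gives $X^i\partial_i\theta$, since $b$ is contracted with the coefficients; degree
  -- $2$ gives $T(X^i)\theta_i=\theta_i\,dX^i$, since $b$ is contracted with $dc$. Together they
  -- form the Lie derivative.
  rw [divPow_of_neg _ (show ((0 : ℕ) : ℤ) - 1 - 0 < 0 by norm_num),
    show ((1 : ℕ) : ℤ) - 1 - 0 = 0 by norm_num, show ((2 : ℕ) : ℤ) - 1 - 0 = 1 by norm_num,
    divPow_zero, divPow_one]
  have h3 : (cdoData n).T = transl n := rfl
  simp only [LinearMap.zero_apply, zero_mul, Module.End.one_apply, h3, transl_C]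
  have h4 : ∀ k, MvPolynomial.C (lie1 X θ k) * cVar k 0 = ∑ i : Fin n, (MvPolynomial.C (X i) *
      (MvPolynomial.C (pd i (θ k)) * cVar k 0) +
        MvPolynomial.C (pd k (X i)) * cVar k 0 * MvPolynomial.C (θ i)) := fun k => by
    rw [lie1, map_sum, Finset.sum_mul]
    refine Finset.sum_congr rfl fun i _ => ?_
    rw [map_add, map_mul, map_mul]
    ring
  rw [tauForm, Finset.sum_congr rfl fun k _ => h4 k, Finset.sum_comm, zero_add,
    ← Finset.sum_add_distrib]
  refine Finset.sum_congr rfl fun i _ => ?_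
  rw [Finset.sum_add_distrib, tauForm, Finset.mul_sum, Finset.sum_mul]

lemma conformalVector_mode_tauForm_of_two_le {m : ℤ} (hm : 2 ≤ m) (θ : FForm1 n) :
    𝓜 m (conformalVector n) (tauForm θ) = 0 := by
  have := conformalVector_mode_add_two_tauForm (m - 2).toNat θ
  rwa [show ((m - 2).toNat : ℤ) + 2 = m by omega] at this

lemma conformalVector_mode_tauW_of_three_le {m : ℤ} (hm : 3 ≤ m) (X : FVect n) :
    𝓜 m (conformalVector n) (tauW X) = 0 :=
  mode_eq_zero_of_lt conformalVector_mem_dimSub (tauW_mem_dimSub X) (by omega)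

/-- One-forms are primary of weight one, so skew-symmetry gives $-T\theta+T\theta=0$. -/
lemma tauForm_mode_zero_conformalVector (θ : FForm1 n) :
    𝓜 0 (tauForm θ) (conformalVector n) = 0 := by
  obtain ⟨J, hJ⟩ := cdo_isTranslationCovariant.mode_skew 0 (tauForm θ) (conformalVector n)
  rw [hJ (J + 2) (by omega), add_comm J, Finset.sum_range_add, Finset.sum_eq_zero (s := Finset.range J)]
  · simp [Finset.sum_range_succ, conformalVector_mode_zero_tauForm,
      conformalVector_mode_one_tauForm]
    exact add_neg_cancel (transl n (tauForm θ))
  · intro j _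
    rw [conformalVector_mode_tauForm_of_two_le (by push_cast; omega), map_zero, smul_zero]

lemma tauForm_mode_one_conformalVector (θ : FForm1 n) :
    𝓜 1 (tauForm θ) (conformalVector n) = tauForm θ := by
  obtain ⟨J, hJ⟩ := cdo_isTranslationCovariant.mode_skew 1 (tauForm θ) (conformalVector n)
  rw [hJ (J + 1) (by omega), add_comm J, Finset.sum_range_add, Finset.sum_eq_zero (s := Finset.range J)]
  · simp [conformalVector_mode_one_tauForm]
  · intro j _
    rw [conformalVector_mode_tauForm_of_two_le (by push_cast; omega), map_zero, smul_zero]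

lemma tauForm_mode_conformalVector_of_two_le {m : ℤ} (hm : 2 ≤ m) (θ : FForm1 n) :
    𝓜 m (tauForm θ) (conformalVector n) = 0 := by
  obtain ⟨J, hJ⟩ := cdo_isTranslationCovariant.mode_skew m (tauForm θ) (conformalVector n)
  rw [hJ J le_rfl]
  refine Finset.sum_eq_zero fun j _ => ?_
  rw [conformalVector_mode_tauForm_of_two_le (by omega), map_zero, smul_zero]

/-- The zero modes of vector fields do not preserve the conformal vector. -/
lemma tauW_mode_zero_conformalVector (X : FVect n) : 𝓜 0 (tauW X) (conformalVector n) =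
    (-(1 / 2) : ℂ) • transl n (tauForm (gfC1 X)) := by
  obtain ⟨J, hJ⟩ := cdo_isTranslationCovariant.mode_skew 0 (tauW X) (conformalVector n)
  rw [hJ (J + 3) (by omega), add_comm J, Finset.sum_range_add, Finset.sum_eq_zero (s := Finset.range J)]
  -- Skew-symmetry gives $-L_{(0)}X+TL_{(1)}X-\tfrac12T^2L_{(2)}X$. The first two terms cancel; in
  -- the third, one $T$ turns the divergence into its differential.
  · have h2 : divPow (cdoData n).T 2 = (1 / 2 : ℂ) • transl n ^ 2 := by
      rw [show (2 : ℤ) = ((2 : ℕ) : ℤ) by norm_num, divPow_natCast]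
      norm_num [Nat.factorial]
      rfl
    simp [Finset.sum_range_succ, conformalVector_mode_zero_tauW,
      conformalVector_mode_one_tauW, conformalVector_mode_two_tauW, h2, pow_two]
    rw [show (cdoData n).T = transl n from rfl, add_neg_cancel, add_zero, gfC1,
      ← transl_C_eq_tauForm, map_sum MvPolynomial.C, map_sum, map_sum, Finset.smul_sum]
  · intro j _
    rw [conformalVector_mode_tauW_of_three_le (by push_cast; omega), map_zero, smul_zero]

lemma extAct_eq (X : FVect n) (B : FForm2 n) (v : CDOhat n) : extAct X B v =
    𝓜 0 (tauW X) v - 𝓜 0 (tauForm (primitive B)) v := by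
  rw [cdoData_mode, cdoData_mode]
  rfl

lemma extAct_conformalVector (X : FVect n) (B : FForm2 n) :
    extAct X B (conformalVector n) = (-(1 / 2) : ℂ) • transl n (tauForm (gfC1 X)) := by
  rw [extAct_eq, tauW_mode_zero_conformalVector, tauForm_mode_zero_conformalVector, sub_zero]

/-- The zero modes of functions. -/
lemma C_mode_zero (f : Ohat n) {v : CDOhat n} (hv : HasDim 1 v) :
    𝓜 0 (MvPolynomial.C f) v = -MvPolynomial.C (pair (dFun f) (toVect v)) := by
  have hv' : v ∈ dimSub n 1 := hasDim_iff.1 hv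
  -- The total dimension is one, so there is at most a single contraction, and only the one of
  -- degree $1$ matters.
  have hK : ∀ d, 2 ≤ d → (cdoData n).W d (MvPolynomial.C f ⊗ₜ v) = 0 := fun d hd =>
    eq_zero_of_mem_dimSub₂ (by push_cast; omega)
      (W_mem_dimSub₂ d (tmul_mem_dimSub₂ rfl (C_mem_dimSub f) hv'))
  have hdb : ∀ i, db i 0 v = MvPolynomial.C (toVect v i) := by
    intro i
    have h0 := db_mem_dimSub i 0 hv'
    ext1 d
    rw [MvPolynomial.coeff_C]
    split_ifs with hd
    · subst hd
      rw [show db i 0 v = MvPolynomial.pderiv (Sum.inl (i, 0)) v from rfl,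
        MvPolynomial.coeff_pderiv]
      simp [toVect]
    · by_contra hne
      have h1 := h0 d hne
      have h2 : Finsupp.weight wt d = 0 := by push_cast at h1; omega
      refine hd (Finsupp.ext fun x => ?_)
      have h3 := Finsupp.le_weight wt (s := x) (by rcases x with (⟨i, k⟩ | ⟨i, k⟩) <;> simp [wt]) d
      rw [Finsupp.zero_apply]
      omega
  have hW1 : (cdoData n).W 1 (MvPolynomial.C f ⊗ₜ v) = contraction n 1 (MvPolynomial.C f ⊗ₜ v) := by
    rw [cdoData_W, wick]
    simp [Finset.sum_range_succ, PowerSeries.coeff_one]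
  rw [WickData.mode, WickData.Y_eq_sum hK]
  simp only [Finset.sum_range_succ, Finset.sum_range_zero, zero_add]
  rw [divPow_of_neg _ (show ((0 : ℕ) : ℤ) - 1 - 0 < 0 by norm_num),
    show ((1 : ℕ) : ℤ) - 1 - 0 = 0 by norm_num, divPow_zero, hW1, contraction_succ_tmul]
  simp [hdb, pair, dFun]

/-- With $f=\operatorname{div}Y$ the vector is $-\tfrac12T^2f$. Since $(T^2f)_{(2)}=2f_{(0)}$ and
$f_{(0)}v=-\langle df,\bar v\rangle$, the factors combine to $1$. -/
theorem mode_two_extAct_conformalVector (Y : FVect n) (B : FForm2 n) {v : CDOhat n}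
    (hv : HasDim 1 v) : 𝓜 2 (extAct Y B (conformalVector n)) v =
      MvPolynomial.C (pair (gfC1 Y) (toVect v)) := by
  have h3 : (cdoData n).T = transl n := rfl
  rw [extAct_conformalVector, cdo_isTranslationCovariant.mode_smul_left, gfC1, ← transl_C_eq_tauForm, ← h3,
    cdo_isTranslationCovariant.mode_T_left, cdo_isTranslationCovariant.mode_T_left, show (2 - 1 - 1 : ℤ) = 0 by norm_num, C_mode_zero _ hv]
  simp only [smul_neg, smul_smul]
  norm_num

/-- The derivative of $T\big(\sum\theta_i\,c^i_{-1}\big)$ by $c^i_{-2}$ is $2\theta_i$, because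
$Tc_{-1}=2c_{-2}$. -/
lemma tauForm_injective {θ : FForm1 n} (h : transl n (tauForm θ) = 0) : θ = 0 := by
  funext i
  have h1 := congrArg (fun v => dc i 2 v) h
  simp only [map_zero] at h1
  have h2 := LinearMap.congr_fun (dc_transl_succ i 1) (tauForm θ)
  simp only [Module.End.mul_apply, LinearMap.add_apply, LinearMap.smul_apply,
    dc_succ_tauForm] at h2
  rw [h2, if_neg one_ne_zero, map_zero, zero_add] at h1
  simp only [↓reduceIte] at h1
  have h3 := (smul_eq_zero.1 h1).resolve_left (by norm_num)
  exact (MvPolynomial.C_injective _ _) (h3.trans (map_zero MvPolynomial.C).symm)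

theorem extAct_conformalVector_eq_zero_iff (Y : FVect n) (B : FForm2 n) :
    extAct Y B (conformalVector n) = 0 ↔ gfC1 Y = 0 := by
  rw [extAct_conformalVector]
  constructor
  · intro h
    exact tauForm_injective ((smul_eq_zero.1 h).resolve_left (by norm_num))
  · intro h
    simp [h, tauForm]

/-- The divergence satisfies
$\operatorname{div}[Y,Z]=Y(\operatorname{div}Z)-Z(\operatorname{div}Y)$, and the de Rham
differential commutes with Lie derivatives. -/
theorem gfC1_bracket (Y Z : FVect n) :
    gfC1 (bracket Y Z) = lie1 Y (gfC1 Z) - lie1 Z (gfC1 Y) := by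
  have h : ∑ i, pd i (bracket Y Z i) =
      ∑ k, (Y k * pd k (∑ i, pd i (Z i)) - Z k * pd k (∑ i, pd i (Y i))) := by
    have e1 : ∀ i, pd i (bracket Y Z i) = ∑ k, (Y k * pd k (pd i (Z i)) - Z k * pd k (pd i (Y i))) +
        (∑ k, pd i (Y k) * pd k (Z i) - ∑ k, pd k (Y i) * pd i (Z k)) := fun i => by
      rw [bracket, map_sum, ← Finset.sum_sub_distrib, ← Finset.sum_add_distrib]
      refine Finset.sum_congr rfl fun k _ => ?_
      rw [map_sub, pd_mul, pd_mul, pd_comm i k, pd_comm i k]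
      ring
    -- The terms with two first derivatives are traces of the two products of the Jacobians of $Y$
    -- and $Z$; they cancel after the indices are exchanged.
    rw [Finset.sum_congr rfl fun i _ => e1 i, Finset.sum_add_distrib, Finset.sum_sub_distrib,
      Finset.sum_comm (f := fun i k => pd k (Y i) * pd i (Z k)), sub_self, add_zero,
      Finset.sum_comm]
    refine Finset.sum_congr rfl fun k _ => ?_
    rw [map_sum, map_sum, Finset.mul_sum, Finset.mul_sum, Finset.sum_sub_distrib]
  funext j
  rw [gfC1, h, Pi.sub_apply, lie1, lie1, ← Finset.sum_sub_distrib, dFun, map_sum]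
  refine Finset.sum_congr rfl fun k _ => ?_
  simp only [gfC1, dFun]
  rw [map_sub, pd_mul, pd_mul, pd_comm j k, pd_comm j k]
  ring

/-- The conformal vector corrected by a one-form. -/
def shiftedConformalVector (ξ : FForm1 n) : CDOhat n :=
  conformalVector n + (1 / 2 : ℂ) • transl n (tauForm ξ)

lemma shiftedConformalVector_mem_dimSub (ξ : FForm1 n) :
    shiftedConformalVector ξ ∈ dimSub n 2 :=
  Submodule.add_mem _ conformalVector_mem_dimSub
    (Submodule.smul_mem _ _ (transl_mem_dimSub (tauForm_mem_dimSub ξ)))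

/-- The term quadratic in $\xi$ contains no $b$ and hence has no singular part. Only the two cross
terms remain, and the translation rules remove $T$ from their arguments. -/
lemma mode_shiftedConformalVector {m : ℤ} (hm : 0 ≤ m) (ξ : FForm1 n) :
    𝓜 m (shiftedConformalVector ξ) (shiftedConformalVector ξ) =
      𝓜 m (conformalVector n) (conformalVector n) +
        (1 / 2 : ℂ) • transl n (𝓜 m (conformalVector n) (tauForm ξ)) +
        (m / 2 : ℂ) • 𝓜 (m - 1) (conformalVector n) (tauForm ξ) -
        (m / 2 : ℂ) • 𝓜 (m - 1) (tauForm ξ) (conformalVector n) := by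
  have h3 : (cdoData n).T = transl n := rfl
  have h1 : 𝓜 m (conformalVector n) (transl n (tauForm ξ)) =
      transl n (𝓜 m (conformalVector n) (tauForm ξ)) +
        (m : ℂ) • 𝓜 (m - 1) (conformalVector n) (tauForm ξ) := by
    rw [← h3, cdo_isTranslationCovariant.T_mode]
    module
  have h2 : 𝓜 m (transl n (tauForm ξ)) (conformalVector n) =
      (-m : ℂ) • 𝓜 (m - 1) (tauForm ξ) (conformalVector n) := by
    rw [← h3, cdo_isTranslationCovariant.mode_T_left]
  rw [shiftedConformalVector, cdo_isTranslationCovariant.mode_add_left, cdo_isTranslationCovariant.mode_add_right, cdo_isTranslationCovariant.mode_add_right,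
    cdo_isTranslationCovariant.mode_smul_left, cdo_isTranslationCovariant.mode_smul_left, cdo_isTranslationCovariant.mode_smul_right, cdo_isTranslationCovariant.mode_smul_right,
    mode_of_db_eq_zero (fun i k => db_transl_tauForm i k ξ) (fun i k => db_transl_tauForm i k ξ) hm,
    h1, h2]
  module

/-- The cross terms combine correctly because $\xi$ is primary of weight one. In the mode $2$ they
cancel, and in the mode $3$ they vanish, so the central charge does not change. -/
theorem shiftedConformalVector_isVirasoro (ξ : FForm1 n) :
    (cdoData n).IsVirasoro (2 * n) (shiftedConformalVector ξ) := by
  have h3 : (cdoData n).T = transl n := rfl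
  have hL := conformalVector_isVirasoro (n := n)
  refine ⟨?_, ?_, ?_, ?_, fun i hi => ?_⟩
  · rw [mode_shiftedConformalVector (by norm_num), hL.mode_zero, conformalVector_mode_zero_tauForm]
    simp [shiftedConformalVector, h3]
  · rw [mode_shiftedConformalVector (by norm_num), hL.mode_one, conformalVector_mode_one_tauForm]
    simp only [sub_self, conformalVector_mode_zero_tauForm, tauForm_mode_zero_conformalVector,
      shiftedConformalVector, Int.cast_one]
    module
  · rw [mode_shiftedConformalVector (by norm_num), hL.mode_two,
      conformalVector_mode_tauForm_of_two_le le_rfl, show (2 - 1 : ℤ) = 1 by norm_num,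
      conformalVector_mode_one_tauForm, tauForm_mode_one_conformalVector]
    simp
  · rw [mode_shiftedConformalVector (by norm_num), hL.mode_three,
      conformalVector_mode_tauForm_of_two_le (by norm_num),
      conformalVector_mode_tauForm_of_two_le (by norm_num),
      tauForm_mode_conformalVector_of_two_le (by norm_num)]
    simp
  · exact mode_eq_zero_of_lt (shiftedConformalVector_mem_dimSub ξ)
      (shiftedConformalVector_mem_dimSub ξ) (by omega)

/-- The zero modes on the corrected conformal vectors. -/
lemma extAct_shiftedConformalVector (X : FVect n) (B : FForm2 n) (ξ : FForm1 n) :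
    extAct X B (shiftedConformalVector ξ) =
      (1 / 2 : ℂ) • transl n (tauForm (lie1 X ξ - gfC1 X)) := by
  have h3 : (cdoData n).T = transl n := rfl
  have h4 : 𝓜 0 (tauW X) (transl n (tauForm ξ)) = transl n (tauForm (lie1 X ξ)) := by
    rw [← tauW_mode_zero_tauForm, ← h3, cdo_isTranslationCovariant.T_mode]
    simp
  have h5 : 𝓜 0 (tauForm (primitive B)) (transl n (tauForm ξ)) = 0 :=
    mode_of_db_eq_zero (fun i k => db_tauForm i k _) (fun i k => db_transl_tauForm i k _) le_rfl
  have h6 : tauForm (lie1 X ξ - gfC1 X) = tauForm (lie1 X ξ) - tauForm (gfC1 X) := by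
    simp [tauForm, sub_mul]
  rw [extAct_eq, shiftedConformalVector, cdo_isTranslationCovariant.mode_add_right, cdo_isTranslationCovariant.mode_add_right,
    cdo_isTranslationCovariant.mode_smul_right, cdo_isTranslationCovariant.mode_smul_right, h4, h5, tauW_mode_zero_conformalVector,
    tauForm_mode_zero_conformalVector, h6, map_sub]
  module

/-! ### The chain rule for formal power series -/

lemma hasSubst_of_zero {a : Fin n → Ohat n} (ha : ∀ i, MvPowerSeries.constantCoeff (a i) = 0) :
    MvPowerSeries.HasSubst a := MvPowerSeries.hasSubst_of_constantCoeff_zero ha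

lemma le_order_subst_of_le {a : Fin n → Ohat n}
    (ha : ∀ i, MvPowerSeries.constantCoeff (a i) = 0) {f : Ohat n} {N : ℕ}
    (hf : (N : ℕ∞) ≤ f.order) : (N : ℕ∞) ≤ (f.subst a).order := by
  refine le_trans ?_ (MvPowerSeries.le_order_subst (hasSubst_of_zero ha) f)
  calc (N : ℕ∞) = 1 * N := (one_mul _).symm
    _ ≤ _ := mul_le_mul' (le_iInf fun i =>
      MvPowerSeries.one_le_order_iff_constCoeff_eq_zero.2 (ha i)) hf

lemma le_order_pd {f : Ohat n} {N : ℕ} (hf : ((N + 1 : ℕ) : ℕ∞) ≤ f.order) (k : Fin n) :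
    (N : ℕ∞) ≤ (pd k f).order := by
  refine MvPowerSeries.nat_le_order fun d hd => ?_
  rw [coeff_pd, MvPowerSeries.coeff_of_lt_order, zero_mul]
  refine lt_of_lt_of_le ?_ hf
  rw [map_add, Finsupp.degree_single]
  exact_mod_cast Nat.add_lt_add_right hd 1

/-- The chain rule for the substitution of formal power series. -/
theorem pd_subst {a : Fin n → Ohat n} (ha : ∀ i, MvPowerSeries.constantCoeff (a i) = 0)
    (k : Fin n) (f : Ohat n) :
    pd k (f.subst a) = ∑ j, (pd j f).subst a * pd k (a j) := by
  have hs := hasSubst_of_zero ha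
  -- The defect of the chain rule. It is a derivation along the substitution and kills constants and
  -- variables, hence all polynomials.
  let D : Ohat n →ₗ[ℂ] Ohat n := pd k ∘ₗ (MvPowerSeries.substAlgHom hs).toLinearMap -
    ∑ j, (LinearMap.mulRight ℂ (pd k (a j))) ∘ₗ (MvPowerSeries.substAlgHom hs).toLinearMap ∘ₗ pd j
  have hD : ∀ g, D g = pd k (g.subst a) - ∑ j, (pd j g).subst a * pd k (a j) := by
    intro g
    simp only [D, LinearMap.sub_apply, LinearMap.comp_apply, AlgHom.toLinearMap_apply,
      MvPowerSeries.coe_substAlgHom, LinearMap.sum_apply, LinearMap.mulRight_apply]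
  have hmul : ∀ g h, D (g * h) = D g * h.subst a + g.subst a * D h := by
    intro g h
    simp only [hD, pd_mul, MvPowerSeries.subst_mul hs, MvPowerSeries.subst_add hs, add_mul,
      Finset.sum_add_distrib, sub_mul, mul_sub, Finset.sum_mul, Finset.mul_sum]
    have h1 : ∀ j, (pd j g).subst a * h.subst a * pd k (a j) =
        (pd j g).subst a * pd k (a j) * h.subst a := fun j => by ring
    have h2 : ∀ j, g.subst a * (pd j h).subst a * pd k (a j) =
        g.subst a * ((pd j h).subst a * pd k (a j)) := fun j => by ring
    simp only [h1, h2]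
    ring
  have hC : ∀ z : ℂ, D (MvPowerSeries.C z) = 0 := by
    intro z
    have h0 : (MvPowerSeries.C z : Ohat n).subst a = MvPowerSeries.C z := by
      rw [MvPowerSeries.subst_C]
    have h1 : (0 : Ohat n).subst a = 0 := by
      rw [← MvPowerSeries.coe_substAlgHom hs, map_zero]
    rw [hD, h0]
    simp [h1]
  have hX : ∀ i, D (MvPowerSeries.X i) = 0 := by
    intro i
    have h1 : (1 : Ohat n).subst a = 1 := by
      rw [← MvPowerSeries.coe_substAlgHom hs, map_one]
    have h0 : (0 : Ohat n).subst a = 0 := by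
      rw [← MvPowerSeries.coe_substAlgHom hs, map_zero]
    rw [hD, MvPowerSeries.subst_X hs]
    simp [pd_X, apply_ite (MvPowerSeries.subst a), h0, h1]
  have hp : ∀ p : MvPolynomial (Fin n) ℂ, D (p : Ohat n) = 0 := by
    intro p
    induction p using MvPolynomial.induction_on with
    | C z => rw [MvPolynomial.coe_C]; exact hC z
    | add p q hp hq => rw [MvPolynomial.coe_add, map_add, hp, hq, add_zero]
    | mul_X p i hp =>
      rw [MvPolynomial.coe_mul, MvPolynomial.coe_X, hmul, hp, hX, zero_mul, mul_zero, add_zero]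
  suffices h : D f = 0 by rw [hD] at h; exact sub_eq_zero.1 h
  ext e
  -- The defect lowers the order by at most one, so the part of $f$ of degree at least $\deg e+2$
  -- does not affect the coefficient `e`.
  set p := MvPowerSeries.truncTotal (e.degree + 2) f
  have hr : ((e.degree + 1 + 1 : ℕ) : ℕ∞) ≤ (f - (p : Ohat n)).order := by
    refine MvPowerSeries.nat_le_order fun d hd => ?_
    rw [map_sub, MvPolynomial.coeff_coe, MvPowerSeries.coeff_truncTotal _ hd, sub_self]
  have h1 : D f = D (f - (p : Ohat n)) := by rw [map_sub, hp, sub_zero]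
  rw [h1, map_zero]
  have hlt : ((e.degree : ℕ) : ℕ∞) < ((e.degree + 1 : ℕ) : ℕ∞) := by
    exact_mod_cast Nat.lt_succ_self _
  rw [hD, map_sub, map_sum, MvPowerSeries.coeff_of_lt_order (lt_of_lt_of_le hlt
    (le_order_pd (le_order_subst_of_le ha hr) k)), zero_sub, neg_eq_zero]
  refine Finset.sum_eq_zero fun j _ => MvPowerSeries.coeff_of_lt_order (lt_of_lt_of_le hlt ?_)
  exact (le_order_subst_of_le ha (le_order_pd hr j)).trans
    (le_self_add.trans MvPowerSeries.le_order_mul)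

/-! ### Linear changes of coordinates -/

section
variable (J : Matrix (Fin n) (Fin n) ℂ)

lemma pd_linSubst (k : Fin n) (f : Ohat n) :
    pd k (linSubst J f) = ∑ j, MvPowerSeries.C (J j k) * linSubst J (pd j f) := by
  have := pd_subst (a := fun i : Fin n =>
    (∑ k, MvPowerSeries.C (J i k) * MvPowerSeries.X k : Ohat n)) (fun i => by simp [map_sum]) k f
  rw [linSubst, MvPowerSeries.coe_substAlgHom, this]
  refine Finset.sum_congr rfl fun j _ => ?_
  rw [mul_comm]
  congr 1
  simp [pd_mul, pd_X]

lemma linSubst_C (z : ℂ) : linSubst J (MvPowerSeries.C z) = MvPowerSeries.C z :=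
  (linSubst J).commutes z

/-- The pull-back of a one-form along `t ↦ J t`. -/
def linPull1 (θ : FForm1 n) : FForm1 n := fun k => ∑ i, MvPowerSeries.C (J i k) * linSubst J (θ i)

@[simp] lemma glAct_C (f : Ohat n) : glAct J (MvPolynomial.C f) = MvPolynomial.C (linSubst J f) := by
  simp [glAct]

@[simp] lemma glAct_bVar (i : Fin n) (k : ℕ) : glAct J (bVar i k) =
    ∑ j, MvPolynomial.C (MvPowerSeries.C (J⁻¹ j i)) * bVar j k := by
  simp [glAct, bVar]

@[simp] lemma glAct_cVar (i : Fin n) (k : ℕ) : glAct J (cVar i k) =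
    ∑ j, MvPolynomial.C (MvPowerSeries.C (J i j)) * cVar j k := by
  simp [glAct, cVar]

lemma C_C_mul (z : ℂ) (v : CDOhat n) : MvPolynomial.C (MvPowerSeries.C z) * v = z • v := by
  rw [Algebra.smul_def]
  rfl

/-- The action of a linear coordinate change as a linear map. -/
def glLin : CDOhat n →ₗ[ℂ] CDOhat n where
  toFun := glAct J
  map_add' := map_add _
  map_smul' z v := by
    rw [← C_C_mul, map_mul, glAct_C, linSubst_C, C_C_mul]
    rfl

lemma glLin_apply (v : CDOhat n) : glLin J v = glAct J v := rfl

lemma glLin_ext {D E : Module.End ℂ (CDOhat n)}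
    (hD : ∀ v w, D (v * w) = D v * glAct J w + glAct J v * D w)
    (hE : ∀ v w, E (v * w) = E v * glAct J w + glAct J v * E w)
    (hC : ∀ f, D (MvPolynomial.C f) = E (MvPolynomial.C f))
    (hb : ∀ i k, D (bVar i k) = E (bVar i k)) (hc : ∀ i k, D (cVar i k) = E (cVar i k)) :
    D = E := by
  refine LinearMap.ext fun v => ?_
  induction v using MvPolynomial.induction_on with
  | C f => exact hC f
  | add p q hp hq => rw [map_add, map_add, hp, hq]
  | mul_X p x hp =>
    have : D (MvPolynomial.X x) = E (MvPolynomial.X x) := by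
      rcases x with (⟨i, k⟩ | ⟨i, k⟩); exacts [hb i k, hc i k]
    rw [hD, hE, hp, this]

lemma IsDeriv.mul_glLin {D : Module.End ℂ (CDOhat n)} (hD : IsDeriv D) (v w : CDOhat n) :
    (D * glLin J) (v * w) = (D * glLin J) v * glAct J w + glAct J v * (D * glLin J) w := by
  simp only [Module.End.mul_apply, glLin_apply, map_mul, hD _ _]

lemma IsDeriv.glLin_mul {D : Module.End ℂ (CDOhat n)} (hD : IsDeriv D) (v w : CDOhat n) :
    (glLin J * D) (v * w) = (glLin J * D) v * glAct J w + glAct J v * (glLin J * D) w := by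
  simp only [Module.End.mul_apply, glLin_apply, hD _ _, map_add, map_mul]

lemma IsDeriv.sum_glLin_mul {D : Fin n → Module.End ℂ (CDOhat n)} (hD : ∀ i, IsDeriv (D i))
    (c : Fin n → ℂ) (v w : CDOhat n) : (∑ j, c j • (glLin J * D j)) (v * w) =
      (∑ j, c j • (glLin J * D j)) v * glAct J w + glAct J v * (∑ j, c j • (glLin J * D j)) w := by
  simp only [LinearMap.sum_apply, LinearMap.smul_apply, (hD _).glLin_mul, smul_add,
    Finset.sum_add_distrib, Finset.sum_mul, Finset.mul_sum, smul_mul_assoc, mul_smul_comm]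

lemma transl_glLin : transl n * glLin J = glLin J * transl n := by
  refine glLin_ext J (isDeriv_transl.mul_glLin J) (isDeriv_transl.glLin_mul J) (fun f => ?_)
    (fun i k => ?_) fun i k => ?_
  · simp only [Module.End.mul_apply, glLin_apply, glAct_C, transl_C, map_sum, map_mul, pd_linSubst,
      glAct_cVar, Finset.sum_mul, Finset.mul_sum]
    rw [Finset.sum_comm]
    exact Finset.sum_congr rfl fun i _ => Finset.sum_congr rfl fun j _ => by ring
  · simp only [Module.End.mul_apply, glLin_apply, glAct_bVar, transl_bVar, map_sum, C_C_mul,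
      map_smul]
    rw [Finset.smul_sum]
    exact Finset.sum_congr rfl fun j _ => smul_comm ..
  · simp only [Module.End.mul_apply, glLin_apply, glAct_cVar, transl_cVar, map_sum, C_C_mul,
      map_smul]
    rw [Finset.smul_sum]
    exact Finset.sum_congr rfl fun j _ => smul_comm ..

lemma db_glLin (i : Fin n) (k : ℕ) :
    db i k * glLin J = ∑ j, J⁻¹ i j • (glLin J * db j k) := by
  refine glLin_ext J ((isDeriv_db i k).mul_glLin J)
    (IsDeriv.sum_glLin_mul J (fun j => isDeriv_db j k) _) (fun f => ?_) (fun l m => ?_) fun l m => ?_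
  · simp [glLin_apply, LinearMap.sum_apply]
  · simp only [Module.End.mul_apply, glLin_apply, glAct_bVar, C_C_mul, map_sum, map_smul, db_bVar,
      LinearMap.sum_apply, LinearMap.smul_apply, apply_ite (glAct J), map_one, map_zero, ite_and,
      smul_ite, smul_zero]
    simp
  · simp [glLin_apply, LinearMap.sum_apply, C_C_mul]

lemma dc_glLin (i : Fin n) (k : ℕ) :
    dc i k * glLin J = ∑ j, J j i • (glLin J * dc j k) := by
  refine glLin_ext J ((isDeriv_dc i k).mul_glLin J)
    (IsDeriv.sum_glLin_mul J (fun j => isDeriv_dc j k) _) (fun f => ?_) (fun l m => ?_) fun l m => ?_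
  · cases k with
    | zero => simp [glLin_apply, LinearMap.sum_apply, pd_linSubst, C_C_mul]
    | succ k => simp [glLin_apply, LinearMap.sum_apply]
  · simp [glLin_apply, LinearMap.sum_apply, C_C_mul]
  · simp only [Module.End.mul_apply, glLin_apply, glAct_cVar, C_C_mul, map_sum, map_smul, dc_cVar,
      LinearMap.sum_apply, LinearMap.smul_apply, apply_ite (glAct J), map_one, map_zero, ite_and,
      smul_ite, smul_zero]
    simp

variable {J}

/-- The derivatives by $b$ transform with $J^{-1}$ and those by $c$ with the transpose of $J$; the
sum over $i$ pairs them and the matrices cancel. -/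
lemma contraction_glLin (hJ : IsUnit J.det) (e : ℕ) (s : CDOhat n ⊗[ℂ] CDOhat n) :
    contraction n e (TensorProduct.map (glLin J) (glLin J) s) =
      TensorProduct.map (glLin J) (glLin J) (contraction n e s) := by
  have hJJ : ∀ l j, ∑ i, J⁻¹ i j * J l i = if l = j then 1 else 0 := fun l j => by
    rw [← Matrix.one_apply, ← Matrix.mul_nonsing_inv J hJ, Matrix.mul_apply]
    exact Finset.sum_congr rfl fun i _ => mul_comm _ _
  have hb : ∀ i k v, db i k (glLin J v) = ∑ j, J⁻¹ i j • glLin J (db j k v) := fun i k v => by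
    have := LinearMap.congr_fun (db_glLin J i k) v
    simpa [LinearMap.sum_apply] using this
  have hc : ∀ i k v, dc i k (glLin J v) = ∑ j, J j i • glLin J (dc j k v) := fun i k v => by
    have := LinearMap.congr_fun (dc_glLin J i k) v
    simpa [LinearMap.sum_apply] using this
  have key : ∀ a b : Fin n → CDOhat n, ∑ i, ((∑ j, J⁻¹ i j • a j) ⊗ₜ[ℂ] (∑ l, J l i • b l)) =
      ∑ i, a i ⊗ₜ[ℂ] b i := by
    intro a b
    simp only [TensorProduct.sum_tmul, TensorProduct.tmul_sum, TensorProduct.smul_tmul_smul]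
    rw [Finset.sum_comm]
    refine Finset.sum_congr rfl fun j _ => ?_
    rw [Finset.sum_comm]
    simp only [← Finset.sum_smul, hJJ, ite_smul, one_smul, zero_smul]
    simp
  have key' : ∀ a b : Fin n → CDOhat n, ∑ i, ((∑ l, J l i • b l) ⊗ₜ[ℂ] (∑ j, J⁻¹ i j • a j)) =
      ∑ i, b i ⊗ₜ[ℂ] a i := by
    intro a b
    have := congrArg (TensorProduct.comm ℂ _ _) (key a b)
    simpa only [map_sum, TensorProduct.comm_tmul] using this
  rcases e with _ | e
  · simp [contraction]
  induction s with
  | zero => simp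
  | add s t hs ht => simp only [map_add, hs, ht]
  | tmul v w =>
    rw [TensorProduct.map_tmul, contraction_succ_tmul, contraction_succ_tmul]
    simp only [map_sum, map_smul, map_add, TensorProduct.map_tmul, hb, hc]
    rw [Finset.sum_comm, Finset.sum_comm (s := Finset.univ)]
    refine Finset.sum_congr rfl fun p _ => ?_
    simp only [← Finset.smul_sum, Finset.sum_add_distrib]
    rw [key (fun j => glLin J (db j p.1 v)) (fun l => glLin J (dc l p.2 w)),
      key' (fun j => glLin J (db j p.1 w)) (fun l => glLin J (dc l p.2 v))]

/-- Invertible linear coordinate changes preserve the product, the translation operator and the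
contraction, from which the modes are built. -/
lemma mode_glLin (hJ : IsUnit J.det) (m : ℤ) (v w : CDOhat n) :
    (cdoData n).mode m (glAct J v) (glAct J w) = glAct J ((cdoData n).mode m v w) := by
  have hW : ∀ d, (cdoData n).W d (glAct J v ⊗ₜ glAct J w) =
      TensorProduct.map (glLin J) (glLin J) ((cdoData n).W d (v ⊗ₜ w)) := fun d =>
    expCoeff_intertwine (A := PowerSeries.mk (cdoData n).R) (B := PowerSeries.mk (cdoData n).R)
      (φ := TensorProduct.map (glLin J) (glLin J)) (fun e s => by
      rw [PowerSeries.coeff_mk, cdoData_R]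
      exact contraction_glLin hJ e s) d (v ⊗ₜ w)
  have hT : ∀ b x, divPow (transl n) b (glAct J x) = glAct J (divPow (transl n) b x) := by
    intro b x
    have : Commute (glLin J) (divPow (transl n) b) := Commute.divPow_right (show Commute (glLin J) (transl n) from (transl_glLin J).symm) b
    exact (LinearMap.congr_fun this.eq x).symm
  have hmu : ∀ b s, LinearMap.mul' ℂ (CDOhat n) (TensorProduct.map (divPow (cdoData n).T b) LinearMap.id
      (TensorProduct.map (glLin J) (glLin J) s)) = glLin J (LinearMap.mul' ℂ (CDOhat n)
        (TensorProduct.map (divPow (cdoData n).T b) LinearMap.id s)) := by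
    intro b s
    induction s with
    | zero => simp
    | add s t hs ht => simp only [map_add, hs, ht]
    | tmul v w =>
      simp only [TensorProduct.map_tmul, LinearMap.mul'_apply, LinearMap.id_apply, glLin_apply,
        map_mul]
      congr 1
      exact hT b v
  obtain ⟨K, hK⟩ := exists_W_eq_zero (v ⊗ₜ[ℂ] w)
  rw [WickData.mode, WickData.mode, WickData.Y_eq_sum (K := K) fun d hd => by
    rw [hW, hK d hd, map_zero], WickData.Y_eq_sum hK, map_sum]
  refine Finset.sum_congr rfl fun d _ => ?_
  rw [hW, hmu, glLin_apply]

lemma glAct_tauForm (θ : FForm1 n) : glAct J (tauForm θ) = tauForm (linPull1 J θ) := by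
  simp only [tauForm, linPull1, map_sum, map_mul, glAct_C, glAct_cVar, Finset.sum_mul,
    Finset.mul_sum]
  rw [Finset.sum_comm]
  exact Finset.sum_congr rfl fun i _ => Finset.sum_congr rfl fun j _ => by ring

lemma glAct_conformalVector (hJ : IsUnit J.det) :
    glAct J (conformalVector n) = conformalVector n := by
  have hJJ : ∀ l j, ∑ i, J⁻¹ l i * J i j = if l = j then 1 else 0 := fun l j => by
    rw [← Matrix.one_apply, ← Matrix.nonsing_inv_mul J hJ, Matrix.mul_apply]
  simp only [conformalVector, map_sum, map_mul, glAct_bVar, glAct_cVar, C_C_mul, Finset.sum_mul,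
    Finset.mul_sum, smul_mul_smul_comm]
  rw [Finset.sum_congr rfl fun i _ => Finset.sum_comm, Finset.sum_comm]
  refine Finset.sum_congr rfl fun j _ => ?_
  rw [Finset.sum_comm]
  simp only [← Finset.sum_smul, hJJ, ite_smul, one_smul, zero_smul, Finset.sum_ite_eq,
    Finset.mem_univ, if_true]

lemma glAct_shiftedConformalVector (hJ : IsUnit J.det) (ξ : FForm1 n) :
    glAct J (shiftedConformalVector ξ) = shiftedConformalVector (linPull1 J ξ) := by
  rw [shiftedConformalVector, map_add, glAct_conformalVector hJ, ← glLin_apply, map_smul,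
    shiftedConformalVector, ← glAct_tauForm, ← glLin_apply J (tauForm ξ)]
  rw [← Module.End.mul_apply, ← transl_glLin]
  rfl

end

/-- The homomorphism from the Virasoro vertex algebra to chiral differential operators that is
defined by a one-form. -/
def virHom (ξ : FForm1 n) : Vir (2 * n) →ₗ[ℂ] CDOhat n :=
  (shiftedConformalVector_isVirasoro ξ).hom cdo_isTranslationCovariant

lemma virHom_nil (ξ : FForm1 n) : virHom ξ (virWord (2 * n) []) = 1 := by
  rw [virWord_nil]
  exact (shiftedConformalVector_isVirasoro ξ).hom_virVac _

lemma virHom_cons (ξ : FForm1 n) (m : ℤ) (w : List ℤ) : virHom ξ (virWord (2 * n) (m :: w)) =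
    (cdoData n).mode (m + 1) (shiftedConformalVector ξ) (virHom ξ (virWord (2 * n) w)) :=
  (shiftedConformalVector_isVirasoro ξ).hom_virWord_cons _ m w

lemma hasDim_virHom (ξ : FForm1 n) {N : ℕ} {x : Vir (2 * n)} (hx : x ∈ virDim (2 * n) N) :
    HasDim N (virHom ξ x) :=
  hasDim_iff.2 ((shiftedConformalVector_isVirasoro ξ).hom_mem_of_mem_virDim _ (dimSub n)
    one_mem_dimSub (fun m k v hv => by
      convert mode_mem_dimSub m (shiftedConformalVector_mem_dimSub ξ) hv using 2
      ring) hx)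

/-- The coordinate change is an automorphism for all modes and sends $L_\xi$ to $L_{J^*\xi}$, so the
images of words correspond letter by letter. -/
lemma glAct_virHom {J : Matrix (Fin n) (Fin n) ℂ} (hJ : IsUnit J.det) (ξ : FForm1 n)
    (x : Vir (2 * n)) : glAct J (virHom ξ x) = virHom (linPull1 J ξ) x := by
  induction x using vir_induction with
  | hword w =>
    induction w with
    | nil => rw [virHom_nil, virHom_nil, map_one]
    | cons m w ih =>
      rw [virHom_cons, virHom_cons, ← mode_glLin hJ, glAct_shiftedConformalVector hJ, ih]
  | hzero => simp
  | hadd x y hx hy => rw [map_add, map_add, map_add, hx, hy]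
  | hsmul z x hx =>
    rw [map_smul (virHom ξ), map_smul (virHom _), ← glLin_apply, map_smul, glLin_apply, hx]

/-! ### Smooth families and their derivatives in a fixed direction -/

section Smooth

variable {E : Type*} [NormedAddCommGroup E] [NormedSpace ℝ E]

/-- The function `f` is smooth on `Ω`, and its derivative in the direction `v` is `f'`. -/
def ScalHasDeriv (Ω : Set E) (v : E) (f f' : E → ℂ) : Prop :=
  ContDiffOn ℝ ∞ f Ω ∧ ∀ y ∈ Ω, fderiv ℝ f y v = f' y

namespace ScalHasDeriv

variable {Ω : Set E} {v : E} {f f' g g' : E → ℂ}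

lemma differentiableAt (h : ScalHasDeriv Ω v f f') (hΩ : IsOpen Ω) {y : E} (hy : y ∈ Ω) :
    DifferentiableAt ℝ f y :=
  (h.1.contDiffAt (hΩ.mem_nhds hy)).differentiableAt (by simp)

lemma const (z : ℂ) : ScalHasDeriv Ω v (fun _ => z) fun _ => 0 :=
  ⟨contDiffOn_const, fun y _ => by simp⟩

lemma add (hΩ : IsOpen Ω) (hf : ScalHasDeriv Ω v f f') (hg : ScalHasDeriv Ω v g g') :
    ScalHasDeriv Ω v (fun y => f y + g y) fun y => f' y + g' y :=
  ⟨hf.1.add hg.1, fun y hy => by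
    rw [fderiv_fun_add (hf.differentiableAt hΩ hy) (hg.differentiableAt hΩ hy),
      add_apply, hf.2 y hy, hg.2 y hy]⟩

lemma mul (hΩ : IsOpen Ω) (hf : ScalHasDeriv Ω v f f') (hg : ScalHasDeriv Ω v g g') :
    ScalHasDeriv Ω v (fun y => f y * g y) fun y => f' y * g y + f y * g' y :=
  ⟨hf.1.mul hg.1, fun y hy => by
    rw [fderiv_fun_mul (hf.differentiableAt hΩ hy) (hg.differentiableAt hΩ hy),
      add_apply, smul_apply,
      smul_apply, hf.2 y hy, hg.2 y hy, smul_eq_mul, smul_eq_mul]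
    ring⟩

lemma congr (hΩ : IsOpen Ω) (hf : ScalHasDeriv Ω v f f') (h : ∀ y ∈ Ω, f y = g y)
    (h' : ∀ y ∈ Ω, f' y = g' y) : ScalHasDeriv Ω v g g' :=
  ⟨hf.1.congr fun y hy => (h y hy).symm, fun y hy => by
    rw [← h' y hy, ← hf.2 y hy]
    have : g =ᶠ[nhds y] f := Filter.eventuallyEq_of_mem (hΩ.mem_nhds hy) fun z hz => (h z hz).symm
    rw [this.fderiv_eq]⟩

lemma sum (hΩ : IsOpen Ω) {ι : Type*} (s : Finset ι) {f f' : ι → E → ℂ}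
    (h : ∀ i ∈ s, ScalHasDeriv Ω v (f i) (f' i)) :
    ScalHasDeriv Ω v (fun y => ∑ i ∈ s, f i y) fun y => ∑ i ∈ s, f' i y := by
  classical
  induction s using Finset.induction_on with
  | empty => simpa using const (Ω := Ω) (v := v) 0
  | insert i s hi ih =>
    simp only [Finset.sum_insert hi]
    exact (h i (Finset.mem_insert_self _ _)).add hΩ
      (ih fun j hj => h j (Finset.mem_insert_of_mem hj))

lemma unique (hf : ScalHasDeriv Ω v f f') (hf' : ScalHasDeriv Ω v f g') {y : E} (hy : y ∈ Ω) :
    f' y = g' y := by rw [← hf.2 y hy, hf'.2 y hy]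

end ScalHasDeriv

/-- The coefficients of the family `f` of formal power series are smooth on `Ω`, and the
derivative in the direction `v` is `f'`. -/
def SerHasDeriv (Ω : Set E) (v : E) (f f' : E → Ohat n) : Prop :=
  ∀ m, ScalHasDeriv Ω v (fun y => MvPowerSeries.coeff m (f y)) fun y => MvPowerSeries.coeff m (f' y)

namespace SerHasDeriv

variable {Ω : Set E} {v : E} {f f' g g' : E → Ohat n}

lemma const (z : Ohat n) : SerHasDeriv Ω v (fun _ => z) fun _ => 0 := fun m => by
  simpa using ScalHasDeriv.const (MvPowerSeries.coeff m z)

lemma add (hΩ : IsOpen Ω) (hf : SerHasDeriv Ω v f f') (hg : SerHasDeriv Ω v g g') :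
    SerHasDeriv Ω v (fun y => f y + g y) fun y => f' y + g' y := fun m => by
  simpa only [map_add] using (hf m).add hΩ (hg m)

lemma mul (hΩ : IsOpen Ω) (hf : SerHasDeriv Ω v f f') (hg : SerHasDeriv Ω v g g') :
    SerHasDeriv Ω v (fun y => f y * g y) fun y => f' y * g y + f y * g' y := fun m => by
  classical
  simp only [map_add, MvPowerSeries.coeff_mul, ← Finset.sum_add_distrib]
  exact ScalHasDeriv.sum hΩ _ fun x _ => (hf x.1).mul hΩ (hg x.2)

lemma congr (hΩ : IsOpen Ω) (hf : SerHasDeriv Ω v f f') (h : ∀ y ∈ Ω, f y = g y)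
    (h' : ∀ y ∈ Ω, f' y = g' y) : SerHasDeriv Ω v g g' := fun m =>
  (hf m).congr hΩ (fun y hy => by rw [h y hy]) fun y hy => by rw [h' y hy]

lemma sum (hΩ : IsOpen Ω) {ι : Type*} (s : Finset ι) {f f' : ι → E → Ohat n}
    (h : ∀ i ∈ s, SerHasDeriv Ω v (f i) (f' i)) :
    SerHasDeriv Ω v (fun y => ∑ i ∈ s, f i y) fun y => ∑ i ∈ s, f' i y := fun m => by
  simp only [map_sum]
  exact ScalHasDeriv.sum hΩ s fun i hi => h i hi m

lemma pd (hΩ : IsOpen Ω) (hf : SerHasDeriv Ω v f f') (k : Fin n) :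
    SerHasDeriv Ω v (fun y => pd k (f y)) fun y => pd k (f' y) := fun m => by
  simp only [coeff_pd]
  simpa using (hf _).mul hΩ (ScalHasDeriv.const _)

end SerHasDeriv

/-- The family `g` of chiral differential operators involves finitely many monomials, its
coefficients are smooth on `Ω`, and its derivative in the direction `v` is `g'`. -/
def FamHasDeriv (Ω : Set E) (v : E) (g g' : E → CDOhat n) : Prop :=
  (∃ S : Finset (Var n →₀ ℕ), ∀ y ∈ Ω, ∀ d, d ∉ S →
    MvPolynomial.coeff d (g y) = 0 ∧ MvPolynomial.coeff d (g' y) = 0) ∧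
  ∀ d, SerHasDeriv Ω v (fun y => MvPolynomial.coeff d (g y)) fun y => MvPolynomial.coeff d (g' y)

namespace FamHasDeriv

variable {Ω : Set E} {v : E} {g g' h h' : E → CDOhat n}

lemma congr (hΩ : IsOpen Ω) (hg : FamHasDeriv Ω v g g') (H : ∀ y ∈ Ω, g y = h y)
    (H' : ∀ y ∈ Ω, g' y = h' y) : FamHasDeriv Ω v h h' := by
  obtain ⟨⟨S, hS⟩, hd⟩ := hg
  refine ⟨⟨S, fun y hy d hdS => ?_⟩, fun d => (hd d).congr hΩ (fun y hy => by rw [H y hy])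
    fun y hy => by rw [H' y hy]⟩
  rw [← H y hy, ← H' y hy]
  exact hS y hy d hdS

lemma const (z : CDOhat n) : FamHasDeriv Ω v (fun _ => z) fun _ => 0 :=
  ⟨⟨z.support, fun y _ d hd => ⟨MvPolynomial.notMem_support_iff.1 hd, MvPolynomial.coeff_zero d⟩⟩,
    fun d => by simpa using SerHasDeriv.const (MvPolynomial.coeff d z)⟩

lemma add (hΩ : IsOpen Ω) (hg : FamHasDeriv Ω v g g') (hh : FamHasDeriv Ω v h h') :
    FamHasDeriv Ω v (fun y => g y + h y) fun y => g' y + h' y := by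
  classical
  obtain ⟨⟨S, hS⟩, hgd⟩ := hg
  obtain ⟨⟨T, hT⟩, hhd⟩ := hh
  refine ⟨⟨S ∪ T, fun y hy d hd => ?_⟩, fun d => by
    simpa only [MvPolynomial.coeff_add] using (hgd d).add hΩ (hhd d)⟩
  rw [Finset.notMem_union] at hd
  simp [(hS y hy d hd.1).1, (hS y hy d hd.1).2, (hT y hy d hd.2).1, (hT y hy d hd.2).2]

lemma sum (hΩ : IsOpen Ω) {ι : Type*} (s : Finset ι) {f f' : ι → E → CDOhat n}
    (h : ∀ i ∈ s, FamHasDeriv Ω v (f i) (f' i)) :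
    FamHasDeriv Ω v (fun y => ∑ i ∈ s, f i y) fun y => ∑ i ∈ s, f' i y := by
  classical
  induction s using Finset.induction_on with
  | empty => simpa using const (Ω := Ω) (v := v) (n := n) 0
  | insert i s hi ih =>
    simp only [Finset.sum_insert hi]
    exact (h i (Finset.mem_insert_self _ _)).add hΩ
      (ih fun j hj => h j (Finset.mem_insert_of_mem hj))

lemma mul (hΩ : IsOpen Ω) (hg : FamHasDeriv Ω v g g') (hh : FamHasDeriv Ω v h h') :
    FamHasDeriv Ω v (fun y => g y * h y) fun y => g' y * h y + g y * h' y := by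
  classical
  obtain ⟨⟨S, hS⟩, hgd⟩ := hg
  obtain ⟨⟨T, hT⟩, hhd⟩ := hh
  refine ⟨⟨(S ×ˢ T).image fun x => x.1 + x.2, fun y hy d hd => ?_⟩, fun d => ?_⟩
  · have key : ∀ x ∈ antidiagonal d, x.1 ∉ S ∨ x.2 ∉ T := by
      intro x hx
      by_contra hc
      push Not at hc
      refine hd (Finset.mem_image.2 ⟨x, Finset.mem_product.2 hc, mem_antidiagonal.1 hx⟩)
    rw [MvPolynomial.coeff_add, MvPolynomial.coeff_mul, MvPolynomial.coeff_mul,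
      MvPolynomial.coeff_mul]
    refine ⟨Finset.sum_eq_zero fun x hx => ?_, ?_⟩
    · rcases key x hx with h1 | h1
      · rw [(hS y hy _ h1).1, zero_mul]
      · rw [(hT y hy _ h1).1, mul_zero]
    · rw [← Finset.sum_add_distrib]
      refine Finset.sum_eq_zero fun x hx => ?_
      rcases key x hx with h1 | h1
      · rw [(hS y hy _ h1).1, (hS y hy _ h1).2, zero_mul, zero_mul, add_zero]
      · rw [(hT y hy _ h1).1, (hT y hy _ h1).2, mul_zero, mul_zero, add_zero]
  · simp only [MvPolynomial.coeff_add, MvPolynomial.coeff_mul, ← Finset.sum_add_distrib]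
    exact SerHasDeriv.sum hΩ _ fun x _ => (hgd x.1).mul hΩ (hhd x.2)

lemma C {f f' : E → Ohat n} (hf : SerHasDeriv Ω v f f') :
    FamHasDeriv Ω v (fun y => MvPolynomial.C (f y)) fun y => MvPolynomial.C (f' y) := by
  classical
  refine ⟨⟨{0}, fun y _ d hd => ?_⟩, fun d => ?_⟩
  · rw [Finset.mem_singleton] at hd
    simp [MvPolynomial.coeff_C, Ne.symm hd]
  · rcases eq_or_ne d 0 with rfl | hd
    · simpa using hf
    · simpa [MvPolynomial.coeff_C, Ne.symm hd] using SerHasDeriv.const (Ω := Ω) (v := v) (n := n) 0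

lemma smul (hΩ : IsOpen Ω) (z : ℂ) (hg : FamHasDeriv Ω v g g') :
    FamHasDeriv Ω v (fun y => z • g y) fun y => z • g' y := by
  simpa only [← C_C_mul, zero_mul, zero_add] using
    (const (MvPolynomial.C (MvPowerSeries.C z))).mul hΩ hg

/-- Operators that are linear over formal functions preserve smooth families. -/
lemma map_linear (hΩ : IsOpen Ω) (D : CDOhat n →ₗ[Ohat n] CDOhat n) (hg : FamHasDeriv Ω v g g') :
    FamHasDeriv Ω v (fun y => D (g y)) fun y => D (g' y) := by
  obtain ⟨⟨S, hS⟩, hgd⟩ := hg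
  have key : ∀ w : CDOhat n, (∀ d, d ∉ S → MvPolynomial.coeff d w = 0) →
      D w = ∑ d ∈ S, MvPolynomial.C (MvPolynomial.coeff d w) * D (MvPolynomial.monomial d 1) := by
    intro w hw
    conv_lhs => rw [MvPolynomial.as_sum w]
    rw [map_sum, Finset.sum_subset (s₂ := S)]
    · refine Finset.sum_congr rfl fun d _ => ?_
      rw [← MvPolynomial.smul_eq_C_mul, ← map_smul, MvPolynomial.smul_monomial, smul_eq_mul, mul_one]
    · intro d hd
      by_contra h
      exact MvPolynomial.mem_support_iff.1 hd (hw d h)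
    · intro d _ hd
      rw [MvPolynomial.notMem_support_iff.1 hd, map_zero, map_zero]
  refine (sum hΩ S fun d _ => (C (hgd d)).mul hΩ (const (D (MvPolynomial.monomial d 1)))).congr hΩ
    (fun y hy => (key _ fun d hd => (hS y hy d hd).1).symm) fun y hy => ?_
  simp only [mul_zero, add_zero]
  exact (key _ fun d hd => (hS y hy d hd).2).symm

lemma dc0 (hΩ : IsOpen Ω) (i : Fin n) (hg : FamHasDeriv Ω v g g') :
    FamHasDeriv Ω v (fun y => dc0 i (g y)) fun y => ChiralDO.dc0 i (g' y) := by
  obtain ⟨⟨S, hS⟩, hgd⟩ := hg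
  refine ⟨⟨S, fun y hy d hd => ?_⟩, fun d => ?_⟩
  · rw [coeff_dc0, coeff_dc0, (hS y hy d hd).1, (hS y hy d hd).2, map_zero]
    exact ⟨rfl, rfl⟩
  · simpa only [coeff_dc0] using (hgd d).pd hΩ i

end FamHasDeriv

/-- The algebra of the operators that preserve smooth families and commute with differentiation
in the parameters. -/
def smoothOps {Ω : Set E} (hΩ : IsOpen Ω) (v : E) (n : ℕ) : Subalgebra ℂ (Module.End ℂ (CDOhat n)) where
  carrier := {A | ∀ g g', FamHasDeriv Ω v g g' →
    FamHasDeriv Ω v (fun y => A (g y)) fun y => A (g' y)}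
  mul_mem' hA hB _ _ hg := hA _ _ (hB _ _ hg)
  add_mem' hA hB _ _ hg := (hA _ _ hg).add hΩ (hB _ _ hg)
  algebraMap_mem' z _ _ hg := hg.smul hΩ z

section
variable {Ω : Set E} (hΩ : IsOpen Ω) (v : E)

lemma db_mem_smoothOps (i : Fin n) (k : ℕ) : db i k ∈ smoothOps hΩ v n := fun _ _ hg =>
  hg.map_linear hΩ (MvPolynomial.pderiv (R := Ohat n) (Sum.inl (i, k))).toLinearMap

lemma dc_mem_smoothOps (i : Fin n) (k : ℕ) : dc i k ∈ smoothOps hΩ v n := fun _ _ hg => by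
  cases k with
  | zero => exact hg.dc0 hΩ i
  | succ k => exact hg.map_linear hΩ (MvPolynomial.pderiv (R := Ohat n) (Sum.inr (i, k))).toLinearMap

lemma transl_mem_smoothOps : transl n ∈ smoothOps hΩ v n := by
  refine add_mem (sum_mem fun i _ => ?_) fun g g' hg => hg.map_linear hΩ (Derivation.toLinearMap _)
  intro g g' hg
  simpa using (FamHasDeriv.const (cVar i 0)).mul hΩ (hg.dc0 hΩ i)

lemma divPow_transl_mem_smoothOps (b : ℤ) : divPow (transl n) b ∈ smoothOps hΩ v n := by
  unfold divPow
  split_ifs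
  · exact Subalgebra.smul_mem _ (pow_mem (transl_mem_smoothOps hΩ v) _) _
  · exact zero_mem _

end

/-- The family `s` of tensors is a sum of tensor products of smooth families, with derivative `s'`
in the direction `v`. -/
inductive TenHasDeriv (Ω : Set E) (v : E) :
    (E → CDOhat n ⊗[ℂ] CDOhat n) → (E → CDOhat n ⊗[ℂ] CDOhat n) → Prop
  | tmul {g g' h h' : E → CDOhat n} (hg : FamHasDeriv Ω v g g') (hh : FamHasDeriv Ω v h h') :
    TenHasDeriv Ω v (fun y => g y ⊗ₜ h y) fun y => g' y ⊗ₜ h y + g y ⊗ₜ h' y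
  | add {s s' t t' : E → CDOhat n ⊗[ℂ] CDOhat n} (hs : TenHasDeriv Ω v s s')
    (ht : TenHasDeriv Ω v t t') : TenHasDeriv Ω v (fun y => s y + t y) fun y => s' y + t' y

lemma TenHasDeriv.smul {Ω : Set E} (hΩ : IsOpen Ω) {v : E} {s s' : E → CDOhat n ⊗[ℂ] CDOhat n}
    (z : ℂ) (h : TenHasDeriv Ω v s s') :
    TenHasDeriv Ω v (fun y => z • s y) fun y => z • s' y := by
  induction h with
  | tmul hg hh =>
    simpa only [TensorProduct.smul_tmul', smul_add] using TenHasDeriv.tmul (hg.smul hΩ z) hh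
  | add _ _ hs ht => simpa only [smul_add] using hs.add ht

/-- The algebra of the operators that preserve smooth families of tensors and commute with
differentiation in the parameters. -/
def smoothOps₂ {Ω : Set E} (hΩ : IsOpen Ω) (v : E) (n : ℕ) :
    Subalgebra ℂ (Module.End ℂ (CDOhat n ⊗[ℂ] CDOhat n)) where
  carrier := {A | ∀ s s', TenHasDeriv Ω v s s' →
    TenHasDeriv Ω v (fun y => A (s y)) fun y => A (s' y)}
  mul_mem' hA hB _ _ hg := hA _ _ (hB _ _ hg)
  add_mem' hA hB _ _ hg := (hA _ _ hg).add (hB _ _ hg)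
  algebraMap_mem' z _ _ hg := hg.smul hΩ z

section
variable {Ω : Set E} (hΩ : IsOpen Ω) (v : E)

lemma map_mem_smoothOps₂ {A B : Module.End ℂ (CDOhat n)} (hA : A ∈ smoothOps hΩ v n)
    (hB : B ∈ smoothOps hΩ v n) : TensorProduct.map A B ∈ smoothOps₂ hΩ v n := by
  intro s s' hs
  induction hs with
  | tmul hg hh =>
    simpa only [TensorProduct.map_tmul, map_add] using
      TenHasDeriv.tmul (hA _ _ hg) (hB _ _ hh)
  | add _ _ hs ht => simpa only [map_add] using hs.add ht

lemma contraction_mem_smoothOps₂ (e : ℕ) : contraction n e ∈ smoothOps₂ hΩ v n := by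
  rcases e with _ | e
  · exact zero_mem _
  · refine sum_mem fun i _ => sum_mem fun p _ => Subalgebra.smul_mem _ (add_mem
      (Subalgebra.smul_mem _ ?_ _) (Subalgebra.smul_mem _ ?_ _)) _
    · exact map_mem_smoothOps₂ hΩ v (db_mem_smoothOps hΩ v _ _) (dc_mem_smoothOps hΩ v _ _)
    · exact map_mem_smoothOps₂ hΩ v (dc_mem_smoothOps hΩ v _ _) (db_mem_smoothOps hΩ v _ _)

lemma W_mem_smoothOps₂ (d : ℕ) : (cdoData n).W d ∈ smoothOps₂ hΩ v n := by
  rw [cdoData_W]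
  refine sum_mem fun p hp => Subalgebra.smul_mem _ ?_ _
  clear hp
  induction p generalizing d with
  | zero =>
    rw [pow_zero, PowerSeries.coeff_one]
    split_ifs
    exacts [one_mem _, zero_mem _]
  | succ p ih =>
    rw [pow_succ, PowerSeries.coeff_mul]
    refine sum_mem fun x _ => mul_mem (ih _) ?_
    rw [PowerSeries.coeff_mk]
    exact contraction_mem_smoothOps₂ hΩ v _

lemma TenHasDeriv.mul' {Ω : Set E} (hΩ : IsOpen Ω) {v : E} {s s' : E → CDOhat n ⊗[ℂ] CDOhat n} (h : TenHasDeriv Ω v s s') :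
    FamHasDeriv Ω v (fun y => LinearMap.mul' ℂ (CDOhat n) (s y))
      fun y => LinearMap.mul' ℂ (CDOhat n) (s' y) := by
  induction h with
  | tmul hg hh => simpa using hg.mul hΩ hh
  | add _ _ hs ht => simpa only [map_add] using hs.add hΩ ht

end

/-- The bound depends only on the monomials that may occur. For families with finitely many
monomials, a mode is therefore one fixed finite sum of operators, and it can be differentiated term
by term. -/
lemma exists_W_tmul_eq_zero (S T : Finset (Var n →₀ ℕ)) : ∃ K : ℕ, ∀ d, K ≤ d → ∀ v w : CDOhat n,
    (∀ a, a ∉ S → MvPolynomial.coeff a v = 0) → (∀ a, a ∉ T → MvPolynomial.coeff a w = 0) →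
      (cdoData n).W d (v ⊗ₜ w) = 0 := by
  refine ⟨S.sup (Finsupp.weight wt) + T.sup (Finsupp.weight wt) + 1, fun d hd v w hv hw => ?_⟩
  rw [MvPolynomial.as_sum v, MvPolynomial.as_sum w, TensorProduct.sum_tmul, map_sum]
  refine Finset.sum_eq_zero fun a ha => ?_
  rw [TensorProduct.tmul_sum, map_sum]
  refine Finset.sum_eq_zero fun b hb => ?_
  have ha' : a ∈ S := by
    by_contra h
    exact MvPolynomial.mem_support_iff.1 ha (hv a h)
  have hb' : b ∈ T := by
    by_contra h
    exact MvPolynomial.mem_support_iff.1 hb (hw b h)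
  have h1 := Finset.le_sup (f := Finsupp.weight (wt (n := n))) ha'
  have h2 := Finset.le_sup (f := Finsupp.weight (wt (n := n))) hb'
  refine eq_zero_of_mem_dimSub₂ ?_ (W_mem_dimSub₂ d
    (tmul_mem_dimSub₂ rfl (monomial_mem_dimSub a _) (monomial_mem_dimSub b _)))
  omega

/-- The product rule for the Fourier modes of smooth families. -/
theorem FamHasDeriv.mode {Ω : Set E} (hΩ : IsOpen Ω) {v : E} {g g' h h' : E → CDOhat n}
    (hg : FamHasDeriv Ω v g g') (hh : FamHasDeriv Ω v h h') (m : ℤ) :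
    FamHasDeriv Ω v (fun y => (cdoData n).mode m (g y) (h y)) fun y =>
      (cdoData n).mode m (g' y) (h y) + (cdoData n).mode m (g y) (h' y) := by
  obtain ⟨S, hS⟩ := hg.1
  obtain ⟨T, hT⟩ := hh.1
  obtain ⟨K, hK⟩ := exists_W_tmul_eq_zero S T
  have hten := TenHasDeriv.tmul hg hh
  refine (FamHasDeriv.sum hΩ (Finset.range K) fun d _ => TenHasDeriv.mul' hΩ
    (map_mem_smoothOps₂ hΩ v (divPow_transl_mem_smoothOps hΩ v (d - 1 - m)) (one_mem _) _ _
      (W_mem_smoothOps₂ hΩ v d _ _ hten))).congr hΩ (fun y hy => ?_) fun y hy => ?_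
  · rw [WickData.mode, WickData.Y_eq_sum fun d hd =>
      hK d hd _ _ (fun a ha => (hS y hy a ha).1) fun a ha => (hT y hy a ha).1]
    rfl
  · rw [WickData.mode, WickData.Y_eq_sum fun d hd =>
      hK d hd _ _ (fun a ha => (hS y hy a ha).2) fun a ha => (hT y hy a ha).1,
      WickData.mode, WickData.Y_eq_sum fun d hd =>
      hK d hd _ _ (fun a ha => (hS y hy a ha).1) fun a ha => (hT y hy a ha).2,
      ← Finset.sum_add_distrib]
    refine Finset.sum_congr rfl fun d _ => ?_
    rw [← map_add, ← map_add, ← map_add]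
    rfl

/-- If the one-form `ξ` satisfies the equation `∂_v ξ + L_X ξ = d (div X)`, then the homomorphisms
that it defines are flat. -/
theorem famHasDeriv_virHom {Ω : Set E} (hΩ : IsOpen Ω) {v : E} {ξ ξ' : E → FForm1 n}
    (X : E → FVect n) (B : E → FForm2 n)
    (hξ : ∀ k, SerHasDeriv Ω v (fun y => ξ y k) fun y => ξ' y k)
    (hX : ∀ y ∈ Ω, ξ' y + lie1 (X y) (ξ y) = gfC1 (X y)) (x : Vir (2 * n)) :
    FamHasDeriv Ω v (fun y => virHom (ξ y) x) fun y => -extAct (X y) (B y) (virHom (ξ y) x) := by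
  have hform : FamHasDeriv Ω v (fun y => tauForm (ξ y)) fun y => tauForm (ξ' y) := by
    refine FamHasDeriv.sum hΩ _ fun i _ => ?_
    simpa using (FamHasDeriv.C (hξ i)).mul hΩ (FamHasDeriv.const (cVar i 0))
  have hw : FamHasDeriv Ω v (fun y => shiftedConformalVector (ξ y))
      fun y => -extAct (X y) (B y) (shiftedConformalVector (ξ y)) := by
    refine ((FamHasDeriv.const (conformalVector n)).add hΩ
      ((transl_mem_smoothOps hΩ v _ _ hform).smul hΩ (1 / 2 : ℂ))).congr hΩ (fun y _ => rfl) ?_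
    intro y hy
    rw [extAct_shiftedConformalVector, ← hX y hy, sub_add_cancel_right, zero_add, ← smul_neg,
      ← map_neg]
    congr 2
    have hneg : tauForm (-ξ' y) = -tauForm (ξ' y) := by
      refine eq_neg_of_add_eq_zero_left ?_
      simp only [tauForm, ← Finset.sum_add_distrib, ← add_mul, ← map_add, Pi.neg_apply,
        neg_add_cancel, map_zero, zero_mul, Finset.sum_const_zero]
    rw [hneg]
    exact (neg_neg (tauForm (ξ' y))).symm
  induction x using vir_induction with
  | hword w =>
    induction w with
    | nil =>
      refine (FamHasDeriv.const 1).congr hΩ (fun y _ => (virHom_nil _).symm) fun y _ => ?_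
      rw [virHom_nil, extAct_eq, cdo_isTranslationCovariant.mode_one_right le_rfl,
        cdo_isTranslationCovariant.mode_one_right le_rfl, sub_zero, neg_zero]
    | cons m w ih =>
      refine (hw.mode hΩ ih (m + 1)).congr hΩ (fun y _ => (virHom_cons _ _ _).symm) fun y _ => ?_
      rw [virHom_cons]
      -- Both $\partial_v$ and the action of $(X,B)$ are derivations of the modes. Flatness of
      -- $L_\xi$ and of the shorter word thus yields flatness of the longer one.
      have h𝒲 := cdo_isTranslationCovariant (n := n)
      rw [extAct_eq _ _ ((cdoData n).mode _ _ _), h𝒲.mode_zero_mode, h𝒲.mode_zero_mode]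
      simp only [extAct_eq, ← h𝒲.modeLin_apply, map_sub, map_neg,
        LinearMap.sub_apply, LinearMap.neg_apply]
      abel
  | hzero =>
    refine (FamHasDeriv.const 0).congr hΩ (fun y _ => (map_zero _).symm) fun y _ => ?_
    simp [extAct_eq, cdo_isTranslationCovariant.mode_zero_right]
  | hadd x x' hx hx' =>
    refine (hx.add hΩ hx').congr hΩ (fun y _ => (map_add _ _ _).symm) fun y _ => ?_
    simp only [map_add, extAct_eq, cdo_isTranslationCovariant.mode_add_right]
    abel
  | hsmul z x hx =>
    refine (hx.smul hΩ z).congr hΩ (fun y _ => (map_smul (virHom _) _ _).symm) fun y _ => ?_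
    simp only [map_smul (virHom _), extAct_eq, cdo_isTranslationCovariant.mode_smul_right]
    module

end Smooth

/-! ### Holomorphic functions of several variables -/

section Holomorphic

variable {E : Type*} [NormedAddCommGroup E] [NormedSpace ℂ E]

lemma differentiableOn_comp_line {Ω : Set E} {f : E → ℂ} (hf : DifferentiableOn ℂ f Ω) (z u : E) :
    DifferentiableOn ℂ (fun ζ : ℂ => f (z + ζ • u)) ((fun ζ : ℂ => z + ζ • u) ⁻¹' Ω) :=
  hf.comp (by fun_prop) (Set.mapsTo_preimage _ _)

lemma isOpen_preimage_line {Ω : Set E} (hΩ : IsOpen Ω) (z u : E) :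
    IsOpen ((fun ζ : ℂ => z + ζ • u) ⁻¹' Ω) :=
  hΩ.preimage (by fun_prop)

lemma deriv_comp_line {Ω : Set E} (hΩ : IsOpen Ω) {f : E → ℂ} (hf : DifferentiableOn ℂ f Ω)
    {z : E} (hz : z ∈ Ω) (u : E) : deriv (fun ζ : ℂ => f (z + ζ • u)) 0 = fderiv ℂ f z u := by
  have h1 : HasFDerivAt f (fderiv ℂ f z) (z + (0 : ℂ) • u) := by
    rw [zero_smul, add_zero]
    exact (hf.differentiableAt (hΩ.mem_nhds hz)).hasFDerivAt
  have h2 : HasDerivAt (fun ζ : ℂ => z + ζ • u) u 0 := by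
    simpa using ((hasDerivAt_id (0 : ℂ)).smul_const u).const_add z
  exact (h1.comp_hasDerivAt 0 h2).deriv

/-- Cauchy's estimate for the first derivative. -/
lemma norm_fderiv_le_of_closedBall {Ω : Set E} (hΩ : IsOpen Ω) {f : E → ℂ}
    (hf : DifferentiableOn ℂ f Ω) {z : E} {ρ M : ℝ} (hρ : 0 < ρ) (hz : Metric.closedBall z ρ ⊆ Ω)
    (hM : ∀ w ∈ Metric.closedBall z ρ, ‖f w‖ ≤ M) : ‖fderiv ℂ f z‖ ≤ M / ρ := by
  have hM0 : 0 ≤ M := (norm_nonneg _).trans (hM z (Metric.mem_closedBall_self hρ.le))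
  refine ContinuousLinearMap.opNorm_le_bound _ (by positivity) fun u => ?_
  rcases eq_or_ne u 0 with rfl | hu
  · simp
  have hu' : 0 < ‖u‖ := norm_pos_iff.2 hu
  have hsub : ∀ ζ ∈ Metric.closedBall (0 : ℂ) (ρ / ‖u‖), z + ζ • u ∈ Metric.closedBall z ρ := by
    intro ζ hζ
    rw [mem_closedBall_zero_iff, le_div_iff₀ hu'] at hζ
    rwa [mem_closedBall_iff_norm, add_sub_cancel_left, norm_smul]
  rw [← deriv_comp_line hΩ hf (hz (Metric.mem_closedBall_self hρ.le)) u]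
  refine (Complex.norm_deriv_le_of_forall_mem_sphere_norm_le (C := M) (div_pos hρ hu')
    ((differentiableOn_comp_line hf z u).diffContOnCl_ball fun ζ hζ => hz (hsub ζ hζ))
    fun ζ hζ => hM _ (hsub ζ (Metric.sphere_subset_closedBall hζ))).trans_eq ?_
  field_simp

/-- Cauchy's integral formula for a directional derivative. -/
lemma fderiv_eq_circleIntegral {Ω : Set E} (hΩ : IsOpen Ω) {f : E → ℂ}
    (hf : DifferentiableOn ℂ f Ω) {z u : E} (hu : ‖u‖ ≤ 1) {r : ℝ} (hr : 0 < r)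
    (hz : Metric.closedBall z r ⊆ Ω) :
    fderiv ℂ f z u = (2 * Real.pi * Complex.I : ℂ)⁻¹ •
      ∮ ζ in C(0, r), ((ζ - 0) ^ 2)⁻¹ • f (z + ζ • u) := by
  rw [← deriv_comp_line hΩ hf (hz (Metric.mem_closedBall_self hr.le)) u]
  refine (Complex.two_pi_I_inv_smul_circleIntegral_sub_sq_inv_smul_of_differentiable
    (isOpen_preimage_line hΩ z u) (fun ζ hζ => hz ?_) (differentiableOn_comp_line hf z u)
    (Metric.mem_ball_self hr)).symm
  rw [mem_closedBall_zero_iff] at hζ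
  rw [mem_closedBall_iff_norm, add_sub_cancel_left, norm_smul]
  exact (mul_le_of_le_one_right (norm_nonneg _) hu).trans hζ

/-- The directional derivatives of a holomorphic function of several variables are
holomorphic. -/
theorem differentiableOn_fderiv_apply [FiniteDimensional ℂ E] {Ω : Set E} (hΩ : IsOpen Ω)
    {f : E → ℂ} (hf : DifferentiableOn ℂ f Ω) {u : E} (hu : ‖u‖ ≤ 1) :
    DifferentiableOn ℂ (fun y => fderiv ℂ f y u) Ω := by
  intro y₀ hy₀
  refine DifferentiableAt.differentiableWithinAt ?_
  let _ : MeasurableSpace E := borel E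
  have : BorelSpace E := ⟨rfl⟩
  have : CompleteSpace E := FiniteDimensional.complete ℂ E
  have : ProperSpace E := FiniteDimensional.proper ℂ E
  obtain ⟨R, hR, hRΩ⟩ := Metric.nhds_basis_closedBall.mem_iff.1 (hΩ.mem_nhds hy₀)
  obtain ⟨M, hM⟩ := (isCompact_closedBall y₀ R).exists_bound_of_continuousOn
    (hf.continuousOn.mono hRΩ)
  -- The point moves by at most $r$, the circle of integration has radius $r$, and Cauchy's estimate
  -- uses another disk of radius $r$; all of this stays within distance $3r<R$.
  set r := R / 4
  have hr : 0 < r := by positivity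
  have hline : ∀ y ∈ Metric.ball y₀ r, ∀ θ : ℝ,
      Metric.closedBall (y + circleMap 0 r θ • u) r ⊆ Metric.closedBall y₀ R := by
    intro y hy θ
    refine Metric.closedBall_subset_closedBall' ?_
    have h1 : dist (y + circleMap 0 r θ • u) y ≤ r := by
      rw [dist_eq_norm, add_sub_cancel_left, norm_smul, norm_circleMap_zero, abs_of_pos hr]
      exact mul_le_of_le_one_right hr.le hu
    have h2 := dist_triangle (y + circleMap 0 r θ • u) y y₀
    have h3 := Metric.mem_ball.1 hy
    have : R = 4 * r := by simp only [r]; ring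
    linarith
  have hmem : ∀ y ∈ Metric.ball y₀ r, ∀ θ : ℝ, y + circleMap 0 r θ • u ∈ Ω := fun y hy θ =>
    hRΩ (hline y hy θ (Metric.mem_closedBall_self hr.le))
  set w : ℝ → ℂ := fun θ => deriv (circleMap 0 r) θ * ((circleMap 0 r θ - 0) ^ 2)⁻¹
  have hw : Continuous w := by
    refine Continuous.mul ?_ (Continuous.inv₀ (by fun_prop) fun θ => ?_)
    · rw [funext (deriv_circleMap 0 r)]
      fun_prop
    · rw [sub_zero]
      exact pow_ne_zero _ (circleMap_ne_center hr.ne')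
  have hcont : ∀ y ∈ Metric.ball y₀ r, Continuous fun θ => w θ * f (y + circleMap 0 r θ • u) :=
    fun y hy => hw.mul (hf.continuousOn.comp_continuous (by fun_prop) (hmem y hy))
  -- Differentiation under the integral sign in Cauchy's formula; Cauchy's estimate supplies the
  -- dominating function.
  have key : HasFDerivAt (fun y => ∫ θ in (0 : ℝ)..2 * Real.pi, w θ * f (y + circleMap 0 r θ • u))
      (∫ θ in (0 : ℝ)..2 * Real.pi, w θ • fderiv ℂ f (y₀ + circleMap 0 r θ • u)) y₀ := by
    refine intervalIntegral.hasFDerivAt_integral_of_dominated_of_fderiv_le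
      (F' := fun y θ => w θ • fderiv ℂ f (y + circleMap 0 r θ • u))
      (bound := fun θ => ‖w θ‖ * (M / r)) (s := Metric.ball y₀ r)
      (Metric.ball_mem_nhds _ hr) ?_ ?_ ?_ ?_ ?_ ?_
    · filter_upwards [Metric.ball_mem_nhds y₀ hr] with y hy
      exact (hcont y hy).aestronglyMeasurable
    · exact (hcont y₀ (Metric.mem_ball_self hr)).intervalIntegrable _ _
    · refine (hw.measurable.smul ((measurable_fderiv ℂ f).comp ?_)).aestronglyMeasurable
      exact Continuous.measurable (by fun_prop)
    · refine Filter.Eventually.of_forall fun θ _ y hy => ?_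
      rw [norm_smul]
      refine mul_le_mul_of_nonneg_left ?_ (norm_nonneg _)
      exact norm_fderiv_le_of_closedBall hΩ hf hr ((hline y hy θ).trans hRΩ)
        fun z hz => hM z (hline y hy θ hz)
    · exact (hw.norm.mul continuous_const).intervalIntegrable _ _
    · refine Filter.Eventually.of_forall fun θ _ y hy => ?_
      have h1 := (hf.differentiableAt (hΩ.mem_nhds (hmem y hy θ))).hasFDerivAt
      have h2 : HasFDerivAt (fun y => y + circleMap 0 r θ • u) (ContinuousLinearMap.id ℂ E) y :=
        (hasFDerivAt_id y).add_const _
      exact (h1.comp y h2).const_mul (w θ)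
  have heq : (fun y => fderiv ℂ f y u) =ᶠ[nhds y₀] fun y => (2 * Real.pi * Complex.I : ℂ)⁻¹ •
      ∫ θ in (0 : ℝ)..2 * Real.pi, w θ * f (y + circleMap 0 r θ • u) := by
    filter_upwards [Metric.ball_mem_nhds y₀ hr] with y hy
    rw [fderiv_eq_circleIntegral hΩ hf hu hr]
    · rw [circleIntegral]
      congr 1
      refine intervalIntegral.integral_congr fun θ _ => ?_
      simp only [w, smul_eq_mul, mul_assoc]
    · refine (Metric.closedBall_subset_closedBall' ?_).trans hRΩ
      have h3 := Metric.mem_ball.1 hy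
      have : R = 4 * r := by simp only [r]; ring
      linarith
  exact heq.differentiableAt_iff.2 (key.differentiableAt.fun_const_smul _)

end Holomorphic

section hpd

variable {Ω : Set (Fin n → ℂ)} {f g : (Fin n → ℂ) → ℂ}

lemma DifferentiableOn.hpd (hΩ : IsOpen Ω) (hf : DifferentiableOn ℂ f Ω) (k : Fin n) :
    DifferentiableOn ℂ (hpd k f) Ω :=
  differentiableOn_fderiv_apply hΩ hf (by simp [Pi.norm_single])

lemma fderiv_eq_sum_hpd (f : (Fin n → ℂ) → ℂ) (y : Fin n → ℂ) :
    fderiv ℂ f y = ∑ k, hpd k f y • ContinuousLinearMap.proj (R := ℂ) (φ := fun _ => ℂ) k := by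
  ext v
  have hv : v = ∑ k, v k • Pi.single k (1 : ℂ) := by
    ext i
    simp [Finset.sum_apply, Pi.single_apply]
  conv_lhs => rw [hv]
  rw [map_sum, sum_apply]
  refine Finset.sum_congr rfl fun k _ => ?_
  rw [map_smul, smul_apply, smul_eq_mul, smul_eq_mul, mul_comm]
  rfl

lemma fderiv_apply_eq_sum_hpd (f : (Fin n → ℂ) → ℂ) (y v : Fin n → ℂ) :
    fderiv ℂ f y v = ∑ k, hpd k f y * v k := by
  rw [fderiv_eq_sum_hpd]
  simp

/-- The partial derivatives are again holomorphic, and they determine the total derivative, so the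
order of differentiability increases by induction. -/
lemma contDiffOn_nat_of_differentiableOn (hΩ : IsOpen Ω) (N : ℕ) (hf : DifferentiableOn ℂ f Ω) :
    ContDiffOn ℂ N f Ω := by
  induction N generalizing f with
  | zero => exact contDiffOn_zero.2 hf.continuousOn
  | succ N ih =>
    rw [Nat.cast_add, Nat.cast_one, contDiffOn_succ_iff_fderiv_of_isOpen hΩ]
    refine ⟨hf, fun h => absurd h (by simp), ?_⟩
    rw [funext (fderiv_eq_sum_hpd f)]
    exact ContDiffOn.sum fun k _ => (ih (DifferentiableOn.hpd hΩ hf k)).smul contDiffOn_const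

lemma contDiffOn_of_differentiableOn (hΩ : IsOpen Ω) (hf : DifferentiableOn ℂ f Ω) :
    ContDiffOn ℂ ∞ f Ω :=
  contDiffOn_infty.2 fun N => contDiffOn_nat_of_differentiableOn hΩ N hf

lemma hpd_congr (hΩ : IsOpen Ω) (h : Set.EqOn f g Ω) (k : Fin n) :
    Set.EqOn (hpd k f) (hpd k g) Ω := fun y hy => by
  rw [hpd, hpd, (Filter.eventuallyEq_of_mem (hΩ.mem_nhds hy) h).fderiv_eq]

lemma hpd_comm (hΩ : IsOpen Ω) (hf : DifferentiableOn ℂ f Ω) (j k : Fin n) :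
    Set.EqOn (hpd j (hpd k f)) (hpd k (hpd j f)) Ω := by
  intro y hy
  have h2 : ContDiffAt ℂ 2 f y :=
    (contDiffOn_nat_of_differentiableOn hΩ 2 hf).contDiffAt (hΩ.mem_nhds hy)
  have hsymm := h2.isSymmSndFDerivAt (by simp)
  have hd : DifferentiableAt ℂ (fderiv ℂ f) y :=
    (h2.fderiv_right (m := 1) (by norm_num)).differentiableAt (by simp)
  have key : ∀ j k : Fin n, hpd j (hpd k f) y =
      fderiv ℂ (fderiv ℂ f) y (Pi.single j 1) (Pi.single k 1) := by
    intro j k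
    have : hpd k f = fun z => fderiv ℂ f z (Pi.single k 1) := rfl
    rw [hpd, this, fderiv_clm_apply hd (differentiableAt_const _)]
    simp
  rw [key, key, hsymm]

lemma hpd_add (hΩ : IsOpen Ω) (hf : DifferentiableOn ℂ f Ω) (hg : DifferentiableOn ℂ g Ω)
    (k : Fin n) : Set.EqOn (hpd k (f + g)) (hpd k f + hpd k g) Ω := fun y hy => by
  rw [hpd, fderiv_add (hf.differentiableAt (hΩ.mem_nhds hy))
    (hg.differentiableAt (hΩ.mem_nhds hy))]
  rfl

lemma hpd_mul (hΩ : IsOpen Ω) (hf : DifferentiableOn ℂ f Ω) (hg : DifferentiableOn ℂ g Ω)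
    (k : Fin n) : Set.EqOn (hpd k (f * g)) (hpd k f * g + f * hpd k g) Ω := fun y hy => by
  rw [hpd, fderiv_mul (hf.differentiableAt (hΩ.mem_nhds hy))
    (hg.differentiableAt (hΩ.mem_nhds hy))]
  simp [hpd]
  ring

lemma hpd_const (k : Fin n) (z : ℂ) : hpd k (fun _ => z) = 0 := by
  ext y
  simp [hpd]

/-! ### Taylor series -/

/-- The iterated partial derivative with the exponents `m` along the list `l`. -/
def iterHpd (l : List (Fin n)) (m : Fin n → ℕ) (f : (Fin n → ℂ) → ℂ) : (Fin n → ℂ) → ℂ :=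
  l.foldr (fun i g => (hpd i)^[m i] g) f

lemma iterHpd_cons (i : Fin n) (l : List (Fin n)) (m : Fin n → ℕ) (f : (Fin n → ℂ) → ℂ) :
    iterHpd (i :: l) m f = (hpd i)^[m i] (iterHpd l m f) := rfl

lemma DifferentiableOn.iterate_hpd (hΩ : IsOpen Ω) (hf : DifferentiableOn ℂ f Ω) (k : Fin n)
    (N : ℕ) : DifferentiableOn ℂ ((ChiralDO.hpd k)^[N] f) Ω := by
  induction N with
  | zero => exact hf
  | succ N ih => rw [Function.iterate_succ_apply']; exact DifferentiableOn.hpd hΩ ih k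

lemma iterate_hpd_congr (hΩ : IsOpen Ω) (h : Set.EqOn f g Ω) (k : Fin n) (N : ℕ) :
    Set.EqOn ((hpd k)^[N] f) ((hpd k)^[N] g) Ω := by
  induction N with
  | zero => exact h
  | succ N ih =>
    rw [Function.iterate_succ_apply', Function.iterate_succ_apply']
    exact hpd_congr hΩ ih k

lemma iterate_hpd_comm (hΩ : IsOpen Ω) (hf : DifferentiableOn ℂ f Ω) (j k : Fin n) (N : ℕ) :
    Set.EqOn (hpd j ((hpd k)^[N] f)) ((hpd k)^[N] (hpd j f)) Ω := by
  induction N with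
  | zero => exact fun _ _ => rfl
  | succ N ih =>
    rw [Function.iterate_succ_apply', Function.iterate_succ_apply']
    exact (hpd_comm hΩ (DifferentiableOn.iterate_hpd hΩ hf k N) j k).trans (hpd_congr hΩ ih k)

lemma DifferentiableOn.iterHpd (hΩ : IsOpen Ω) (hf : DifferentiableOn ℂ f Ω) (l : List (Fin n))
    (m : Fin n → ℕ) : DifferentiableOn ℂ (iterHpd l m f) Ω := by
  induction l with
  | nil => exact hf
  | cons i l ih => exact DifferentiableOn.iterate_hpd hΩ ih i _

lemma iterHpd_congr (hΩ : IsOpen Ω) (h : Set.EqOn f g Ω) (l : List (Fin n)) (m : Fin n → ℕ) :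
    Set.EqOn (iterHpd l m f) (iterHpd l m g) Ω := by
  induction l with
  | nil => exact h
  | cons i l ih => exact iterate_hpd_congr hΩ ih i _

lemma hpd_iterHpd (hΩ : IsOpen Ω) (hf : DifferentiableOn ℂ f Ω) (j : Fin n) (l : List (Fin n))
    (m : Fin n → ℕ) : Set.EqOn (hpd j (iterHpd l m f)) (iterHpd l m (hpd j f)) Ω := by
  induction l with
  | nil => exact fun _ _ => rfl
  | cons i l ih =>
    exact (iterate_hpd_comm hΩ (DifferentiableOn.iterHpd hΩ hf l m) j i _).trans
      (iterate_hpd_congr hΩ ih i _)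

lemma iterHpd_eq_of_eq {l : List (Fin n)} {m m' : Fin n → ℕ} (h : ∀ i ∈ l, m i = m' i)
    (f : (Fin n → ℂ) → ℂ) : iterHpd l m f = iterHpd l m' f := by
  induction l with
  | nil => rfl
  | cons i l ih =>
    rw [iterHpd_cons, iterHpd_cons, h i List.mem_cons_self,
      ih fun k hk => h k (List.mem_cons_of_mem _ hk)]

/-- The additional derivative is carried to the innermost place, since the partial derivatives of
holomorphic functions commute. As `l` has no repetitions, it is met exactly once. -/
lemma iterHpd_add_single (hΩ : IsOpen Ω) (hf : DifferentiableOn ℂ f Ω) {j : Fin n}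
    {l : List (Fin n)} (hl : l.Nodup) (hj : j ∈ l) (m : Fin n →₀ ℕ) :
    Set.EqOn (iterHpd l (m + Finsupp.single j 1 : Fin n →₀ ℕ) f) (iterHpd l m (hpd j f)) Ω := by
  induction l with
  | nil => simp at hj
  | cons i l ih =>
    rw [List.nodup_cons] at hl
    rw [iterHpd_cons, iterHpd_cons]
    rcases eq_or_ne j i with rfl | hji
    · have h1 : iterHpd l (m + Finsupp.single j 1 : Fin n →₀ ℕ) f = iterHpd l m f :=
        iterHpd_eq_of_eq (fun k hk => by
          have : j ≠ k := fun h => hl.1 (h ▸ hk)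
          simp [this]) f
      rw [h1, Finsupp.add_apply, Finsupp.single_eq_same, Function.iterate_succ_apply]
      exact iterate_hpd_congr hΩ (hpd_iterHpd hΩ hf j l m) j _
    · have hjl : j ∈ l := (List.mem_cons.1 hj).resolve_left hji
      rw [Finsupp.add_apply, Finsupp.single_apply, if_neg hji, add_zero]
      exact iterate_hpd_congr hΩ (ih hl.2 hjl) i _

lemma coeff_taylor (f : (Fin n → ℂ) → ℂ) (y : Fin n → ℂ) (m : Fin n →₀ ℕ) :
    MvPowerSeries.coeff m (taylor f y) =
      iterHpd (List.finRange n) m f y / ∏ i, ((m i).factorial : ℂ) := rfl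

lemma taylor_congr (hΩ : IsOpen Ω) (h : Set.EqOn f g Ω) {y : Fin n → ℂ} (hy : y ∈ Ω) :
    taylor f y = taylor g y := by
  ext m
  rw [coeff_taylor, coeff_taylor, iterHpd_congr hΩ h _ _ hy]

lemma constantCoeff_taylor (f : (Fin n → ℂ) → ℂ) (y : Fin n → ℂ) :
    MvPowerSeries.constantCoeff (taylor f y) = f y := by
  rw [← MvPowerSeries.coeff_zero_eq_constantCoeff_apply, coeff_taylor]
  have : ∀ l : List (Fin n), iterHpd l ((0 : Fin n →₀ ℕ)) f = f := by
    intro l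
    induction l with
    | nil => rfl
    | cons i l ih => rw [iterHpd_cons, ih]; rfl
  rw [this]
  simp

lemma pd_taylor (hΩ : IsOpen Ω) (hf : DifferentiableOn ℂ f Ω) {y : Fin n → ℂ} (hy : y ∈ Ω)
    (j : Fin n) : pd j (taylor f y) = taylor (hpd j f) y := by
  ext m
  rw [coeff_pd, coeff_taylor, coeff_taylor,
    iterHpd_add_single hΩ hf (List.nodup_finRange n) (List.mem_finRange j) m hy]
  have h1 : ∏ i, (((m + Finsupp.single j 1 : Fin n →₀ ℕ) i).factorial : ℂ) =
      (m j + 1) * ∏ i, ((m i).factorial : ℂ) := by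
    rw [← Finset.mul_prod_erase _ _ (Finset.mem_univ j),
      ← Finset.mul_prod_erase _ (fun i => ((m i).factorial : ℂ)) (Finset.mem_univ j), ← mul_assoc]
    congr 1
    · rw [Finsupp.add_apply, Finsupp.single_eq_same, Nat.factorial_succ]
      push_cast
      ring
    · refine Finset.prod_congr rfl fun i hi => ?_
      rw [Finsupp.add_apply, Finsupp.single_apply, if_neg (Finset.ne_of_mem_erase hi).symm,
        add_zero]
  rw [h1]
  have h2 : (m j + 1 : ℂ) ≠ 0 := by exact_mod_cast Nat.succ_ne_zero (m j)
  have h3 : ∏ i, ((m i).factorial : ℂ) ≠ 0 :=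
    Finset.prod_ne_zero_iff.2 fun i _ => by exact_mod_cast Nat.factorial_ne_zero (m i)
  field_simp

lemma taylor_add (hΩ : IsOpen Ω) (hf : DifferentiableOn ℂ f Ω) (hg : DifferentiableOn ℂ g Ω)
    {y : Fin n → ℂ} (hy : y ∈ Ω) : taylor (f + g) y = taylor f y + taylor g y := by
  have h1 : ∀ (k : Fin n) (N : ℕ) {f g : (Fin n → ℂ) → ℂ}, DifferentiableOn ℂ f Ω →
      DifferentiableOn ℂ g Ω → Set.EqOn ((hpd k)^[N] (f + g)) ((hpd k)^[N] f + (hpd k)^[N] g) Ω := by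
    intro k N f g hf hg
    induction N with
    | zero => exact fun _ _ => rfl
    | succ N ih =>
      simp only [Function.iterate_succ_apply']
      exact (hpd_congr hΩ ih k).trans (hpd_add hΩ (DifferentiableOn.iterate_hpd hΩ hf k N)
        (DifferentiableOn.iterate_hpd hΩ hg k N) k)
  have h2 : ∀ (l : List (Fin n)) (m : Fin n → ℕ),
      Set.EqOn (iterHpd l m (f + g)) (iterHpd l m f + iterHpd l m g) Ω := by
    intro l m
    induction l with
    | nil => exact fun _ _ => rfl
    | cons i l ih =>
      exact (iterate_hpd_congr hΩ ih i _).trans (h1 i _ (DifferentiableOn.iterHpd hΩ hf l m)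
        (DifferentiableOn.iterHpd hΩ hg l m))
  ext m
  rw [map_add, coeff_taylor, coeff_taylor, coeff_taylor, h2 _ _ hy, Pi.add_apply, add_div]

end hpd

/-! ### Formal power series are determined by their derivatives -/

lemma coeff_eq_zero_of_pd {f : Ohat n} {N : ℕ} (h0 : MvPowerSeries.constantCoeff f = 0)
    (h : ∀ k m, m.degree < N → MvPowerSeries.coeff m (pd k f) = 0) {m : Fin n →₀ ℕ}
    (hm : m.degree < N + 1) : MvPowerSeries.coeff m f = 0 := by
  rcases eq_or_ne m 0 with rfl | hm0
  · rwa [MvPowerSeries.coeff_zero_eq_constantCoeff_apply]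
  obtain ⟨k, hk⟩ := Finsupp.ne_iff.1 hm0
  have hle : Finsupp.single k 1 ≤ m := by
    rw [Finsupp.single_le_iff]
    exact Nat.one_le_iff_ne_zero.2 hk
  have hdeg : (m - Finsupp.single k 1).degree + 1 = m.degree := by
    conv_rhs => rw [← tsub_add_cancel_of_le hle, map_add, Finsupp.degree_single]
  have := h k (m - Finsupp.single k 1) (by omega)
  rw [coeff_pd, tsub_add_cancel_of_le hle] at this
  refine (mul_eq_zero.1 this).resolve_right ?_
  exact Nat.cast_add_one_ne_zero _

/-- A family of formal power series without constant terms vanishes if the derivatives of its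
members belong to the ideal that it generates. -/
theorem eq_zero_of_pd_mem_span {ι : Type*} {F : ι → Ohat n}
    (h0 : ∀ i, MvPowerSeries.constantCoeff (F i) = 0)
    (h : ∀ i k, pd k (F i) ∈ Ideal.span (Set.range F)) (i : ι) : F i = 0 := by
  -- The induction treats all members at once: if all coefficients of degree below `N` vanish on the
  -- family, they vanish on the ideal, hence on the derivatives, and integration gains one degree.
  have key : ∀ N : ℕ, ∀ i m, m.degree < N → MvPowerSeries.coeff m (F i) = 0 := by
    intro N
    induction N with
    | zero => intro i m hm; omega
    | succ N ih =>
      intro i m hm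
      refine coeff_eq_zero_of_pd (h0 i) (fun k m hm => ?_) hm
      have h1 := h i k
      generalize pd k (F i) = g at h1
      induction h1 using Submodule.span_induction generalizing m with
      | mem g hg =>
        obtain ⟨i, rfl⟩ := hg
        exact ih i m hm
      | zero => simp
      | add a b _ _ ha hb => rw [map_add, ha m hm, hb m hm, add_zero]
      | smul a b _ hb =>
        classical
        rw [smul_eq_mul, MvPowerSeries.coeff_mul]
        refine Finset.sum_eq_zero fun x hx => ?_
        rw [hb x.2, mul_zero]
        have := congrArg Finsupp.degree (mem_antidiagonal.1 hx)
        rw [map_add] at this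
        omega
  ext m
  exact key (m.degree + 1) i m (Nat.lt_succ_self _)

lemma constantCoeff_subst_of_zero {a : Fin n → Ohat n}
    (ha : ∀ i, MvPowerSeries.constantCoeff (a i) = 0) (f : Ohat n) :
    MvPowerSeries.constantCoeff (f.subst a) = MvPowerSeries.constantCoeff f := by
  have hs := hasSubst_of_zero ha
  have h1 : ((1 : ℕ) : ℕ∞) ≤ (f - MvPowerSeries.C (MvPowerSeries.constantCoeff f)).order := by
    rw [Nat.cast_one, MvPowerSeries.one_le_order_iff_constCoeff_eq_zero]
    simp
  have h2 := le_order_subst_of_le ha h1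
  rw [Nat.cast_one, MvPowerSeries.one_le_order_iff_constCoeff_eq_zero,
    ← MvPowerSeries.coe_substAlgHom hs, map_sub, MvPowerSeries.coe_substAlgHom hs,
    MvPowerSeries.subst_C, map_sub, sub_eq_zero] at h2
  rw [h2, MvPowerSeries.constantCoeff_C]

lemma constantCoeff_linSubst (J : Matrix (Fin n) (Fin n) ℂ) (f : Ohat n) :
    MvPowerSeries.constantCoeff (linSubst J f) = MvPowerSeries.constantCoeff f := by
  rw [linSubst, MvPowerSeries.coe_substAlgHom]
  exact constantCoeff_subst_of_zero (fun i => by simp [map_sum]) f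

/-! ### The pull-back of holomorphic functions along formal coordinates -/

/-- The Taylor series of `f` at `y` in the formal coordinates `φ`. -/
def jetPull (φ : Fin n → Ohat n) (y : Fin n → ℂ) (f : (Fin n → ℂ) → ℂ) : Ohat n :=
  MvPowerSeries.subst (fun j => φ j - MvPowerSeries.C (y j)) (taylor f y)

section jetPull

variable {φ : Fin n → Ohat n} {y : Fin n → ℂ} {Ω : Set (Fin n → ℂ)} {f g : (Fin n → ℂ) → ℂ}

lemma constantCoeff_sub_C (hφ : ∀ i, MvPowerSeries.constantCoeff (φ i) = y i) (i : Fin n) :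
    MvPowerSeries.constantCoeff (φ i - MvPowerSeries.C (y i)) = 0 := by
  simp [hφ]

lemma constantCoeff_jetPull (hφ : ∀ i, MvPowerSeries.constantCoeff (φ i) = y i) :
    MvPowerSeries.constantCoeff (jetPull φ y f) = f y := by
  rw [jetPull, constantCoeff_subst_of_zero (constantCoeff_sub_C hφ), constantCoeff_taylor]

lemma jetPull_congr (hΩ : IsOpen Ω) (h : Set.EqOn f g Ω) (hy : y ∈ Ω) :
    jetPull φ y f = jetPull φ y g := by
  rw [jetPull, taylor_congr hΩ h hy, jetPull]

lemma pd_jetPull (hΩ : IsOpen Ω) (hf : DifferentiableOn ℂ f Ω) (hy : y ∈ Ω)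
    (hφ : ∀ i, MvPowerSeries.constantCoeff (φ i) = y i) (k : Fin n) :
    pd k (jetPull φ y f) = ∑ j, jetPull φ y (hpd j f) * pd k (φ j) := by
  rw [jetPull, pd_subst (constantCoeff_sub_C hφ)]
  refine Finset.sum_congr rfl fun j _ => ?_
  rw [pd_taylor hΩ hf hy, map_sub, pd_C, sub_zero]
  rfl

lemma jetPull_add (hΩ : IsOpen Ω) (hf : DifferentiableOn ℂ f Ω) (hg : DifferentiableOn ℂ g Ω)
    (hy : y ∈ Ω) (hφ : ∀ i, MvPowerSeries.constantCoeff (φ i) = y i) :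
    jetPull φ y (f + g) = jetPull φ y f + jetPull φ y g := by
  rw [jetPull, taylor_add hΩ hf hg hy,
    MvPowerSeries.subst_add (hasSubst_of_zero (constantCoeff_sub_C hφ))]
  rfl

/-- The defects for all constants form the family; its derivatives are multiples of the member at
the constant $0$. -/
lemma jetPull_const (hφ : ∀ i, MvPowerSeries.constantCoeff (φ i) = y i) (z : ℂ) :
    jetPull φ y (fun _ => z) = MvPowerSeries.C z := by
  refine sub_eq_zero.1 (eq_zero_of_pd_mem_span
    (F := fun z : ℂ => jetPull φ y (fun _ => z) - MvPowerSeries.C z) (fun z => ?_) (fun z k => ?_) z)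
  · rw [map_sub, constantCoeff_jetPull hφ, MvPowerSeries.constantCoeff_C, sub_self]
  · rw [map_sub, pd_C, sub_zero, pd_jetPull isOpen_univ (differentiableOn_const z) (Set.mem_univ y) hφ]
    refine Ideal.sum_mem _ fun j _ => Ideal.mul_mem_right _ _ (Ideal.subset_span ⟨0, ?_⟩)
    simp only [map_zero, sub_zero, hpd_const]
    rfl

/-- The defects of multiplicativity for all pairs of holomorphic functions form a family whose
derivatives are combinations of the defects for $(\partial_jf,g)$ and $(f,\partial_jg)$. No formula
for the coefficients of a product of Taylor series is needed. -/
lemma jetPull_mul (hΩ : IsOpen Ω) (hf : DifferentiableOn ℂ f Ω) (hg : DifferentiableOn ℂ g Ω)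
    (hy : y ∈ Ω) (hφ : ∀ i, MvPowerSeries.constantCoeff (φ i) = y i) :
    jetPull φ y (f * g) = jetPull φ y f * jetPull φ y g := by
  let ι := {f : (Fin n → ℂ) → ℂ // DifferentiableOn ℂ f Ω}
  refine sub_eq_zero.1 (eq_zero_of_pd_mem_span
    (F := fun p : ι × ι => jetPull φ y (p.1.1 * p.2.1) - jetPull φ y p.1.1 * jetPull φ y p.2.1)
    (fun p => ?_) (fun p k => ?_) (⟨f, hf⟩, ⟨g, hg⟩))
  · rw [map_sub, map_mul, constantCoeff_jetPull hφ, constantCoeff_jetPull hφ,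
      constantCoeff_jetPull hφ, Pi.mul_apply, sub_self]
  · obtain ⟨⟨f, hf⟩, ⟨g, hg⟩⟩ := p
    have hf' := fun j => DifferentiableOn.hpd hΩ hf j
    have hg' := fun j => DifferentiableOn.hpd hΩ hg j
    have h1 : ∀ j, jetPull φ y (hpd j (f * g)) =
        jetPull φ y (hpd j f * g) + jetPull φ y (f * hpd j g) := fun j => by
      rw [jetPull_congr hΩ (hpd_mul hΩ hf hg j) hy,
        jetPull_add hΩ ((hf' j).mul hg) (hf.mul (hg' j)) hy hφ]
    have h2 : pd k (jetPull φ y (f * g) - jetPull φ y f * jetPull φ y g) =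
        ∑ j, ((jetPull φ y (hpd j f * g) - jetPull φ y (hpd j f) * jetPull φ y g) * pd k (φ j) +
          (jetPull φ y (f * hpd j g) - jetPull φ y f * jetPull φ y (hpd j g)) * pd k (φ j)) := by
      rw [map_sub, pd_mul, pd_jetPull hΩ (hf.mul hg) hy hφ, pd_jetPull hΩ hf hy hφ,
        pd_jetPull hΩ hg hy hφ, Finset.sum_mul, Finset.mul_sum, ← Finset.sum_add_distrib,
        ← Finset.sum_sub_distrib]
      refine Finset.sum_congr rfl fun j _ => ?_
      rw [h1]
      ring
    rw [h2]
    exact Ideal.sum_mem _ fun j _ => Ideal.add_mem _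
      (Ideal.mul_mem_right _ _ (Ideal.subset_span ⟨(⟨_, hf' j⟩, ⟨_, hg⟩), rfl⟩))
      (Ideal.mul_mem_right _ _ (Ideal.subset_span ⟨(⟨_, hf⟩, ⟨_, hg' j⟩), rfl⟩))

/-- The algebra of holomorphic functions on `Ω`. -/
def holSubring (Ω : Set (Fin n → ℂ)) : Subring ((Fin n → ℂ) → ℂ) where
  carrier := {f | DifferentiableOn ℂ f Ω}
  mul_mem' hf hg := hf.mul hg
  one_mem' := differentiableOn_const 1
  add_mem' hf hg := hf.add hg
  zero_mem' := differentiableOn_const 0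
  neg_mem' hf := hf.neg

/-- The pull-back of holomorphic functions along formal coordinates as a ring homomorphism. -/
def jetPullHom (hΩ : IsOpen Ω) (hy : y ∈ Ω)
    (hφ : ∀ i, MvPowerSeries.constantCoeff (φ i) = y i) : holSubring Ω →+* Ohat n where
  toFun f := jetPull φ y f
  map_one' := (jetPull_const hφ 1).trans (map_one _)
  map_zero' := (jetPull_const hφ 0).trans (map_zero _)
  map_mul' f g := jetPull_mul hΩ f.2 g.2 hy hφ
  map_add' f g := jetPull_add hΩ f.2 g.2 hy hφ

/-- The determinant is formed in the ring of holomorphic functions and evaluated pointwise by a ring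
homomorphism. -/
lemma differentiableOn_matrix_det {M : (Fin n → ℂ) → Matrix (Fin n) (Fin n) ℂ}
    (hM : ∀ i j, DifferentiableOn ℂ (fun z => M z i j) Ω) :
    DifferentiableOn ℂ (fun z => (M z).det) Ω := by
  let M' : Matrix (Fin n) (Fin n) (holSubring Ω) := Matrix.of fun i j => ⟨fun z => M z i j, hM i j⟩
  have h : (fun z => (M z).det) = (M'.det : (Fin n → ℂ) → ℂ) := by
    funext z
    have := RingHom.map_det ((Pi.evalRingHom (fun _ => ℂ) z).comp (holSubring Ω).subtype) M'
    exact this.symm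
  rw [h]
  exact M'.det.2

lemma jetPull_det (hΩ : IsOpen Ω) {M : (Fin n → ℂ) → Matrix (Fin n) (Fin n) ℂ}
    (hM : ∀ i j, DifferentiableOn ℂ (fun z => M z i j) Ω) (hy : y ∈ Ω)
    (hφ : ∀ i, MvPowerSeries.constantCoeff (φ i) = y i) :
    jetPull φ y (fun z => (M z).det) =
      (Matrix.of fun i j => jetPull φ y fun z => M z i j).det := by
  let M' : Matrix (Fin n) (Fin n) (holSubring Ω) := Matrix.of fun i j => ⟨fun z => M z i j, hM i j⟩
  have h : (fun z => (M z).det) = (M'.det : (Fin n → ℂ) → ℂ) := by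
    funext z
    have := RingHom.map_det ((Pi.evalRingHom (fun _ => ℂ) z).comp (holSubring Ω).subtype) M'
    exact this.symm
  rw [h]
  exact RingHom.map_det (jetPullHom hΩ hy hφ) M'

lemma hpd_comp {Ω' : Set (Fin n → ℂ)} (hΩ : IsOpen Ω) (hΩ' : IsOpen Ω')
    {ψ : (Fin n → ℂ) → Fin n → ℂ} (hψ : ∀ i, DifferentiableOn ℂ (fun z => ψ z i) Ω)
    (hmaps : Set.MapsTo ψ Ω Ω') {h : (Fin n → ℂ) → ℂ} (hh : DifferentiableOn ℂ h Ω') (k : Fin n) :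
    Set.EqOn (hpd k (fun z => h (ψ z)))
      (∑ i, (fun z => hpd i h (ψ z)) * hpd k (fun z => ψ z i)) Ω := by
  intro y hy
  have h1 : DifferentiableAt ℂ h (ψ y) := hh.differentiableAt (hΩ'.mem_nhds (hmaps hy))
  have h2 : ∀ i, DifferentiableAt ℂ (fun z => ψ z i) y := fun i =>
    (hψ i).differentiableAt (hΩ.mem_nhds hy)
  have h3 : DifferentiableAt ℂ ψ y := differentiableAt_pi.2 h2
  rw [hpd, show (fun z => h (ψ z)) = h ∘ ψ from rfl, fderiv_comp y h1 h3,
    ContinuousLinearMap.comp_apply, fderiv_apply_eq_sum_hpd, Finset.sum_apply]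
  refine Finset.sum_congr rfl fun i _ => ?_
  rw [Pi.mul_apply, hpd, hpd, fderiv_pi h2]
  rfl

/-- The pull-back is compatible with holomorphic changes of coordinates. -/
theorem jetPull_comp {Ω' : Set (Fin n → ℂ)} (hΩ : IsOpen Ω) (hΩ' : IsOpen Ω') (hy : y ∈ Ω)
    {ψ : (Fin n → ℂ) → Fin n → ℂ} (hψ : ∀ i, DifferentiableOn ℂ (fun z => ψ z i) Ω)
    (hmaps : Set.MapsTo ψ Ω Ω') {φ' : Fin n → Ohat n} {J : Matrix (Fin n) (Fin n) ℂ}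
    (hφ : ∀ i, MvPowerSeries.constantCoeff (φ i) = y i)
    (hφ' : ∀ i, MvPowerSeries.constantCoeff (φ' i) = ψ y i)
    (hJ : ∀ i, jetPull φ y (fun z => ψ z i) = linSubst J (φ' i))
    {h : (Fin n → ℂ) → ℂ} (hh : DifferentiableOn ℂ h Ω') :
    jetPull φ y (fun z => h (ψ z)) = linSubst J (jetPull φ' (ψ y) h) := by
  have hψ' : DifferentiableOn ℂ ψ Ω := differentiableOn_pi.2 hψ
  -- The family of defects runs over all holomorphic functions on the target. By the chain rule, the
  -- derivative of the defect of $h$ is a combination of the defects of the $\partial_ih$.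
  refine sub_eq_zero.1 (eq_zero_of_pd_mem_span
    (F := fun h : {h : (Fin n → ℂ) → ℂ // DifferentiableOn ℂ h Ω'} =>
      jetPull φ y (fun z => h.1 (ψ z)) - linSubst J (jetPull φ' (ψ y) h.1))
    (fun h => ?_) (fun h k => ?_) ⟨h, hh⟩)
  · rw [map_sub, constantCoeff_jetPull hφ, constantCoeff_linSubst, constantCoeff_jetPull hφ',
      sub_self]
  · obtain ⟨h, hh⟩ := h
    have hh' := fun i => DifferentiableOn.hpd hΩ' hh i
    have hd : ∀ {h : (Fin n → ℂ) → ℂ}, DifferentiableOn ℂ h Ω' →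
        DifferentiableOn ℂ (fun z => h (ψ z)) Ω := fun hh => hh.comp hψ' hmaps
    have hprod : ∀ i k, (fun z => hpd i h (ψ z)) * hpd k (fun z => ψ z i) ∈ holSubring Ω :=
      fun i k => (hd (hh' i)).mul (DifferentiableOn.hpd hΩ (hψ i) k)
    have h1 : ∀ j, jetPull φ y (hpd j (fun z => h (ψ z))) =
        ∑ i, jetPull φ y (fun z => hpd i h (ψ z)) * jetPull φ y (hpd j fun z => ψ z i) := by
      intro j
      rw [jetPull_congr hΩ (hpd_comp hΩ hΩ' hψ hmaps hh j) hy]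
      have := map_sum (jetPullHom hΩ hy hφ) (fun i => (⟨_, hprod i j⟩ : holSubring Ω)) Finset.univ
      refine Eq.trans ?_ (this.trans (Finset.sum_congr rfl fun i _ =>
        jetPull_mul hΩ (hd (hh' i)) (DifferentiableOn.hpd hΩ (hψ i) j) hy hφ))
      change _ = jetPull φ y _
      rw [AddSubmonoidClass.coe_finsetSum]
    have h2 : ∀ i, ∑ j, jetPull φ y (hpd j fun z => ψ z i) * pd k (φ j) =
        ∑ l, MvPowerSeries.C (J l k) * linSubst J (pd l (φ' i)) := by
      intro i
      rw [← pd_jetPull hΩ (hψ i) hy hφ, hJ, pd_linSubst]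
    have h3 : pd k (jetPull φ y (fun z => h (ψ z)) - linSubst J (jetPull φ' (ψ y) h)) =
        ∑ i, (jetPull φ y (fun z => hpd i h (ψ z)) - linSubst J (jetPull φ' (ψ y) (hpd i h))) *
          ∑ l, MvPowerSeries.C (J l k) * linSubst J (pd l (φ' i)) := by
      rw [map_sub, pd_jetPull hΩ (hd hh) hy hφ, pd_linSubst]
      simp only [sub_mul, Finset.sum_sub_distrib]
      congr 1
      · simp only [← h2, h1, Finset.sum_mul, Finset.mul_sum]
        rw [Finset.sum_comm]
        exact Finset.sum_congr rfl fun i _ => Finset.sum_congr rfl fun j _ => by ring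
      · simp only [pd_jetPull hΩ' hh (hmaps hy) hφ', map_sum, map_mul, Finset.mul_sum]
        rw [Finset.sum_comm]
        exact Finset.sum_congr rfl fun i _ => Finset.sum_congr rfl fun j _ => by ring
    rw [h3]
    exact Ideal.sum_mem _ fun i _ =>
      Ideal.mul_mem_right _ _ (Ideal.subset_span ⟨⟨_, hh' i⟩, rfl⟩)

end jetPull

/-! ### The one-form of a formal coordinate -/

/-- The Jacobian matrix of formal coordinates. -/
def formalJac (φ : Fin n → Ohat n) : Matrix (Fin n) (Fin n) (Ohat n) :=
  Matrix.of fun i k => pd k (φ i)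

/-- The one-form `-(d log det Dφ + ∑ θ_i dφ^i)`. -/
def coordForm (φ θ : Fin n → Ohat n) : FForm1 n := fun k =>
  -((formalJac φ).det⁻¹ * pd k (formalJac φ).det + ∑ i, θ i * pd k (φ i))

/-- Taking $d\log\det$ of `hM` gives $d\log\det M+d\log\det D\varphi=J^*d\log\det D\varphi'$,
because $\det J$ is constant. The hypothesis `hdet` says that $d\log\det M$ is the difference of the
forms defined by $\theta$ and by $\theta'$, so the two corrections match. -/
lemma coordForm_linPull1 {φ θ φ' θ' : Fin n → Ohat n} {J : Matrix (Fin n) (Fin n) ℂ}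
    {M : Matrix (Fin n) (Fin n) (Ohat n)}
    (hM : M * formalJac φ = (formalJac φ').map (linSubst J) * J.map MvPowerSeries.C)
    (h1 : MvPowerSeries.constantCoeff M.det ≠ 0)
    (h2 : MvPowerSeries.constantCoeff (formalJac φ).det ≠ 0)
    (h3 : MvPowerSeries.constantCoeff (formalJac φ').det ≠ 0)
    (hdet : ∀ k, pd k M.det = M.det * (∑ j, θ j * pd k (φ j) -
      ∑ i, linSubst J (θ' i) * ∑ j, M i j * pd k (φ j))) :
    coordForm φ θ = linPull1 J (coordForm φ' θ') := by
  have hMk : ∀ i k, ∑ j, M i j * pd k (φ j) =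
      ∑ l, linSubst J (pd l (φ' i)) * MvPowerSeries.C (J l k) := fun i k => by
    simpa [Matrix.mul_apply, formalJac] using congrFun (congrFun hM i) k
  have hdetM : M.det * (formalJac φ).det =
      linSubst J (formalJac φ').det * MvPowerSeries.C J.det := by
    have := congrArg Matrix.det hM
    rw [Matrix.det_mul, Matrix.det_mul] at this
    rw [this]
    congr 1
    · exact (RingHom.map_det (linSubst J : Ohat n →+* Ohat n) (formalJac φ')).symm
    · exact (RingHom.map_det (MvPowerSeries.C : ℂ →+* Ohat n) J).symm
  funext k
  have hpd := congrArg (pd k) hdetM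
  rw [pd_mul, pd_mul, pd_C, mul_zero, add_zero, hdet, pd_linSubst] at hpd
  set m := M.det
  set δ := (formalJac φ).det
  set δ' := (formalJac φ').det
  have hm : m * m⁻¹ = 1 := MvPowerSeries.mul_inv_cancel _ h1
  have hδ : δ * δ⁻¹ = 1 := MvPowerSeries.mul_inv_cancel _ h2
  have hδ' : linSubst J δ' * linSubst J δ'⁻¹ = 1 := by
    rw [← map_mul, MvPowerSeries.mul_inv_cancel _ h3, map_one]
  have hb : linSubst J δ'⁻¹ = m⁻¹ * δ⁻¹ * MvPowerSeries.C J.det := by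
    linear_combination (-linSubst J δ'⁻¹ * δ * δ⁻¹) * hm - linSubst J δ'⁻¹ * hδ +
      (linSubst J δ'⁻¹ * m⁻¹ * δ⁻¹) * hdetM + (m⁻¹ * δ⁻¹ * MvPowerSeries.C J.det) * hδ'
  have h4 : ∑ i, linSubst J (θ' i) * ∑ j, M i j * pd k (φ j) = ∑ l, MvPowerSeries.C (J l k) *
      ∑ i, linSubst J (θ' i) * linSubst J (pd l (φ' i)) := by
    simp only [hMk, Finset.mul_sum]
    rw [Finset.sum_comm]
    exact Finset.sum_congr rfl fun i _ => Finset.sum_congr rfl fun j _ => by ring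
  have h5 : linPull1 J (coordForm φ' θ') k =
      -(linSubst J δ'⁻¹ * ∑ l, MvPowerSeries.C (J l k) * linSubst J (pd l δ')) -
        ∑ i, linSubst J (θ' i) * ∑ j, M i j * pd k (φ j) := by
    rw [h4]
    simp only [linPull1, coordForm, map_neg, map_add, map_mul, map_sum, mul_neg, mul_add,
      Finset.sum_neg_distrib, Finset.sum_add_distrib, Finset.mul_sum]
    rw [neg_add, sub_eq_add_neg]
    congr 2
    exact Finset.sum_congr rfl fun l _ => by ring
  rw [h5, hb, coordForm]
  set S := ∑ j, θ j * pd k (φ j)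
  set S' := ∑ i, linSubst J (θ' i) * ∑ j, M i j * pd k (φ j)
  set T := ∑ l, MvPowerSeries.C (J l k) * linSubst J (pd l δ')
  linear_combination (-m⁻¹ * δ⁻¹) * hpd + (δ * δ⁻¹ * (S - S') + δ⁻¹ * pd k δ) * hm + (S - S') * hδ

section

variable {E : Type*} [NormedAddCommGroup E] [NormedSpace ℝ E] {Ω : Set E} {v : E}

/-- The inverses of a smooth family of invertible formal power series. -/
lemma SerHasDeriv.inv (hΩ : IsOpen Ω) {f f' : E → Ohat n} (hf : SerHasDeriv Ω v f f')
    (h1 : ∀ y ∈ Ω, MvPowerSeries.constantCoeff (f y) = 1) :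
    SerHasDeriv Ω v (fun y => (f y)⁻¹) fun y => -(f y)⁻¹ * (f y)⁻¹ * f' y := by
  classical
  have hinv : ∀ y ∈ Ω, f y * (f y)⁻¹ = 1 := fun y hy =>
    MvPowerSeries.mul_inv_cancel _ (by rw [h1 y hy]; exact one_ne_zero)
  -- The constant terms are identically $1$ on the open set, so their derivative vanishes.
  have h0 : ∀ y ∈ Ω, MvPowerSeries.coeff 0 (f' y) = 0 := fun y hy =>
    ((hf 0).congr (g' := fun y => MvPowerSeries.coeff 0 (f' y)) hΩ
      (g := fun _ => (1 : ℂ)) (fun y hy => by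
        rw [MvPowerSeries.coeff_zero_eq_constantCoeff_apply, h1 y hy]) fun y _ => rfl).unique
      (ScalHasDeriv.const 1) hy
  have key : ∀ N : ℕ, ∀ m : Fin n →₀ ℕ, m.degree < N →
      ScalHasDeriv Ω v (fun y => MvPowerSeries.coeff m (f y)⁻¹)
        fun y => MvPowerSeries.coeff m (-(f y)⁻¹ * (f y)⁻¹ * f' y) := by
    intro N
    induction N with
    | zero => intro m hm; omega
    | succ N ih =>
      intro m hm
      -- As the constant term of $f$ is $1$, the relation $ff^{-1}=1$ expresses the coefficient `m`
      -- of the inverse by those of smaller degree; the omitted pair is that coefficient itself.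
      set A := (antidiagonal m).erase (0, m)
      have hA : (0, m) ∈ antidiagonal m := by simp
      have hsum := ScalHasDeriv.sum (v := v) hΩ A
        (f := fun x y => MvPowerSeries.coeff x.1 (f y) * MvPowerSeries.coeff x.2 (f y)⁻¹)
        (fun x hx => (hf x.1).mul hΩ (ih x.2 (by
          obtain ⟨hx1, hx2⟩ := Finset.mem_erase.1 hx
          have hx3 := mem_antidiagonal.1 hx2
          have hx4 := congrArg Finsupp.degree hx3
          rw [map_add] at hx4
          have : x.1.degree ≠ 0 := fun h => hx1 (by
            rw [Finsupp.degree_eq_zero_iff] at h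
            rw [h, zero_add] at hx3
            exact Prod.ext h hx3)
          omega)))
      refine ((ScalHasDeriv.const (MvPowerSeries.coeff m (1 : Ohat n))).add hΩ
        ((ScalHasDeriv.const (-1)).mul hΩ hsum)).congr hΩ (fun y hy => ?_) fun y hy => ?_
      · have := congrArg (MvPowerSeries.coeff m) (hinv y hy)
        rw [MvPowerSeries.coeff_mul, ← Finset.add_sum_erase _ _ hA] at this
        simp only [MvPowerSeries.coeff_zero_eq_constantCoeff_apply, h1 y hy] at this
        rw [← this]
        ring
      · have h2 : f' y * (f y)⁻¹ + f y * (-(f y)⁻¹ * (f y)⁻¹ * f' y) = 0 := by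
          linear_combination (-(f y)⁻¹ * f' y) * hinv y hy
        have h3 := congrArg (MvPowerSeries.coeff m) h2
        rw [map_add, MvPowerSeries.coeff_mul, MvPowerSeries.coeff_mul,
          ← Finset.sum_add_distrib, ← Finset.add_sum_erase _ _ hA, map_zero] at h3
        simp only [h0 y hy, MvPowerSeries.coeff_zero_eq_constantCoeff_apply (f y), h1 y hy,
          zero_mul, one_mul, zero_add] at h3 ⊢
        linear_combination -h3
  exact fun m => key (m.degree + 1) m (Nat.lt_succ_self _)

/-- The derivative of the family `f` along the vector field `∂_v + X` is `g`. -/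
def HasTotDeriv (Ω : Set E) (v : E) (X : E → FVect n) (f g : E → Ohat n) : Prop :=
  SerHasDeriv Ω v f fun y => g y - ∑ k, X y k * pd k (f y)

namespace HasTotDeriv

variable {X : E → FVect n} {f f' g g' : E → Ohat n}

lemma congr (hΩ : IsOpen Ω) (h : HasTotDeriv Ω v X f f') (hfg : ∀ y ∈ Ω, f y = g y)
    (hfg' : ∀ y ∈ Ω, f' y = g' y) : HasTotDeriv Ω v X g g' :=
  SerHasDeriv.congr hΩ h hfg fun y hy => by rw [hfg y hy, hfg' y hy]

lemma const (z : ℂ) : HasTotDeriv Ω v X (fun _ => MvPowerSeries.C z) fun _ => 0 := by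
  simpa [HasTotDeriv, pd_C] using SerHasDeriv.const (Ω := Ω) (v := v) (MvPowerSeries.C z : Ohat n)

lemma add (hΩ : IsOpen Ω) (hf : HasTotDeriv Ω v X f f') (hg : HasTotDeriv Ω v X g g') :
    HasTotDeriv Ω v X (fun y => f y + g y) fun y => f' y + g' y :=
  (SerHasDeriv.add hΩ hf hg).congr hΩ (fun _ _ => rfl) fun y _ => by
    simp only [map_add, mul_add, Finset.sum_add_distrib]
    ring

lemma mul (hΩ : IsOpen Ω) (hf : HasTotDeriv Ω v X f f') (hg : HasTotDeriv Ω v X g g') :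
    HasTotDeriv Ω v X (fun y => f y * g y) fun y => f' y * g y + f y * g' y :=
  (SerHasDeriv.mul hΩ hf hg).congr hΩ (fun _ _ => rfl) fun y _ => by
    simp only [pd_mul, mul_add, Finset.sum_add_distrib, sub_mul, mul_sub, Finset.sum_mul,
      Finset.mul_sum]
    rw [Finset.sum_congr rfl fun k _ => (mul_assoc (X y k) (pd k (f y)) (g y)).symm,
      Finset.sum_congr rfl fun k _ => mul_left_comm (X y k) (f y) (pd k (g y))]
    ring

lemma neg (hΩ : IsOpen Ω) (hf : HasTotDeriv Ω v X f f') :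
    HasTotDeriv Ω v X (fun y => -f y) fun y => -f' y := by
  simpa using (const (-1)).mul hΩ hf

lemma sum (hΩ : IsOpen Ω) {ι : Type*} (s : Finset ι) {f f' : ι → E → Ohat n}
    (h : ∀ i ∈ s, HasTotDeriv Ω v X (f i) (f' i)) :
    HasTotDeriv Ω v X (fun y => ∑ i ∈ s, f i y) fun y => ∑ i ∈ s, f' i y := by
  classical
  induction s using Finset.induction_on with
  | empty => simpa using const (Ω := Ω) (v := v) (X := X) 0
  | insert i s hi ih =>
    simp only [Finset.sum_insert hi]
    exact (h i (Finset.mem_insert_self _ _)).add hΩ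
      (ih fun j hj => h j (Finset.mem_insert_of_mem hj))

lemma prod (hΩ : IsOpen Ω) {ι : Type*} [DecidableEq ι] (s : Finset ι) {f f' : ι → E → Ohat n}
    (h : ∀ i ∈ s, HasTotDeriv Ω v X (f i) (f' i)) :
    HasTotDeriv Ω v X (fun y => ∏ i ∈ s, f i y)
      fun y => ∑ j ∈ s, f' j y * ∏ i ∈ s.erase j, f i y := by
  induction s using Finset.induction_on with
  | empty => simpa using const (Ω := Ω) (v := v) (X := X) 1
  | insert i s hi ih =>
    refine ((h i (Finset.mem_insert_self _ _)).mul hΩ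
      (ih fun j hj => h j (Finset.mem_insert_of_mem hj))).congr hΩ (fun y _ => ?_) fun y _ => ?_
    · rw [Finset.prod_insert hi]
    · rw [Finset.sum_insert hi, Finset.erase_insert hi, Finset.mul_sum]
      congr 1
      refine Finset.sum_congr rfl fun j hj => ?_
      have hij : i ≠ j := fun h => hi (h ▸ hj)
      rw [Finset.erase_insert_of_ne hij, Finset.prod_insert (by simp [hi])]
      ring

/-- The derivative of a determinant. -/
lemma det (hΩ : IsOpen Ω) {A A' : E → Matrix (Fin n) (Fin n) (Ohat n)}
    (h : ∀ i j, HasTotDeriv Ω v X (fun y => A y i j) fun y => A' y i j) :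
    HasTotDeriv Ω v X (fun y => (A y).det)
      fun y => ∑ j, ((A y).updateCol j fun i => A' y i j).det := by
  have h1 : ∀ τ : Equiv.Perm (Fin n), HasTotDeriv Ω v X
      (fun y => MvPowerSeries.C ((Equiv.Perm.sign τ : ℤ) : ℂ) * ∏ i, A y (τ i) i) fun y =>
      MvPowerSeries.C ((Equiv.Perm.sign τ : ℤ) : ℂ) *
        ∑ j, A' y (τ j) j * ∏ i ∈ Finset.univ.erase j, A y (τ i) i := fun τ => by
    simpa only [zero_mul, zero_add] using (const _).mul hΩ (prod hΩ Finset.univ fun i _ => h (τ i) i)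
  refine (sum hΩ Finset.univ fun τ _ => h1 τ).congr hΩ (fun y _ => ?_) fun y _ => ?_
  · rw [Matrix.det_apply']
    simp
  · simp only [Matrix.det_apply', Finset.mul_sum]
    rw [Finset.sum_comm]
    refine Finset.sum_congr rfl fun j _ => Finset.sum_congr rfl fun τ _ => ?_
    rw [← Finset.mul_prod_erase Finset.univ _ (Finset.mem_univ j), Matrix.updateCol_self]
    have : ∏ i ∈ Finset.univ.erase j, (A y).updateCol j (fun i => A' y i j) (τ i) i =
        ∏ i ∈ Finset.univ.erase j, A y (τ i) i := Finset.prod_congr rfl fun i hi => by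
      rw [Matrix.updateCol_ne (Finset.ne_of_mem_erase hi)]
    rw [this]
    simp

lemma inv (hΩ : IsOpen Ω) (hf : HasTotDeriv Ω v X f f')
    (h1 : ∀ y ∈ Ω, MvPowerSeries.constantCoeff (f y) = 1) :
    HasTotDeriv Ω v X (fun y => (f y)⁻¹) fun y => -(f y)⁻¹ * (f y)⁻¹ * f' y := by
  refine (SerHasDeriv.inv hΩ hf h1).congr hΩ (fun _ _ => rfl) fun y hy => ?_
  have hinv : f y * (f y)⁻¹ = 1 :=
    MvPowerSeries.mul_inv_cancel _ (by rw [h1 y hy]; exact one_ne_zero)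
  have hpd : ∀ k, pd k (f y)⁻¹ = -(f y)⁻¹ * (f y)⁻¹ * pd k (f y) := by
    intro k
    have h := congrArg (pd k) hinv
    rw [pd_mul, ← map_one MvPowerSeries.C, pd_C] at h
    linear_combination (f y)⁻¹ * h - pd k (f y)⁻¹ * hinv
  simp only [hpd, mul_sub, Finset.mul_sum]
  congr 1
  exact Finset.sum_congr rfl fun k _ => by ring

/-- The commutator $[\partial_v+X,\partial_k]=-\sum_l(\partial_kX^l)\,\partial_l$ supplies the
additional term. -/
lemma pd (hΩ : IsOpen Ω) (hf : HasTotDeriv Ω v X f f') (k : Fin n) :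
    HasTotDeriv Ω v X (fun y => pd k (f y))
      fun y => pd k (f' y) - ∑ l, ChiralDO.pd k (X y l) * ChiralDO.pd l (f y) := by
  refine (SerHasDeriv.pd hΩ hf k).congr hΩ (fun _ _ => rfl) fun y _ => ?_
  simp only [map_sub, map_sum, pd_mul, Finset.sum_add_distrib, pd_comm k]
  ring

end HasTotDeriv

/-- If the formal coordinates `φ` and the series `θ` are flat, then the one-form that they define
satisfies the equation `∂_v ξ + L_X ξ = d (div X)`. -/
theorem coordForm_flat (hΩ : IsOpen Ω) {X : E → FVect n} {φ θ : E → Fin n → Ohat n}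
    (hφ : ∀ i, HasTotDeriv Ω v X (fun y => φ y i) fun _ => 0)
    (hθ : ∀ i, HasTotDeriv Ω v X (fun y => θ y i) fun _ => 0)
    (h1 : ∀ y ∈ Ω, MvPowerSeries.constantCoeff (formalJac (φ y)).det = 1) :
    ∃ ξ' : E → FForm1 n,
      (∀ k, SerHasDeriv Ω v (fun y => coordForm (φ y) (θ y) k) fun y => ξ' y k) ∧
      ∀ y ∈ Ω, ξ' y + lie1 (X y) (coordForm (φ y) (θ y)) = gfC1 (X y) := by
  have hA : ∀ i k, HasTotDeriv Ω v X (fun y => formalJac (φ y) i k) fun y =>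
      -∑ l, ChiralDO.pd k (X y l) * ChiralDO.pd l (φ y i) := fun i k => by
    have := (hφ i).pd hΩ k
    simp only [map_zero, zero_sub] at this
    exact this
  -- The total derivative of the $j$-th column of $D\varphi$ is $-\sum_l(\partial_jX^l)$ times the
  -- $l$-th column. In the determinant only $l=j$ survives, and the sum over $j$ is
  -- $-\operatorname{div}X$.
  have hδ : HasTotDeriv Ω v X (fun y => (formalJac (φ y)).det) fun y =>
      -(∑ j, pd j (X y j)) * (formalJac (φ y)).det := by
    refine (HasTotDeriv.det (A' := fun y => Matrix.of fun i k =>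
      -∑ l, ChiralDO.pd k (X y l) * ChiralDO.pd l (φ y i)) hΩ hA).congr hΩ
      (fun _ _ => rfl) fun y _ => ?_
    rw [neg_mul, Finset.sum_mul, ← Finset.sum_neg_distrib]
    refine Finset.sum_congr rfl fun j _ => ?_
    have := Matrix.det_updateCol_sum (formalJac (φ y)) j fun l => -pd j (X y l)
    rw [smul_eq_mul, neg_mul] at this
    rw [← this]
    congr 2
    funext i
    simp [formalJac]
  -- The desired equation in components: the transport term $X(\xi_k)$ belongs to the total
  -- derivative, and the remaining part of $\mathcal L_X\xi$ is the sum over `l`.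
  have hk : ∀ k, HasTotDeriv Ω v X (fun y => coordForm (φ y) (θ y) k) fun y =>
      pd k (∑ i, pd i (X y i)) - ∑ l, pd k (X y l) * coordForm (φ y) (θ y) l := by
    intro k
    refine (HasTotDeriv.neg hΩ (((hδ.inv hΩ h1).mul hΩ (hδ.pd hΩ k)).add hΩ
      (HasTotDeriv.sum hΩ Finset.univ fun i _ => (hθ i).mul hΩ (hA i k)))).congr hΩ
      (fun _ _ => rfl) fun y hy => ?_
    have hinv : (formalJac (φ y)).det * (formalJac (φ y)).det⁻¹ = 1 :=
      MvPowerSeries.mul_inv_cancel _ (by rw [h1 y hy]; exact one_ne_zero)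
    have e1 : ∑ l, pd k (X y l) * coordForm (φ y) (θ y) l =
        -((formalJac (φ y)).det⁻¹ * ∑ l, pd k (X y l) * pd l (formalJac (φ y)).det) -
          ∑ i, θ y i * ∑ l, pd k (X y l) * pd l (φ y i) := by
      simp only [coordForm, mul_neg, mul_add, Finset.sum_neg_distrib, Finset.sum_add_distrib,
        Finset.mul_sum, neg_add, sub_eq_add_neg]
      congr 2
      · exact Finset.sum_congr rfl fun l _ => by ring
      · rw [Finset.sum_comm]
        exact Finset.sum_congr rfl fun i _ => Finset.sum_congr rfl fun l _ => by ring
    have e2 : pd k (-(∑ j, pd j (X y j)) * (formalJac (φ y)).det) =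
        -(pd k (∑ j, pd j (X y j)) * (formalJac (φ y)).det +
          (∑ j, pd j (X y j)) * pd k (formalJac (φ y)).det) := by
      rw [neg_mul, map_neg, pd_mul]
    rw [e1, e2]
    simp only [zero_mul, zero_add, mul_neg, Finset.sum_neg_distrib]
    set δ := (formalJac (φ y)).det
    set D := ∑ i, pd i (X y i)
    linear_combination (-D * δ⁻¹ * pd k δ + pd k D) * hinv
  refine ⟨_, hk, fun y _ => ?_⟩
  funext k
  simp only [Pi.add_apply, lie1, gfC1, dFun, Finset.sum_add_distrib]
  ring

end

/-! ### The derivatives of the pull-backs of holomorphic functions -/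

/-- The derivatives of the pull-back of holomorphic functions along a family of formal
coordinates. -/
theorem serHasDeriv_jetPull {Ω : Set (Fin n → ℂ)} (hΩ : IsOpen Ω) {v : Fin n → ℂ}
    {φ φ' : (Fin n → ℂ) → Fin n → Ohat n}
    (hφ : ∀ y ∈ Ω, ∀ i, MvPowerSeries.constantCoeff (φ y i) = y i)
    (hφ' : ∀ i, SerHasDeriv Ω v (fun y => φ y i) fun y => φ' y i)
    {f : (Fin n → ℂ) → ℂ} (hf : DifferentiableOn ℂ f Ω) :
    SerHasDeriv Ω v (fun y => jetPull (φ y) y f) fun y =>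
      ∑ j, jetPull (φ y) y (hpd j f) * φ' y j := by
  classical
  -- The base point of $\varphi_y$ is $y$ itself, so the constant term of its derivative is the
  -- direction $v$. The induction starts from here, with the ordinary derivative of $f$.
  have h0 : ∀ y ∈ Ω, ∀ i, MvPowerSeries.constantCoeff (φ' y i) = v i := by
    intro y hy i
    have h1 := (hφ' i 0).congr (g := fun y => y i)
      (g' := fun y => MvPowerSeries.coeff 0 (φ' y i)) hΩ
      (fun y hy => by rw [MvPowerSeries.coeff_zero_eq_constantCoeff_apply, hφ y hy i])
      fun _ _ => rfl
    rw [← MvPowerSeries.coeff_zero_eq_constantCoeff_apply]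
    refine (h1.2 y hy).symm.trans ?_
    have : (fun y : Fin n → ℂ => y i) =
        ContinuousLinearMap.proj (R := ℝ) (φ := fun _ : Fin n => ℂ) i := rfl
    rw [this, ContinuousLinearMap.fderiv]
    rfl
  have key : ∀ N : ℕ, ∀ f : (Fin n → ℂ) → ℂ, DifferentiableOn ℂ f Ω → ∀ m : Fin n →₀ ℕ,
      m.degree < N → ScalHasDeriv Ω v (fun y => MvPowerSeries.coeff m (jetPull (φ y) y f))
        fun y => MvPowerSeries.coeff m (∑ j, jetPull (φ y) y (hpd j f) * φ' y j) := by
    intro N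
    induction N with
    | zero => intro f _ m hm; omega
    | succ N ih =>
      intro f hf m hm
      rcases eq_or_ne m 0 with rfl | hm0
      · simp only [MvPowerSeries.coeff_zero_eq_constantCoeff_apply]
        refine ⟨((contDiffOn_of_differentiableOn hΩ hf).restrict_scalars ℝ).congr fun y hy =>
          constantCoeff_jetPull (hφ y hy), fun y hy => ?_⟩
        have h1 : (fun y => MvPowerSeries.constantCoeff (jetPull (φ y) y f)) =ᶠ[nhds y] f :=
          Filter.eventuallyEq_of_mem (hΩ.mem_nhds hy) fun z hz => constantCoeff_jetPull (hφ z hz)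
        rw [h1.fderiv_eq, (hf.differentiableAt (hΩ.mem_nhds hy)).fderiv_restrictScalars ℝ,
          ContinuousLinearMap.coe_restrictScalars', fderiv_apply_eq_sum_hpd]
        beta_reduce
        rw [map_sum]
        refine Finset.sum_congr rfl fun j _ => ?_
        rw [map_mul, constantCoeff_jetPull (hφ y hy), h0 y hy]
      -- A coefficient of positive degree is read off from $\partial_k$ of the pull-back, which
      -- involves the pull-backs of the $\partial_jf$ in lower degree. For this reason the induction
      -- is over all holomorphic functions simultaneously.
      · obtain ⟨k, hk⟩ := Finsupp.ne_iff.1 hm0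
        have hle : Finsupp.single k 1 ≤ m := by
          rw [Finsupp.single_le_iff]
          exact Nat.one_le_iff_ne_zero.2 hk
        obtain ⟨m', rfl⟩ : ∃ m', m = m' + Finsupp.single k 1 :=
          ⟨m - Finsupp.single k 1, (tsub_add_cancel_of_le hle).symm⟩
        rw [map_add, Finsupp.degree_single] at hm
        have hz : (m' k + 1 : ℂ) ≠ 0 := by exact_mod_cast Nat.succ_ne_zero (m' k)
        have hcoeff : ∀ F : Ohat n, MvPowerSeries.coeff (m' + Finsupp.single k 1) F =
            (m' k + 1 : ℂ)⁻¹ * MvPowerSeries.coeff m' (pd k F) := fun F => by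
          rw [coeff_pd]
          field_simp
        have hsum := ScalHasDeriv.sum (v := v) hΩ Finset.univ fun j _ =>
          ScalHasDeriv.sum (v := v) hΩ (antidiagonal m') fun x hx =>
            (ih (hpd j f) (DifferentiableOn.hpd hΩ hf j) x.1 (by
              have := congrArg Finsupp.degree (mem_antidiagonal.1 hx)
              rw [map_add] at this
              omega)).mul hΩ ((hφ' j).pd hΩ k x.2)
        refine ((ScalHasDeriv.const (m' k + 1 : ℂ)⁻¹).mul hΩ hsum).congr hΩ (fun y hy => ?_)
          fun y hy => ?_
        · rw [hcoeff, pd_jetPull hΩ hf hy (hφ y hy), map_sum]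
          simp only [MvPowerSeries.coeff_mul]
        · rw [zero_mul, zero_add, hcoeff]
          congr 1
          simp only [Finset.sum_add_distrib, ← MvPowerSeries.coeff_mul, ← map_sum, ← map_add]
          congr 1
          simp only [map_sum, pd_mul, Finset.sum_add_distrib]
          congr 1
          have hd : ∀ j, pd k (jetPull (φ y) y (hpd j f)) =
              ∑ i, jetPull (φ y) y (hpd j (hpd i f)) * pd k (φ y i) := fun j => by
            rw [pd_jetPull hΩ (DifferentiableOn.hpd hΩ hf j) hy (hφ y hy)]
            exact Finset.sum_congr rfl fun i _ => by
              rw [jetPull_congr hΩ (hpd_comm hΩ hf i j) hy]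
          simp only [hd, Finset.sum_mul]
          rw [Finset.sum_comm]
          exact Finset.sum_congr rfl fun i _ => Finset.sum_congr rfl fun j _ => by ring
  exact fun m => key (m.degree + 1) f hf m (Nat.lt_succ_self _)

/-- The pull-backs of holomorphic functions along flat formal coordinates are flat. -/
theorem hasTotDeriv_jetPull {Ω : Set (Fin n → ℂ)} (hΩ : IsOpen Ω) {v : Fin n → ℂ}
    {X : (Fin n → ℂ) → FVect n} {φ : (Fin n → ℂ) → Fin n → Ohat n}
    (hφ : ∀ y ∈ Ω, ∀ i, MvPowerSeries.constantCoeff (φ y i) = y i)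
    (hφX : ∀ i, HasTotDeriv Ω v X (fun y => φ y i) fun _ => 0)
    {f : (Fin n → ℂ) → ℂ} (hf : DifferentiableOn ℂ f Ω) :
    HasTotDeriv Ω v X (fun y => jetPull (φ y) y f) fun _ => 0 := by
  refine (serHasDeriv_jetPull hΩ hφ (φ' := fun y j => 0 - ∑ k, X y k * pd k (φ y j)) hφX hf).congr
    hΩ (fun _ _ => rfl) fun y hy => ?_
  simp only [zero_sub, pd_jetPull hΩ hf hy (hφ y hy), mul_neg, Finset.sum_neg_distrib,
    Finset.mul_sum]
  rw [Finset.sum_comm]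
  congr 1
  exact Finset.sum_congr rfl fun i _ => Finset.sum_congr rfl fun j _ => by ring

/-! ### Coordinate changes -/

section Charts

variable {n : ℕ} {X : Type*} [TopologicalSpace X] [ChartedSpace (Fin n → ℂ) X]

lemma isOpen_overlap (e e' : atlas (Fin n → ℂ) X) : IsOpen (overlap e e') :=
  (e.1.symm.trans e'.1).open_source

lemma mem_overlap {e e' : atlas (Fin n → ℂ) X} {y : Fin n → ℂ} :
    y ∈ overlap e e' ↔ y ∈ e.1.target ∧ e.1.symm y ∈ e'.1.source := by
  simp [overlap]

lemma coordChange_mem_target {e e' : atlas (Fin n → ℂ) X} {y : Fin n → ℂ}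
    (hy : y ∈ overlap e e') : coordChange e e' y ∈ e'.1.target :=
  e'.1.map_source (mem_overlap.1 hy).2

lemma symm_coordChange {e e' : atlas (Fin n → ℂ) X} {y : Fin n → ℂ} (hy : y ∈ overlap e e') :
    e'.1.symm (coordChange e e' y) = e.1.symm y :=
  e'.1.left_inv (mem_overlap.1 hy).2

lemma coordChange_mem_overlap {e e' : atlas (Fin n → ℂ) X} {y : Fin n → ℂ}
    (hy : y ∈ overlap e e') : coordChange e e' y ∈ overlap e' e := by
  refine mem_overlap.2 ⟨coordChange_mem_target hy, ?_⟩
  rw [symm_coordChange hy]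
  exact e.1.map_target (mem_overlap.1 hy).1

lemma coordChange_coordChange {e e' : atlas (Fin n → ℂ) X} {y : Fin n → ℂ}
    (hy : y ∈ overlap e e') : coordChange e' e (coordChange e e' y) = y := by
  rw [coordChange, symm_coordChange hy]
  exact e.1.right_inv (mem_overlap.1 hy).1

variable [IsManifold 𝓘(ℂ, Fin n → ℂ) ω X]

lemma differentiableOn_coordChange (e e' : atlas (Fin n → ℂ) X) (i : Fin n) :
    DifferentiableOn ℂ (fun z => coordChange e e' z i) (overlap e e') := by
  have h : e.1.symm.trans e'.1 ∈ contDiffGroupoid ω 𝓘(ℂ, Fin n → ℂ) :=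
    StructureGroupoid.compatible _ e.2 e'.2
  have h1 := (contDiffGroupoid.eq_1 ω 𝓘(ℂ, Fin n → ℂ) ▸ h).1
  have h2 : ContDiffOn ℂ ω (e.1.symm.trans e'.1) (e.1.symm.trans e'.1).source := by
    simpa [contDiffPregroupoid] using h1
  exact differentiableOn_pi.1 (h2.differentiableOn (by simp)) i

lemma differentiableOn_jac (e e' : atlas (Fin n → ℂ) X) (i k : Fin n) :
    DifferentiableOn ℂ (fun z => jac e e' z i k) (overlap e e') :=
  DifferentiableOn.hpd (isOpen_overlap e e') (differentiableOn_coordChange e e' i) k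

/-- The chain rule for the transition map and its inverse shows that the Jacobian matrix has a left
inverse. -/
lemma isUnit_det_jac {e e' : atlas (Fin n → ℂ) X} {y : Fin n → ℂ} (hy : y ∈ overlap e e') :
    IsUnit (jac e e' y).det := by
  have h : jac e' e (coordChange e e' y) * jac e e' y = 1 := by
    ext i k
    rw [Matrix.mul_apply]
    have h1 := hpd_comp (isOpen_overlap e e') (isOpen_overlap e' e)
      (differentiableOn_coordChange e e') (fun z hz => coordChange_mem_overlap hz)
      (differentiableOn_coordChange e' e i) k hy
    rw [hpd_congr (g := fun z => z i) (isOpen_overlap e e')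
      (fun z hz => congrFun (coordChange_coordChange hz) i) k hy, Finset.sum_apply] at h1
    refine h1.symm.trans ?_
    have : (fun z : Fin n → ℂ => z i) =
        ContinuousLinearMap.proj (R := ℂ) (φ := fun _ : Fin n => ℂ) i := rfl
    rw [hpd, this, ContinuousLinearMap.fderiv, ContinuousLinearMap.proj_apply, Matrix.one_apply,
      Pi.single_apply]
  have := congrArg Matrix.det h
  rw [Matrix.det_mul, Matrix.det_one, mul_comm] at this
  exact IsUnit.of_mul_eq_one _ this

end Charts

/-! ### The one-forms of a formal exponential -/

section

variable {n : ℕ} {X : Type*} [TopologicalSpace X] [ChartedSpace (Fin n → ℂ) X]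
  (σ : FormalExponential n X)

/-- In the frame of its own chart the formal coordinate is tangent to the identity, by
`linear_coord`. Hence the formal Jacobian is invertible. -/
lemma constantCoeff_formalJac_coord {e : atlas (Fin n → ℂ) X} {y : Fin n → ℂ}
    (hy : y ∈ e.1.target) :
    MvPowerSeries.constantCoeff (formalJac (σ.coord e y)).det = 1 := by
  rw [RingHom.map_det, ← Matrix.det_one (n := Fin n)]
  congr 1
  ext i k
  rw [RingHom.mapMatrix_apply, Matrix.map_apply, formalJac, Matrix.of_apply,
    ← MvPowerSeries.coeff_zero_eq_constantCoeff_apply, coeff_pd, zero_add,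
    σ.linear_coord e y hy, Matrix.one_apply]
  simp

/-- The connection annihilates the formal coordinates. -/
lemma hasTotDeriv_coord (e : atlas (Fin n → ℂ) X) (v : Fin n → ℂ) (i : Fin n) :
    HasTotDeriv e.1.target v (fun y => σ.conn e y v) (fun y => σ.coord e y i) fun _ => 0 := by
  have h : SerHasDeriv e.1.target v (fun y => σ.coord e y i)
      fun y => serDeriv (fun z => σ.coord e z i) y v :=
    fun m => ⟨σ.smooth_coord e i m, fun y _ => rfl⟩
  refine h.congr e.1.open_target (fun _ _ => rfl) fun y hy => ?_
  have hu : IsUnit (formalJac (σ.coord e y)).det := by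
    rw [MvPowerSeries.isUnit_iff_constantCoeff, constantCoeff_formalJac_coord σ hy]
    exact isUnit_one
  have h1 : (formalJac (σ.coord e y)).mulVec (σ.conn e y v) =
      -fun i => serDeriv (fun z => σ.coord e z i) y v := by
    rw [FormalExponential.conn, Matrix.mulVec_neg, Matrix.mulVec_mulVec]
    exact congrArg Neg.neg ((congrArg (Matrix.mulVec · _) (Matrix.mul_nonsing_inv _ hu)).trans
      (Matrix.one_mulVec _))
  have h2 := congrFun h1 i
  rw [Pi.neg_apply] at h2
  rw [zero_sub, eq_comm, neg_eq_iff_eq_neg, ← h2]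
  exact Finset.sum_congr rfl fun k _ => mul_comm _ _

/-- The one-form on the formal disk that is defined by the formal exponential and by one-forms
on the charts. -/
def chartForm (η : atlas (Fin n → ℂ) X → (Fin n → ℂ) → Fin n → ℂ) (e : atlas (Fin n → ℂ) X)
    (y : Fin n → ℂ) : FForm1 n :=
  coordForm (σ.coord e y) fun i => jetPull (σ.coord e y) y fun z => η e z i

variable {η : atlas (Fin n → ℂ) X → (Fin n → ℂ) → Fin n → ℂ}

lemma chartForm_flat (hη : ∀ e, DifferentiableOn ℂ (η e) e.1.target) (e : atlas (Fin n → ℂ) X)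
    (v : Fin n → ℂ) : ∃ ξ' : (Fin n → ℂ) → FForm1 n,
      (∀ k, SerHasDeriv e.1.target v (fun y => chartForm σ η e y k) fun y => ξ' y k) ∧
      ∀ y ∈ e.1.target, ξ' y + lie1 (σ.conn e y v) (chartForm σ η e y) = gfC1 (σ.conn e y v) :=
  coordForm_flat e.1.open_target (hasTotDeriv_coord σ e v)
    (fun i => hasTotDeriv_jetPull e.1.open_target (σ.constantCoeff_coord e)
      (hasTotDeriv_coord σ e v) (differentiableOn_pi.1 (hη e) i))
    fun _ hy => constantCoeff_formalJac_coord σ hy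

/-- The matrix relating the two charts is the jet of the Jacobian along the formal coordinate. The
chain rule for the equivariance of $\sigma$ gives its relation to the formal Jacobians, and the
pull-back of the cocycle identity gives its logarithmic derivative. -/
lemma chartForm_equivariant [IsManifold 𝓘(ℂ, Fin n → ℂ) ω X]
    (hη : ∀ e, DifferentiableOn ℂ (η e) e.1.target)
    (hη' : ∀ e e', ∀ y ∈ overlap e e', ∀ k,
      hpd k (fun z => (jac e e' z).det) y / (jac e e' y).det =
        η e y k - ∑ i, jac e e' y i k * η e' (coordChange e e' y) i)
    {e e' : atlas (Fin n → ℂ) X} {y : Fin n → ℂ} (hy : y ∈ overlap e e') :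
    chartForm σ η e y = linPull1 (jac e e' y) (chartForm σ η e' (coordChange e e' y)) := by
  have hΩ := isOpen_overlap e e'
  have hyt := (mem_overlap.1 hy).1
  have hyt' := coordChange_mem_target hy
  have hφ := σ.constantCoeff_coord e y hyt
  have hφ' := σ.constantCoeff_coord e' _ hyt'
  have hψ := differentiableOn_coordChange e e'
  have hmaps : Set.MapsTo (coordChange e e') (overlap e e') e'.1.target :=
    fun z hz => coordChange_mem_target hz
  have hJ : ∀ i, jetPull (σ.coord e y) y (fun z => coordChange e e' z i) =
      linSubst (jac e e' y) (σ.coord e' (coordChange e e' y) i) := σ.equivariant e e' y hy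
  have hdetd : DifferentiableOn ℂ (fun z => (jac e e' z).det) (overlap e e') :=
    differentiableOn_matrix_det fun i j => differentiableOn_jac e e' i j
  have hηd : ∀ k, (fun z => η e z k) ∈ holSubring (overlap e e') := fun k =>
    (differentiableOn_pi.1 (hη e) k).mono fun z hz => (mem_overlap.1 hz).1
  have hηd' : ∀ k, DifferentiableOn ℂ (fun z => η e' z k) e'.1.target := fun k =>
    differentiableOn_pi.1 (hη e') k
  have hηψ : ∀ i, (fun z => η e' (coordChange e e' z) i) ∈ holSubring (overlap e e') := fun i =>
    (hηd' i).comp (differentiableOn_pi.2 hψ) hmaps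
  have hdet : jetPull (σ.coord e y) y (fun z => (jac e e' z).det) =
      (Matrix.of fun i j => jetPull (σ.coord e y) y fun z => jac e e' z i j).det :=
    jetPull_det hΩ (fun i j => differentiableOn_jac e e' i j) hy hφ
  refine coordForm_linPull1
    (M := Matrix.of fun i j => jetPull (σ.coord e y) y fun z => jac e e' z i j) ?_ ?_ ?_ ?_ ?_
  · ext1 i k
    have h1 := pd_jetPull hΩ (hψ i) hy hφ k
    rw [hJ, pd_linSubst] at h1
    simp only [Matrix.mul_apply, Matrix.of_apply, formalJac, Matrix.map_apply]
    refine h1.symm.trans (Finset.sum_congr rfl fun j _ => mul_comm _ _)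
  · rw [← hdet, constantCoeff_jetPull hφ]
    exact (isUnit_det_jac hy).ne_zero
  · rw [constantCoeff_formalJac_coord σ hyt]
    exact one_ne_zero
  · rw [constantCoeff_formalJac_coord σ hyt']
    exact one_ne_zero
  · intro k
    -- The cocycle identity is multiplied by the determinant, so that it becomes an identity in the
    -- ring of holomorphic functions and can be pulled back by a ring homomorphism.
    have h1 : ∀ j, jetPull (σ.coord e y) y (hpd j fun z => (jac e e' z).det) =
        jetPull (σ.coord e y) y (fun z => (jac e e' z).det) *
          (jetPull (σ.coord e y) y (fun z => η e z j) - ∑ i,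
            jetPull (σ.coord e y) y (fun z => jac e e' z i j) *
              linSubst (jac e e' y) (jetPull (σ.coord e' (coordChange e e' y))
                (coordChange e e' y) fun z => η e' z i)) := by
      intro j
      let D : holSubring (overlap e e') := ⟨_, hdetd⟩
      let H : holSubring (overlap e e') := ⟨_, hηd j⟩
      let G : Fin n → holSubring (overlap e e') := fun i => ⟨_, hηψ i⟩
      let K : Fin n → holSubring (overlap e e') := fun i => ⟨_, differentiableOn_jac e e' i j⟩
      have h2 : Set.EqOn (hpd j fun z => (jac e e' z).det)
          (D * (H - ∑ i, K i * G i) : holSubring (overlap e e')) (overlap e e') := by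
        intro z hz
        have h3 := hη' e e' z hz j
        rw [div_eq_iff (isUnit_det_jac hz).ne_zero, mul_comm] at h3
        rw [h3]
        change _ = ((Pi.evalRingHom (fun _ => ℂ) z).comp (holSubring (overlap e e')).subtype)
          (D * (H - ∑ i, K i * G i))
        rw [map_mul, map_sub, map_sum]
        simp only [map_mul]
        rfl
      rw [jetPull_congr hΩ h2 hy]
      have h4 : ∀ f : holSubring (overlap e e'), jetPull (σ.coord e y) y f =
          jetPullHom hΩ hy hφ f := fun _ => rfl
      rw [h4, map_mul, map_sub, map_sum]
      simp only [← h4]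
      congr 3
      funext i
      rw [← jetPull_comp hΩ e'.1.open_target hy hψ hmaps hφ hφ' hJ (hηd' i)]
      exact jetPull_mul hΩ (differentiableOn_jac e e' i j) (hηψ i) hy hφ
    rw [← hdet, pd_jetPull hΩ hdetd hy hφ]
    simp only [h1, Matrix.of_apply]
    rw [mul_sub, Finset.mul_sum, Finset.mul_sum]
    simp only [mul_sub, sub_mul, Finset.sum_sub_distrib, Finset.mul_sum, Finset.sum_mul]
    congr 1
    · exact Finset.sum_congr rfl fun j _ => mul_assoc _ _ _
    · rw [Finset.sum_comm]
      exact Finset.sum_congr rfl fun i _ => Finset.sum_congr rfl fun j _ => by ring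

end

/-! ### The global homomorphism -/

section

variable {n : ℕ} {X : Type*} [TopologicalSpace X] [ChartedSpace (Fin n → ℂ) X]

/-- The morphism from the constant sheaf that is defined by one-forms on the formal disk. -/
def virSheafHom (ξ : atlas (Fin n → ℂ) X → (Fin n → ℂ) → FForm1 n)
    (U : TopologicalSpace.Opens X) : LocallyConstant U (Vir (2 * n)) →ₗ[ℂ] Fam n U where
  toFun a e y := virHom (ξ e y.1) (a ⟨e.1.symm y.1, y.2.2⟩)
  map_add' a b := by
    funext e y
    exact map_add (virHom (ξ e y.1)) _ _
  map_smul' z a := by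
    funext e y
    exact map_smul (virHom (ξ e y.1)) _ _

lemma virSheafHom_apply (ξ : atlas (Fin n → ℂ) X → (Fin n → ℂ) → FForm1 n)
    (U : TopologicalSpace.Opens X) (a : LocallyConstant U (Vir (2 * n)))
    (e : atlas (Fin n → ℂ) X) (y : chartSet U e) :
    virSheafHom ξ U a e y = virHom (ξ e y.1) (a ⟨e.1.symm y.1, y.2.2⟩) := rfl

lemma isVertexHom_virSheafHom (ξ : atlas (Fin n → ℂ) X → (Fin n → ℂ) → FForm1 n)
    (U : TopologicalSpace.Opens X) : IsVertexHom (virSheafHom ξ U) where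
  map_vac := by
    funext e y
    exact (shiftedConformalVector_isVirasoro (ξ e y.1)).hom_virVac _
  map_T a := by
    funext e y
    exact (shiftedConformalVector_isVirasoro (ξ e y.1)).hom_T _ _
  map_prod m a b := by
    funext e y
    refine ((shiftedConformalVector_isVirasoro (ξ e y.1)).hom_virModes _ _ _ _).trans ?_
    rw [cdoData_mode]
    rfl

lemma isOpen_chartSet (U : TopologicalSpace.Opens X) (e : atlas (Fin n → ℂ) X) :
    IsOpen (chartSet U e) := e.1.isOpen_inter_preimage_symm U.2

/-- By local constancy the section is, near a point, the image of a single vector of the Virasoro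
vertex algebra. Smoothness, boundedness and flatness thereby reduce to a fixed vector. -/
lemma eventually_virSheafHom_eq (ξ : atlas (Fin n → ℂ) X → (Fin n → ℂ) → FForm1 n)
    (U : TopologicalSpace.Opens X) (a : LocallyConstant U (Vir (2 * n)))
    (e : atlas (Fin n → ℂ) X) (y : chartSet U e) :
    ∀ᶠ y' in nhds y, virSheafHom ξ U a e y' =
      virHom (ξ e y'.1) (a ⟨e.1.symm y.1, y.2.2⟩) := by
  have hc : Continuous fun y' : chartSet U e => (⟨e.1.symm y'.1, y'.2.2⟩ : U) :=
    Continuous.subtype_mk (e.1.continuousOn_symm.comp_continuous continuous_subtype_val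
      fun y' => y'.2.1) _
  filter_upwards [(a.isLocallyConstant.comp_continuous hc).eventually_eq y] with y' hy'
  rw [virSheafHom_apply]
  exact congrArg _ hy'

lemma eventually_coeff_virSheafHom_eq (ξ : atlas (Fin n → ℂ) X → (Fin n → ℂ) → FForm1 n)
    (U : TopologicalSpace.Opens X) (a : LocallyConstant U (Vir (2 * n)))
    (e : atlas (Fin n → ℂ) X) (y : chartSet U e) (d : Var n →₀ ℕ) (m : Fin n →₀ ℕ) :
    (virSheafHom ξ U a).coeff e d m =ᶠ[nhds y.1] fun y' => MvPowerSeries.coeff m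
      (MvPolynomial.coeff d (virHom (ξ e y') (a ⟨e.1.symm y.1, y.2.2⟩))) := by
  rw [← (isOpen_chartSet U e).isOpenEmbedding_subtypeVal.map_nhds_eq y]
  refine Filter.eventually_map.2 ?_
  filter_upwards [eventually_virSheafHom_eq ξ U a e y] with y' hy'
  rw [Fam.coeff, dif_pos y'.2]
  exact congrArg (fun w => MvPowerSeries.coeff m (MvPolynomial.coeff d w)) hy'

/-- Equivariance comes from the compatibility of `virHom` with linear coordinate changes. The other
conditions hold because the image of a fixed vector is a flat smooth family with finitely many
monomials, which also bounds its conformal dimension. -/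
theorem isSection_virSheafHom [IsManifold 𝓘(ℂ, Fin n → ℂ) ω X] {σ : FormalExponential n X}
    (α : Ch2Trivialization σ) {ξ : atlas (Fin n → ℂ) X → (Fin n → ℂ) → FForm1 n}
    (hequiv : ∀ e e', ∀ y ∈ overlap e e',
      ξ e y = linPull1 (jac e e' y) (ξ e' (coordChange e e' y)))
    (hflat : ∀ e v, ∃ ξ' : (Fin n → ℂ) → FForm1 n,
      (∀ k, SerHasDeriv e.1.target v (fun y => ξ e y k) fun y => ξ' y k) ∧
      ∀ y ∈ e.1.target, ξ' y + lie1 (σ.conn e y v) (ξ e y) = gfC1 (σ.conn e y v))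
    (U : TopologicalSpace.Opens X) (a : LocallyConstant U (Vir (2 * n))) :
    IsSection α U (virSheafHom ξ U a) := by
  have hfam : ∀ e v x, FamHasDeriv e.1.target v (fun y => virHom (ξ e y) x)
      fun y => -extAct (σ.conn e y v) (-α.form e y v) (virHom (ξ e y) x) := by
    intro e v x
    obtain ⟨ξ', h1, h2⟩ := hflat e v
    exact famHasDeriv_virHom e.1.open_target _ _ h1 h2 x
  constructor
  · intro e e' y y' hy hy'
    have hx : (⟨e'.1.symm y'.1, y'.2.2⟩ : U) = ⟨e.1.symm y.1, y.2.2⟩ :=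
      Subtype.ext ((congrArg e'.1.symm hy').trans (symm_coordChange hy))
    rw [virSheafHom_apply, virSheafHom_apply, glAct_virHom (isUnit_det_jac hy), hx, hy',
      ← hequiv e e' y.1 hy]
  · intro e d m y hy
    refine ContDiffAt.contDiffWithinAt ?_
    refine ContDiffAt.congr_of_eventuallyEq ?_
      (eventually_coeff_virSheafHom_eq ξ U a e ⟨y, hy⟩ d m)
    exact ((hfam e 0 _).2 d m).1.contDiffAt (e.1.open_target.mem_nhds hy.1)
  · intro e y
    obtain ⟨S, hS⟩ := (hfam e 0 (a ⟨e.1.symm y.1, y.2.2⟩)).1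
    refine ⟨S.sup (Finsupp.weight wt), ?_⟩
    filter_upwards [eventually_virSheafHom_eq ξ U a e y] with y' hy'
    rw [hy']
    refine Finset.sup_mono fun d hd => ?_
    by_contra h
    exact MvPolynomial.mem_support_iff.1 hd (hS y'.1 y'.2.1 d h).1
  · intro e y v d m
    rw [(eventually_coeff_virSheafHom_eq ξ U a e y d m).fderiv_eq, virSheafHom_apply]
    refine (congrArg (· + _) (((hfam e v _).2 d m).2 y.1 y.2.1)).trans ?_
    simp only [MvPolynomial.coeff_neg, map_neg]
    exact neg_add_cancel _

theorem exists_virSheafHom [IsManifold 𝓘(ℂ, Fin n → ℂ) ω X] (σ : FormalExponential n X)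
    (α : Ch2Trivialization σ) (h : C1Vanishes n X) :
    ∃ Φ : ∀ U : TopologicalSpace.Opens X, LocallyConstant U (Vir (2 * n)) →ₗ[ℂ] Fam n U,
      (∀ U a, IsSection α U (Φ U a)) ∧
      (∀ U, IsVertexHom (Φ U)) ∧
      (∀ U (N : ℕ) a, (∀ x, a x ∈ virDim (2 * n) N) → ∀ e y, HasDim N (Φ U a e y)) ∧
      (∀ (U U' : TopologicalSpace.Opens X) (h : U' ≤ U)
          (a : LocallyConstant U (Vir (2 * n))) (a' : LocallyConstant U' (Vir (2 * n))),
        (∀ x : U', a' x = a ⟨x.1, h x.2⟩) → Φ U' a' = Fam.restrict h (Φ U a)) := by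
  obtain ⟨η, hη, hη'⟩ := h
  refine ⟨virSheafHom (chartForm σ η), fun U a => isSection_virSheafHom α
    (fun e e' y hy => chartForm_equivariant σ hη hη' hy) (chartForm_flat σ hη) U a,
    isVertexHom_virSheafHom _, fun U N a ha e y => hasDim_virHom _ (ha _),
    fun U U' h a a' haa' => ?_⟩
  funext e y
  rw [virSheafHom_apply, haa']
  rfl

end

end

end ChiralDO

theorem mainTheorem9 (n : ℕ) (X : Type*) [TopologicalSpace X] [ChartedSpace (Fin n → ℂ) X]
    [IsManifold 𝓘(ℂ, Fin n → ℂ) ω X]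
    (σ : ChiralDO.FormalExponential n X) (α : ChiralDO.Ch2Trivialization σ) :
    (ChiralDO.C1Vanishes n X →
      ∃ Φ : ∀ U : TopologicalSpace.Opens X,
          LocallyConstant U (ChiralDO.Vir (2 * n)) →ₗ[ℂ] ChiralDO.Fam n U,
        (∀ U a, ChiralDO.IsSection α U (Φ U a)) ∧
        (∀ U, ChiralDO.IsVertexHom (Φ U)) ∧
        (∀ U (N : ℕ) a, (∀ x, a x ∈ ChiralDO.virDim (2 * n) N) →
          ∀ e y, ChiralDO.HasDim N (Φ U a e y)) ∧
        (∀ (U U' : TopologicalSpace.Opens X) (h : U' ≤ U)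
            (a : LocallyConstant U (ChiralDO.Vir (2 * n)))
            (a' : LocallyConstant U' (ChiralDO.Vir (2 * n))),
          (∀ x : U', a' x = a ⟨x.1, h x.2⟩) →
            Φ U' a' = ChiralDO.Fam.restrict h (Φ U a))) ∧
    (∀ (Y : ChiralDO.FVect n) (B : ChiralDO.FForm2 n), ChiralDO.IsClosed2 B →
      (∀ v, ChiralDO.HasDim 1 v →
        ChiralDO.VertexOps.prod 2 (ChiralDO.extAct Y B (ChiralDO.conformalVector n)) v =
          MvPolynomial.C (ChiralDO.pair (ChiralDO.gfC1 Y) (ChiralDO.toVect v))) ∧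
      (ChiralDO.extAct Y B (ChiralDO.conformalVector n) = 0 ↔ ChiralDO.gfC1 Y = 0)) ∧
    (∀ Y Z : ChiralDO.FVect n, ChiralDO.gfC1 (ChiralDO.bracket Y Z) =
      ChiralDO.lie1 Y (ChiralDO.gfC1 Z) - ChiralDO.lie1 Z (ChiralDO.gfC1 Y)) := by
  refine ⟨ChiralDO.exists_virSheafHom σ α, fun Y B _ => ⟨fun v hv => ?_,
    ChiralDO.extAct_conformalVector_eq_zero_iff Y B⟩, ChiralDO.gfC1_bracket⟩
  rw [← ChiralDO.mode_two_extAct_conformalVector Y B hv, ChiralDO.cdoData_mode]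
  rfl
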